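/- **Setting.** Let $\mathcal G$ be a finite-dimensional semisimple ribbon Hopf-$*$-algebra over $\mathbb C$, with co-product $\Delta$, co-unit $\epsilon$, antipode $\mathcal S$, $R$-matrix $R=\sum r^1\otimes r^2$ (with $R'=\sum r^2\otimes r^1$), and ribbon element $v$ with $v^*=v^{-1}$, whose $*$-operation satisfies $\Delta(\xi^*)=\Delta(\xi)^*$ for the convention $(\xi\otimes\eta)^*=\eta^*\otimes\xi^*$. Put $u=\sum\mathcal S(r^2)r^1$, $g=u^{-1}v$. Let $\tau^I$ on the finite-dimensional Hilbert spaces $V^I$ ($I$ in a finite set of labels) be irreducible $*$-representations, one in each equivalence class of irreducible representations of $\mathcal G$; $0$ is the label of $\epsilon$, $\bar I$ the label of the dual of $\tau^I$; for $x\in\mathcal G\otimes\mathcal G$ put $x^{IJ}=(\tau^I\otimes\tau^J)(x)$. Let $\kappa_I$ be square roots of the numbers $\tau^I(v)$, $\kappa\in\mathcal G$ the central element with $\tau^I(\kappa)=\kappa_I$, and assume that the spaces of intertwiners $V^I\otimes V^J\to V^K$ have spanning families $C^a[IJ|K]$ with $C^a[IJ|K](R')^{IJ}C^b[IJ|L]^*=\delta_{ab}\delta_{KL}\,\kappa_I\kappa_J/\kappa_K$.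 For $X\in \mathrm{End}(V^I)\otimes B$ put $tr_q^I(X)=tr^I(X\tau^I(g))$ and $d_I=tr^I_q(1)$. Assume that $d_I>0$ for all $I$ and that the matrix $S_{IJ}=\mathcal N\,(tr^I_q\otimes tr_q^J)(R'R)$, $\mathcal N=(\sum_K d_K^2)^{-1/2}$, is invertible. **Algebras.** $\mathcal L_m$ is the unital algebra generated by the matrix elements of $M^I_\nu\in \mathrm{End}(V^I)\otimes\mathcal L_m$, $\nu=1,\dots,m$, with the relations $M^0_\nu=1$, $M^I_{\nu,1}R^{IJ}M^J_{\nu,2}=\sum_{K,a} C^a[IJ|K]^*M^K_\nu C^a[IJ|K]$, and $(R^{-1})^{IJ}M^I_{\nu,1}R^{IJ}M^J_{\mu,2}=M^J_{\mu,2}(R^{-1})^{IJ}M^I_{\nu,1}R^{IJ}$ for $\nu<\mu$ (the subscripts $1,2$ indicate the factor of $\mathrm{End}(V^I)\otimes\mathrm{End}(V^J)$). $\mathcal S_m$ is the algebra generated by $\mathcal L_m$ and $\mathcal G$ with the cross relations $\mu^J(\xi)M^J_\nu=M^J_\nu\mu^J(\xi)$, $\mu^J(\xi)=(\tau^J\otimes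 id)\Delta(\xi)$. The $*$-operation of $\mathcal S_m$ extends that of $\mathcal G$ and satisfies $(M^I_\nu)^*=\kappa^{-1}R^I(M_\nu^I)^{-1}(R^{-1})^I\kappa$, $R^I=(\tau^I\otimes id)(R)\in\mathrm{End}(V^I)\otimes\mathcal G$. $\mathcal A_m\subset\mathcal L_m$ consists of the elements $X$ with $\xi(X)=\epsilon(\xi)X$ for all $\xi\in\mathcal G$, where $\xi(X)=\sum\xi_{(1)}X\mathcal S(\xi_{(2)})$. Put $c^I_\nu=\kappa_I\,tr_q^I(M^I_\nu)$, $c^I_0=\kappa_I^m\,tr^I_q(M^I_m\cdots M^I_1)$, $\chi^K_\nu=\sum_I\mathcal N d_KS_{K\bar I}\,c^I_\nu$ for $\nu=0,\dots,m$. For labels $K_1,\dots,K_m$ of $m$ points on a sphere, the moduli algebra is $\mathcal M_m^{\{K_\nu\}}=\chi^0_0\prod_{\nu=1}^m\chi_\nu^{K_\nu}\mathcal A_m$. **Representation.** On $\Im=V^{K_1}\otimes\dots\otimes V^{K_m}$ let $\imath_\nu$ be the tensor product of $\tau^{K_1},\dots,\tau^{K_{\nu-1}}$ acting on the first $\nu-1$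 factors ($\imath_1=\epsilon$), and $\imath=\imath_{m+1}$. $D^{K_1\dots K_m}$ is the representation of $\mathcal S_m$ on $\Im$ with $D(\xi)=\imath(\xi)$ and $D(M^J_\nu)=(\tau^J\otimes\imath_\nu)(R')\;\kappa_J^{-1}(R'R)^{JK_\nu}\;(\tau^J\otimes\imath_\nu)(R'^{-1})$, where $(R'R)^{JK_\nu}$ acts on $V^J$ and the factor $V^{K_\nu}$. $\Im$ carries the form $\langle\cdot,\cdot\rangle$ obtained by iterating $\langle v,w\rangle=(v,(\tau\otimes\tau')(R\,\Delta(\kappa)(\kappa^{-1}\otimes\kappa^{-1}))w)$. $W^0(K_1,\dots,K_m)=\{w\in\Im:\imath(\xi)w=\epsilon(\xi)w\ \forall\xi\in\mathcal G\}$. **Theorem.** $\mathcal L_m$ embeds in $\mathcal S_m$, the $*$-operation of $\mathcal S_m$ and the representation $D=D^{K_1\dots K_m}$ exist and are unique, and $\langle\cdot,\cdot\rangle$ is positive definite. $\mathcal M=\mathcal M_m^{\{K_\nu\}}$ is a $*$-algebra with unit $\chi_0^0\prod_\nu\chi_\nu^{K_\nu}$. The restriction of $D$ to $\mathcal M$ maps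 $W^0(K_1,\dots,K_m)$ to itself and is there a unital $*$-representation with respect to $\langle\cdot,\cdot\rangle$, without proper invariant subspaces (hence irreducible if $W^0\ne0$). Every irreducible unital $*$-representation of $\mathcal M$ on a (nonzero) Hilbert space is unitarily equivalent to it; so $\mathcal M$ has exactly one irreducible $*$-representation if $W^0(K_1,\dots,K_m)\neq 0$, and none if $W^0(K_1,\dots,K_m)=0$. -/

import Mathlib

open scoped TensorProduct Kronecker ComplexOrder Matrix

noncomputable section

namespace GraphAlgebra

/-! ## Ribbon Hopf-*-algebras -/

section Ribbon

variable {G : Type*} [Ring G] [HopfAlgebra ℂ G]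

/-- The flip `x ⊗ y ↦ y ⊗ x`, written `R ↦ R'` below. -/
def tensorFlip (x : G ⊗[ℂ] G) : G ⊗[ℂ] G := TensorProduct.comm ℂ G G x

/-- `x ⊗ y ↦ x ⊗ y ⊗ 1`. -/
def leg12 (x : G ⊗[ℂ] G) : G ⊗[ℂ] (G ⊗[ℂ] G) :=
  Algebra.TensorProduct.map (AlgHom.id ℂ G) Algebra.TensorProduct.includeLeft x

/-- `x ⊗ y ↦ x ⊗ 1 ⊗ y`. -/
def leg13 (x : G ⊗[ℂ] G) : G ⊗[ℂ] (G ⊗[ℂ] G) :=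
  Algebra.TensorProduct.map (AlgHom.id ℂ G) Algebra.TensorProduct.includeRight x

/-- `x ⊗ y ↦ 1 ⊗ x ⊗ y`. -/
def leg23 (x : G ⊗[ℂ] G) : G ⊗[ℂ] (G ⊗[ℂ] G) := 1 ⊗ₜ[ℂ] x

/-- The element `u = ∑ S(r²) r¹` attached to `R = ∑ r¹ ⊗ r²`. -/
def uElt (R : G ⊗[ℂ] G) : G :=
  LinearMap.mul' ℂ G
    (TensorProduct.map (HopfAlgebra.antipode ℂ) LinearMap.id (tensorFlip R))

/-- A ribbon Hopf-*-algebra structure on the Hopf algebra `G`: the `*`-operation is compatible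
with the co-product through `(x ⊗ y)^* = y^* ⊗ x^*`, `R` is a quasi-triangular structure and `v`
is a ribbon element. -/
structure RibbonStar (G : Type*) [Ring G] [HopfAlgebra ℂ G] [StarRing G] [StarModule ℂ G] where
  R : (G ⊗[ℂ] G)ˣ
  v : Gˣ
  comul_star : ∀ x : G, Coalgebra.comul (R := ℂ) (star x) =
    tensorFlip (star (Coalgebra.comul (R := ℂ) x))
  R_mul_comul : ∀ x : G, (R : G ⊗[ℂ] G) * Coalgebra.comul (R := ℂ) x =
    tensorFlip (Coalgebra.comul (R := ℂ) x) * (R : G ⊗[ℂ] G)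
  comul_id_R : TensorProduct.assoc ℂ G G G
      (TensorProduct.map (Coalgebra.comul (R := ℂ)) LinearMap.id (R : G ⊗[ℂ] G)) =
    leg13 (R : G ⊗[ℂ] G) * leg23 (R : G ⊗[ℂ] G)
  id_comul_R : TensorProduct.map LinearMap.id (Coalgebra.comul (R := ℂ)) (R : G ⊗[ℂ] G) =
    leg13 (R : G ⊗[ℂ] G) * leg12 (R : G ⊗[ℂ] G)
  v_central : ∀ x : G, (v : G) * x = x * (v : G)
  v_sq : (v : G) * (v : G) =
    uElt (R : G ⊗[ℂ] G) * HopfAlgebra.antipode ℂ (uElt (R : G ⊗[ℂ] G))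
  antipode_v : HopfAlgebra.antipode ℂ (v : G) = (v : G)
  counit_v : Coalgebra.counit (R := ℂ) (v : G) = 1
  star_v : star (v : G) = ((v⁻¹ : Gˣ) : G)
  comul_v : tensorFlip (R : G ⊗[ℂ] G) * (R : G ⊗[ℂ] G) * Coalgebra.comul (R := ℂ) (v : G) =
    (v : G) ⊗ₜ[ℂ] (v : G)

/-- The inverse of the `R`-matrix. -/
abbrev RibbonStar.Rinv [StarRing G] [StarModule ℂ G] (𝒢 : RibbonStar G) : G ⊗[ℂ] G :=
  ((𝒢.R⁻¹ : (G ⊗[ℂ] G)ˣ) : G ⊗[ℂ] G)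

/-- The grouplike element `g = u⁻¹ v` (`u` is invertible, because `u S(u) = v²`). -/
def gElt [StarRing G] [StarModule ℂ G] (𝒢 : RibbonStar G) : G :=
  Ring.inverse (uElt (𝒢.R : G ⊗[ℂ] G)) * (𝒢.v : G)

end Ribbon

/-! ## Irreducible representations and Clebsch-Gordan maps -/

section Reps

variable {G : Type*} [Ring G] [HopfAlgebra ℂ G]

/-- A matrix representation is irreducible: it is nonzero and has no proper invariant subspace. -/
def IsIrreducible {n : ℕ} (ρ : G → Matrix (Fin n) (Fin n) ℂ) : Prop :=
  0 < n ∧ ∀ W : Submodule ℂ (Fin n → ℂ), (∀ x, ∀ w ∈ W, ρ x *ᵥ w ∈ W) → W = ⊥ ∨ W = ⊤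

/-- Equivalence of matrix representations (through an invertible intertwiner). -/
def IsEquivalent {n k : ℕ} (ρ : G → Matrix (Fin n) (Fin n) ℂ)
    (σ : G → Matrix (Fin k) (Fin k) ℂ) : Prop :=
  ∃ (T : Matrix (Fin n) (Fin k) ℂ) (T' : Matrix (Fin k) (Fin n) ℂ),
    T * T' = 1 ∧ T' * T = 1 ∧ ∀ x, ρ x * T = T * σ x

/-- A choice of one irreducible `*`-representation `τ I` (on the Hilbert space `ℂ^(dim I)`) in
every equivalence class of irreducible representations of `G`; `zero` labels the trivial one. -/
structure Irreps (G : Type*) [Ring G] [HopfAlgebra ℂ G] [StarRing G] [StarModule ℂ G]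
    (Λ : Type*) where
  dim : Λ → ℕ
  τ : ∀ I : Λ, G →⋆ₐ[ℂ] Matrix (Fin (dim I)) (Fin (dim I)) ℂ
  irreducible : ∀ I, IsIrreducible (τ I)
  inequivalent : ∀ I J, IsEquivalent (τ I) (τ J) → I = J
  complete : ∀ (n : ℕ) (ρ : G →ₐ[ℂ] Matrix (Fin n) (Fin n) ℂ),
    IsIrreducible ρ → ∃ I, IsEquivalent ρ (τ I)
  zero : Λ
  τ_zero : ∀ x, τ zero x = Coalgebra.counit (R := ℂ) x • (1 : Matrix _ _ ℂ)

variable [StarRing G] [StarModule ℂ G] {Λ : Type*}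

namespace Irreps

variable (𝒯 : Irreps G Λ)

/-- `End(V^I)`-valued matrices: matrices of size `dim I` with entries in `B`,
that is `End(V^I) ⊗ B`. -/
abbrev Mat (I : Λ) (B : Type*) := Matrix (Fin (𝒯.dim I)) (Fin (𝒯.dim I)) B

/-- `(τ^I ⊗ τ^J)(x)`; in particular `R^{IJ}` is `𝒯.rep2 I J R`. -/
def rep2 (I J : Λ) (x : G ⊗[ℂ] G) :
    Matrix (Fin (𝒯.dim I) × Fin (𝒯.dim J)) (Fin (𝒯.dim I) × Fin (𝒯.dim J)) ℂ :=
  Matrix.kroneckerAlgEquiv (Fin (𝒯.dim I)) (Fin (𝒯.dim J)) ℂ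
    (Algebra.TensorProduct.map (𝒯.τ I).toAlgHom (𝒯.τ J).toAlgHom x)

/-- A matrix element of `τ^J` as a linear functional on `G`. -/
def entry (J : Λ) (i j : Fin (𝒯.dim J)) : G →ₗ[ℂ] ℂ where
  toFun x := 𝒯.τ J x i j
  map_add' x y := by simp
  map_smul' c x := by simp

/-- `(τ^J ⊗ φ)(x) ∈ End(V^J) ⊗ B` for a linear map `φ : G → B`. -/
def slot (J : Λ) {B : Type*} [Ring B] [Algebra ℂ B] (φ : G →ₗ[ℂ] B) (x : G ⊗[ℂ] G) :
    𝒯.Mat J B :=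
  Matrix.of fun i j => TensorProduct.lid ℂ B (TensorProduct.map (𝒯.entry J i j) φ x)

/-- The conjugate label `Ī`: the unique label such that `τ^Ī` is equivalent to the
dual representation `x ↦ τ^I(S(x))ᵀ`. -/
def conj (I : Λ) : Λ :=
  @Classical.epsilon Λ ⟨𝒯.zero⟩ fun J =>
    IsEquivalent (fun x : G => (𝒯.τ I (HopfAlgebra.antipode ℂ x))ᵀ) (𝒯.τ J)

end Irreps

/-- Square roots `kap I` of the numbers `τ^I(v)`, the central element `κ` with `τ^I(κ) = kap I`,
and Clebsch-Gordan maps `C I J K a : V^I ⊗ V^J → V^K`, `a = 1, …, N I J K`, which span the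
intertwiners and are normalized by
`C^a[IJ|K] (R')^{IJ} C^b[IJ|L]^* = δ_{ab} δ_{KL} κ_I κ_J / κ_K`. -/
structure Clebsch (𝒢 : RibbonStar G) (𝒯 : Irreps G Λ) where
  kap : Λ → ℂ
  kap_sq : ∀ I, 𝒯.τ I (𝒢.v : G) = (kap I ^ 2) • (1 : Matrix _ _ ℂ)
  κ : Gˣ
  τ_κ : ∀ I, 𝒯.τ I (κ : G) = kap I • (1 : Matrix _ _ ℂ)
  N : Λ → Λ → Λ → ℕ
  C : ∀ I J K : Λ, Fin (N I J K) →
    Matrix (Fin (𝒯.dim K)) (Fin (𝒯.dim I) × Fin (𝒯.dim J)) ℂ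
  intertwine : ∀ (I J K : Λ) (a : Fin (N I J K)) (x : G),
    C I J K a * 𝒯.rep2 I J (Coalgebra.comul (R := ℂ) x) = 𝒯.τ K x * C I J K a
  span : ∀ (I J K : Λ) (T : Matrix (Fin (𝒯.dim K)) (Fin (𝒯.dim I) × Fin (𝒯.dim J)) ℂ),
    (∀ x : G, T * 𝒯.rep2 I J (Coalgebra.comul (R := ℂ) x) = 𝒯.τ K x * T) →
    T ∈ Submodule.span ℂ (Set.range (C I J K))
  normal_same : ∀ (I J K : Λ) (a b : Fin (N I J K)),
    C I J K a * 𝒯.rep2 I J (tensorFlip (𝒢.R : G ⊗[ℂ] G)) * (C I J K b)ᴴ =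
      if a = b then (kap I * kap J / kap K) • (1 : Matrix _ _ ℂ) else 0
  normal_ne : ∀ (I J K L : Λ) (a : Fin (N I J K)) (b : Fin (N I J L)), K ≠ L →
    C I J K a * 𝒯.rep2 I J (tensorFlip (𝒢.R : G ⊗[ℂ] G)) * (C I J L b)ᴴ = 0

/-! ## Quantum traces and the S-matrix -/

/-- The `q`-trace `tr_q^I(X) = tr(X τ^I(g))` of `X ∈ End(V^I) ⊗ B`. -/
def qtr (𝒢 : RibbonStar G) (𝒯 : Irreps G Λ) (I : Λ) {B : Type*} [Ring B] [Algebra ℂ B]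
    (X : 𝒯.Mat I B) : B :=
  (X * (𝒯.τ I (gElt 𝒢)).map (algebraMap ℂ B)).trace

/-- The quantum dimension `d_I = tr_q^I(1)`. -/
def qdim (𝒢 : RibbonStar G) (𝒯 : Irreps G Λ) (I : Λ) : ℂ :=
  qtr 𝒢 𝒯 I (1 : 𝒯.Mat I ℂ)

/-- `s^{IJ} = (tr_q^I ⊗ tr_q^J)(R'R)`. -/
def sElt (𝒢 : RibbonStar G) (𝒯 : Irreps G Λ) (I J : Λ) : ℂ :=
  (𝒯.rep2 I J (tensorFlip (𝒢.R : G ⊗[ℂ] G) * (𝒢.R : G ⊗[ℂ] G)) *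
    (𝒯.τ I (gElt 𝒢) ⊗ₖ 𝒯.τ J (gElt 𝒢))).trace

variable [Fintype Λ]

/-- `𝒩 = (∑ d_K²)^{-1/2}` (the quantum dimensions are real numbers). -/
def normN (𝒢 : RibbonStar G) (𝒯 : Irreps G Λ) : ℝ :=
  (Real.sqrt (∑ K, (qdim 𝒢 𝒯 K).re ^ 2))⁻¹

/-- The matrix `S_{IJ} = 𝒩 s^{IJ}`. -/
def SMatrix (𝒢 : RibbonStar G) (𝒯 : Irreps G Λ) : Matrix Λ Λ ℂ :=
  Matrix.of fun I J => (normN 𝒢 𝒯 : ℂ) * sElt 𝒢 𝒯 I J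

end Reps

/-! ## The graph algebra of a sphere with `m` marked points -/

section Graph

variable {G : Type*} [Ring G] [HopfAlgebra ℂ G] [StarRing G] [StarModule ℂ G]
  {Λ : Type*} [Fintype Λ] {𝒢 : RibbonStar G} {𝒯 : Irreps G Λ}

/-- The names of the matrix elements of the monodromies `M_ν^I`. -/
abbrev Gen (𝒯 : Irreps G Λ) (m : ℕ) :=
  Fin m × (Σ I : Λ, Fin (𝒯.dim I) × Fin (𝒯.dim I))

/-- The matrix `M_ν^I` with entries in the free algebra on its matrix elements. -/
def freeM (𝒯 : Irreps G Λ) {m : ℕ} (ν : Fin m) (I : Λ) :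
    𝒯.Mat I (FreeAlgebra ℂ (Gen 𝒯 m)) :=
  Matrix.of fun i j => FreeAlgebra.ι ℂ (ν, ⟨I, (i, j)⟩)

/-- A matrix of scalars, read as a matrix over an algebra. -/
abbrev scal (B : Type*) [Ring B] [Algebra ℂ B] {k l : Type*} (X : Matrix k l ℂ) :
    Matrix k l B :=
  Matrix.map X (algebraMap ℂ B)

/-- `X₁ = X ⊗ 1 ∈ End(V^I) ⊗ End(V^J) ⊗ B` for `X ∈ End(V^I) ⊗ B`. -/
def leg1 (𝒯 : Irreps G Λ) {B : Type*} [Ring B] {I : Λ} (J : Λ) (X : 𝒯.Mat I B) :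
    Matrix (Fin (𝒯.dim I) × Fin (𝒯.dim J)) (Fin (𝒯.dim I) × Fin (𝒯.dim J)) B :=
  X ⊗ₖ (1 : 𝒯.Mat J B)

/-- `X₂ = 1 ⊗ X ∈ End(V^I) ⊗ End(V^J) ⊗ B` for `X ∈ End(V^J) ⊗ B`. -/
def leg2 (𝒯 : Irreps G Λ) {B : Type*} [Ring B] (I : Λ) {J : Λ} (X : 𝒯.Mat J B) :
    Matrix (Fin (𝒯.dim I) × Fin (𝒯.dim J)) (Fin (𝒯.dim I) × Fin (𝒯.dim J)) B :=
  (1 : 𝒯.Mat I B) ⊗ₖ X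

/-- The defining relations of the graph algebra: the monodromy in the trivial representation is
the unit, functoriality `M₁ R^{IJ} M₂ = ∑ C^* M^K C` for every `ν`, and the exchange relations
`R⁻¹ M_{ν,1} R M_{μ,2} = M_{μ,2} R⁻¹ M_{ν,1} R` for `ν < μ`. -/
inductive GraphRel (𝒞 : Clebsch 𝒢 𝒯) (m : ℕ) :
    FreeAlgebra ℂ (Gen 𝒯 m) → FreeAlgebra ℂ (Gen 𝒯 m) → Prop
  | trivial (ν : Fin m) (i j : Fin (𝒯.dim 𝒯.zero)) :
      GraphRel 𝒞 m (freeM 𝒯 ν 𝒯.zero i j) ((1 : 𝒯.Mat 𝒯.zero (FreeAlgebra ℂ (Gen 𝒯 m))) i j)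
  | functoriality (ν : Fin m) (I J : Λ) (p q : Fin (𝒯.dim I) × Fin (𝒯.dim J)) :
      GraphRel 𝒞 m
        ((leg1 𝒯 J (freeM 𝒯 ν I) * scal (FreeAlgebra ℂ (Gen 𝒯 m)) (𝒯.rep2 I J 𝒢.R) *
          leg2 𝒯 I (freeM 𝒯 ν J)) p q)
        ((∑ K, ∑ a, scal (FreeAlgebra ℂ (Gen 𝒯 m)) (𝒞.C I J K a)ᴴ * freeM 𝒯 ν K *
          scal (FreeAlgebra ℂ (Gen 𝒯 m)) (𝒞.C I J K a)) p q)
  | exchange (ν μ : Fin m) (h : ν < μ) (I J : Λ) (p q : Fin (𝒯.dim I) × Fin (𝒯.dim J)) :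
      GraphRel 𝒞 m
        ((scal (FreeAlgebra ℂ (Gen 𝒯 m)) (𝒯.rep2 I J 𝒢.Rinv) * leg1 𝒯 J (freeM 𝒯 ν I) *
          scal (FreeAlgebra ℂ (Gen 𝒯 m)) (𝒯.rep2 I J 𝒢.R) * leg2 𝒯 I (freeM 𝒯 μ J)) p q)
        ((leg2 𝒯 I (freeM 𝒯 μ J) * scal (FreeAlgebra ℂ (Gen 𝒯 m)) (𝒯.rep2 I J 𝒢.Rinv) *
          leg1 𝒯 J (freeM 𝒯 ν I) * scal (FreeAlgebra ℂ (Gen 𝒯 m)) (𝒯.rep2 I J 𝒢.R)) p q)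

/-- The graph algebra `ℒ_m`. -/
def GraphAlg (𝒞 : Clebsch 𝒢 𝒯) (m : ℕ) : Type _ := RingQuot (GraphRel 𝒞 m)

instance (𝒞 : Clebsch 𝒢 𝒯) (m : ℕ) : Ring (GraphAlg 𝒞 m) :=
  inferInstanceAs (Ring (RingQuot (GraphRel 𝒞 m)))

instance (𝒞 : Clebsch 𝒢 𝒯) (m : ℕ) : Algebra ℂ (GraphAlg 𝒞 m) :=
  inferInstanceAs (Algebra ℂ (RingQuot (GraphRel 𝒞 m)))

/-- The monodromy `M_ν^I ∈ End(V^I) ⊗ ℒ_m`. -/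
def graphM (𝒞 : Clebsch 𝒢 𝒯) {m : ℕ} (ν : Fin m) (I : Λ) : 𝒯.Mat I (GraphAlg 𝒞 m) :=
  (freeM 𝒯 ν I).map (RingQuot.mkAlgHom ℂ (GraphRel 𝒞 m))

/-! ## The semi-direct product of `ℒ_m` with `G` -/

/-- The elements of `G` as generators. -/
def preG (𝒞 : Clebsch 𝒢 𝒯) (m : ℕ) : G →ₗ[ℂ] TensorAlgebra ℂ (G × GraphAlg 𝒞 m) :=
  TensorAlgebra.ι ℂ ∘ₗ LinearMap.inl ℂ G (GraphAlg 𝒞 m)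

/-- The elements of `ℒ_m` as generators. -/
def preL (𝒞 : Clebsch 𝒢 𝒯) (m : ℕ) :
    GraphAlg 𝒞 m →ₗ[ℂ] TensorAlgebra ℂ (G × GraphAlg 𝒞 m) :=
  TensorAlgebra.ι ℂ ∘ₗ LinearMap.inr ℂ G (GraphAlg 𝒞 m)

/-- The relations of the semi-direct product: those of `G`, those of `ℒ_m`, and the cross
relations `μ^J(x) M_ν^J = M_ν^J μ^J(x)` with `μ^J(x) = (τ^J ⊗ id) Δ(x)`. -/
inductive SemiRel (𝒞 : Clebsch 𝒢 𝒯) (m : ℕ) :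
    TensorAlgebra ℂ (G × GraphAlg 𝒞 m) → TensorAlgebra ℂ (G × GraphAlg 𝒞 m) → Prop
  | mulG (x y : G) : SemiRel 𝒞 m (preG 𝒞 m (x * y)) (preG 𝒞 m x * preG 𝒞 m y)
  | oneG : SemiRel 𝒞 m (preG 𝒞 m 1) 1
  | mulL (X Y : GraphAlg 𝒞 m) : SemiRel 𝒞 m (preL 𝒞 m (X * Y)) (preL 𝒞 m X * preL 𝒞 m Y)
  | oneL : SemiRel 𝒞 m (preL 𝒞 m 1) 1
  | cross (ν : Fin m) (J : Λ) (x : G) (i j : Fin (𝒯.dim J)) :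
      SemiRel 𝒞 m
        ((𝒯.slot J (preG 𝒞 m) (Coalgebra.comul (R := ℂ) x) * (graphM 𝒞 ν J).map (preL 𝒞 m)) i j)
        (((graphM 𝒞 ν J).map (preL 𝒞 m) * 𝒯.slot J (preG 𝒞 m) (Coalgebra.comul (R := ℂ) x)) i j)

/-- The semi-direct product `𝒮_m` of `ℒ_m` and `G`. -/
def SemiAlg (𝒞 : Clebsch 𝒢 𝒯) (m : ℕ) : Type _ := RingQuot (SemiRel 𝒞 m)

instance (𝒞 : Clebsch 𝒢 𝒯) (m : ℕ) : Ring (SemiAlg 𝒞 m) :=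
  inferInstanceAs (Ring (RingQuot (SemiRel 𝒞 m)))

instance (𝒞 : Clebsch 𝒢 𝒯) (m : ℕ) : Algebra ℂ (SemiAlg 𝒞 m) :=
  inferInstanceAs (Algebra ℂ (RingQuot (SemiRel 𝒞 m)))

/-- The canonical homomorphism `G → 𝒮_m`. -/
def ofG (𝒞 : Clebsch 𝒢 𝒯) (m : ℕ) : G →ₐ[ℂ] SemiAlg 𝒞 m :=
  AlgHom.ofLinearMap ((RingQuot.mkAlgHom ℂ (SemiRel 𝒞 m)).toLinearMap ∘ₗ preG 𝒞 m)
    (by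
      have h := RingQuot.mkAlgHom_rel ℂ (SemiRel.oneG (𝒞 := 𝒞) (m := m))
      exact h.trans (map_one (RingQuot.mkAlgHom ℂ (SemiRel 𝒞 m))))
    (by
      intro x y
      have h := RingQuot.mkAlgHom_rel ℂ (SemiRel.mulG (𝒞 := 𝒞) (m := m) x y)
      exact h.trans (map_mul (RingQuot.mkAlgHom ℂ (SemiRel 𝒞 m)) _ _))

/-- The canonical homomorphism `ℒ_m → 𝒮_m`. -/
def ofL (𝒞 : Clebsch 𝒢 𝒯) (m : ℕ) : GraphAlg 𝒞 m →ₐ[ℂ] SemiAlg 𝒞 m :=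
  AlgHom.ofLinearMap ((RingQuot.mkAlgHom ℂ (SemiRel 𝒞 m)).toLinearMap ∘ₗ preL 𝒞 m)
    (by
      have h := RingQuot.mkAlgHom_rel ℂ (SemiRel.oneL (𝒞 := 𝒞) (m := m))
      exact h.trans (map_one (RingQuot.mkAlgHom ℂ (SemiRel 𝒞 m))))
    (by
      intro x y
      have h := RingQuot.mkAlgHom_rel ℂ (SemiRel.mulL (𝒞 := 𝒞) (m := m) x y)
      exact h.trans (map_mul (RingQuot.mkAlgHom ℂ (SemiRel 𝒞 m)) _ _))

/-- The monodromy `M_ν^I`, regarded in `End(V^I) ⊗ 𝒮_m`. -/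
def mono (𝒞 : Clebsch 𝒢 𝒯) {m : ℕ} (ν : Fin m) (I : Λ) : 𝒯.Mat I (SemiAlg 𝒞 m) :=
  (graphM 𝒞 ν I).map (ofL 𝒞 m)

/-- `st` is the `*`-operation of `𝒮_m`: an involutive antilinear anti-automorphism which extends
the one of `G` and satisfies `(M_ν^I)^* = κ⁻¹ R^I (M_ν^I)⁻¹ (R^I)⁻¹ κ`, where
`R^I = (τ^I ⊗ id)(R)` and the `*` on the left acts on both factors of `End(V^I) ⊗ 𝒮_m`. -/
structure IsStarOperation (𝒞 : Clebsch 𝒢 𝒯) (m : ℕ) (st : SemiAlg 𝒞 m → SemiAlg 𝒞 m) :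
    Prop where
  map_add : ∀ X Y, st (X + Y) = st X + st Y
  map_smul : ∀ (c : ℂ) X, st (c • X) = star c • st X
  map_mul : ∀ X Y, st (X * Y) = st Y * st X
  involutive : ∀ X, st (st X) = X
  map_ofG : ∀ x : G, st (ofG 𝒞 m x) = ofG 𝒞 m (star x)
  map_mono : ∀ (ν : Fin m) (I : Λ), ∃ Minv : 𝒯.Mat I (SemiAlg 𝒞 m),
    mono 𝒞 ν I * Minv = 1 ∧ Minv * mono 𝒞 ν I = 1 ∧
    ((mono 𝒞 ν I).map st)ᵀ =
      (𝒯.slot I (ofG 𝒞 m).toLinearMap (𝒢.R : G ⊗[ℂ] G) * Minv *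
        𝒯.slot I (ofG 𝒞 m).toLinearMap 𝒢.Rinv).map
          fun F => ofG 𝒞 m ((𝒞.κ⁻¹ : Gˣ) : G) * F * ofG 𝒞 m (𝒞.κ : G)

/-! ## Invariants, characteristic projectors, moduli algebra -/

/-- The action `x(X) = ∑ x₁ X S(x₂)` of `G`. On the generators it reads
`x(M) = ∑ τ(S(x₁)) M τ(x₂)`, by the cross relations, and `x(XY) = ∑ x₁(X) x₂(Y)`. -/
def act (𝒞 : Clebsch 𝒢 𝒯) (m : ℕ) (x : G) (X : SemiAlg 𝒞 m) : SemiAlg 𝒞 m :=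
  LinearMap.mul' ℂ (SemiAlg 𝒞 m)
    (TensorProduct.map (LinearMap.mulRight ℂ X ∘ₗ (ofG 𝒞 m).toLinearMap)
      ((ofG 𝒞 m).toLinearMap ∘ₗ HopfAlgebra.antipode ℂ) (Coalgebra.comul (R := ℂ) x))

/-- The algebra `𝒜_m` of invariant elements of `ℒ_m` (as a subset of `𝒮_m ⊇ ℒ_m`). -/
def invariantAlg (𝒞 : Clebsch 𝒢 𝒯) (m : ℕ) : Set (SemiAlg 𝒞 m) :=
  {X | X ∈ (ofL 𝒞 m).range ∧ ∀ x : G, act 𝒞 m x X = Coalgebra.counit (R := ℂ) x • X}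

/-- `c_ν^I = κ_I tr_q^I(M_ν^I)`. -/
def cLoop (𝒞 : Clebsch 𝒢 𝒯) {m : ℕ} (ν : Fin m) (I : Λ) : SemiAlg 𝒞 m :=
  𝒞.kap I • qtr 𝒢 𝒯 I (mono 𝒞 ν I)

/-- `c_0^I = κ_I tr_q^I(κ_I^{m-1} M_m^I ⋯ M_1^I)`. -/
def cTotal (𝒞 : Clebsch 𝒢 𝒯) (m : ℕ) (I : Λ) : SemiAlg 𝒞 m :=
  𝒞.kap I ^ m • qtr 𝒢 𝒯 I ((List.ofFn fun ν : Fin m => mono 𝒞 ν I).reverse.prod)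

/-- The characteristic projector `χ^K = ∑_I 𝒩 d_K S_{K Ī} c^I` of a family `c^I`. -/
def charProj (𝒢 : RibbonStar G) (𝒯 : Irreps G Λ) {B : Type*} [Ring B] [Algebra ℂ B]
    (c : Λ → B) (K : Λ) : B :=
  ∑ I, ((normN 𝒢 𝒯 : ℂ) * qdim 𝒢 𝒯 K * SMatrix 𝒢 𝒯 K (𝒯.conj I)) • c I

/-- `χ_ν^K`. -/
def chiLoop (𝒞 : Clebsch 𝒢 𝒯) {m : ℕ} (ν : Fin m) (K : Λ) : SemiAlg 𝒞 m :=
  charProj 𝒢 𝒯 (cLoop 𝒞 ν) K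

/-- `χ_0^K`. -/
def chiTotal (𝒞 : Clebsch 𝒢 𝒯) (m : ℕ) (K : Λ) : SemiAlg 𝒞 m :=
  charProj 𝒢 𝒯 (cTotal 𝒞 m) K

/-- The product `χ_0^0 χ_1^{K_1} ⋯ χ_m^{K_m}`. -/
def moduliUnit (𝒞 : Clebsch 𝒢 𝒯) {m : ℕ} (K : Fin m → Λ) : SemiAlg 𝒞 m :=
  chiTotal 𝒞 m 𝒯.zero * (List.ofFn fun ν : Fin m => chiLoop 𝒞 ν (K ν)).prod

/-- The moduli algebra `ℳ_m^{K} = χ_0^0 ∏ χ_ν^{K_ν} 𝒜_m`. -/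
def moduliSet (𝒞 : Clebsch 𝒢 𝒯) {m : ℕ} (K : Fin m → Λ) : Set (SemiAlg 𝒞 m) :=
  {X | ∃ A ∈ invariantAlg 𝒞 m, X = moduliUnit 𝒞 K * A}

/-! ## The representations `D^{K_1 … K_m}` on `V^{K_1} ⊗ ⋯ ⊗ V^{K_m}` -/

/-- The index set of the product basis of `V^{K_1} ⊗ ⋯ ⊗ V^{K_m}`. -/
abbrev Idx (𝒯 : Irreps G Λ) {m : ℕ} (K : Fin m → Λ) := ∀ ν : Fin m, Fin (𝒯.dim (K ν))

/-- The operators on `V^{K_1} ⊗ ⋯ ⊗ V^{K_m}`. -/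
abbrev Op (𝒯 : Irreps G Λ) {m : ℕ} (K : Fin m → Λ) := Matrix (Idx 𝒯 K) (Idx 𝒯 K) ℂ

open Classical in
/-- `id ⊗ ⋯ ⊗ τ^{K_ν}(x) ⊗ ⋯ ⊗ id`, acting on the factor number `ν`. -/
def site (𝒯 : Irreps G Λ) {m : ℕ} (K : Fin m → Λ) (ν : Fin m) : G →ₗ[ℂ] Op 𝒯 K where
  toFun x := Matrix.of fun p q =>
    if ∀ μ, μ ≠ ν → p μ = q μ then 𝒯.τ (K ν) x (p ν) (q ν) else 0
  map_add' x y := by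
    ext p q
    by_cases h : ∀ μ, μ ≠ ν → p μ = q μ
    · simp only [Matrix.of_apply, Matrix.add_apply, if_pos h, map_add]
    · simp only [Matrix.of_apply, Matrix.add_apply, if_neg h, add_zero]
  map_smul' c x := by
    ext p q
    by_cases h : ∀ μ, μ ≠ ν → p μ = q μ
    · simp only [Matrix.of_apply, Matrix.smul_apply, if_pos h, map_smul, RingHom.id_apply]
    · simp only [Matrix.of_apply, Matrix.smul_apply, if_neg h, smul_zero, RingHom.id_apply]

/-- The tensor product of `τ^{K_1}, …, τ^{K_n}`, acting on the first `n` factors (and as the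
identity on the others): `x ↦ ε(x)` for `n = 0`, and `x ↦ ∑ ι_n(x₁) τ^{K_{n+1}}(x₂)` for `n + 1`.
The natural action of `G` is the case `n = m`. -/
def iota (𝒯 : Irreps G Λ) {m : ℕ} (K : Fin m → Λ) : ℕ → (G →ₗ[ℂ] Op 𝒯 K)
  | 0 => (Algebra.linearMap ℂ (Op 𝒯 K)) ∘ₗ Coalgebra.counit
  | n + 1 =>
      if h : n < m then
        LinearMap.mul' ℂ (Op 𝒯 K) ∘ₗ
          TensorProduct.map (iota 𝒯 K n) (site 𝒯 K ⟨n, h⟩) ∘ₗ Coalgebra.comul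
      else iota 𝒯 K n

/-- `D` is the representation `D^{K_1 … K_m}` of `𝒮_m ⊇ ℒ_m`:
`D(M_ν^J) = (τ^J ⊗ ι_ν)(R') D^{K_ν}_ν(M_ν^J) (τ^J ⊗ ι_ν)(R'⁻¹)` with
`D^{K_ν}_ν(M_ν^J) = κ_J⁻¹ (R'R)^{J K_ν}` acting on the factor `ν`, and `D(x) = ι(x)` on `G`. -/
structure IsLoopRep (𝒞 : Clebsch 𝒢 𝒯) {m : ℕ} (K : Fin m → Λ)
    (D : SemiAlg 𝒞 m →ₐ[ℂ] Op 𝒯 K) : Prop where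
  map_mono : ∀ (ν : Fin m) (J : Λ), (mono 𝒞 ν J).map D =
    𝒯.slot J (iota 𝒯 K ν) (tensorFlip (𝒢.R : G ⊗[ℂ] G)) *
      ((𝒞.kap J)⁻¹ •
        𝒯.slot J (site 𝒯 K ν) (tensorFlip (𝒢.R : G ⊗[ℂ] G) * (𝒢.R : G ⊗[ℂ] G))) *
      𝒯.slot J (iota 𝒯 K ν) (tensorFlip 𝒢.Rinv)
  map_ofG : ∀ x : G, D (ofG 𝒞 m x) = iota 𝒯 K m x

/-- The Gram matrix of the scalar product `⟨·,·⟩` obtained by iterating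
`⟨v, w⟩ = (v, (τ ⊗ τ')(R η) w)`, `η = Δ(κ)(κ⁻¹ ⊗ κ⁻¹)`, over the first `n` factors. -/
def gram (𝒞 : Clebsch 𝒢 𝒯) {m : ℕ} (K : Fin m → Λ) : ℕ → Op 𝒯 K
  | 0 => 1
  | n + 1 =>
      if h : n < m then
        gram 𝒞 K n *
          LinearMap.mul' ℂ (Op 𝒯 K)
            (TensorProduct.map (iota 𝒯 K n) (site 𝒯 K ⟨n, h⟩)
              ((𝒢.R : G ⊗[ℂ] G) * (Coalgebra.comul (R := ℂ) (𝒞.κ : G) *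
                (((𝒞.κ⁻¹ : Gˣ) : G) ⊗ₜ[ℂ] ((𝒞.κ⁻¹ : Gˣ) : G)))))
      else gram 𝒞 K n

/-- The scalar product `⟨v, w⟩` on `V^{K_1} ⊗ ⋯ ⊗ V^{K_m}` (antilinear in `v`). -/
def form (𝒞 : Clebsch 𝒢 𝒯) {m : ℕ} (K : Fin m → Λ) (v w : Idx 𝒯 K → ℂ) : ℂ :=
  star v ⬝ᵥ (gram 𝒞 K m *ᵥ w)

/-- The multiplicity space `W^0(K_1, …, K_m)` of the trivial representation, that is the space of
invariant vectors in `V^{K_1} ⊗ ⋯ ⊗ V^{K_m}`. -/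
def W0 (𝒯 : Irreps G Λ) {m : ℕ} (K : Fin m → Λ) : Submodule ℂ (Idx 𝒯 K → ℂ) where
  carrier := {w | ∀ x : G, iota 𝒯 K m x *ᵥ w = Coalgebra.counit (R := ℂ) x • w}
  add_mem' := by
    intro a b ha hb x
    rw [Matrix.mulVec_add, ha x, hb x, smul_add]
  zero_mem' := by
    intro x
    simp
  smul_mem' := by
    intro c a ha x
    rw [Matrix.mulVec_smul, ha x, smul_comm]

/-! ## Irreducible `*`-representations -/

/-- `π` is an irreducible `*`-representation on the Hilbert space `H` of the `*`-algebra `M`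
with unit `e` and `*`-operation `st`: it is unital, compatible with the `*`-operations, `H` is
nonzero, and there is no proper closed invariant subspace. -/
structure IsIrredStarRep {B : Type*} [Ring B] [Algebra ℂ B] (st : B → B)
    (M : NonUnitalSubalgebra ℂ B) (e : B) {H : Type*} [NormedAddCommGroup H]
    [InnerProductSpace ℂ H] [CompleteSpace H] (π : M →ₙₐ[ℂ] (H →L[ℂ] H)) : Prop where
  map_unit : ∀ X : M, (X : B) = e → π X = 1
  map_star : ∀ X Y : M, (Y : B) = st (X : B) → π Y = ContinuousLinearMap.adjoint (π X)
  nontrivial : Nontrivial H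
  irreducible : ∀ U : Submodule ℂ H, IsClosed (U : Set H) →
    (∀ X : M, ∀ u ∈ U, π X u ∈ U) → U = ⊥ ∨ U = ⊤

end Graph

end GraphAlgebra

end

open scoped TensorProduct Kronecker ComplexOrder Matrix

set_option linter.unusedSectionVars false

noncomputable section

namespace GraphAlgebra

/-! ## Legs: linear maps from a Hopf algebra to an algebra -/

section Legs

variable {G : Type*} [Ring G] [HopfAlgebra ℂ G] {A : Type*} [Ring A] [Algebra ℂ A]
  {B : Type*} [Ring B] [Algebra ℂ B]

/-! Call a unital multiplicative linear map from `G` to an algebra a leg. Evaluated on commuting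
legs, the axioms of `R` give the whole `R`-matrix calculus (Yang-Baxter equation, behaviour under
coproduct and antipode) inside any algebra, so the same lemmas serve for tensor powers of `G`, for
matrices over an algebra and for operators of left and right multiplication.

Let `s 0, s 1, …` be commuting legs with convolution products `ι_n = s 0 * ⋯ * s (n-1)`. The
matrices `(τ^J ⊗ ι_ν)(R') (τ^J ⊗ s_ν)(R'R) (τ^J ⊗ ι_ν)(R')⁻¹`, divided by `κ_J`, satisfy the
exchange and functoriality relations and commute with `(τ^J ⊗ ι_n)Δ(x)` for `n > ν`. Hence every
such system defines a homomorphism on `𝒮_m` (`sysHom`). Two systems are decisive: the site operators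
in the product over all labellings `K` of the algebras `End(V^{K_1} ⊗ ⋯ ⊗ V^{K_m})`, which has
dimension `(dim G)^m`, and the same system with one more tensor factor `G`. They give isomorphisms
on `ℒ_m` and on `𝒮_m` respectively. They are surjective because invertibility of `S` implies
factorizability: every element of `G` is a slice of `R'R` (`Clebsch.exists_slice_eq`), so the legs
can be recovered one after the other from the monodromies (`LegSystem.mem_of_loopMat`). They are
injective because ordered monomials span, which bounds the dimensions by `(dim G)^m` and `(dim
G)^{m+1}`.

In this picture everything is explicit. The `*`-operation is `X ↦ P⁻¹ X^* P`, where `P` is an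
ordered product of copies of `ω = RΔ(κ)(κ⁻¹ ⊗ κ⁻¹)`; `P` has the form `Y^* Y` because `ω^{IJ} = ∑
C^* C`. The elements `c_ν^I` and `c_0^I` become `s_ν(z_I)` and `ι_m(z_I)` for the central elements
`z_I = (tr_q^I ⊗ id)(R'R)`. Orthogonality of the `S`-matrix, a consequence of the fusion rules, of
`N_{ĪJ}^0 = δ_{IJ}` and of the invertibility of `S`, then turns `χ_ν^K` into the projection onto the
label `K` at the site `ν`, and `χ_0^0` into `p = ι_m(h)` with `h` the two-sided integral.

Invariant elements are those commuting with `ι_m(G)`, so the moduli algebra is the corner `p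
End(V^{K_1} ⊗ ⋯ ⊗ V^{K_m}) p`. Since `p` projects onto `W^0`, this is the full operator algebra of
`W^0`, whose only irreducible `*`-representation is the defining one, and there is none when `W^0 =
0` (`IsCorner.classification`). -/

theorem leg13_add (x y : G ⊗[ℂ] G) : leg13 (x + y) = leg13 x + leg13 y := map_add _ x y

theorem leg12_add (x y : G ⊗[ℂ] G) : leg12 (x + y) = leg12 x + leg12 y := map_add _ x y

theorem leg23_add (x y : G ⊗[ℂ] G) : leg23 (x + y) = leg23 x + leg23 y :=
  TensorProduct.tmul_add _ _ _

theorem tensorFlip_add (x y : G ⊗[ℂ] G) : tensorFlip (x + y) = tensorFlip x + tensorFlip y :=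
  map_add (TensorProduct.comm ℂ G G) x y

/-- `x ⊗ y ↦ f x * g y`. -/
def tens (f g : G →ₗ[ℂ] A) : G ⊗[ℂ] G →ₗ[ℂ] A :=
  LinearMap.mul' ℂ A ∘ₗ TensorProduct.map f g

/-- The convolution product `x ↦ ∑ f x₁ * g x₂`. -/
def conv (f g : G →ₗ[ℂ] A) : G →ₗ[ℂ] A :=
  tens f g ∘ₗ Coalgebra.comul

/-- The unit of the convolution product. -/
def unitLeg : G →ₗ[ℂ] A := Algebra.linearMap ℂ A ∘ₗ Coalgebra.counit

/-- `x ⊗ y ⊗ z ↦ f x * g y * h z`. -/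
def tens₃ (f g h : G →ₗ[ℂ] A) : G ⊗[ℂ] (G ⊗[ℂ] G) →ₗ[ℂ] A :=
  LinearMap.mul' ℂ A ∘ₗ TensorProduct.map f (tens g h)

/-- A multiplicative and unital linear map. -/
structure IsLeg (f : G →ₗ[ℂ] A) : Prop where
  one : f 1 = 1
  mul : ∀ x y, f (x * y) = f x * f y

/-- The images of `f` and `g` commute. -/
def Comm (f g : G →ₗ[ℂ] A) : Prop := ∀ x y, Commute (f x) (g y)

@[simp] theorem tens_tmul (f g : G →ₗ[ℂ] A) (x y : G) : tens f g (x ⊗ₜ y) = f x * g y := rfl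

@[simp] theorem tens₃_tmul (f g h : G →ₗ[ℂ] A) (x : G) (y : G ⊗[ℂ] G) :
    tens₃ f g h (x ⊗ₜ y) = f x * tens g h y := rfl

theorem conv_apply (f g : G →ₗ[ℂ] A) (x : G) : conv f g x = tens f g (Coalgebra.comul x) := rfl

theorem unitLeg_apply (x : G) :
    (unitLeg x : A) = algebraMap ℂ A (Coalgebra.counit x) := rfl

theorem Comm.symm {f g : G →ₗ[ℂ] A} (h : Comm f g) : Comm g f := fun _ _ => (h _ _).symm

theorem isLeg_unitLeg : IsLeg (unitLeg : G →ₗ[ℂ] A) where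
  one := by simp [unitLeg]
  mul x y := by simp [unitLeg]

theorem comm_unitLeg_left (f : G →ₗ[ℂ] A) : Comm unitLeg f := fun _ _ =>
  Algebra.commute_algebraMap_left _ _

theorem comm_unitLeg_right (f : G →ₗ[ℂ] A) : Comm f unitLeg := (comm_unitLeg_left f).symm

theorem IsLeg.comp {f : G →ₗ[ℂ] A} (hf : IsLeg f) (F : A →ₐ[ℂ] B) :
    IsLeg (F.toLinearMap ∘ₗ f) where
  one := by simp [hf.one]
  mul x y := by simp [hf.mul]

theorem Comm.comp {f g : G →ₗ[ℂ] A} (h : Comm f g) (F : A →ₐ[ℂ] B) :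
    Comm (F.toLinearMap ∘ₗ f) (F.toLinearMap ∘ₗ g) := fun _ _ => (h _ _).map F

theorem map_tens (F : A →ₐ[ℂ] B) (f g : G →ₗ[ℂ] A) (x : G ⊗[ℂ] G) :
    F (tens f g x) = tens (F.toLinearMap ∘ₗ f) (F.toLinearMap ∘ₗ g) x := by
  induction x using TensorProduct.induction_on with
  | zero => simp
  | tmul x y => simp
  | add x y hx hy => simp [hx, hy]

theorem comp_conv (F : A →ₐ[ℂ] B) (f g : G →ₗ[ℂ] A) :
    F.toLinearMap ∘ₗ conv f g = conv (F.toLinearMap ∘ₗ f) (F.toLinearMap ∘ₗ g) :=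
  LinearMap.ext fun _ => map_tens F f g _

theorem comp_unitLeg (F : A →ₐ[ℂ] B) : F.toLinearMap ∘ₗ (unitLeg : G →ₗ[ℂ] A) = unitLeg := by
  ext x
  simp [unitLeg]

theorem tens_one {f g : G →ₗ[ℂ] A} (hf : IsLeg f) (hg : IsLeg g) : tens f g 1 = 1 := by
  rw [Algebra.TensorProduct.one_def, tens_tmul, hf.one, hg.one, one_mul]

theorem tens_mul {f g : G →ₗ[ℂ] A} (hf : IsLeg f) (hg : IsLeg g) (h : Comm f g)
    (x y : G ⊗[ℂ] G) : tens f g (x * y) = tens f g x * tens f g y := by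
  induction x using TensorProduct.induction_on with
  | zero => simp
  | add x x' hx hx' => simp [hx, hx', add_mul]
  | tmul a b =>
    induction y using TensorProduct.induction_on with
    | zero => simp
    | add x x' hx hx' => simp [hx, hx', mul_add]
    | tmul c d =>
      simp only [Algebra.TensorProduct.tmul_mul_tmul, tens_tmul, hf.mul, hg.mul]
      rw [mul_assoc, ← mul_assoc (f c), (h c b).eq]
      simp only [mul_assoc]

theorem tens_flip {f g : G →ₗ[ℂ] A} (h : Comm f g) (x : G ⊗[ℂ] G) :
    tens f g (tensorFlip x) = tens g f x := by
  induction x using TensorProduct.induction_on with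
  | zero => simp [tensorFlip]
  | add x y hx hy =>
    simp [tensorFlip_add, hx, hy]
  | tmul a b => exact (h b a).eq

theorem tens_commute {f g : G →ₗ[ℂ] A} {a : A} (hf : ∀ x, Commute (f x) a)
    (hg : ∀ x, Commute (g x) a) (y : G ⊗[ℂ] G) : Commute (tens f g y) a := by
  induction y using TensorProduct.induction_on with
  | zero => simp
  | add x y hx hy => simpa using hx.add_left hy
  | tmul x y => exact (hf x).mul_left (hg y)

theorem conv_commute {f g : G →ₗ[ℂ] A} {a : A} (hf : ∀ x, Commute (f x) a)
    (hg : ∀ x, Commute (g x) a) (y : G) : Commute (conv f g y) a := tens_commute hf hg _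

theorem Comm.conv_left {f g h : G →ₗ[ℂ] A} (hf : Comm f h) (hg : Comm g h) :
    Comm (conv f g) h := fun x y => conv_commute (fun x => hf x y) (fun x => hg x y) x

theorem Comm.conv_right {f g h : G →ₗ[ℂ] A} (hf : Comm h f) (hg : Comm h g) :
    Comm h (conv f g) := (hf.symm.conv_left hg.symm).symm

theorem isLeg_conv {f g : G →ₗ[ℂ] A} (hf : IsLeg f) (hg : IsLeg g) (h : Comm f g) :
    IsLeg (conv f g) where
  one := by simp [conv, tens_one hf hg]
  mul x y := by simp [conv, tens_mul hf hg h]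

theorem tens₃_assoc_comul (f g h : G →ₗ[ℂ] A) (x : G ⊗[ℂ] G) :
    tens₃ f g h (TensorProduct.assoc ℂ G G G
      (TensorProduct.map (Coalgebra.comul (R := ℂ)) LinearMap.id x)) = tens (conv f g) h x := by
  induction x using TensorProduct.induction_on with
  | zero => simp
  | add x y hx hy => simp [hx, hy]
  | tmul x y =>
    simp only [TensorProduct.map_tmul, LinearMap.id_coe, id_eq, tens_tmul, conv_apply]
    induction Coalgebra.comul (R := ℂ) x using TensorProduct.induction_on with
    | zero => simp
    | add x y hx hy => simp [hx, hy, add_mul, TensorProduct.add_tmul]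
    | tmul a b => simp [mul_assoc]

theorem tens₃_comul (f g h : G →ₗ[ℂ] A) (x : G ⊗[ℂ] G) :
    tens₃ f g h (TensorProduct.map LinearMap.id (Coalgebra.comul (R := ℂ)) x) =
      tens f (conv g h) x := by
  induction x using TensorProduct.induction_on with
  | zero => simp
  | add x y hx hy => simp [hx, hy]
  | tmul x y => rfl

theorem conv_assoc (f g h : G →ₗ[ℂ] A) : conv (conv f g) h = conv f (conv g h) := by
  ext x
  rw [conv_apply, ← tens₃_assoc_comul, conv_apply, ← tens₃_comul]
  congr 1
  exact Coalgebra.coassoc_apply x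

theorem unitLeg_conv (f : G →ₗ[ℂ] A) : conv unitLeg f = f := by
  ext x
  have h := congrArg (fun t => LinearMap.mul' ℂ A (TensorProduct.map (Algebra.linearMap ℂ A) f t))
    (Coalgebra.rTensor_counit_comul (R := ℂ) x)
  simp only [TensorProduct.map_tmul, LinearMap.mul'_apply, map_one, one_mul,
    Algebra.linearMap_apply] at h
  rw [← h, conv_apply]
  induction Coalgebra.comul (R := ℂ) x using TensorProduct.induction_on with
  | zero => simp
  | add x y hx hy => simp [hx, hy]
  | tmul a b => simp [unitLeg_apply]

theorem conv_unitLeg (f : G →ₗ[ℂ] A) : conv f unitLeg = f := by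
  ext x
  have h := congrArg (fun t => LinearMap.mul' ℂ A (TensorProduct.map f (Algebra.linearMap ℂ A) t))
    (Coalgebra.lTensor_counit_comul (R := ℂ) x)
  simp only [TensorProduct.map_tmul, LinearMap.mul'_apply, map_one, mul_one,
    Algebra.linearMap_apply] at h
  rw [← h, conv_apply]
  induction Coalgebra.comul (R := ℂ) x using TensorProduct.induction_on with
  | zero => simp
  | add x y hx hy => simp [hx, hy]
  | tmul a b => simp [unitLeg_apply]

/-- `x ↦ f (S x)`. -/
def antip (f : G →ₗ[ℂ] A) : G →ₗ[ℂ] A := f ∘ₗ HopfAlgebra.antipode ℂ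

@[simp] theorem antip_apply (f : G →ₗ[ℂ] A) (x : G) :
    antip f x = f (HopfAlgebra.antipode ℂ x) := rfl

theorem antip_conv_self {f : G →ₗ[ℂ] A} (hf : IsLeg f) : conv (antip f) f = unitLeg := by
  ext x
  let F : G →ₐ[ℂ] A := AlgHom.ofLinearMap f hf.one hf.mul
  have h := congrArg F (HopfAlgebra.mul_antipode_rTensor_comul_apply (R := ℂ) x)
  rw [AlgHom.commutes] at h
  rw [unitLeg_apply, ← h, conv_apply]
  induction Coalgebra.comul (R := ℂ) x using TensorProduct.induction_on with
  | zero => simp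
  | add x y hx hy => simp [hx, hy]
  | tmul a b => exact (hf.mul _ _).symm

theorem self_conv_antip {f : G →ₗ[ℂ] A} (hf : IsLeg f) : conv f (antip f) = unitLeg := by
  ext x
  let F : G →ₐ[ℂ] A := AlgHom.ofLinearMap f hf.one hf.mul
  have h := congrArg F (HopfAlgebra.mul_antipode_lTensor_comul_apply (R := ℂ) x)
  rw [AlgHom.commutes] at h
  rw [unitLeg_apply, ← h, conv_apply]
  induction Coalgebra.comul (R := ℂ) x using TensorProduct.induction_on with
  | zero => simp
  | add x y hx hy => simp [hx, hy]
  | tmul a b => exact (hf.mul _ _).symm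

theorem conv_inv_unique {f g h : G →ₗ[ℂ] A} (h₁ : conv g f = unitLeg) (h₂ : conv f h = unitLeg) :
    g = h := by
  rw [← conv_unitLeg g, ← h₂, ← conv_assoc, h₁, unitLeg_conv]

/-- Both sides invert `conv f g` in the convolution algebra, one from the left and one from the
right. -/
theorem antip_conv {f g : G →ₗ[ℂ] A} (hf : IsLeg f) (hg : IsLeg g) (h : Comm f g) :
    antip (conv f g) = conv (antip g) (antip f) := by
  refine conv_inv_unique (antip_conv_self (isLeg_conv hf hg h)) ?_
  rw [conv_assoc, ← conv_assoc g, self_conv_antip hg, unitLeg_conv, self_conv_antip hf]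

/-- Evaluates the right side of the axiom for `(Δ ⊗ id)(R)` on three legs. Nothing is asked of `f`,
so that it may be replaced by its antipode, which reverses products. -/
theorem tens₃_leg13_mul_leg23 {f g h : G →ₗ[ℂ] A} (hh : IsLeg h) (hgh : Comm g h)
    (x y : G ⊗[ℂ] G) :
    tens₃ f g h (leg13 x * leg23 y) = tens f h x * tens g h y := by
  induction x using TensorProduct.induction_on with
  | zero => simp [leg13]
  | add x x' hx hx' => simp [leg13_add, add_mul, hx, hx']
  | tmul a b =>
    induction y using TensorProduct.induction_on with
    | zero => simp [leg23]
    | add x x' hx hx' => simp [leg23_add, mul_add, hx, hx']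
    | tmul c d =>
      simp only [leg13, leg23, Algebra.TensorProduct.map_tmul, AlgHom.coe_id, id_eq,
        Algebra.TensorProduct.includeRight_apply, Algebra.TensorProduct.tmul_mul_tmul, mul_one,
        one_mul, tens₃_tmul, tens_tmul, hh.mul]
      rw [mul_assoc, ← mul_assoc (g c), (hgh c b).eq, mul_assoc]

theorem tens₃_leg13_mul_leg12_tmul (f g h : G →ₗ[ℂ] A) (a b c d : G) :
    tens₃ f g h (leg13 (a ⊗ₜ b) * leg12 (c ⊗ₜ d)) = f (a * c) * (g d * h b) := by
  simp [leg13, leg12]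

theorem tens₃_leg13_mul_leg12 {f g h : G →ₗ[ℂ] A} (hf : IsLeg f) (hfh : Comm f h)
    (hgh : Comm g h) (x y : G ⊗[ℂ] G) :
    tens₃ f g h (leg13 x * leg12 y) = tens f h x * tens f g y := by
  induction x using TensorProduct.induction_on with
  | zero => simp [leg13]
  | add x x' hx hx' => simp [leg13_add, add_mul, hx, hx']
  | tmul a b =>
    induction y using TensorProduct.induction_on with
    | zero => simp [leg12]
    | add x x' hx hx' => simp [leg12_add, mul_add, hx, hx']
    | tmul c d =>
      rw [tens₃_leg13_mul_leg12_tmul, tens_tmul, tens_tmul, hf.mul, (hgh d b).eq, mul_assoc,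
        mul_assoc, ← mul_assoc (f c), (hfh c b).eq, mul_assoc]

/-- Reduces a statement about an arbitrary linear map `f` to the leg `id` of `G` itself. -/
theorem tens_unitLeg (f : G →ₗ[ℂ] A) (x : G ⊗[ℂ] G) :
    tens f unitLeg x = f (tens LinearMap.id unitLeg x) := by
  induction x using TensorProduct.induction_on with
  | zero => simp
  | add x y hx hy => simp [hx, hy]
  | tmul a b =>
    simp only [tens_tmul, unitLeg_apply, LinearMap.id_apply]
    rw [← Algebra.commutes, ← Algebra.smul_def, ← Algebra.commutes, ← Algebra.smul_def, map_smul]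

theorem isLeg_id : IsLeg (LinearMap.id : G →ₗ[ℂ] G) := ⟨rfl, fun _ _ => rfl⟩

end Legs

/-! ## Identities for the `R`-matrix -/

section RMatrix

variable {G : Type*} [Ring G] [HopfAlgebra ℂ G] [StarRing G] [StarModule ℂ G]
  (𝒢 : RibbonStar G) {A : Type*} [Ring A] [Algebra ℂ A]
  {B : Type*} [Ring B] [Algebra ℂ B]

/-- `(f ⊗ g)(R)`. -/
def Rr (f g : G →ₗ[ℂ] A) : A := tens f g (𝒢.R : G ⊗[ℂ] G)

/-- `(f ⊗ g)(R⁻¹)`. -/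
def Ri (f g : G →ₗ[ℂ] A) : A := tens f g 𝒢.Rinv

/-- `(f ⊗ g)(R'R)`. -/
def Qm (f g : G →ₗ[ℂ] A) : A := Rr 𝒢 g f * Rr 𝒢 f g

theorem map_Rr (F : A →ₐ[ℂ] B) (f g : G →ₗ[ℂ] A) :
    F (Rr 𝒢 f g) = Rr 𝒢 (F.toLinearMap ∘ₗ f) (F.toLinearMap ∘ₗ g) := map_tens F f g _

theorem map_Ri (F : A →ₐ[ℂ] B) (f g : G →ₗ[ℂ] A) :
    F (Ri 𝒢 f g) = Ri 𝒢 (F.toLinearMap ∘ₗ f) (F.toLinearMap ∘ₗ g) := map_tens F f g _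

theorem map_Qm (F : A →ₐ[ℂ] B) (f g : G →ₗ[ℂ] A) :
    F (Qm 𝒢 f g) = Qm 𝒢 (F.toLinearMap ∘ₗ f) (F.toLinearMap ∘ₗ g) := by
  simp [Qm, map_Rr]

theorem tens_flip_R_mul_R {f g : G →ₗ[ℂ] A} (hf : IsLeg f) (hg : IsLeg g) (h : Comm f g) :
    tens f g (tensorFlip (𝒢.R : G ⊗[ℂ] G) * (𝒢.R : G ⊗[ℂ] G)) = Qm 𝒢 f g := by
  rw [tens_mul hf hg h, tens_flip h]; rfl

theorem Rr_mul_Ri {f g : G →ₗ[ℂ] A} (hf : IsLeg f) (hg : IsLeg g) (h : Comm f g) :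
    Rr 𝒢 f g * Ri 𝒢 f g = 1 := by
  rw [Rr, Ri, ← tens_mul hf hg h, Units.mul_inv, tens_one hf hg]

theorem Ri_mul_Rr {f g : G →ₗ[ℂ] A} (hf : IsLeg f) (hg : IsLeg g) (h : Comm f g) :
    Ri 𝒢 f g * Rr 𝒢 f g = 1 := by
  rw [Rr, Ri, ← tens_mul hf hg h, Units.inv_mul, tens_one hf hg]

/-- `(f ⊗ g)(R)` as a unit. -/
def Ru {f g : G →ₗ[ℂ] A} (hf : IsLeg f) (hg : IsLeg g) (h : Comm f g) : Aˣ where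
  val := Rr 𝒢 f g
  inv := Ri 𝒢 f g
  val_inv := Rr_mul_Ri 𝒢 hf hg h
  inv_val := Ri_mul_Rr 𝒢 hf hg h

theorem Rr_mul_conv {f g : G →ₗ[ℂ] A} (hf : IsLeg f) (hg : IsLeg g) (h : Comm f g) (x : G) :
    Rr 𝒢 f g * conv f g x = conv g f x * Rr 𝒢 f g := by
  rw [Rr, conv_apply, ← tens_mul hf hg h, 𝒢.R_mul_comul, tens_mul hf hg h, tens_flip h]
  rfl

theorem Rr_conv_left {f g h : G →ₗ[ℂ] A} (hh : IsLeg h) (hgh : Comm g h) :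
    Rr 𝒢 (conv f g) h = Rr 𝒢 f h * Rr 𝒢 g h := by
  rw [Rr, ← tens₃_assoc_comul, 𝒢.comul_id_R, tens₃_leg13_mul_leg23 hh hgh]; rfl

theorem Rr_conv_right {f g h : G →ₗ[ℂ] A} (hf : IsLeg f) (hfh : Comm f h) (hgh : Comm g h) :
    Rr 𝒢 f (conv g h) = Rr 𝒢 f h * Rr 𝒢 f g := by
  rw [Rr, ← tens₃_comul, 𝒢.id_comul_R, tens₃_leg13_mul_leg12 hf hfh hgh]; rfl

theorem Rr_tens_conv {f g h : G →ₗ[ℂ] A} (hf : IsLeg f) (hg : IsLeg g) (hfg : Comm f g)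
    (hfh : Comm f h) (hgh : Comm g h) (x : G ⊗[ℂ] G) :
    Rr 𝒢 f g * tens (conv f g) h x = tens (conv g f) h x * Rr 𝒢 f g := by
  induction x using TensorProduct.induction_on with
  | zero => simp
  | add x y hx hy => simp [mul_add, add_mul, hx, hy]
  | tmul a b =>
    rw [tens_tmul, tens_tmul, ← mul_assoc, Rr_mul_conv 𝒢 hf hg hfg, mul_assoc, mul_assoc]
    congr 1
    exact tens_commute (fun x => hfh x b) (fun x => hgh x b) _

/-- The products `R_{fh} R_{gh}` and `R_{gh} R_{fh}` are `R` on a coproduct and on its flip, and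
`R_{fg}` exchanges these two. -/
theorem yang_baxter {f g h : G →ₗ[ℂ] A} (hf : IsLeg f) (hg : IsLeg g) (hh : IsLeg h)
    (hfg : Comm f g) (hfh : Comm f h) (hgh : Comm g h) :
    Rr 𝒢 f g * Rr 𝒢 f h * Rr 𝒢 g h = Rr 𝒢 g h * Rr 𝒢 f h * Rr 𝒢 f g := by
  rw [mul_assoc, ← Rr_conv_left 𝒢 hh hgh, ← Rr_conv_left 𝒢 hh hfh]
  exact Rr_tens_conv 𝒢 hf hg hfg hfh hgh _

theorem Qm_conv_right {f g h : G →ₗ[ℂ] A} (hf : IsLeg f) (hfh : Comm f h)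
    (hgh : Comm g h) :
    Qm 𝒢 f (conv g h) = Rr 𝒢 g f * Qm 𝒢 f h * Rr 𝒢 f g := by
  rw [Qm, Rr_conv_left 𝒢 hf hfh.symm, Rr_conv_right 𝒢 hf hfh hgh, Qm]
  simp only [mul_assoc]

theorem Qm_conv_left {f g h : G →ₗ[ℂ] A} (hh : IsLeg h) (hfg : Comm f g)
    (hgh : Comm g h) :
    Qm 𝒢 (conv f g) h = Rr 𝒢 h g * Qm 𝒢 f h * Rr 𝒢 g h := by
  rw [Qm, Rr_conv_left 𝒢 hh hgh, Rr_conv_right 𝒢 hh hgh.symm hfg, Qm]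
  simp only [mul_assoc]

theorem Qm_commute_conv {f g : G →ₗ[ℂ] A} (hf : IsLeg f) (hg : IsLeg g) (h : Comm f g) (x : G) :
    Commute (Qm 𝒢 f g) (conv f g x) := by
  rw [Qm, Commute, SemiconjBy, mul_assoc, Rr_mul_conv 𝒢 hf hg h, ← mul_assoc,
    Rr_mul_conv 𝒢 hg hf h.symm, mul_assoc]

/-- Since `ε * ε = ε`, the element is idempotent; being invertible it is `1`. -/
theorem Rr_unitLeg_left {g : G →ₗ[ℂ] A} (hg : IsLeg g) : Rr 𝒢 unitLeg g = 1 := by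
  have h := Rr_conv_left 𝒢 (f := unitLeg) (g := unitLeg) hg (comm_unitLeg_left g)
  rw [unitLeg_conv] at h
  exact ((Ru 𝒢 isLeg_unitLeg hg (comm_unitLeg_left g)).isUnit.mul_eq_left).mp h.symm

/-- Multiplicativity of `g` is not required: the lemma is also used for maps of the form `f ∘ S`,
which reverse products. -/
theorem Rr_unitLeg_right (g : G →ₗ[ℂ] A) : Rr 𝒢 g unitLeg = g 1 := by
  have h := Rr_conv_right 𝒢 (f := (LinearMap.id : G →ₗ[ℂ] G)) (g := unitLeg) (h := unitLeg)
    isLeg_id (comm_unitLeg_right _) (comm_unitLeg_right _)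
  rw [unitLeg_conv] at h
  have h' : Rr 𝒢 (LinearMap.id : G →ₗ[ℂ] G) unitLeg = 1 :=
    ((Ru 𝒢 isLeg_id isLeg_unitLeg (comm_unitLeg_right _)).isUnit.mul_eq_left).mp h.symm
  rw [Rr, tens_unitLeg]
  exact congrArg g h'

theorem Rr_antip_left {f g : G →ₗ[ℂ] A} (hf : IsLeg f) (hg : IsLeg g) (h : Comm f g) :
    Rr 𝒢 (antip f) g = Ri 𝒢 f g := by
  have e := Rr_conv_left 𝒢 (f := antip f) hg h
  rw [antip_conv_self hf, Rr_unitLeg_left 𝒢 hg] at e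
  calc _ = Rr 𝒢 (antip f) g * (Rr 𝒢 f g * Ri 𝒢 f g) := by rw [Rr_mul_Ri 𝒢 hf hg h, mul_one]
    _ = _ := by rw [← mul_assoc, ← e, one_mul]

/-- `∑ f(r¹ s¹) g(S(s²)) g(r²) = f(1)`. -/
theorem tens₃_antip_R {f g : G →ₗ[ℂ] A} (hg : IsLeg g) :
    tens₃ f (antip g) g (leg13 (𝒢.R : G ⊗[ℂ] G) * leg12 (𝒢.R : G ⊗[ℂ] G)) = f 1 := by
  rw [← 𝒢.id_comul_R, tens₃_comul, antip_conv_self hg]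
  exact Rr_unitLeg_right 𝒢 f

/-- Evaluating `(id ⊗ Δ)(R) = R₁₃R₁₂` on `S f`, `S g`, `g` shows that `(S ⊗ S)(R)` is inverse to `(S
⊗ id)(R) = R⁻¹`. -/
theorem Rr_antip_antip {f g : G →ₗ[ℂ] A} (hf : IsLeg f) (hg : IsLeg g) (h : Comm f g) :
    Rr 𝒢 (antip f) (antip g) = Rr 𝒢 f g := by
  -- The antipode reverses products in the first leg, so the two factors come out in the order
  -- opposite to that of `tens₃_leg13_mul_leg12`.
  have e : ∀ x y : G ⊗[ℂ] G, tens₃ (antip f) (antip g) g (leg13 x * leg12 y) =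
      tens (antip f) (antip g) y * tens (antip f) g x := by
    intro x y
    induction x using TensorProduct.induction_on with
    | zero => simp [leg13]
    | add x x' hx hx' => simp [leg13_add, add_mul, mul_add, hx, hx']
    | tmul a b =>
      induction y using TensorProduct.induction_on with
      | zero => simp [leg12]
      | add x x' hx hx' => simp [leg12_add, mul_add, add_mul, hx, hx']
      | tmul c d =>
        simp only [tens₃_leg13_mul_leg12_tmul, tens_tmul, antip_apply,
          HopfAlgebra.antipode_mul_antidistrib, hf.mul]
        rw [mul_assoc, mul_assoc, ← mul_assoc _ _ (g b), (h _ _).eq, mul_assoc]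
  have e' := tens₃_antip_R 𝒢 (f := antip f) hg
  rw [e, antip_apply, HopfAlgebra.antipode_one, hf.one] at e'
  change Rr 𝒢 (antip f) (antip g) * Rr 𝒢 (antip f) g = 1 at e'
  rw [Rr_antip_left 𝒢 hf hg h] at e'
  calc _ = Rr 𝒢 (antip f) (antip g) * (Ri 𝒢 f g * Rr 𝒢 f g) := by
        rw [Ri_mul_Rr 𝒢 hf hg h, mul_one]
    _ = _ := by rw [← mul_assoc, e', one_mul]

end RMatrix

/-! ## Operator legs -/

section Operators

variable {G : Type*} [Ring G] [HopfAlgebra ℂ G] {A : Type*} [Ring A] [Algebra ℂ A]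

/-- The operators on `A`, composed from left to right. -/
abbrev OpEnd (A : Type*) [Ring A] [Algebra ℂ A] := (Module.End ℂ A)ᵐᵒᵖ

/-- `X ↦ X f(x)`. -/
def rightLeg (f : G →ₗ[ℂ] A) : G →ₗ[ℂ] OpEnd A :=
  (MulOpposite.opLinearEquiv ℂ).toLinearMap ∘ₗ (LinearMap.mul ℂ A).flip ∘ₗ f

/-- `X ↦ f(S(x)) X`. -/
def leftLeg (f : G →ₗ[ℂ] A) : G →ₗ[ℂ] OpEnd A :=
  (MulOpposite.opLinearEquiv ℂ).toLinearMap ∘ₗ LinearMap.mul ℂ A ∘ₗ antip f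

@[simp] theorem unop_rightLeg (f : G →ₗ[ℂ] A) (x : G) (X : A) :
    (rightLeg f x).unop X = X * f x := rfl

@[simp] theorem unop_leftLeg (f : G →ₗ[ℂ] A) (x : G) (X : A) :
    (leftLeg f x).unop X = f (HopfAlgebra.antipode ℂ x) * X := rfl

theorem OpEnd.ext {a b : OpEnd A} (h : ∀ X, a.unop X = b.unop X) : a = b :=
  MulOpposite.unop_injective (LinearMap.ext h)

theorem isLeg_rightLeg {f : G →ₗ[ℂ] A} (hf : IsLeg f) : IsLeg (rightLeg f) where
  one := OpEnd.ext fun X => by simp [hf.one]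
  mul x y := OpEnd.ext fun X => by simp [hf.mul, mul_assoc]

theorem isLeg_leftLeg {f : G →ₗ[ℂ] A} (hf : IsLeg f) : IsLeg (leftLeg f) where
  one := OpEnd.ext fun X => by simp [hf.one, HopfAlgebra.antipode_one]
  mul x y := OpEnd.ext fun X => by
    simp [hf.mul, mul_assoc, HopfAlgebra.antipode_mul_antidistrib]

/-- Left and right multiplications commute, so sandwiches `∑ f(S r²) X f(r¹)`, such as the one
defining `u`, are values of `R` on commuting legs and obey the general identities. -/
theorem comm_rightLeg_leftLeg (f g : G →ₗ[ℂ] A) : Comm (rightLeg f) (leftLeg g) :=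
  fun _ _ => OpEnd.ext fun X => by simp [mul_assoc]

theorem comm_rightLeg {f g : G →ₗ[ℂ] A} (h : Comm f g) : Comm (rightLeg f) (rightLeg g) :=
  fun _ _ => OpEnd.ext fun X => by simp [mul_assoc, (h _ _).eq]

theorem comm_leftLeg {f g : G →ₗ[ℂ] A} (h : Comm f g) : Comm (leftLeg f) (leftLeg g) :=
  fun _ _ => OpEnd.ext fun X => by simp [← mul_assoc, (h _ _).eq]

theorem unop_tens_rightLeg (f g : G →ₗ[ℂ] A) (x : G ⊗[ℂ] G) (X : A) :
    (tens (rightLeg f) (rightLeg g) x).unop X = X * tens f g x := by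
  induction x using TensorProduct.induction_on with
  | zero => simp
  | add x y hx hy => simp [hx, hy, mul_add]
  | tmul a b => simp [mul_assoc]

theorem unop_tens_leftLeg (f g : G →ₗ[ℂ] A) (x : G ⊗[ℂ] G) (X : A) :
    (tens (leftLeg f) (leftLeg g) x).unop X = tens (antip g) (antip f) (tensorFlip x) * X := by
  induction x using TensorProduct.induction_on with
  | zero => simp [tensorFlip]
  | add x y hx hy =>
    simp [tensorFlip_add, hx, hy, add_mul]
  | tmul a b =>
    change _ = tens (antip g) (antip f) (b ⊗ₜ a) * X
    simp [mul_assoc]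

theorem rightLeg_conv (f g : G →ₗ[ℂ] A) :
    rightLeg (conv f g) = conv (rightLeg f) (rightLeg g) :=
  LinearMap.ext fun _ => OpEnd.ext fun X => (unop_tens_rightLeg f g _ X).symm

theorem leftLeg_conv {f g : G →ₗ[ℂ] A} (hf : IsLeg f) (hg : IsLeg g) (h : Comm f g) :
    leftLeg (conv f g) = conv (leftLeg g) (leftLeg f) :=
  LinearMap.ext fun x => OpEnd.ext fun X => by
    rw [unop_leftLeg, ← antip_apply, antip_conv hf hg h, conv_apply (leftLeg g), unop_tens_leftLeg,
      tens_flip (f := antip f) (g := antip g) (fun _ _ => h _ _), conv_apply]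

/-- A vector on which `f` acts through the counit does not see `f` in a convolution product. -/
theorem unop_conv_of_counit {f : G →ₗ[ℂ] OpEnd A} {X : A}
    (hf : ∀ x, (f x).unop X = Coalgebra.counit (R := ℂ) x • X) (g : G →ₗ[ℂ] OpEnd A) (x : G) :
    (conv f g x).unop X = (g x).unop X := by
  have e : ∀ y : G ⊗[ℂ] G, (tens f g y).unop X = (tens unitLeg g y).unop X := by
    intro y
    induction y using TensorProduct.induction_on with
    | zero => simp
    | add x y hx hy => simp [hx, hy]
    | tmul a b => simp [hf, unitLeg_apply, Algebra.algebraMap_eq_smul_one]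
  rw [conv_apply, e, ← conv_apply, unitLeg_conv]

end Operators

/-! ## The element `u` and the grouplike element `g` -/

section Drinfeld

variable {G : Type*} [Ring G] [HopfAlgebra ℂ G] {A : Type*} [Ring A] [Algebra ℂ A]

theorem unop_tens_sandwich_tmul (f g : G →ₗ[ℂ] A) (a b : G) (X : A) :
    (tens (rightLeg f) (leftLeg g) (a ⊗ₜ b)).unop X =
      g (HopfAlgebra.antipode ℂ b) * (X * f a) := rfl

theorem apply_uElt {f : G →ₗ[ℂ] A} (hf : IsLeg f) (x : G ⊗[ℂ] G) :
    f (uElt x) = (tens (rightLeg f) (leftLeg f) x).unop 1 := by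
  unfold uElt
  induction x using TensorProduct.induction_on with
  | zero => simp [tensorFlip]
  | add x y hx hy => simp [tensorFlip_add, hx, hy]
  | tmul a b =>
    rw [unop_tens_sandwich_tmul, one_mul, ← hf.mul]
    rfl

theorem unop_sandwich_of_commute (f : G →ₗ[ℂ] A) {X : A} (hX : ∀ y, Commute X (f y))
    (x : G ⊗[ℂ] G) :
    (tens (rightLeg f) (leftLeg f) x).unop X = X * (tens (rightLeg f) (leftLeg f) x).unop 1 := by
  induction x using TensorProduct.induction_on with
  | zero => simp
  | add x y hx hy => simp [hx, hy, mul_add]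
  | tmul a b =>
    rw [unop_tens_sandwich_tmul, unop_tens_sandwich_tmul, one_mul, ← mul_assoc, ← mul_assoc,
      (hX _).eq]

/-- Brings a sandwich into the form of `tens₃_antip_R`, which evaluates it to `g 1` when `x = y =
R`. -/
theorem unop_sandwich_tens {f g : G →ₗ[ℂ] A} (hg : IsLeg g) (h : Comm g f)
    (x y : G ⊗[ℂ] G) :
    (tens (rightLeg g) (leftLeg f) y).unop (tens g f x) =
      tens₃ g (antip f) f (leg13 x * leg12 y) := by
  induction x using TensorProduct.induction_on with
  | zero => simp [leg13]
  | add x x' hx hx' => simp [leg13_add, add_mul, hx, hx']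
  | tmul a b =>
    induction y using TensorProduct.induction_on with
    | zero => simp [leg12]
    | add x x' hx hx' =>
      simp only [map_add, MulOpposite.unop_add, LinearMap.add_apply, hx, hx', leg12_add, mul_add]
    | tmul c d =>
      rw [tens₃_leg13_mul_leg12_tmul, unop_tens_sandwich_tmul, tens_tmul, hg.mul, antip_apply,
        mul_assoc (g a), ← (h c b).eq, ← mul_assoc (g a), ← mul_assoc,
        ← ((h a _).mul_left (h c _)).eq, mul_assoc]

variable [StarRing G] [StarModule ℂ G] (𝒢 : RibbonStar G)

/-- The element `u`. -/
abbrev drinfeldU : G := uElt (𝒢.R : G ⊗[ℂ] G)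

/-- Apply `a ⊗ b ↦ S(b) a` to `R Δ(x) = Δ'(x) R`: the left side sandwiches `u` by `Δ(x)`, and on the
right `∑ S(x₁) x₂ = ε(x)` appears inside the sandwich by `R`. -/
theorem conv_sandwich_drinfeldU (x : G) :
    (conv (rightLeg LinearMap.id) (leftLeg LinearMap.id) x).unop (drinfeldU 𝒢) =
      Coalgebra.counit (R := ℂ) x • drinfeldU 𝒢 := by
  let φ : G ⊗[ℂ] G →ₗ[ℂ] G := LinearMap.mul' ℂ G ∘ₗ
    TensorProduct.map (HopfAlgebra.antipode ℂ) LinearMap.id ∘ₗ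
      (TensorProduct.comm ℂ G G).toLinearMap
  have hφ : ∀ a b, φ (a ⊗ₜ b) = HopfAlgebra.antipode ℂ b * a := fun a b => rfl
  have h₁ : ∀ y z : G ⊗[ℂ] G, φ (y * z) =
      (tens (rightLeg LinearMap.id) (leftLeg LinearMap.id) z).unop (φ y) := by
    intro y z
    induction z using TensorProduct.induction_on with
    | zero => simp
    | add x y hx hy => simp [mul_add, hx, hy]
    | tmul a b =>
      induction y using TensorProduct.induction_on with
      | zero => simp
      | add x y hx hy => simp only [map_add, add_mul, hx, hy]
      | tmul c d =>
        rw [Algebra.TensorProduct.tmul_mul_tmul, hφ, hφ, unop_tens_sandwich_tmul,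
          HopfAlgebra.antipode_mul_antidistrib]
        simp [mul_assoc]
  have h₂ : ∀ y z : G ⊗[ℂ] G, φ (tensorFlip y * z) =
      (tens (rightLeg LinearMap.id) (leftLeg LinearMap.id) z).unop
        (tens (antip LinearMap.id) LinearMap.id y) := by
    intro y z
    rw [h₁]
    congr 1
    induction y using TensorProduct.induction_on with
    | zero => simp [tensorFlip]
    | add x y hx hy => simp [tensorFlip_add, hx, hy]
    | tmul a b => rfl
  have h₃ : φ (𝒢.R : G ⊗[ℂ] G) = drinfeldU 𝒢 := rfl
  have e := congrArg φ (𝒢.R_mul_comul x)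
  rw [h₁, h₂, h₃, ← conv_apply (antip _), antip_conv_self isLeg_id, ← conv_apply] at e
  rw [e, unitLeg_apply, Algebra.algebraMap_eq_smul_one, map_smul,
    ← apply_uElt isLeg_id, LinearMap.id_apply]

/-- Cancel the left multiplication in `∑ S(x₂) u x₁ = ε(x) u` by convolving with its antipode. -/
theorem antipode_sq_mul_drinfeldU (x : G) :
    HopfAlgebra.antipode ℂ (HopfAlgebra.antipode ℂ x) * drinfeldU 𝒢 = drinfeldU 𝒢 * x := by
  have h : conv (conv (rightLeg (LinearMap.id : G →ₗ[ℂ] G)) (leftLeg LinearMap.id))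
      (antip (leftLeg LinearMap.id)) = rightLeg LinearMap.id := by
    rw [conv_assoc, self_conv_antip (isLeg_leftLeg isLeg_id), conv_unitLeg]
  have e := congrArg (fun F => (F x).unop (drinfeldU 𝒢)) h
  beta_reduce at e
  rw [unop_conv_of_counit (conv_sandwich_drinfeldU 𝒢)] at e
  exact e

/-- The inverse `∑ r² S²(r¹)` of `u`. -/
def drinfeldUInv : G :=
  tens LinearMap.id (antip (antip LinearMap.id)) (tensorFlip (𝒢.R : G ⊗[ℂ] G))

/-- Apply `a ⊗ b ⊗ c ↦ b S(c) a` to `(id ⊗ Δ)(R) = R₁₃R₁₂`. The left side collapses to `(id ⊗ ε)(R)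
= 1`; the right side is `∑ r² u r¹ = ∑ r² S²(r¹) u`. -/
theorem drinfeldUInv_mul : drinfeldUInv 𝒢 * drinfeldU 𝒢 = 1 := by
  let ψ : G ⊗[ℂ] (G ⊗[ℂ] G) →ₗ[ℂ] G := LinearMap.mul' ℂ G ∘ₗ
    (TensorProduct.comm ℂ G G).toLinearMap ∘ₗ
      TensorProduct.map LinearMap.id (tens LinearMap.id (antip LinearMap.id))
  have hψ : ∀ a b c, ψ (a ⊗ₜ (b ⊗ₜ c)) = b * HopfAlgebra.antipode ℂ c * a := fun _ _ _ => rfl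
  have h₁ : ∀ y : G ⊗[ℂ] G, ψ (TensorProduct.map LinearMap.id (Coalgebra.comul (R := ℂ)) y) =
      tens LinearMap.id unitLeg y := by
    intro y
    induction y using TensorProduct.induction_on with
    | zero => simp
    | add x y hx hy => simp only [map_add, hx, hy]
    | tmul a b =>
      change conv LinearMap.id (antip LinearMap.id) b * a = _
      rw [self_conv_antip isLeg_id, tens_tmul, unitLeg_apply]
      exact Algebra.commutes _ _
  have h₂ : ∀ y z : G ⊗[ℂ] G, ψ (leg13 y * leg12 z) =
      tens LinearMap.id ((LinearMap.mul ℂ G (uElt y))) (tensorFlip z) := by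
    intro y z
    induction y using TensorProduct.induction_on with
    | zero =>
      have : uElt (0 : G ⊗[ℂ] G) = 0 := by simp [uElt, tensorFlip]
      induction z using TensorProduct.induction_on with
      | zero => simp [leg13, tensorFlip]
      | add x x' hx hx' => simp only [leg12_add, mul_add, map_add, hx, hx', tensorFlip_add]
      | tmul c d => simp [leg13, this, tensorFlip]
    | add x x' hx hx' =>
      have : uElt (x + x') = uElt x + uElt x' := by simp [uElt, tensorFlip_add]
      rw [leg13_add, add_mul, map_add, hx, hx', this]
      simp [tens, TensorProduct.map_add_right]
    | tmul a b =>
      induction z using TensorProduct.induction_on with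
      | zero => simp [leg12, tensorFlip]
      | add x x' hx hx' => simp only [leg12_add, mul_add, map_add, hx, hx', tensorFlip_add]
      | tmul c d =>
        have : leg13 (a ⊗ₜ[ℂ] b) * leg12 (c ⊗ₜ[ℂ] d) = (a * c) ⊗ₜ (d ⊗ₜ b) := by
          simp [leg13, leg12]
        rw [this, hψ]
        change _ = d * ((HopfAlgebra.antipode ℂ b * a) * c)
        simp only [mul_assoc]
  have h₃ : ∀ z : G ⊗[ℂ] G, tens LinearMap.id ((LinearMap.mul ℂ G (drinfeldU 𝒢))) z =
      tens LinearMap.id (antip (antip LinearMap.id)) z * drinfeldU 𝒢 := by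
    intro z
    induction z using TensorProduct.induction_on with
    | zero => simp
    | add x y hx hy => simp only [map_add, hx, hy, add_mul]
    | tmul a b =>
      simp only [tens_tmul, LinearMap.id_apply, LinearMap.mul_apply', antip_apply]
      rw [← antipode_sq_mul_drinfeldU 𝒢, mul_assoc]
  have e := congrArg ψ 𝒢.id_comul_R
  rw [h₁, h₂, h₃] at e
  exact e.symm.trans (Rr_unitLeg_right 𝒢 LinearMap.id)

theorem mul_drinfeldUInv [FiniteDimensional ℂ G] : drinfeldU 𝒢 * drinfeldUInv 𝒢 = 1 := by
  have := IsNoetherianRing.of_finite ℂ G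
  exact mul_eq_one_symm (drinfeldUInv_mul 𝒢)

/-- On legs, `(R'R)Δ(u) = u ⊗ u`. Sandwiching `R'R`, which commutes with the coproduct, by `R` on
coproducts produces the left side. Yang-Baxter moves split this operation into elementary
sandwiches, which yield the right side. -/
theorem Qm_mul_conv_drinfeldU {f g : G →ₗ[ℂ] A} (hf : IsLeg f) (hg : IsLeg g)
    (h : Comm f g) :
    Qm 𝒢 f g * conv f g (drinfeldU 𝒢) = f (drinfeldU 𝒢) * g (drinfeldU 𝒢) := by
  have l1 := isLeg_rightLeg hf
  have l2 := isLeg_rightLeg hg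
  have l3 := isLeg_leftLeg hg
  have l4 := isLeg_leftLeg hf
  have c12 := comm_rightLeg h
  have c34 := comm_leftLeg h.symm
  have c13 := comm_rightLeg_leftLeg f g
  have c14 := comm_rightLeg_leftLeg f f
  have c23 := comm_rightLeg_leftLeg g g
  have c24 := comm_rightLeg_leftLeg g f
  -- An identity between operators; both sides are then applied to `R_{gf}`, the leftmost factor
  -- first.
  have key : Rr 𝒢 (rightLeg f) (rightLeg g) *
      Rr 𝒢 (rightLeg (conv f g)) (leftLeg (conv f g)) =
      Rr 𝒢 (rightLeg g) (leftLeg f) * Rr 𝒢 (rightLeg g) (leftLeg g) *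
      (Rr 𝒢 (rightLeg f) (leftLeg f) * Rr 𝒢 (rightLeg f) (leftLeg g)) *
      Rr 𝒢 (rightLeg f) (rightLeg g) := by
    rw [rightLeg_conv, leftLeg_conv hf hg h]
    have := Rr_tens_conv 𝒢 l1 l2 c12 (c13.conv_right c14) (c23.conv_right c24)
      (𝒢.R : G ⊗[ℂ] G)
    rw [← Rr, ← Rr, Rr_conv_left 𝒢 (f := rightLeg g) (isLeg_conv l3 l4 c34)
      (c13.conv_right c14), Rr_conv_right 𝒢 l2 c24 c34, Rr_conv_right 𝒢 l1 c14 c34] at this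
    exact this
  have hQ : (Rr 𝒢 (rightLeg f) (rightLeg g)).unop (Rr 𝒢 g f) = Qm 𝒢 f g :=
    unop_tens_rightLeg f g _ _
  rw [apply_uElt (isLeg_conv hf hg h),
    ← unop_sandwich_of_commute (conv f g) (Qm_commute_conv 𝒢 hf hg h), ← hQ]
  have e := congrArg (fun F => F.unop (Rr 𝒢 g f)) key
  simp only [MulOpposite.unop_mul, Module.End.mul_apply] at e
  refine e.trans ?_
  have e24 : (Rr 𝒢 (rightLeg g) (leftLeg f)).unop (Rr 𝒢 g f) = 1 := by
    rw [Rr, Rr, unop_sandwich_tens hg h.symm, tens₃_antip_R 𝒢 hf, hg.one]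
  have e23 : (Rr 𝒢 (rightLeg g) (leftLeg g)).unop 1 = g (drinfeldU 𝒢) :=
    (apply_uElt hg _).symm
  have e14 : (Rr 𝒢 (rightLeg f) (leftLeg f)).unop (g (drinfeldU 𝒢)) =
      g (drinfeldU 𝒢) * f (drinfeldU 𝒢) := by
    rw [Rr, unop_sandwich_of_commute f (fun y => (h y _).symm), apply_uElt hf]
  -- Here `S²` is conjugation by `u`, and the remaining factor `(S ⊗ id)(R) = R⁻¹` is cancelled by
  -- the last elementary operation.
  have e13 : (Rr 𝒢 (rightLeg f) (leftLeg g)).unop (g (drinfeldU 𝒢) * f (drinfeldU 𝒢)) =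
      f (drinfeldU 𝒢) * g (drinfeldU 𝒢) * Rr 𝒢 (antip f) g := by
    rw [← Rr_antip_antip 𝒢 l1 l3 c13, Rr, Rr]
    induction (𝒢.R : G ⊗[ℂ] G) using TensorProduct.induction_on with
    | zero => simp
    | add x y hx hy => simp only [map_add, MulOpposite.unop_add, LinearMap.add_apply, hx, hy,
        mul_add]
    | tmul a b =>
      simp only [tens_tmul, antip_apply, MulOpposite.unop_mul, Module.End.mul_apply,
        unop_rightLeg, unop_leftLeg]
      rw [← mul_assoc, ← mul_assoc, ← hg.mul, antipode_sq_mul_drinfeldU, hg.mul, mul_assoc,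
        mul_assoc, ← ((h _ b).mul_left (h _ b)).eq, (h (drinfeldU 𝒢) (drinfeldU 𝒢)).eq]
      simp only [mul_assoc]
  rw [e24, e23, e14, e13, Rr, unop_tens_rightLeg, ← Rr, Rr_antip_left 𝒢 hf hg h, mul_assoc,
    Ri_mul_Rr 𝒢 hf hg h, mul_one]

theorem Qm_mul_conv_v {f g : G →ₗ[ℂ] A} (hf : IsLeg f) (hg : IsLeg g) (h : Comm f g) :
    Qm 𝒢 f g * conv f g (𝒢.v : G) = f (𝒢.v : G) * g (𝒢.v : G) := by
  rw [← tens_flip_R_mul_R 𝒢 hf hg h, conv_apply, ← tens_mul hf hg h, 𝒢.comul_v, tens_tmul]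

variable [FiniteDimensional ℂ G]

/-- `u` as a unit. -/
def drinfeldUnit : Gˣ where
  val := drinfeldU 𝒢
  inv := drinfeldUInv 𝒢
  val_inv := mul_drinfeldUInv 𝒢
  inv_val := drinfeldUInv_mul 𝒢

theorem gElt_eq : gElt 𝒢 = drinfeldUInv 𝒢 * (𝒢.v : G) := by
  rw [gElt]
  congr 1
  exact Ring.inverse_unit (drinfeldUnit 𝒢)

/-- `S²` is conjugation by `u`, and `g = u⁻¹ v` with `v` central. -/
theorem gElt_mul_antipode_sq (x : G) :
    gElt 𝒢 * HopfAlgebra.antipode ℂ (HopfAlgebra.antipode ℂ x) = x * gElt 𝒢 := by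
  have h : HopfAlgebra.antipode ℂ (HopfAlgebra.antipode ℂ x) =
      drinfeldU 𝒢 * x * drinfeldUInv 𝒢 := by
    rw [← antipode_sq_mul_drinfeldU, mul_assoc, mul_drinfeldUInv, mul_one]
  rw [gElt_eq, h, mul_assoc, 𝒢.v_central, ← mul_assoc, ← mul_assoc, ← mul_assoc,
    drinfeldUInv_mul, one_mul, mul_assoc, ← 𝒢.v_central]

theorem isUnit_gElt : IsUnit (gElt 𝒢) := by
  rw [gElt_eq]
  exact (drinfeldUnit 𝒢)⁻¹.isUnit.mul 𝒢.v.isUnit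

/-- Both `u` and `v` satisfy `(R'R)Δ(x) = x ⊗ x`, so their quotient `g` is grouplike. -/
theorem conv_gElt {f g : G →ₗ[ℂ] A} (hf : IsLeg f) (hg : IsLeg g) (h : Comm f g) :
    conv f g (gElt 𝒢) = f (gElt 𝒢) * g (gElt 𝒢) := by
  have hc := isLeg_conv hf hg h
  have e : f (drinfeldU 𝒢) * g (drinfeldU 𝒢) * conv f g (gElt 𝒢) =
      f (𝒢.v : G) * g (𝒢.v : G) := by
    rw [← Qm_mul_conv_v 𝒢 hf hg h, ← Qm_mul_conv_drinfeldU 𝒢 hf hg h, mul_assoc, ← hc.mul,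
      gElt_eq, ← mul_assoc, mul_drinfeldUInv, one_mul]
  have e' : f (drinfeldUInv 𝒢) * g (drinfeldUInv 𝒢) * (f (drinfeldU 𝒢) * g (drinfeldU 𝒢)) = 1 := by
    rw [mul_assoc, ← mul_assoc (g _), ← (h _ _).eq, mul_assoc, ← mul_assoc, ← hf.mul, ← hg.mul,
      drinfeldUInv_mul, hf.one, hg.one, one_mul]
  calc _ = f (drinfeldUInv 𝒢) * g (drinfeldUInv 𝒢) * (f (drinfeldU 𝒢) * g (drinfeldU 𝒢)) *
        conv f g (gElt 𝒢) := by rw [e', one_mul]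
    _ = f (drinfeldUInv 𝒢) * g (drinfeldUInv 𝒢) * (f (𝒢.v : G) * g (𝒢.v : G)) := by
        rw [mul_assoc, e]
    _ = _ := by
        rw [mul_assoc, ← mul_assoc (g _), ← (h _ _).eq, mul_assoc, ← mul_assoc, ← hf.mul,
          ← hg.mul, gElt_eq]

end Drinfeld

/-! ## The irreducible representations determine `G` -/

section Schur

variable {G : Type*} [Ring G] [HopfAlgebra ℂ G] [StarRing G] [StarModule ℂ G] {Λ : Type*}

namespace Irreps

variable (𝒯 : Irreps G Λ)

theorem dim_pos (I : Λ) : 0 < 𝒯.dim I := (𝒯.irreducible I).1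

instance (I : Λ) : NeZero (𝒯.dim I) := ⟨(𝒯.dim_pos I).ne'⟩

theorem bijective_of_intertwiner {I J : Λ} {T : Matrix (Fin (𝒯.dim I)) (Fin (𝒯.dim J)) ℂ}
    (hT : ∀ x, 𝒯.τ I x * T = T * 𝒯.τ J x) (h0 : T ≠ 0) :
    Function.Bijective T.mulVecLin := by
  constructor
  · rw [← LinearMap.ker_eq_bot]
    refine ((𝒯.irreducible J).2 (LinearMap.ker T.mulVecLin) fun x w hw => ?_).resolve_right ?_
    · rw [LinearMap.mem_ker, Matrix.mulVecLin_apply] at hw ⊢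
      rw [Matrix.mulVec_mulVec, ← hT, ← Matrix.mulVec_mulVec, hw, Matrix.mulVec_zero]
    · intro h
      rw [LinearMap.ker_eq_top] at h
      exact h0 (Matrix.toLin'.injective (h.trans (map_zero Matrix.toLin').symm))
  · rw [← LinearMap.range_eq_top]
    refine ((𝒯.irreducible I).2 (LinearMap.range T.mulVecLin) ?_).resolve_left ?_
    · rintro x _ ⟨w, rfl⟩
      refine ⟨𝒯.τ J x *ᵥ w, ?_⟩
      simp only [Matrix.mulVecLin_apply, Matrix.mulVec_mulVec, hT]
    · intro h
      rw [LinearMap.range_eq_bot] at h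
      exact h0 (Matrix.toLin'.injective (h.trans (map_zero Matrix.toLin').symm))

theorem schur_ne {I J : Λ} (hIJ : I ≠ J) {T : Matrix (Fin (𝒯.dim I)) (Fin (𝒯.dim J)) ℂ}
    (hT : ∀ x, 𝒯.τ I x * T = T * 𝒯.τ J x) : T = 0 := by
  by_contra h0
  let e := LinearEquiv.ofBijective T.mulVecLin (𝒯.bijective_of_intertwiner hT h0)
  have hTe : T = LinearMap.toMatrix' (e : (Fin (𝒯.dim J) → ℂ) →ₗ[ℂ] (Fin (𝒯.dim I) → ℂ)) :=
    (LinearMap.toMatrix'_toLin' T).symm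
  refine hIJ (𝒯.inequivalent I J ⟨T, LinearMap.toMatrix'
    (e.symm : (Fin (𝒯.dim I) → ℂ) →ₗ[ℂ] (Fin (𝒯.dim J) → ℂ)), ?_, ?_, hT⟩)
  · rw [hTe, ← LinearMap.toMatrix'_comp, LinearEquiv.comp_symm, LinearMap.toMatrix'_id]
  · rw [hTe, ← LinearMap.toMatrix'_comp, LinearEquiv.symm_comp, LinearMap.toMatrix'_id]

theorem schur_self {I : Λ} {T : 𝒯.Mat I ℂ} (hT : ∀ x, 𝒯.τ I x * T = T * 𝒯.τ I x) :
    ∃ c : ℂ, T = c • (1 : 𝒯.Mat I ℂ) := by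
  obtain ⟨c, hc⟩ := Module.End.exists_eigenvalue (Matrix.toLin' T)
  refine ⟨c, ?_⟩
  by_contra h
  have h' := 𝒯.bijective_of_intertwiner (T := T - c • (1 : 𝒯.Mat I ℂ))
    (fun x => by simp [mul_sub, sub_mul, hT x]) (sub_ne_zero.mpr h)
  obtain ⟨v, hv⟩ := hc.exists_hasEigenvector
  refine hv.2 (h'.1 ?_)
  have := hv.apply_eq_smul
  rw [Matrix.toLin'_apply] at this
  rw [Matrix.mulVecLin_apply, Matrix.mulVecLin_apply, Matrix.sub_mulVec, this, Matrix.smul_mulVec,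
    Matrix.one_mulVec, sub_self, Matrix.mulVec_zero]

section

variable [FiniteDimensional ℂ G] [IsSemisimpleRing G]

/-- Each simple left ideal is a copy of some `τ I`, so `x` annihilates it; by semisimplicity these
ideals span `G` and hence contain `1`. -/
theorem eq_zero_of_rep {x : G} (hx : ∀ I, 𝒯.τ I x = 0) : x = 0 := by
  have key : ∀ S : Submodule G G, IsSimpleModule G S → ∀ s ∈ S, x * s = 0 := by
    intro S hS s hs
    have : Module.Finite ℂ S :=
      Module.Finite.of_injective (S.subtype.restrictScalars ℂ) S.subtype_injective
    let b := Module.finBasis ℂ S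
    let ρ : G →ₐ[ℂ] Matrix (Fin (Module.finrank ℂ S)) (Fin (Module.finrank ℂ S)) ℂ :=
      (LinearMap.toMatrixAlgEquiv b).toAlgHom.comp (Algebra.lsmul ℂ ℂ S)
    have hρ : ∀ (y : G) (t : S), ρ y *ᵥ b.equivFun t = b.equivFun (y • t) := by
      intro y t
      exact LinearMap.toMatrix_mulVec_repr b b (Algebra.lsmul ℂ ℂ S y) t
    have hirr : IsIrreducible ρ := by
      have : Nontrivial S := IsSimpleModule.nontrivial G S
      refine ⟨Module.finrank_pos, fun W hW => ?_⟩
      let W' : Submodule G S :=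
        { carrier := {t | b.equivFun t ∈ W}
          add_mem' := fun {a c} ha hc => by
            simp only [Set.mem_ofPred_eq, map_add] at ha hc ⊢
            exact W.add_mem ha hc
          zero_mem' := by simp
          smul_mem' := fun y t ht => by
            simp only [Set.mem_ofPred_eq] at ht ⊢
            rw [← hρ]
            exact hW _ _ ht }
      rcases eq_bot_or_eq_top W' with h | h
      · left
        rw [eq_bot_iff]
        intro w hw
        have : b.equivFun.symm w ∈ W' := by
          change b.equivFun (b.equivFun.symm w) ∈ W
          rwa [LinearEquiv.apply_symm_apply]
        rw [h, Submodule.mem_bot, LinearEquiv.map_eq_zero_iff] at this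
        exact this
      · right
        rw [eq_top_iff]
        intro w _
        have : b.equivFun.symm w ∈ W' := by rw [h]; trivial
        change b.equivFun (b.equivFun.symm w) ∈ W at this
        rwa [LinearEquiv.apply_symm_apply] at this
    obtain ⟨I, T, T', h1, -, h3⟩ := 𝒯.complete _ ρ hirr
    have h0 : ρ x = 0 := by
      rw [← mul_one (ρ x), ← h1, ← Matrix.mul_assoc, h3, hx, Matrix.mul_zero, Matrix.zero_mul]
    have h4 := hρ x ⟨s, hs⟩
    rw [h0, Matrix.zero_mulVec, eq_comm, LinearEquiv.map_eq_zero_iff] at h4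
    exact congrArg Subtype.val h4
  have htop : (1 : G) ∈ sSup {S : Submodule G G | IsSimpleModule G S} := by
    rw [IsSemisimpleModule.sSup_simples_eq_top]; trivial
  have h2 : ∀ t ∈ sSup {S : Submodule G G | IsSimpleModule G S}, x * t = 0 := by
    intro t ht
    rw [sSup_eq_iSup'] at ht
    refine Submodule.iSup_induction _ (motive := fun t => x * t = 0) ht ?_ (mul_zero _) ?_
    · exact fun S s hs => key S.1 S.2 s hs
    · intro a b ha hb
      rw [mul_add, ha, hb, add_zero]
  simpa using h2 1 htop

theorem ext_rep {x y : G} (h : ∀ I, 𝒯.τ I x = 𝒯.τ I y) : x = y :=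
  sub_eq_zero.mp (𝒯.eq_zero_of_rep fun I => by rw [map_sub, h, sub_self])

end

/-- The direct sum of all irreducible representations. -/
abbrev Space := ∀ I, Fin (𝒯.dim I) → ℂ

/-- The action of `G` on the direct sum of all irreducible representations. -/
abbrev spaceModule : Module G 𝒯.Space where
  smul x w := fun I => 𝒯.τ I x *ᵥ w I
  one_smul w := funext fun I => by
    change 𝒯.τ I 1 *ᵥ w I = w I
    rw [map_one, Matrix.one_mulVec]
  mul_smul x y w := funext fun I => by
    change 𝒯.τ I (x * y) *ᵥ w I = 𝒯.τ I x *ᵥ (𝒯.τ I y *ᵥ w I)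
    rw [map_mul, Matrix.mulVec_mulVec]
  smul_zero x := funext fun I => Matrix.mulVec_zero _
  smul_add x w w' := funext fun I => Matrix.mulVec_add _ _ _
  add_smul x y w := funext fun I => by
    change 𝒯.τ I (x + y) *ᵥ w I = 𝒯.τ I x *ᵥ w I + 𝒯.τ I y *ᵥ w I
    rw [map_add, Matrix.add_mulVec]
  zero_smul w := funext fun I => by
    change 𝒯.τ I 0 *ᵥ w I = 0
    rw [map_zero, Matrix.zero_mulVec]

/-- Jacobson density on `⨁ V^I`. By Schur's lemma the components of a `G`-endomorphism are zero
between different labels and scalar on each label, so every block-diagonal operator commutes with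
all of them and is realized by an element of `G`. -/
theorem exists_rep [Fintype Λ] [IsSemisimpleRing G] (Y : ∀ I, 𝒯.Mat I ℂ) :
    ∃ x : G, ∀ I, 𝒯.τ I x = Y I := by
  classical
  let _ := 𝒯.spaceModule
  have space_smul_apply : ∀ (x : G) (w : 𝒯.Space) (I : Λ), (x • w) I = 𝒯.τ I x *ᵥ w I :=
    fun _ _ _ => rfl
  have scal : ∀ (c : ℂ) (w : 𝒯.Space), algebraMap ℂ G c • w = c • w := by
    intro c w
    funext I
    rw [space_smul_apply, Algebra.algebraMap_eq_smul_one, map_smul, map_one, Matrix.smul_mulVec,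
      Matrix.one_mulVec,
      Pi.smul_apply]
  have hlin : ∀ (φ : Module.End G 𝒯.Space) (w : 𝒯.Space) (I : Λ),
      φ (fun J => Y J *ᵥ w J) I = Y I *ᵥ (φ w) I := by
    intro φ w I
    -- Complex linearity follows from `G`-linearity, because scalars act through `algebraMap ℂ G`.
    let φ' : 𝒯.Space →ₗ[ℂ] 𝒯.Space :=
      { toFun := φ
        map_add' := map_add φ
        map_smul' := fun c w => by rw [← scal, map_smul, scal]; rfl }
    let T : ∀ J, Matrix (Fin (𝒯.dim I)) (Fin (𝒯.dim J)) ℂ := fun J =>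
      LinearMap.toMatrix' (LinearMap.proj I ∘ₗ φ' ∘ₗ
        LinearMap.single ℂ (fun J => Fin (𝒯.dim J) → ℂ) J)
    have hT : ∀ J u, T J *ᵥ u = φ (Pi.single J u : ∀ J, Fin (𝒯.dim J) → ℂ) I := by
      intro J u
      rw [← Matrix.toLin'_apply, Matrix.toLin'_toMatrix']
      rfl
    have hφ : ∀ w : 𝒯.Space, φ w I = ∑ J, T J *ᵥ w J := by
      intro w
      have e : w = (∑ J, (Pi.single J (w J) : ∀ J, Fin (𝒯.dim J) → ℂ) : 𝒯.Space) :=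
        (Finset.univ_sum_single w).symm
      conv_lhs => rw [e, map_sum]
      simp only [hT]
      exact Finset.sum_apply _ _ _
    have hint : ∀ J x, 𝒯.τ I x * T J = T J * 𝒯.τ J x := by
      intro J x
      refine Matrix.toLin'.injective (LinearMap.ext fun u => ?_)
      have e : x • (Pi.single J u : 𝒯.Space) = Pi.single J (𝒯.τ J x *ᵥ u) := by
        funext L
        rw [space_smul_apply]
        by_cases h : L = J
        · subst h; simp
        · simp [Pi.single_eq_of_ne h]
      rw [Matrix.toLin'_apply, Matrix.toLin'_apply, ← Matrix.mulVec_mulVec,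
        ← Matrix.mulVec_mulVec, hT, hT, ← space_smul_apply, ← map_smul, e]
    have hcomm : ∀ J, T J * Y J = Y I * T J := by
      intro J
      by_cases h : I = J
      · subst h
        obtain ⟨c, hc⟩ := 𝒯.schur_self (hint I)
        rw [hc]; simp
      · rw [𝒯.schur_ne h (hint J)]; simp
    rw [hφ, hφ, Matrix.mulVec_sum]
    exact Finset.sum_congr rfl fun J _ => by
      rw [Matrix.mulVec_mulVec, Matrix.mulVec_mulVec, hcomm]
  let f : Module.End (Module.End G 𝒯.Space) 𝒯.Space :=
    { toFun := fun w I => Y I *ᵥ w I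
      map_add' := fun w w' => funext fun I => Matrix.mulVec_add _ _ _
      map_smul' := fun φ w => funext fun I => (hlin φ w I).symm }
  let vec : (Σ I, Fin (𝒯.dim I)) → 𝒯.Space := fun p =>
    (Pi.single p.1 (Pi.single p.2 1) : ∀ J, Fin (𝒯.dim J) → ℂ)
  obtain ⟨x, hx⟩ := jacobson_density f (Finset.univ.image vec)
  refine ⟨x, fun I => ?_⟩
  ext i j
  have h := congrFun (congrFun (hx (vec ⟨I, j⟩) (Finset.mem_image_of_mem _ (Finset.mem_univ _))) I) i
  have e : vec ⟨I, j⟩ I = Pi.single j 1 := Pi.single_eq_same _ _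
  change (Y I *ᵥ vec ⟨I, j⟩ I) i = (𝒯.τ I x *ᵥ vec ⟨I, j⟩ I) i at h
  rw [e] at h
  simpa using h.symm

@[simp] theorem rep2_tmul (I J : Λ) (x y : G) :
    𝒯.rep2 I J (x ⊗ₜ y) = 𝒯.τ I x ⊗ₖ 𝒯.τ J y := by
  simp [rep2]

variable [Fintype Λ] [FiniteDimensional ℂ G] [IsSemisimpleRing G]

/-- The matrix elements of an element of `G` in all irreducible representations. -/
def coords : G ≃ₗ[ℂ] ((Σ I : Λ, Fin (𝒯.dim I) × Fin (𝒯.dim I)) → ℂ) :=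
  LinearEquiv.ofBijective (LinearMap.pi fun p => 𝒯.entry p.1 p.2.1 p.2.2) <| by
    constructor
    · intro x y h
      refine 𝒯.ext_rep fun I => ?_
      ext i j
      exact congrFun h ⟨I, i, j⟩
    · intro c
      obtain ⟨x, hx⟩ := 𝒯.exists_rep fun I => Matrix.of fun i j => c ⟨I, i, j⟩
      refine ⟨x, funext fun p => ?_⟩
      change 𝒯.τ p.1 x p.2.1 p.2.2 = c p
      rw [hx]; rfl

/-- The basis of matrix units. -/
def basis : Module.Basis (Σ I : Λ, Fin (𝒯.dim I) × Fin (𝒯.dim I)) ℂ G :=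
  Module.Basis.ofEquivFun 𝒯.coords

theorem basis_repr (x : G) (p : Σ I : Λ, Fin (𝒯.dim I) × Fin (𝒯.dim I)) :
    𝒯.basis.repr x p = 𝒯.τ p.1 x p.2.1 p.2.2 := by
  rw [basis, Module.Basis.ofEquivFun_repr_apply]
  rfl

theorem τ_basis (p q : Σ I : Λ, Fin (𝒯.dim I) × Fin (𝒯.dim I)) [Decidable (p = q)] :
    𝒯.τ q.1 (𝒯.basis p) q.2.1 q.2.2 = if p = q then 1 else 0 := by
  rw [← basis_repr, Module.Basis.repr_self, Finsupp.single_apply]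

theorem basis_tensor_repr (x : G ⊗[ℂ] G)
    (p q : Σ I : Λ, Fin (𝒯.dim I) × Fin (𝒯.dim I)) :
    (𝒯.basis.tensorProduct 𝒯.basis).repr x (p, q) =
      𝒯.rep2 p.1 q.1 x (p.2.1, q.2.1) (p.2.2, q.2.2) := by
  induction x using TensorProduct.induction_on with
  | zero => simp [rep2]
  | add x y hx hy =>
    rw [map_add, Finsupp.add_apply, hx, hy]
    simp [rep2]
  | tmul a b => simp [basis_repr, mul_comm]

theorem ext_rep2 {x y : G ⊗[ℂ] G} (h : ∀ I J, 𝒯.rep2 I J x = 𝒯.rep2 I J y) : x = y := by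
  refine (𝒯.basis.tensorProduct 𝒯.basis).repr.injective (Finsupp.ext fun ⟨p, q⟩ => ?_)
  rw [basis_tensor_repr, basis_tensor_repr, h]

theorem exists_rep2 (Y : ∀ I J, Matrix (Fin (𝒯.dim I) × Fin (𝒯.dim J))
    (Fin (𝒯.dim I) × Fin (𝒯.dim J)) ℂ) : ∃ x : G ⊗[ℂ] G, ∀ I J, 𝒯.rep2 I J x = Y I J := by
  refine ⟨(𝒯.basis.tensorProduct 𝒯.basis).equivFun.symm fun p =>
    Y p.1.1 p.2.1 (p.1.2.1, p.2.2.1) (p.1.2.2, p.2.2.2), fun I J => ?_⟩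
  ext ⟨i, k⟩ ⟨j, l⟩
  rw [← 𝒯.basis_tensor_repr _ ⟨I, i, j⟩ ⟨J, k, l⟩, ← Module.Basis.equivFun_apply,
    LinearEquiv.apply_symm_apply]

end Irreps

end Schur

/-! ## Consequences of the normalization of the Clebsch-Gordan maps -/

section ClebschFacts

variable {G : Type*} [Ring G] [HopfAlgebra ℂ G] [StarRing G] [StarModule ℂ G] {Λ : Type*}

namespace Irreps

variable (𝒯 : Irreps G Λ)

theorem rep2_mul (I J : Λ) (x y : G ⊗[ℂ] G) :
    𝒯.rep2 I J (x * y) = 𝒯.rep2 I J x * 𝒯.rep2 I J y := by rw [rep2, map_mul, map_mul]; rfl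

theorem rep2_one (I J : Λ) : 𝒯.rep2 I J 1 = 1 := by rw [rep2, map_one, map_one]

theorem rep2_add (I J : Λ) (x y : G ⊗[ℂ] G) :
    𝒯.rep2 I J (x + y) = 𝒯.rep2 I J x + 𝒯.rep2 I J y := by simp [rep2]

theorem rep2_smul (I J : Λ) (c : ℂ) (x : G ⊗[ℂ] G) :
    𝒯.rep2 I J (c • x) = c • 𝒯.rep2 I J x := by simp [rep2]

theorem rep2_star (I J : Λ) (x : G ⊗[ℂ] G) :
    𝒯.rep2 I J (star x) = (𝒯.rep2 I J x)ᴴ := by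
  induction x using TensorProduct.induction_on with
  | zero => simp [rep2]
  | add x y hx hy => rw [star_add, rep2_add, rep2_add, hx, hy, Matrix.conjTranspose_add]
  | tmul a b =>
    rw [TensorProduct.star_tmul, rep2_tmul, rep2_tmul, map_star, map_star,
      Matrix.conjTranspose_kronecker]
    rfl

theorem counit_star {Λ : Type*} (𝒯 : Irreps G Λ) (x : G) :
    Coalgebra.counit (R := ℂ) (star x) = star (Coalgebra.counit (R := ℂ) x) := by
  have h := map_star (𝒯.τ 𝒯.zero) x
  rw [𝒯.τ_zero, 𝒯.τ_zero, star_smul, star_one] at h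
  simpa using congrFun (congrFun h 0) 0

variable [Fintype Λ] [FiniteDimensional ℂ G] [IsSemisimpleRing G]

theorem τ_basis_self (I : Λ) (i j : Fin (𝒯.dim I)) :
    𝒯.τ I (𝒯.basis ⟨I, i, j⟩) = Matrix.single i j 1 := by
  classical
  ext k l
  rw [𝒯.τ_basis ⟨I, i, j⟩ ⟨I, k, l⟩]
  simp [Matrix.single_apply]

theorem τ_basis_ne {I L : Λ} (h : I ≠ L) (i j : Fin (𝒯.dim I)) :
    𝒯.τ L (𝒯.basis ⟨I, i, j⟩) = 0 := by
  classical
  ext k l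
  rw [𝒯.τ_basis ⟨I, i, j⟩ ⟨L, k, l⟩, if_neg (fun e => h (congrArg Sigma.fst e))]
  rfl

theorem basis_mul (I : Λ) (i j : Fin (𝒯.dim I)) (x : G) :
    𝒯.basis ⟨I, i, j⟩ * x = ∑ k, 𝒯.τ I x j k • 𝒯.basis ⟨I, i, k⟩ := by
  refine 𝒯.ext_rep fun L => ?_
  rw [map_mul, map_sum]
  simp only [map_smul]
  by_cases h : I = L
  · subst h
    simp only [τ_basis_self]
    ext a b
    by_cases ha : a = i
    · subst ha
      simp [Matrix.sum_apply, Matrix.single_apply, Matrix.single_mul_apply_same]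
    · rw [Matrix.single_mul_apply_of_ne _ _ _ _ _ ha]
      simp [Matrix.sum_apply, Ne.symm ha]
  · simp [τ_basis_ne 𝒯 h]

end Irreps

variable {𝒢 : RibbonStar G} {𝒯 : Irreps G Λ} (𝒞 : Clebsch 𝒢 𝒯)

namespace Clebsch

theorem kap_ne_zero (I : Λ) : 𝒞.kap I ≠ 0 := by
  intro h
  have h1 : 𝒯.τ I ((𝒞.κ : G) * ((𝒞.κ⁻¹ : Gˣ) : G)) = 1 := by rw [Units.mul_inv, map_one]
  rw [map_mul, 𝒞.τ_κ, h, zero_smul, zero_mul] at h1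
  exact zero_ne_one h1

/-- Unitarity of `v` gives `|κ_I|⁴ = 1`, and `|κ_I|²` is nonnegative. -/
theorem kap_mul_star (I : Λ) : 𝒞.kap I * star (𝒞.kap I) = 1 := by
  have h1 : 𝒯.τ I ((𝒢.v : G) * star (𝒢.v : G)) = 1 := by
    rw [𝒢.star_v, Units.mul_inv, map_one]
  rw [map_mul, map_star, 𝒞.kap_sq, star_smul, star_one, smul_mul_smul_comm, mul_one] at h1
  have h2 := congrFun (congrFun h1 0) 0
  simp only [Matrix.smul_apply, Matrix.one_apply_eq, smul_eq_mul, mul_one, star_pow] at h2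
  rw [← mul_pow, Complex.star_def, Complex.mul_conj] at h2
  rw [Complex.star_def, Complex.mul_conj]
  norm_cast at h2 ⊢
  exact (pow_eq_one_iff_of_nonneg (Complex.normSq_nonneg _) two_ne_zero).mp h2

theorem star_kap (I : Λ) : star (𝒞.kap I) = (𝒞.kap I)⁻¹ :=
  eq_inv_of_mul_eq_one_right (𝒞.kap_mul_star I)

theorem τ_κ_inv (I : Λ) :
    𝒯.τ I ((𝒞.κ⁻¹ : Gˣ) : G) = (𝒞.kap I)⁻¹ • (1 : Matrix _ _ ℂ) := by
  have h1 : 𝒯.τ I ((𝒞.κ : G) * ((𝒞.κ⁻¹ : Gˣ) : G)) = 1 := by rw [Units.mul_inv, map_one]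
  rw [map_mul, 𝒞.τ_κ, smul_mul_assoc, one_mul] at h1
  rw [← h1, smul_smul, inv_mul_cancel₀ (𝒞.kap_ne_zero I), one_smul]

theorem τ_v_inv (I : Λ) :
    𝒯.τ I ((𝒢.v⁻¹ : Gˣ) : G) = (𝒞.kap I ^ 2)⁻¹ • (1 : Matrix _ _ ℂ) := by
  have h1 : 𝒯.τ I ((𝒢.v : G) * ((𝒢.v⁻¹ : Gˣ) : G)) = 1 := by rw [Units.mul_inv, map_one]
  rw [map_mul, 𝒞.kap_sq, smul_mul_assoc, one_mul] at h1
  rw [← h1, smul_smul, inv_mul_cancel₀ (pow_ne_zero 2 (𝒞.kap_ne_zero I)), one_smul]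

variable [Fintype Λ] [FiniteDimensional ℂ G] [IsSemisimpleRing G]

theorem κ_central (x : G) : (𝒞.κ : G) * x = x * (𝒞.κ : G) := by
  refine 𝒯.ext_rep fun I => ?_
  simp [𝒞.τ_κ]

theorem κ_inv_central (x : G) : ((𝒞.κ⁻¹ : Gˣ) : G) * x = x * ((𝒞.κ⁻¹ : Gˣ) : G) := by
  refine 𝒯.ext_rep fun I => ?_
  simp [𝒞.τ_κ_inv]

/-- The Clebsch-Gordan maps are jointly injective. -/
theorem eq_zero_of_C_mul {I J : Λ} {n : Type*} {X : Matrix (Fin (𝒯.dim I) × Fin (𝒯.dim J)) n ℂ}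
    (hX : ∀ K a, 𝒞.C I J K a * X = 0) : X = 0 := by
  let ρ : G →ₗ[ℂ] Matrix (Fin (𝒯.dim I) × Fin (𝒯.dim J)) (Fin (𝒯.dim I) × Fin (𝒯.dim J)) ℂ :=
    { toFun := fun x => 𝒯.rep2 I J (Coalgebra.comul (R := ℂ) x)
      map_add' := fun x y => by rw [map_add, 𝒯.rep2_add]
      map_smul' := fun c x => by rw [map_smul, 𝒯.rep2_smul]; rfl }
  have hρ : ∀ x y, ρ (x * y) = ρ x * ρ y := fun x y => by
    change 𝒯.rep2 I J _ = _
    rw [Bialgebra.comul_mul, 𝒯.rep2_mul]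
    rfl
  have hint : ∀ (K : Λ) (T : Matrix (Fin (𝒯.dim K)) (Fin (𝒯.dim I) × Fin (𝒯.dim J)) ℂ),
      (∀ x : G, T * 𝒯.rep2 I J (Coalgebra.comul (R := ℂ) x) = 𝒯.τ K x * T) → T * X = 0 := by
    intro K T hT
    refine Submodule.span_induction (p := fun (T : Matrix (Fin (𝒯.dim K)) (Fin (𝒯.dim I) × Fin (𝒯.dim J)) ℂ) _ => T * X = 0) ?_ (Matrix.zero_mul _) ?_ ?_
      (𝒞.span I J K T hT)
    · rintro _ ⟨a, rfl⟩
      exact hX K a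
    · intro S T _ _ hS hT
      rw [Matrix.add_mul, hS, hT, add_zero]
    · intro c T _ hT
      rw [Matrix.smul_mul, hT, smul_zero]
  have hb : ∀ p, ρ (𝒯.basis p) * X = 0 := by
    rintro ⟨K, r, i⟩
    ext ℓ s
    -- For fixed `K`, `r` and `ℓ`, the `ℓ`-th rows of the images of the matrix units `e^K_{ri}` form
    -- an intertwiner, because right multiplication by `x` acts on the index `i` through `τ^K(x)`.
    have h := hint K (Matrix.of fun i p => ρ (𝒯.basis ⟨K, r, i⟩) ℓ p) (by
      intro x
      ext i p
      change (ρ (𝒯.basis ⟨K, r, i⟩) * ρ x) ℓ p = _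
      rw [← hρ, 𝒯.basis_mul, map_sum, Matrix.sum_apply, Matrix.mul_apply]
      simp)
    exact congrFun (congrFun h i) s
  have hall : ∀ x, ρ x * X = 0 := by
    intro x
    rw [← 𝒯.basis.sum_repr x, map_sum, Matrix.sum_mul]
    exact Finset.sum_eq_zero fun p _ => by rw [map_smul, Matrix.smul_mul, hb, smul_zero]
  have h1 : ρ 1 = 1 := by
    change 𝒯.rep2 I J _ = 1
    rw [Bialgebra.comul_one, 𝒯.rep2_one]
  rw [← Matrix.one_mul X, ← h1, hall]

/-- By the normalization, every Clebsch-Gordan map takes the same value on both sides; these maps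
are jointly injective. -/
theorem completeness (I J : Λ) :
    ∑ K, ∑ a, (𝒞.kap K / (𝒞.kap I * 𝒞.kap J)) •
      (𝒯.rep2 I J (tensorFlip (𝒢.R : G ⊗[ℂ] G)) * ((𝒞.C I J K a)ᴴ * 𝒞.C I J K a)) = 1 := by
  classical
  rw [← sub_eq_zero]
  refine 𝒞.eq_zero_of_C_mul fun L b => ?_
  rw [Matrix.mul_sub, Matrix.mul_one, sub_eq_zero, Matrix.mul_sum, Finset.sum_eq_single L,
    Matrix.mul_sum, Finset.sum_eq_single b]
  · rw [Matrix.mul_smul, ← Matrix.mul_assoc, ← Matrix.mul_assoc, 𝒞.normal_same, if_pos rfl,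
      Matrix.smul_mul, Matrix.one_mul, smul_smul]
    have h1 := 𝒞.kap_ne_zero I
    have h2 := 𝒞.kap_ne_zero J
    have h3 := 𝒞.kap_ne_zero L
    rw [show 𝒞.kap L / (𝒞.kap I * 𝒞.kap J) * (𝒞.kap I * 𝒞.kap J / 𝒞.kap L) = 1 by
      field_simp, one_smul]
  · intro a _ ha
    rw [Matrix.mul_smul, ← Matrix.mul_assoc, ← Matrix.mul_assoc, 𝒞.normal_same,
      if_neg (Ne.symm ha), Matrix.zero_mul, smul_zero]
  · simp
  · intro K _ hK
    rw [Matrix.mul_sum]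
    refine Finset.sum_eq_zero fun a _ => ?_
    rw [Matrix.mul_smul, ← Matrix.mul_assoc, ← Matrix.mul_assoc,
      𝒞.normal_ne _ _ _ _ _ _ (Ne.symm hK), Matrix.zero_mul, smul_zero]
  · simp

/-- `tr (τ^I ⊗ τ^J)Δ(x) = ∑_K N_{IJ}^K tr τ^K(x)`. -/
theorem trace_rep2_comul (I J : Λ) (x : G) :
    (𝒯.rep2 I J (Coalgebra.comul (R := ℂ) x)).trace =
      ∑ K, (𝒞.N I J K : ℂ) * (𝒯.τ K x).trace := by
  have h1 := 𝒞.kap_ne_zero I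
  have h2 := 𝒞.kap_ne_zero J
  rw [← Matrix.one_mul (𝒯.rep2 I J (Coalgebra.comul (R := ℂ) x)), ← 𝒞.completeness I J,
    Matrix.sum_mul, Matrix.trace_sum]
  refine Finset.sum_congr rfl fun K _ => ?_
  have h3 := 𝒞.kap_ne_zero K
  rw [Matrix.sum_mul, Matrix.trace_sum]
  have : ∀ a : Fin (𝒞.N I J K), ((𝒞.kap K / (𝒞.kap I * 𝒞.kap J)) •
      (𝒯.rep2 I J (tensorFlip (𝒢.R : G ⊗[ℂ] G)) * ((𝒞.C I J K a)ᴴ * 𝒞.C I J K a)) *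
      𝒯.rep2 I J (Coalgebra.comul (R := ℂ) x)).trace = (𝒯.τ K x).trace := by
    intro a
    rw [Matrix.smul_mul, Matrix.mul_assoc, Matrix.mul_assoc, 𝒞.intertwine, Matrix.trace_smul,
      ← Matrix.mul_assoc, ← Matrix.mul_assoc, Matrix.trace_mul_comm, ← Matrix.mul_assoc,
      ← Matrix.mul_assoc, 𝒞.normal_same, if_pos rfl, Matrix.smul_mul, Matrix.one_mul,
      Matrix.trace_smul, smul_smul]
    rw [show 𝒞.kap K / (𝒞.kap I * 𝒞.kap J) * (𝒞.kap I * 𝒞.kap J / 𝒞.kap K) = 1 by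
      field_simp, one_smul]
  simp only [this, Finset.sum_const, Finset.card_univ, Fintype.card_fin, nsmul_eq_mul]

/-- `Δ(v) = R⁻¹ R'⁻¹ (v ⊗ v)`, and after a map into `V^K` the element `Δ(v)` is the scalar `κ_K²`.
-/
theorem C_mul_Rinv (I J K : Λ) (a : Fin (𝒞.N I J K)) :
    𝒞.C I J K a * 𝒯.rep2 I J 𝒢.Rinv = (𝒞.kap K ^ 2 / (𝒞.kap I ^ 2 * 𝒞.kap J ^ 2)) •
      (𝒞.C I J K a * 𝒯.rep2 I J (tensorFlip (𝒢.R : G ⊗[ℂ] G))) := by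
  have e : 𝒯.rep2 I J (Coalgebra.comul (R := ℂ) (𝒢.v : G)) =
      (𝒞.kap I ^ 2 * 𝒞.kap J ^ 2) • (𝒯.rep2 I J 𝒢.Rinv *
        𝒯.rep2 I J (tensorFlip 𝒢.Rinv)) := by
    have hv := congrArg (𝒯.rep2 I J) 𝒢.comul_v
    have hfl : tensorFlip 𝒢.Rinv * tensorFlip (𝒢.R : G ⊗[ℂ] G) = 1 := by
      change Algebra.TensorProduct.comm ℂ G G _ * Algebra.TensorProduct.comm ℂ G G _ = 1
      rw [← map_mul, Units.inv_mul, map_one]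
    rw [𝒯.rep2_tmul, 𝒞.kap_sq, 𝒞.kap_sq, Matrix.smul_kronecker, Matrix.kronecker_smul,
      Matrix.one_kronecker_one, smul_smul] at hv
    have := congrArg (fun X => 𝒯.rep2 I J (𝒢.Rinv * tensorFlip 𝒢.Rinv) * X) hv
    simp only [← 𝒯.rep2_mul] at this
    rw [mul_assoc, mul_assoc, ← mul_assoc (tensorFlip 𝒢.Rinv), hfl, one_mul, ← mul_assoc,
      Units.inv_mul, one_mul] at this
    rw [this]
    simp [𝒯.rep2_mul]
  have h1 := 𝒞.kap_ne_zero I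
  have h2 := 𝒞.kap_ne_zero J
  have hfl : tensorFlip 𝒢.Rinv * tensorFlip (𝒢.R : G ⊗[ℂ] G) = 1 := by
    change Algebra.TensorProduct.comm ℂ G G _ * Algebra.TensorProduct.comm ℂ G G _ = 1
    rw [← map_mul, Units.inv_mul, map_one]
  have hi := 𝒞.intertwine I J K a (𝒢.v : G)
  rw [𝒞.kap_sq, e, Matrix.smul_mul, Matrix.one_mul, Matrix.mul_smul] at hi
  have := congrArg (fun X => (𝒞.kap I ^ 2 * 𝒞.kap J ^ 2)⁻¹ •
    (X * 𝒯.rep2 I J (tensorFlip (𝒢.R : G ⊗[ℂ] G)))) hi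
  simp only [Matrix.smul_mul, smul_smul] at this
  rw [inv_mul_cancel₀ (by positivity), one_smul, Matrix.mul_assoc, Matrix.mul_assoc,
    ← 𝒯.rep2_mul, hfl, 𝒯.rep2_one, Matrix.mul_one] at this
  rw [this]
  congr 1
  field_simp

/-- This is not an axiom but follows from the normalization: compare the blocks `C · C^*` of both
sides, which are given by `normal_same` and `normal_ne`, using that the `κ` have modulus one. -/
theorem Rinv_eq_star {𝒢 : RibbonStar G} {𝒯 : Irreps G Λ} (𝒞 : Clebsch 𝒢 𝒯) : 𝒢.Rinv = star (tensorFlip (𝒢.R : G ⊗[ℂ] G)) := by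
  refine 𝒯.ext_rep2 fun I J => ?_
  rw [𝒯.rep2_star, ← sub_eq_zero, ← Matrix.conjTranspose_eq_zero]
  refine 𝒞.eq_zero_of_C_mul fun L b => ?_
  rw [← Matrix.conjTranspose_eq_zero, Matrix.conjTranspose_mul, Matrix.conjTranspose_conjTranspose]
  refine 𝒞.eq_zero_of_C_mul fun K a => ?_
  rw [← Matrix.mul_assoc, Matrix.mul_sub, Matrix.sub_mul, 𝒞.C_mul_Rinv, Matrix.smul_mul,
    sub_eq_zero]
  have h1 := 𝒞.kap_ne_zero I
  have h2 := 𝒞.kap_ne_zero J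
  have h3 := 𝒞.kap_ne_zero K
  -- The adjoint reduces this block to the normalization with the two Clebsch-Gordan maps exchanged.
  have hs : 𝒞.C I J K a * (𝒯.rep2 I J (tensorFlip (𝒢.R : G ⊗[ℂ] G)))ᴴ * (𝒞.C I J L b)ᴴ =
      (𝒞.C I J L b * 𝒯.rep2 I J (tensorFlip (𝒢.R : G ⊗[ℂ] G)) * (𝒞.C I J K a)ᴴ)ᴴ := by
    simp [Matrix.mul_assoc]
  rw [hs]
  by_cases hKL : K = L
  · subst hKL
    rw [𝒞.normal_same, 𝒞.normal_same]
    by_cases hab : a = b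
    · subst hab
      rw [if_pos rfl, Matrix.conjTranspose_smul, Matrix.conjTranspose_one, smul_smul]
      congr 1
      rw [star_div₀, star_mul', 𝒞.star_kap, 𝒞.star_kap, 𝒞.star_kap]
      field_simp
    · rw [if_neg hab, if_neg (Ne.symm hab), smul_zero, Matrix.conjTranspose_zero]
  · rw [𝒞.normal_ne _ _ _ _ _ _ hKL, 𝒞.normal_ne _ _ _ _ _ _ (Ne.symm hKL), smul_zero,
      Matrix.conjTranspose_zero]

end Clebsch

end ClebschFacts

/-! ### Positivity of `ω` and the behaviour of `R`, `u` and `g` under the `*`-operation. -/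

section StarFacts

variable {G : Type*} [Ring G] [HopfAlgebra ℂ G] [StarRing G] [StarModule ℂ G] {Λ : Type*}
  {𝒢 : RibbonStar G} {𝒯 : Irreps G Λ} (𝒞 : Clebsch 𝒢 𝒯)

/-- The element `R Δ(κ) (κ⁻¹ ⊗ κ⁻¹)`. -/
def Clebsch.omega : G ⊗[ℂ] G :=
  (𝒢.R : G ⊗[ℂ] G) * (Coalgebra.comul (R := ℂ) (𝒞.κ : G) *
    (((𝒞.κ⁻¹ : Gˣ) : G) ⊗ₜ[ℂ] ((𝒞.κ⁻¹ : Gˣ) : G)))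

theorem tensorFlip_Rinv_mul (𝒢 : RibbonStar G) :
    tensorFlip 𝒢.Rinv * tensorFlip (𝒢.R : G ⊗[ℂ] G) = 1 := by
  change Algebra.TensorProduct.comm ℂ G G _ * Algebra.TensorProduct.comm ℂ G G _ = 1
  rw [← map_mul, Units.inv_mul, map_one]

section

variable [Fintype Λ] [FiniteDimensional ℂ G] [IsSemisimpleRing G]

namespace Clebsch

/-- Write `R = R'⁻¹ (v ⊗ v) Δ(v⁻¹)` and expand `R'⁻¹` by `completeness`; `Δ(v⁻¹)` is scalar behind
each Clebsch-Gordan map. -/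
theorem rep2_R (I J : Λ) :
    𝒯.rep2 I J (𝒢.R : G ⊗[ℂ] G) = ∑ K, ∑ a, (𝒞.kap I * 𝒞.kap J / 𝒞.kap K) •
      ((𝒞.C I J K a)ᴴ * 𝒞.C I J K a) := by
  have h1 := 𝒞.kap_ne_zero I
  have h2 := 𝒞.kap_ne_zero J
  have hc : 𝒯.rep2 I J (tensorFlip 𝒢.Rinv) = ∑ K, ∑ a,
      (𝒞.kap K / (𝒞.kap I * 𝒞.kap J)) • ((𝒞.C I J K a)ᴴ * 𝒞.C I J K a) := by
    rw [← Matrix.mul_one (𝒯.rep2 I J (tensorFlip 𝒢.Rinv)), ← 𝒞.completeness I J,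
      Matrix.mul_sum]
    refine Finset.sum_congr rfl fun K _ => ?_
    rw [Matrix.mul_sum]
    refine Finset.sum_congr rfl fun a _ => ?_
    rw [Matrix.mul_smul, ← Matrix.mul_assoc, ← 𝒯.rep2_mul, tensorFlip_Rinv_mul, 𝒯.rep2_one,
      Matrix.one_mul]
  have hv : (𝒢.R : G ⊗[ℂ] G) = tensorFlip 𝒢.Rinv * ((𝒢.v : G) ⊗ₜ (𝒢.v : G)) *
      Coalgebra.comul (R := ℂ) ((𝒢.v⁻¹ : Gˣ) : G) := by
    rw [← 𝒢.comul_v, mul_assoc, mul_assoc, ← Bialgebra.comul_mul, Units.mul_inv,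
      Bialgebra.comul_one, mul_one, ← mul_assoc, tensorFlip_Rinv_mul, one_mul]
  rw [hv, 𝒯.rep2_mul, 𝒯.rep2_mul, hc, 𝒯.rep2_tmul, 𝒞.kap_sq, 𝒞.kap_sq, Matrix.smul_kronecker,
    Matrix.kronecker_smul, Matrix.one_kronecker_one, smul_smul, Matrix.mul_smul, Matrix.mul_one,
    Matrix.smul_mul, Matrix.sum_mul, Finset.smul_sum]
  refine Finset.sum_congr rfl fun K _ => ?_
  have h3 := 𝒞.kap_ne_zero K
  rw [Matrix.sum_mul, Finset.smul_sum]
  refine Finset.sum_congr rfl fun a _ => ?_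
  rw [Matrix.smul_mul, Matrix.mul_assoc, 𝒞.intertwine, 𝒞.τ_v_inv, Matrix.smul_mul,
    Matrix.one_mul, Matrix.mul_smul, smul_smul, smul_smul]
  congr 1
  field_simp

/-- The factors `Δ(κ)` and `κ⁻¹ ⊗ κ⁻¹` cancel exactly the scalars of `rep2_R`; the sum `∑ C^* C`
that remains is the source of positivity of the scalar product. -/
theorem rep2_omega (I J : Λ) :
    𝒯.rep2 I J 𝒞.omega = ∑ K, ∑ a, (𝒞.C I J K a)ᴴ * 𝒞.C I J K a := by
  have h1 := 𝒞.kap_ne_zero I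
  have h2 := 𝒞.kap_ne_zero J
  rw [omega, 𝒯.rep2_mul, 𝒯.rep2_mul, 𝒞.rep2_R, 𝒯.rep2_tmul, 𝒞.τ_κ_inv, 𝒞.τ_κ_inv,
    Matrix.smul_kronecker, Matrix.kronecker_smul, Matrix.one_kronecker_one, smul_smul,
    Matrix.mul_smul, Matrix.mul_one, Matrix.mul_smul, Matrix.sum_mul, Finset.smul_sum]
  refine Finset.sum_congr rfl fun K _ => ?_
  have h3 := 𝒞.kap_ne_zero K
  rw [Matrix.sum_mul, Finset.smul_sum]
  refine Finset.sum_congr rfl fun a _ => ?_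
  rw [Matrix.smul_mul, Matrix.mul_assoc, 𝒞.intertwine, 𝒞.τ_κ, Matrix.smul_mul,
    Matrix.one_mul, Matrix.mul_smul, smul_smul, smul_smul]
  convert one_smul ℂ _ using 2
  field_simp

theorem exists_omega_eq : ∃ x : G ⊗[ℂ] G, 𝒞.omega = star x * x := by
  have h : ∀ I J, ∃ Y : Matrix (Fin (𝒯.dim I) × Fin (𝒯.dim J)) (Fin (𝒯.dim I) × Fin (𝒯.dim J)) ℂ,
      𝒯.rep2 I J 𝒞.omega = Yᴴ * Y := by
    intro I J
    have hp : (𝒯.rep2 I J 𝒞.omega).PosSemidef := by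
      rw [𝒞.rep2_omega]
      exact Matrix.posSemidef_sum _ fun K _ => Matrix.posSemidef_sum _ fun a _ =>
        Matrix.posSemidef_conjTranspose_mul_self _
    -- A square root is chosen in each block `(I, J)`; together these define an element of `G ⊗ G`.
    open scoped MatrixOrder Matrix.Norms.L2Operator in
    exact CStarAlgebra.nonneg_iff_eq_star_mul_self.mp hp.nonneg
  choose Y hY using h
  obtain ⟨x, hx⟩ := 𝒯.exists_rep2 Y
  refine ⟨x, 𝒯.ext_rep2 fun I J => ?_⟩
  rw [𝒯.rep2_mul, 𝒯.rep2_star, hx, hY]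

theorem isUnit_omega : IsUnit 𝒞.omega := by
  refine 𝒢.R.isUnit.mul (IsUnit.mul ?_ ?_)
  · exact (𝒞.κ.isUnit).map (Bialgebra.comulAlgHom ℂ G)
  · have h : ((𝒞.κ⁻¹ : Gˣ) : G) ⊗ₜ[ℂ] ((𝒞.κ⁻¹ : Gˣ) : G) =
        (((𝒞.κ⁻¹ : Gˣ) : G) ⊗ₜ[ℂ] 1) * (1 ⊗ₜ[ℂ] ((𝒞.κ⁻¹ : Gˣ) : G)) := by simp
    rw [h]
    exact ((𝒞.κ⁻¹).isUnit.map (Algebra.TensorProduct.includeLeft : G →ₐ[ℂ] G ⊗[ℂ] G)).mul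
      ((𝒞.κ⁻¹).isUnit.map (Algebra.TensorProduct.includeRight : G →ₐ[ℂ] G ⊗[ℂ] G))

end Clebsch

end

/-! ### The antipode and the `*`-operation -/

/-- The first canonical leg of `G ⊗ G`. -/
def inclL : G →ₗ[ℂ] G ⊗[ℂ] G :=
  (Algebra.TensorProduct.includeLeft : G →ₐ[ℂ] G ⊗[ℂ] G).toLinearMap

/-- The second canonical leg of `G ⊗ G`. -/
def inclR : G →ₗ[ℂ] G ⊗[ℂ] G :=
  (Algebra.TensorProduct.includeRight : G →ₐ[ℂ] G ⊗[ℂ] G).toLinearMap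

theorem inclL_apply (x : G) : inclL x = x ⊗ₜ[ℂ] (1 : G) := rfl

theorem inclR_apply (x : G) : inclR x = (1 : G) ⊗ₜ[ℂ] x := rfl

theorem isLeg_inclL : IsLeg (inclL : G →ₗ[ℂ] G ⊗[ℂ] G) :=
  isLeg_id.comp (Algebra.TensorProduct.includeLeft : G →ₐ[ℂ] G ⊗[ℂ] G)

theorem isLeg_inclR : IsLeg (inclR : G →ₗ[ℂ] G ⊗[ℂ] G) :=
  isLeg_id.comp (Algebra.TensorProduct.includeRight : G →ₐ[ℂ] G ⊗[ℂ] G)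

theorem comm_inclL_inclR : Comm (inclL : G →ₗ[ℂ] G ⊗[ℂ] G) inclR := fun x y => by
  simp [Commute, SemiconjBy, inclL_apply, inclR_apply]

theorem tens_inclL_inclR (x : G ⊗[ℂ] G) : tens inclL inclR x = x := by
  induction x using TensorProduct.induction_on with
  | zero => simp
  | add x y hx hy => simp [hx, hy]
  | tmul a b => simp [inclL_apply, inclR_apply]

theorem Rinv_eq_map_antipode (𝒢 : RibbonStar G) :
    𝒢.Rinv = TensorProduct.map (HopfAlgebra.antipode ℂ) LinearMap.id (𝒢.R : G ⊗[ℂ] G) := by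
  have h := Rr_antip_left 𝒢 (isLeg_inclL (G := G)) isLeg_inclR comm_inclL_inclR
  rw [Ri, tens_inclL_inclR] at h
  rw [← h, Rr]
  induction (𝒢.R : G ⊗[ℂ] G) using TensorProduct.induction_on with
  | zero => simp
  | add x y hx hy => simp [hx, hy]
  | tmul a b => simp [inclL_apply, inclR_apply]

theorem star_unitLeg (𝒯 : Irreps G Λ) (x : G) :
    star (unitLeg (star x) : G) = unitLeg x := by
  rw [unitLeg_apply, unitLeg_apply, 𝒯.counit_star, Algebra.algebraMap_eq_smul_one, star_smul,
    star_star, star_one, Algebra.algebraMap_eq_smul_one]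

/-- For this convention, in which `*` flips the coproduct, `x ↦ S(x^*)^*` is a convolution inverse
of the identity, so it is `S`. -/
theorem antipode_star (𝒢 : RibbonStar G) (𝒯 : Irreps G Λ) (x : G) :
    HopfAlgebra.antipode ℂ (star x) = star (HopfAlgebra.antipode ℂ x) := by
  let F : G →ₗ[ℂ] G :=
    { toFun := fun x => star (HopfAlgebra.antipode ℂ (star x))
      map_add' := fun x y => by simp
      map_smul' := fun c x => by simp }
  have hF : conv F LinearMap.id = unitLeg := by
    ext x
    have e : ∀ w : G ⊗[ℂ] G, tens F LinearMap.id (tensorFlip (star w)) =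
        star (tens LinearMap.id (antip LinearMap.id) w) := by
      intro w
      induction w using TensorProduct.induction_on with
      | zero => simp [tensorFlip]
      | add x y hx hy => simp [tensorFlip_add, hx, hy]
      | tmul a b =>
        change star (HopfAlgebra.antipode ℂ (star (star b))) * star a =
          star (a * HopfAlgebra.antipode ℂ b)
        rw [star_star, star_mul]
    have hx := 𝒢.comul_star (star x)
    rw [star_star] at hx
    rw [conv_apply, hx, e, ← conv_apply, self_conv_antip isLeg_id, star_unitLeg 𝒯]
  have h : F = antip LinearMap.id := conv_inv_unique hF (self_conv_antip isLeg_id)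
  have h' := LinearMap.congr_fun h (star x)
  change star (HopfAlgebra.antipode ℂ (star (star x))) = HopfAlgebra.antipode ℂ (star x) at h'
  rw [← h', star_star]

theorem tensorFlip_star (x : G ⊗[ℂ] G) : tensorFlip (star x) = star (tensorFlip x) := by
  induction x using TensorProduct.induction_on with
  | zero => simp [tensorFlip]
  | add x y hx hy => simp [tensorFlip_add, hx, hy]
  | tmul a b => rfl

theorem tensorFlip_tensorFlip (x : G ⊗[ℂ] G) : tensorFlip (tensorFlip x) = x := by
  induction x using TensorProduct.induction_on with
  | zero => simp [tensorFlip]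
  | add x y hx hy => simp [tensorFlip_add, hx, hy]
  | tmul a b => rfl

variable [Fintype Λ] [FiniteDimensional ℂ G] [IsSemisimpleRing G]

include 𝒞 in
theorem star_R : star (𝒢.R : G ⊗[ℂ] G) = tensorFlip 𝒢.Rinv := by
  rw [𝒞.Rinv_eq_star, tensorFlip_star, tensorFlip_tensorFlip]

include 𝒞 in
theorem star_Rinv : star 𝒢.Rinv = tensorFlip (𝒢.R : G ⊗[ℂ] G) := by
  rw [𝒞.Rinv_eq_star, star_star]

include 𝒞 in
-- Insert `R^* = R'⁻¹` and `R⁻¹ = (S ⊗ id)(R)` into the adjoint of `u`; what results is the formula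
-- for its inverse.
theorem star_drinfeldU : star (drinfeldU 𝒢) = drinfeldUInv 𝒢 := by
  have e : ∀ x : G ⊗[ℂ] G, star (uElt x) =
      tens LinearMap.id (antip LinearMap.id) (star x) := by
    intro x
    unfold uElt
    induction x using TensorProduct.induction_on with
    | zero => simp [tensorFlip]
    | add x y hx hy => simp only [tensorFlip_add, map_add, star_add, hx, hy]
    | tmul a b =>
      change star (HopfAlgebra.antipode ℂ b * a) = star a * HopfAlgebra.antipode ℂ (star b)
      rw [star_mul, antipode_star 𝒢 𝒯]
  rw [e, star_R 𝒞, Rinv_eq_map_antipode, drinfeldUInv]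
  induction (𝒢.R : G ⊗[ℂ] G) using TensorProduct.induction_on with
  | zero => simp [tensorFlip]
  | add x y hx hy => simp only [tensorFlip_add, map_add, hx, hy]
  | tmul a b => rfl

include 𝒞 in
theorem gElt_mul_star : gElt 𝒢 * star (gElt 𝒢) = 1 := by
  have h := star_drinfeldU 𝒞
  rw [gElt_eq, ← h, star_mul, star_star, 𝒢.star_v, mul_assoc, ← mul_assoc (𝒢.v : G),
    Units.mul_inv, one_mul, h, drinfeldUInv_mul]

include 𝒞 in
-- `g` is grouplike and unitary, so both `S(g)` and `g^*` are its inverse.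
theorem antipode_gElt : HopfAlgebra.antipode ℂ (gElt 𝒢) = star (gElt 𝒢) := by
  have h := conv_gElt 𝒢 (isLeg_inclL (G := G)) isLeg_inclR comm_inclL_inclR
  rw [conv_apply, tens_inclL_inclR, inclL_apply, inclR_apply,
    Algebra.TensorProduct.tmul_mul_tmul, one_mul, mul_one] at h
  have h1 := LinearMap.congr_fun (antip_conv_self (isLeg_id (G := G))) (gElt 𝒢)
  rw [conv_apply, h] at h1
  change HopfAlgebra.antipode ℂ (gElt 𝒢) * gElt 𝒢 = algebraMap ℂ G _ at h1
  have h2 : Coalgebra.counit (R := ℂ) (gElt 𝒢) = 1 := by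
    have h3 := LinearMap.congr_fun (unitLeg_conv (LinearMap.id : G →ₗ[ℂ] G)) (gElt 𝒢)
    rw [conv_apply, h, tens_tmul, unitLeg_apply, LinearMap.id_apply] at h3
    have h4 := (isUnit_gElt 𝒢).mul_eq_right.mp h3
    have h5 := congrArg (Coalgebra.counit (R := ℂ)) h4
    rw [Bialgebra.counit_algebraMap, Bialgebra.counit_one] at h5
    exact h5
  rw [h2, map_one] at h1
  rw [← mul_one (HopfAlgebra.antipode ℂ (gElt 𝒢)), ← gElt_mul_star 𝒞, ← mul_assoc, h1, one_mul]

end StarFacts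

/-! ## Slices, quantum characters and the averaging projection -/

section Slices

variable {G : Type*} [Ring G] [HopfAlgebra ℂ G] {A : Type*} [Ring A] [Algebra ℂ A]
  {B : Type*} [Ring B] [Algebra ℂ B]

/-- `a ⊗ b ↦ t(a) b`. -/
def slice (t : G →ₗ[ℂ] ℂ) : G ⊗[ℂ] B →ₗ[ℂ] B :=
  TensorProduct.lid ℂ B ∘ₗ TensorProduct.map t LinearMap.id

@[simp] theorem slice_tmul (t : G →ₗ[ℂ] ℂ) (a : G) (b : B) : slice t (a ⊗ₜ b) = t a • b := by
  simp [slice]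

theorem slice_mul_left (t : G →ₗ[ℂ] ℂ) (X : G ⊗[ℂ] B) (b : B) :
    slice t ((1 ⊗ₜ b) * X) = b * slice t X := by
  induction X using TensorProduct.induction_on with
  | zero => simp
  | add x y hx hy => simp [hx, hy, mul_add]
  | tmul x y => simp

theorem slice_mul_right (t : G →ₗ[ℂ] ℂ) (X : G ⊗[ℂ] B) (c : B) :
    slice t (X * (1 ⊗ₜ c)) = slice t X * c := by
  induction X using TensorProduct.induction_on with
  | zero => simp
  | add x y hx hy => simp [hx, hy, add_mul]
  | tmul x y => simp

theorem slice_map (t : G →ₗ[ℂ] ℂ) (F : A →ₐ[ℂ] B) (X : G ⊗[ℂ] A) :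
    slice t (Algebra.TensorProduct.map (AlgHom.id ℂ G) F X) = F (slice t X) := by
  induction X using TensorProduct.induction_on with
  | zero => simp
  | add x y hx hy => simp [hx, hy]
  | tmul x y => simp

theorem apply_slice (t u : G →ₗ[ℂ] ℂ) (X : G ⊗[ℂ] G) : u (slice t X) = tens t u X := by
  induction X using TensorProduct.induction_on with
  | zero => simp
  | add x y hx hy => simp [hx, hy]
  | tmul x y => simp

theorem unop_conv_of_commute {f h : G →ₗ[ℂ] A} {X : A} (hX : ∀ y, Commute X (h y)) (x : G) :
    (conv (leftLeg f) (rightLeg h) x).unop X = conv (antip f) h x * X := by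
  have e : ∀ w : G ⊗[ℂ] G, (tens (leftLeg f) (rightLeg h) w).unop X = tens (antip f) h w * X := by
    intro w
    induction w using TensorProduct.induction_on with
    | zero => simp
    | add x y hx hy => simp [hx, hy, add_mul]
    | tmul a b => simp [mul_assoc, (hX b).eq]
  exact e _

/-- Invariance of the quantum trace under the adjoint action: cyclicity together with `g S²(y) = y
g` gathers the two factors into `∑ x₁ S(x₂) = ε(x)`. -/
theorem trace_like_sandwich {f : G →ₗ[ℂ] A} (T : A →ₗ[ℂ] B) (g : A)
    (hT : ∀ (X : A) y, T (f y * X) = T (X * f y)) (hf : IsLeg f)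
    (hg : ∀ y, g * f (HopfAlgebra.antipode ℂ (HopfAlgebra.antipode ℂ y)) = f y * g)
    (X : A) (x : G) :
    T ((conv (leftLeg f) (rightLeg f) x).unop X * g) =
      Coalgebra.counit (R := ℂ) x • T (X * g) := by
  have e : ∀ w : G ⊗[ℂ] G, T ((tens (leftLeg f) (rightLeg f) w).unop X * g) =
      T (X * (g * f (HopfAlgebra.antipode ℂ (tens LinearMap.id (antip LinearMap.id) w)))) := by
    intro w
    induction w using TensorProduct.induction_on with
    | zero => simp
    | add x y hx hy => simp [hx, hy, add_mul, mul_add]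
    | tmul a b =>
      simp only [tens_tmul, MulOpposite.unop_mul, Module.End.mul_apply, unop_leftLeg,
        unop_rightLeg, LinearMap.id_apply, antip_apply, HopfAlgebra.antipode_mul_antidistrib,
        hf.mul]
      rw [mul_assoc, mul_assoc, hT, ← mul_assoc g, hg]
      simp only [mul_assoc]
  rw [conv_apply, e, ← conv_apply, self_conv_antip isLeg_id, unitLeg_apply,
    Algebra.algebraMap_eq_smul_one, map_smul, HopfAlgebra.antipode_one, map_smul, hf.one]
  simp

end Slices

/-! ### Quantum characters and the central elements `z_I = (tr_q^I ⊗ id)(R'R)`. -/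

section Characters

variable {G : Type*} [Ring G] [HopfAlgebra ℂ G] [StarRing G] [StarModule ℂ G] {Λ : Type*}
  (𝒢 : RibbonStar G) (𝒯 : Irreps G Λ)

/-- The element `R'R`. -/
def monodromy : G ⊗[ℂ] G := tensorFlip (𝒢.R : G ⊗[ℂ] G) * (𝒢.R : G ⊗[ℂ] G)

/-- The representation `τ I` as a linear map. -/
def Irreps.lin (I : Λ) : G →ₗ[ℂ] 𝒯.Mat I ℂ := (𝒯.τ I).toAlgHom.toLinearMap

@[simp] theorem Irreps.lin_apply (I : Λ) (x : G) : 𝒯.lin I x = 𝒯.τ I x := rfl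

theorem Irreps.isLeg_lin (I : Λ) : IsLeg (𝒯.lin I) := isLeg_id.comp (𝒯.τ I).toAlgHom

/-- The quantum character `x ↦ tr(τ^I(x g))`. -/
def qch (I : Λ) : G →ₗ[ℂ] ℂ :=
  Matrix.traceLinearMap _ ℂ ℂ ∘ₗ 𝒯.lin I ∘ₗ LinearMap.mulRight ℂ (gElt 𝒢)

theorem qch_apply (I : Λ) (x : G) : qch 𝒢 𝒯 I x = (𝒯.τ I x * 𝒯.τ I (gElt 𝒢)).trace := by
  simp [qch]

theorem qch_one (I : Λ) : qch 𝒢 𝒯 I 1 = qdim 𝒢 𝒯 I := by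
  rw [qch_apply, qdim, qtr, map_one]
  rfl

theorem qdim_eq (I : Λ) : qdim 𝒢 𝒯 I = (𝒯.τ I (gElt 𝒢)).trace := by
  rw [← qch_one, qch_apply, map_one, one_mul]

theorem tens_qch (I J : Λ) (x : G ⊗[ℂ] G) :
    tens (qch 𝒢 𝒯 I) (qch 𝒢 𝒯 J) x =
      (𝒯.rep2 I J x * (𝒯.τ I (gElt 𝒢) ⊗ₖ 𝒯.τ J (gElt 𝒢))).trace := by
  induction x using TensorProduct.induction_on with
  | zero => simp [Irreps.rep2]
  | add x y hx hy => simp [hx, hy, Irreps.rep2_add, add_mul]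
  | tmul a b =>
    rw [tens_tmul, Irreps.rep2_tmul, ← Matrix.mul_kronecker_mul, Matrix.trace_kronecker, qch_apply,
      qch_apply]

theorem sElt_eq (I J : Λ) : sElt 𝒢 𝒯 I J = tens (qch 𝒢 𝒯 I) (qch 𝒢 𝒯 J) (monodromy 𝒢) :=
  (tens_qch 𝒢 𝒯 I J _).symm

/-- The element `(tr_q^I ⊗ id)(R'R)` of `G`. -/
def zElt (I : Λ) : G := slice (qch 𝒢 𝒯 I) (monodromy 𝒢)

variable [Fintype Λ] [FiniteDimensional ℂ G] [IsSemisimpleRing G]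

include 𝒢 in
-- `S²` is conjugation by the unit `u`.
theorem antipode_surjective : Function.Surjective (HopfAlgebra.antipode ℂ : G →ₗ[ℂ] G) := by
  intro y
  refine ⟨HopfAlgebra.antipode ℂ (drinfeldUInv 𝒢 * y * drinfeldU 𝒢), ?_⟩
  have h := antipode_sq_mul_drinfeldU 𝒢 (drinfeldUInv 𝒢 * y * drinfeldU 𝒢)
  rw [← mul_assoc, ← mul_assoc, mul_drinfeldUInv, one_mul] at h
  have h2 := congrArg (· * drinfeldUInv 𝒢) h
  simpa only [mul_assoc, mul_drinfeldUInv, mul_one] using h2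

include 𝒢 in
-- Convolving the invariance `∑ f(S y₁) Z f(y₂) = ε(y) Z` with `f ∘ S` from the right cancels
-- `f(y₂)`; the relation is left for `S(y)`, hence for all elements.
theorem commute_of_invariant {A : Type*} [Ring A] [Algebra ℂ A]
    {f : G →ₗ[ℂ] A} (hf : IsLeg f) {Z : A}
    (hZ : ∀ y, (conv (leftLeg f) (rightLeg f) y).unop Z = Coalgebra.counit (R := ℂ) y • Z)
    (x : G) : Commute (f x) Z := by
  obtain ⟨y, rfl⟩ := antipode_surjective 𝒢 x
  have h1 := unop_conv_of_counit hZ (antip (rightLeg f)) y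
  rw [conv_assoc, self_conv_antip (isLeg_rightLeg hf), conv_unitLeg] at h1
  exact Eq.symm (by simpa using h1.symm)

/-- `R'R` commutes with the coproduct, and the quantum trace over the first factor is invariant
under the adjoint action, so the action on the second factor alone remains. -/
theorem zElt_central (I : Λ) (y : G) : Commute (zElt 𝒢 𝒯 I) y := by
  have had : ∀ (a y : G), qch 𝒢 𝒯 I ((conv (leftLeg LinearMap.id) (rightLeg LinearMap.id) y).unop a)
      = Coalgebra.counit (R := ℂ) y • qch 𝒢 𝒯 I a := by
    intro a y
    refine trace_like_sandwich (f := LinearMap.id) (Matrix.traceLinearMap _ ℂ ℂ ∘ₗ 𝒯.lin I)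
      (gElt 𝒢) (fun X y => ?_) isLeg_id (fun y => gElt_mul_antipode_sq 𝒢 y) a y
    simpa using Matrix.trace_mul_comm (𝒯.τ I y) (𝒯.τ I X)
  have hsl : ∀ (X : G ⊗[ℂ] G) (y : G),
      slice (qch 𝒢 𝒯 I) ((conv (leftLeg inclL) (rightLeg inclL) y).unop X) =
        Coalgebra.counit (R := ℂ) y • slice (qch 𝒢 𝒯 I) X := by
    intro X y
    induction X using TensorProduct.induction_on with
    | zero => simp
    | add x y hx hy => simp [hx, hy]
    | tmul a b =>
      have e : ∀ w : G ⊗[ℂ] G, (tens (leftLeg inclL) (rightLeg inclL) w).unop (a ⊗ₜ[ℂ] b) =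
          ((tens (leftLeg LinearMap.id) (rightLeg LinearMap.id) w).unop a) ⊗ₜ[ℂ] b := by
        intro w
        induction w using TensorProduct.induction_on with
        | zero => simp
        | add x y hx hy => simp [hx, hy, TensorProduct.add_tmul]
        | tmul c d => simp [inclL_apply]
      rw [conv_apply, e, ← conv_apply, slice_tmul, had, slice_tmul, smul_assoc]
  have hQ : ∀ y, Commute (monodromy 𝒢) (conv inclL inclR y) := by
    intro y
    have h := Qm_commute_conv 𝒢 (isLeg_inclL (G := G)) isLeg_inclR comm_inclL_inclR y
    rwa [← tens_flip_R_mul_R 𝒢 isLeg_inclL isLeg_inclR comm_inclL_inclR, tens_inclL_inclR] at h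
  have h1 := unop_conv_of_commute (f := inclL) hQ y
  have h2 : conv (antip inclL) (conv inclL inclR) y = (1 : G) ⊗ₜ[ℂ] y := by
    rw [← conv_assoc, antip_conv_self isLeg_inclL, unitLeg_conv, inclR_apply]
  rw [h2, rightLeg_conv, ← conv_assoc] at h1
  have h3 := congrArg (slice (qch 𝒢 𝒯 I)) h1
  have e : ∀ w : G ⊗[ℂ] G, slice (qch 𝒢 𝒯 I)
      ((tens (conv (leftLeg inclL) (rightLeg inclL)) (rightLeg inclR) w).unop (monodromy 𝒢)) =
      zElt 𝒢 𝒯 I * tens unitLeg LinearMap.id w := by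
    intro w
    induction w using TensorProduct.induction_on with
    | zero => simp
    | add x y hx hy => simp [hx, hy, mul_add]
    | tmul c d =>
      rw [tens_tmul, MulOpposite.unop_mul, Module.End.mul_apply, unop_rightLeg, inclR_apply,
        slice_mul_right, hsl, tens_tmul, unitLeg_apply, LinearMap.id_apply,
        Algebra.algebraMap_eq_smul_one, smul_mul_assoc, smul_mul_assoc, one_mul, mul_smul_comm]
      rfl
  rw [conv_apply, e, ← conv_apply, unitLeg_conv] at h3
  rw [slice_mul_left] at h3
  exact h3

theorem qdim_pos_ne {I : Λ} (hd : ∀ I, 0 < qdim 𝒢 𝒯 I) : qdim 𝒢 𝒯 I ≠ 0 := (hd I).ne'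

/-- By Schur's lemma the central element acts as a scalar `c`; pairing with the quantum character of
`L` gives `s_{IL} = c d_L`. -/
theorem τ_zElt (hd : ∀ I, 0 < qdim 𝒢 𝒯 I) (I L : Λ) :
    𝒯.τ L (zElt 𝒢 𝒯 I) = (sElt 𝒢 𝒯 I L / qdim 𝒢 𝒯 L) • (1 : 𝒯.Mat L ℂ) := by
  obtain ⟨c, hc⟩ := 𝒯.schur_self (I := L) (T := 𝒯.τ L (zElt 𝒢 𝒯 I)) fun x => by
    rw [← map_mul, ← map_mul, (zElt_central 𝒢 𝒯 I x).eq]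
  have h := apply_slice (qch 𝒢 𝒯 I) (qch 𝒢 𝒯 L) (monodromy 𝒢)
  rw [← sElt_eq, ← zElt, qch_apply, hc, Matrix.smul_mul, one_mul, Matrix.trace_smul,
    ← qdim_eq, smul_eq_mul] at h
  rw [hc, ← h, mul_div_assoc, div_self (qdim_pos_ne 𝒢 𝒯 hd), mul_one]

theorem comul_gElt : Coalgebra.comul (R := ℂ) (gElt 𝒢) = gElt 𝒢 ⊗ₜ[ℂ] gElt 𝒢 := by
  have h := conv_gElt 𝒢 (isLeg_inclL (G := G)) isLeg_inclR comm_inclL_inclR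
  rw [conv_apply, tens_inclL_inclR] at h
  simpa [inclL_apply, inclR_apply] using h

/-- `R'R` and `RR'` are conjugate by `R`, which commutes with `g ⊗ g = Δ(g)`. -/
theorem sElt_symm (I J : Λ) : sElt 𝒢 𝒯 I J = sElt 𝒢 𝒯 J I := by
  have hR := 𝒢.R_mul_comul (gElt 𝒢)
  rw [comul_gElt, show tensorFlip (gElt 𝒢 ⊗ₜ[ℂ] gElt 𝒢) = gElt 𝒢 ⊗ₜ[ℂ] gElt 𝒢 from rfl] at hR
  have hflip : ∀ x : G ⊗[ℂ] G, tens (qch 𝒢 𝒯 J) (qch 𝒢 𝒯 I) x =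
      tens (qch 𝒢 𝒯 I) (qch 𝒢 𝒯 J) (tensorFlip x) := fun x =>
    (tens_flip (fun a b => Commute.all _ _) x).symm
  have hm : tensorFlip (monodromy 𝒢) = (𝒢.R : G ⊗[ℂ] G) * tensorFlip (𝒢.R : G ⊗[ℂ] G) := by
    rw [monodromy]
    refine (map_mul (Algebra.TensorProduct.comm ℂ G G) _ _).trans ?_
    exact congrArg (· * _) (tensorFlip_tensorFlip _)
  rw [sElt_eq 𝒢 𝒯 J I, hflip, hm, tens_qch, sElt, ← Irreps.rep2_tmul, ← 𝒯.rep2_mul,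
    ← 𝒯.rep2_mul, mul_assoc, mul_assoc, hR, ← mul_assoc, 𝒯.rep2_mul, Matrix.trace_mul_comm,
    ← 𝒯.rep2_mul]

end Characters

/-! ## The fusion algebra and the `S`-matrix -/

section ThreeLegs

variable {G : Type*} [Ring G] [HopfAlgebra ℂ G] [StarRing G] [StarModule ℂ G]

/-- `x ↦ x ⊗ 1 ⊗ 1`. -/
def triL : G →ₗ[ℂ] G ⊗[ℂ] (G ⊗[ℂ] G) :=
  (Algebra.TensorProduct.includeLeft : G →ₐ[ℂ] G ⊗[ℂ] (G ⊗[ℂ] G)).toLinearMap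

/-- `x ↦ 1 ⊗ x ⊗ 1`. -/
def triM : G →ₗ[ℂ] G ⊗[ℂ] (G ⊗[ℂ] G) :=
  (Algebra.TensorProduct.includeRight : G ⊗[ℂ] G →ₐ[ℂ] G ⊗[ℂ] (G ⊗[ℂ] G)).toLinearMap ∘ₗ inclL

/-- `x ↦ 1 ⊗ 1 ⊗ x`. -/
def triR : G →ₗ[ℂ] G ⊗[ℂ] (G ⊗[ℂ] G) :=
  (Algebra.TensorProduct.includeRight : G ⊗[ℂ] G →ₐ[ℂ] G ⊗[ℂ] (G ⊗[ℂ] G)).toLinearMap ∘ₗ inclR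

theorem triL_apply (x : G) : triL x = x ⊗ₜ[ℂ] (1 : G ⊗[ℂ] G) := rfl

theorem triM_apply (x : G) : triM x = (1 : G) ⊗ₜ[ℂ] (x ⊗ₜ[ℂ] (1 : G)) := rfl

theorem triR_apply (x : G) : triR x = (1 : G) ⊗ₜ[ℂ] ((1 : G) ⊗ₜ[ℂ] x) := rfl

theorem isLeg_triL : IsLeg (triL : G →ₗ[ℂ] G ⊗[ℂ] (G ⊗[ℂ] G)) :=
  isLeg_id.comp (Algebra.TensorProduct.includeLeft : G →ₐ[ℂ] G ⊗[ℂ] (G ⊗[ℂ] G))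

theorem isLeg_triM : IsLeg (triM : G →ₗ[ℂ] G ⊗[ℂ] (G ⊗[ℂ] G)) := isLeg_inclL.comp _

theorem isLeg_triR : IsLeg (triR : G →ₗ[ℂ] G ⊗[ℂ] (G ⊗[ℂ] G)) := isLeg_inclR.comp _

theorem comm_triL_triM : Comm (triL : G →ₗ[ℂ] G ⊗[ℂ] (G ⊗[ℂ] G)) triM := fun x y => by
  simp [Commute, SemiconjBy, triL_apply, triM_apply]

theorem comm_triL_triR : Comm (triL : G →ₗ[ℂ] G ⊗[ℂ] (G ⊗[ℂ] G)) triR := fun x y => by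
  simp [Commute, SemiconjBy, triL_apply, triR_apply]

theorem comm_triM_triR : Comm (triM : G →ₗ[ℂ] G ⊗[ℂ] (G ⊗[ℂ] G)) triR := comm_inclL_inclR.comp _

theorem slice_sum {B : Type*} [Ring B] [Algebra ℂ B] {ι : Type*} (s : Finset ι) (c : ι → ℂ)
    (t : ι → (G →ₗ[ℂ] ℂ)) (X : G ⊗[ℂ] B) :
    slice (∑ i ∈ s, c i • t i) X = ∑ i ∈ s, c i • slice (t i) X := by
  induction X using TensorProduct.induction_on with
  | zero => simp
  | add x y hx hy => simp [hx, hy, Finset.sum_add_distrib]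
  | tmul x y => simp [Finset.sum_smul, mul_smul]

theorem slice_slice_tens (t u : G →ₗ[ℂ] ℂ) (w : G ⊗[ℂ] G) :
    slice u (slice t (tens (conv triL triM) triR w)) = slice (conv t u) w := by
  have e : ∀ x : G ⊗[ℂ] G, slice u (slice t (tens triL triM x)) = tens t u x • (1 : G) := by
    intro x
    induction x using TensorProduct.induction_on with
    | zero => simp
    | add x y hx hy => simp [hx, hy, add_smul]
    | tmul a b => simp [triL_apply, triM_apply, mul_smul]
  induction w using TensorProduct.induction_on with
  | zero => simp
  | add x y hx hy => simp [hx, hy]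
  | tmul a b =>
    rw [tens_tmul, triR_apply, slice_mul_right, slice_mul_right, conv_apply, e, slice_tmul,
      conv_apply, smul_mul_assoc, one_mul]

variable (𝒢 : RibbonStar G)

theorem Qm_inclL_inclR : Qm 𝒢 (inclL : G →ₗ[ℂ] G ⊗[ℂ] G) inclR = monodromy 𝒢 := by
  rw [← tens_flip_R_mul_R 𝒢 isLeg_inclL isLeg_inclR comm_inclL_inclR, tens_inclL_inclR, monodromy]

theorem Qm_eq_tens {A : Type*} [Ring A] [Algebra ℂ A] {f g : G →ₗ[ℂ] A} (hf : IsLeg f)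
    (hg : IsLeg g) (h : Comm f g) : Qm 𝒢 f g = tens f g (monodromy 𝒢) :=
  (tens_flip_R_mul_R 𝒢 hf hg h).symm

theorem Qm_triL_triR : Qm 𝒢 (triL : G →ₗ[ℂ] G ⊗[ℂ] (G ⊗[ℂ] G)) triR =
    Algebra.TensorProduct.map (AlgHom.id ℂ G)
      (Algebra.TensorProduct.includeRight : G →ₐ[ℂ] G ⊗[ℂ] G) (monodromy 𝒢) := by
  rw [← Qm_inclL_inclR, map_Qm]
  congr 1

theorem Rr_triM_triR : Rr 𝒢 (triM : G →ₗ[ℂ] G ⊗[ℂ] (G ⊗[ℂ] G)) triR =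
    (1 : G) ⊗ₜ[ℂ] (𝒢.R : G ⊗[ℂ] G) := by
  have h := map_Rr 𝒢 (Algebra.TensorProduct.includeRight : G ⊗[ℂ] G →ₐ[ℂ] G ⊗[ℂ] (G ⊗[ℂ] G))
    inclL inclR
  rw [Rr, tens_inclL_inclR] at h
  exact h.symm

theorem Rr_triR_triM : Rr 𝒢 (triR : G →ₗ[ℂ] G ⊗[ℂ] (G ⊗[ℂ] G)) triM =
    (1 : G) ⊗ₜ[ℂ] tensorFlip (𝒢.R : G ⊗[ℂ] G) := by
  have h := map_Rr 𝒢 (Algebra.TensorProduct.includeRight : G ⊗[ℂ] G →ₐ[ℂ] G ⊗[ℂ] (G ⊗[ℂ] G))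
    inclR inclL
  rw [Rr, ← tens_flip comm_inclL_inclR, tens_inclL_inclR] at h
  exact h.symm

end ThreeLegs

/-! ### The fusion rules of the central elements `z_I` and of the `S`-matrix. -/

section Fusion

variable {G : Type*} [Ring G] [HopfAlgebra ℂ G] [StarRing G] [StarModule ℂ G] {Λ : Type*}
  {𝒢 : RibbonStar G} {𝒯 : Irreps G Λ} (𝒞 : Clebsch 𝒢 𝒯)
  [Fintype Λ] [FiniteDimensional ℂ G] [IsSemisimpleRing G]

namespace Clebsch

/-- Because `g` is grouplike, this is the decomposition of the ordinary character of `V^I ⊗ V^J`. -/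
theorem conv_qch (I J : Λ) :
    conv (qch 𝒢 𝒯 I) (qch 𝒢 𝒯 J) = ∑ K, (𝒞.N I J K : ℂ) • qch 𝒢 𝒯 K := by
  ext x
  rw [conv_apply, tens_qch, ← Irreps.rep2_tmul, ← comul_gElt, ← 𝒯.rep2_mul, ← Bialgebra.comul_mul,
    𝒞.trace_rep2_comul, LinearMap.sum_apply]
  simp [qch_apply]

/-- Slice `(Δ ⊗ id)(R'R) = R'₂₃ (R'R)₁₃ R₂₃` by two quantum characters: the first slice puts the
central `z_I` between `R'` and `R`, the second then gives `z_I z_J`, and on the left the characters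
multiply by the fusion rules. -/
theorem zElt_mul (I J : Λ) :
    zElt 𝒢 𝒯 I * zElt 𝒢 𝒯 J = ∑ K, (𝒞.N I J K : ℂ) • zElt 𝒢 𝒯 K := by
  have hcen : ∀ X : G ⊗[ℂ] G, X * ((1 : G) ⊗ₜ[ℂ] zElt 𝒢 𝒯 I) = (1 ⊗ₜ[ℂ] zElt 𝒢 𝒯 I) * X := by
    intro X
    induction X using TensorProduct.induction_on with
    | zero => simp
    | add x y hx hy => simp [hx, hy, mul_add, add_mul]
    | tmul a b => simp [(zElt_central 𝒢 𝒯 I b).eq]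
  have h := Qm_conv_left 𝒢 (isLeg_triR (G := G)) comm_triL_triM comm_triM_triR
  rw [Qm_eq_tens 𝒢 (isLeg_conv isLeg_triL isLeg_triM comm_triL_triM) isLeg_triR
    (comm_triL_triR.conv_left comm_triM_triR), Rr_triR_triM, Rr_triM_triR, Qm_triL_triR] at h
  have h2 := congrArg (fun X => slice (qch 𝒢 𝒯 J) (slice (qch 𝒢 𝒯 I) X)) h
  simp only [slice_slice_tens, slice_mul_right, slice_mul_left, slice_map] at h2
  rw [𝒞.conv_qch, slice_sum, ← zElt, Algebra.TensorProduct.includeRight_apply, hcen, mul_assoc,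
    slice_mul_left, ← monodromy, ← zElt] at h2
  exact h2.symm

theorem sElt_mul (hd : ∀ I, 0 < qdim 𝒢 𝒯 I) (I J L : Λ) :
    sElt 𝒢 𝒯 I L * sElt 𝒢 𝒯 J L / qdim 𝒢 𝒯 L = ∑ K, (𝒞.N I J K : ℂ) * sElt 𝒢 𝒯 K L := by
  have h := congrArg (fun x => 𝒯.τ L x ⟨0, 𝒯.dim_pos L⟩ ⟨0, 𝒯.dim_pos L⟩) (𝒞.zElt_mul I J)
  simp only [map_mul, map_sum, map_smul, τ_zElt 𝒢 𝒯 hd, Matrix.sum_apply] at h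
  simp at h
  have h0 := qdim_pos_ne 𝒢 𝒯 (I := L) hd
  field_simp at h ⊢
  simp only [mul_div_assoc', ← Finset.sum_div] at h
  field_simp at h
  linear_combination h

end Clebsch

end Fusion

/-! ## Orthogonality relations and the conjugation of labels -/

section Orthogonality

variable {G : Type*} [Ring G] [HopfAlgebra ℂ G] [StarRing G] [StarModule ℂ G] {Λ : Type*}
  (𝒢 : RibbonStar G) (𝒯 : Irreps G Λ)

/-- `G` acts by scalars, so by Schur's lemma even the diagonal matrix units are multiples of the
identity. -/
theorem Irreps.dim_zero : 𝒯.dim 𝒯.zero = 1 := by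
  have hs : ∀ i j : Fin (𝒯.dim 𝒯.zero), i = j := by
    intro i j
    obtain ⟨c, hc⟩ := 𝒯.schur_self (I := 𝒯.zero) (T := Matrix.single i i (1 : ℂ)) fun x => by
      rw [𝒯.τ_zero]; simp
    by_contra hij
    have h1 := congrFun (congrFun hc i) i
    have h2 := congrFun (congrFun hc j) j
    simp [hij] at h1 h2
    exact one_ne_zero (h1.trans h2.symm)
  have := 𝒯.dim_pos 𝒯.zero
  by_contra hne
  have h1 : 1 < 𝒯.dim 𝒯.zero := by omega
  have := hs ⟨0, by omega⟩ ⟨1, h1⟩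
  simp at this

/-- `a ⊗ b ↦ τ^I(S(a)) X τ^J(b)`. -/
def Irreps.sandwich (I J : Λ) (X : Matrix (Fin (𝒯.dim I)) (Fin (𝒯.dim J)) ℂ) :
    G ⊗[ℂ] G →ₗ[ℂ] Matrix (Fin (𝒯.dim I)) (Fin (𝒯.dim J)) ℂ :=
  TensorProduct.lift (LinearMap.mk₂ ℂ
    (fun a b => 𝒯.τ I (HopfAlgebra.antipode ℂ a) * X * 𝒯.τ J b)
    (fun a a' b => by simp [Matrix.add_mul]) (fun c a b => by simp)
    (fun a b b' => by simp [Matrix.mul_add]) (fun c a b => by simp))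

theorem Irreps.sandwich_tmul (I J : Λ) (X : Matrix (Fin (𝒯.dim I)) (Fin (𝒯.dim J)) ℂ) (a b : G) :
    𝒯.sandwich I J X (a ⊗ₜ b) = 𝒯.τ I (HopfAlgebra.antipode ℂ a) * X * 𝒯.τ J b := rfl

/-- The direct sum of `τ I` and `τ J`. -/
def Irreps.blockLeg (I J : Λ) :
    G →ₗ[ℂ] Matrix (Fin (𝒯.dim I) ⊕ Fin (𝒯.dim J)) (Fin (𝒯.dim I) ⊕ Fin (𝒯.dim J)) ℂ where
  toFun x := Matrix.fromBlocks (𝒯.τ I x) 0 0 (𝒯.τ J x)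
  map_add' x y := by simp [Matrix.fromBlocks_add]
  map_smul' c x := by simp [Matrix.fromBlocks_smul]

theorem Irreps.blockLeg_apply (I J : Λ) (x : G) :
    𝒯.blockLeg I J x = Matrix.fromBlocks (𝒯.τ I x) 0 0 (𝒯.τ J x) := rfl

theorem Irreps.isLeg_blockLeg (I J : Λ) : IsLeg (𝒯.blockLeg I J) where
  one := by simp [Irreps.blockLeg_apply]
  mul x y := by simp [Irreps.blockLeg_apply, Matrix.fromBlocks_multiply]

/-- A rectangular matrix becomes an off-diagonal block of the direct sum, where averaging with a
single leg applies. -/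
theorem Irreps.unop_sandwich_block (I J : Λ) (X : Matrix (Fin (𝒯.dim I)) (Fin (𝒯.dim J)) ℂ)
    (w : G ⊗[ℂ] G) :
    (tens (leftLeg (𝒯.blockLeg I J)) (rightLeg (𝒯.blockLeg I J)) w).unop
      (Matrix.fromBlocks 0 X 0 0) = Matrix.fromBlocks 0 (𝒯.sandwich I J X w) 0 0 := by
  induction w using TensorProduct.induction_on with
  | zero => simp
  | add x y hx hy => simp [hx, hy, Matrix.fromBlocks_add]
  | tmul a b =>
    simp [Irreps.blockLeg_apply, Matrix.fromBlocks_multiply, Irreps.sandwich_tmul]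

theorem Irreps.unop_sandwich_lin (I : Λ) (X : 𝒯.Mat I ℂ) (w : G ⊗[ℂ] G) :
    (tens (leftLeg (𝒯.lin I)) (rightLeg (𝒯.lin I)) w).unop X = 𝒯.sandwich I I X w := by
  induction w using TensorProduct.induction_on with
  | zero => simp
  | add x y hx hy => simp [hx, hy]
  | tmul a b => simp [Irreps.sandwich_tmul]

variable [Fintype Λ] [DecidableEq Λ] [FiniteDimensional ℂ G] [IsSemisimpleRing G]

/-- The two-sided integral: `τ^0(h) = 1` and `τ^L(h) = 0` for `L ≠ 0`. -/
def Irreps.haar : G :=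
  Classical.choose (𝒯.exists_rep fun L => if L = 𝒯.zero then 1 else 0)

theorem Irreps.τ_haar (L : Λ) : 𝒯.τ L 𝒯.haar = if L = 𝒯.zero then 1 else 0 :=
  Classical.choose_spec (𝒯.exists_rep fun L => if L = 𝒯.zero then 1 else 0) L

theorem Irreps.haar_mul (y : G) : 𝒯.haar * y = Coalgebra.counit (R := ℂ) y • 𝒯.haar := by
  refine 𝒯.ext_rep fun L => ?_
  rw [map_mul, map_smul, 𝒯.τ_haar]
  by_cases h : L = 𝒯.zero
  · subst h
    rw [𝒯.τ_zero]
    simp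
  · simp [h]

theorem Irreps.mul_haar (y : G) : y * 𝒯.haar = Coalgebra.counit (R := ℂ) y • 𝒯.haar := by
  refine 𝒯.ext_rep fun L => ?_
  rw [map_mul, map_smul, 𝒯.τ_haar]
  by_cases h : L = 𝒯.zero
  · subst h
    rw [𝒯.τ_zero]
    simp
  · simp [h]

theorem Irreps.counit_haar : Coalgebra.counit (R := ℂ) 𝒯.haar = 1 := by
  have h := 𝒯.τ_zero 𝒯.haar
  rw [𝒯.τ_haar, if_pos rfl] at h
  have h2 := congrFun (congrFun h ⟨0, 𝒯.dim_pos _⟩) ⟨0, 𝒯.dim_pos _⟩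
  simpa using h2.symm

include 𝒢 in
-- Averaging with the integral: since `h y = ε(y) h`, the result is invariant under the adjoint
-- action and therefore commutes with `f`.
theorem commute_average {A : Type*} [Ring A] [Algebra ℂ A] {f : G →ₗ[ℂ] A} (hf : IsLeg f) (X : A)
    (x : G) : Commute (f x) ((conv (leftLeg f) (rightLeg f) 𝒯.haar).unop X) := by
  refine commute_of_invariant 𝒢 hf (fun y => ?_) x
  have hl := isLeg_conv (isLeg_leftLeg hf) (isLeg_rightLeg hf) (comm_rightLeg_leftLeg f f).symm
  rw [← Module.End.mul_apply, ← MulOpposite.unop_mul, ← hl.mul, 𝒯.haar_mul, map_smul]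
  rfl

include 𝒢 in
theorem sandwich_intertwine (I J : Λ) (X : Matrix (Fin (𝒯.dim I)) (Fin (𝒯.dim J)) ℂ) (x : G) :
    𝒯.τ I x * 𝒯.sandwich I J X (Coalgebra.comul 𝒯.haar) =
      𝒯.sandwich I J X (Coalgebra.comul 𝒯.haar) * 𝒯.τ J x := by
  have h := commute_average 𝒢 𝒯 (𝒯.isLeg_blockLeg I J) (Matrix.fromBlocks 0 X 0 0) x
  rw [conv_apply, 𝒯.unop_sandwich_block, Irreps.blockLeg_apply, Commute, SemiconjBy,
    Matrix.fromBlocks_multiply, Matrix.fromBlocks_multiply] at h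
  simpa using congrArg Matrix.toBlocks₁₂ h

include 𝒢 in
theorem sandwich_ne {I J : Λ} (hIJ : I ≠ J) (X : Matrix (Fin (𝒯.dim I)) (Fin (𝒯.dim J)) ℂ) :
    𝒯.sandwich I J X (Coalgebra.comul 𝒯.haar) = 0 :=
  𝒯.schur_ne hIJ (sandwich_intertwine 𝒢 𝒯 I J X)

/-- Schur orthogonality: the average is a scalar, determined by the quantum trace, which averaging
preserves. -/
theorem sandwich_self (hd : ∀ I, 0 < qdim 𝒢 𝒯 I) (I : Λ) (X : 𝒯.Mat I ℂ) :
    𝒯.sandwich I I X (Coalgebra.comul 𝒯.haar) =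
      ((X * 𝒯.τ I (gElt 𝒢)).trace / qdim 𝒢 𝒯 I) • (1 : 𝒯.Mat I ℂ) := by
  obtain ⟨c, hc⟩ := 𝒯.schur_self (sandwich_intertwine 𝒢 𝒯 I I X)
  have h := trace_like_sandwich (f := 𝒯.lin I) (Matrix.traceLinearMap _ ℂ ℂ) (𝒯.τ I (gElt 𝒢))
    (fun X y => Matrix.trace_mul_comm (𝒯.τ I y) X) (𝒯.isLeg_lin I)
    (fun y => by simp only [Irreps.lin_apply, ← map_mul, gElt_mul_antipode_sq]) X 𝒯.haar
  rw [conv_apply, 𝒯.unop_sandwich_lin, hc, 𝒯.counit_haar, one_smul, smul_mul_assoc, one_mul,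
    map_smul, Matrix.traceLinearMap_apply, Matrix.traceLinearMap_apply, ← qdim_eq,
    smul_eq_mul] at h
  rw [hc, ← h, mul_div_assoc, div_self (qdim_pos_ne 𝒢 𝒯 hd), mul_one]

theorem Irreps.exists_τ_eq (I : Λ) (Y : 𝒯.Mat I ℂ) : ∃ x, 𝒯.τ I x = Y := by
  obtain ⟨x, hx⟩ := 𝒯.exists_rep (Function.update 0 I Y)
  exact ⟨x, by rw [hx, Function.update_self]⟩

/-- The dual representation `x ↦ τ^I(S(x))ᵀ`. -/
def Irreps.dual (I : Λ) : G →ₐ[ℂ] 𝒯.Mat I ℂ :=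
  AlgHom.ofLinearMap ((Matrix.transposeLinearEquiv _ _ ℂ ℂ).toLinearMap ∘ₗ antip (𝒯.lin I))
    (by simp [HopfAlgebra.antipode_one])
    (fun x y => by simp [HopfAlgebra.antipode_mul_antidistrib, Matrix.transpose_mul])

theorem Irreps.dual_apply (I : Λ) (x : G) :
    𝒯.dual I x = (𝒯.τ I (HopfAlgebra.antipode ℂ x))ᵀ := rfl

include 𝒢 in
-- The dual is irreducible because its image is again the full matrix algebra (`S` is onto);
-- completeness of the list then gives the label for the choice made in `conj`.
theorem conj_spec (I : Λ) :
    IsEquivalent (fun x : G => (𝒯.τ I (HopfAlgebra.antipode ℂ x))ᵀ) (𝒯.τ (𝒯.conj I)) := by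
  have hirr : IsIrreducible (𝒯.dual I) := by
    refine ⟨𝒯.dim_pos I, fun W hW => (𝒯.irreducible I).2 W fun x w hw => ?_⟩
    obtain ⟨y, hy⟩ := 𝒯.exists_τ_eq I (𝒯.τ I x)ᵀ
    obtain ⟨z, rfl⟩ := antipode_surjective 𝒢 y
    have h := hW z w hw
    rwa [𝒯.dual_apply, hy, Matrix.transpose_transpose] at h
  exact Classical.epsilon_spec (𝒯.complete _ _ hirr)

theorem IsEquivalent.trace_eq {n k : ℕ} {ρ : G → Matrix (Fin n) (Fin n) ℂ}
    {σ : G → Matrix (Fin k) (Fin k) ℂ} (h : IsEquivalent ρ σ) (x : G) :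
    (ρ x).trace = (σ x).trace := by
  obtain ⟨T, T', h1, h2, h3⟩ := h
  calc (ρ x).trace = (ρ x * (T * T')).trace := by rw [h1, mul_one]
    _ = (σ x).trace := by
      rw [← Matrix.mul_assoc, h3, Matrix.trace_mul_comm, ← Matrix.mul_assoc, h2, one_mul]

include 𝒢 in
theorem trace_conj (I : Λ) (x : G) :
    (𝒯.τ (𝒯.conj I) x).trace = (𝒯.τ I (HopfAlgebra.antipode ℂ x)).trace := by
  rw [← (conj_spec 𝒢 𝒯 I).trace_eq x, Matrix.trace_transpose]

include 𝒢 in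
theorem conj_zero : 𝒯.conj 𝒯.zero = 𝒯.zero := by
  refine (𝒯.inequivalent _ _ ?_).symm
  have h := conj_spec 𝒢 𝒯 𝒯.zero
  have e : (fun x : G => (𝒯.τ 𝒯.zero (HopfAlgebra.antipode ℂ x))ᵀ) = 𝒯.τ 𝒯.zero := by
    funext x
    rw [𝒯.τ_zero, 𝒯.τ_zero]
    simp
  rwa [e] at h

variable {𝒢 𝒯} (𝒞 : Clebsch 𝒢 𝒯)

include 𝒞 in
-- `S(g) = g^*`, and quantum dimensions are real.
theorem Clebsch.qdim_conj (hd : ∀ I, 0 < qdim 𝒢 𝒯 I) (I : Λ) :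
    qdim 𝒢 𝒯 (𝒯.conj I) = qdim 𝒢 𝒯 I := by
  rw [qdim_eq, trace_conj 𝒢, antipode_gElt 𝒞, map_star, Matrix.star_eq_conjTranspose,
    Matrix.trace_conjTranspose, ← qdim_eq]
  exact (IsSelfAdjoint.of_nonneg (hd I).le)

/-- The multiplicity is the trace of the integral on `V^Ī ⊗ V^J`, since only the trivial constituent
survives; Schur orthogonality evaluates that trace. -/
theorem Clebsch.N_conj (hd : ∀ I, 0 < qdim 𝒢 𝒯 I) (I J : Λ) :
    (𝒞.N (𝒯.conj I) J 𝒯.zero : ℂ) = if I = J then 1 else 0 := by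
  have e : ∀ w : G ⊗[ℂ] G, (𝒯.rep2 (𝒯.conj I) J w).trace =
      ∑ k, ∑ j, 𝒯.sandwich I J (Matrix.single k j 1) w k j := by
    intro w
    induction w using TensorProduct.induction_on with
    | zero => simp [Irreps.rep2]
    | add x y hx hy => simp [Irreps.rep2_add, hx, hy, Finset.sum_add_distrib]
    | tmul a b =>
      rw [Irreps.rep2_tmul, Matrix.trace_kronecker, trace_conj 𝒢]
      simp only [Irreps.sandwich_tmul, Matrix.trace, Matrix.diag, Finset.sum_mul_sum]
      refine Finset.sum_congr rfl fun k _ => Finset.sum_congr rfl fun j _ => ?_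
      simp [Matrix.mul_apply, Matrix.single_apply, Finset.sum_ite_eq, ite_and]
  have h := 𝒞.trace_rep2_comul (𝒯.conj I) J 𝒯.haar
  rw [e] at h
  have h2 : ∑ K, (𝒞.N (𝒯.conj I) J K : ℂ) * (𝒯.τ K 𝒯.haar).trace =
      𝒞.N (𝒯.conj I) J 𝒯.zero := by
    rw [Finset.sum_eq_single 𝒯.zero]
    · rw [𝒯.τ_haar, if_pos rfl, Matrix.trace_one, Fintype.card_fin, 𝒯.dim_zero]
      simp
    · intro K _ hK
      simp [𝒯.τ_haar, hK]
    · simp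
  rw [h2] at h
  rw [← h]
  split_ifs with hIJ
  · subst hIJ
    simp only [sandwich_self 𝒢 𝒯 hd]
    have hd0 := qdim_pos_ne 𝒢 𝒯 (I := I) hd
    simp [Matrix.one_apply, ← Finset.sum_div]
    rw [div_eq_one_iff_eq hd0, qdim_eq]
    exact Finset.sum_congr rfl fun i _ => (Matrix.trace_single_mul _ _ _ _).trans (one_smul _ _)
  · simp [sandwich_ne 𝒢 𝒯 hIJ]

end Orthogonality

/-! ## Unitarity of the `S`-matrix and factorizability -/

section Modularity

/-- `C` inherits symmetry from `s`, so its left inverse `Γᵀ` equals its right inverse `Γ`; then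
`diag(b) s Γ` and `Γ s diag(b)` are a right and a left inverse of `s`. It is applied with `Γ` the
conjugation of labels. -/
theorem matrix_conjugation {n : Type*} [Fintype n] [DecidableEq n] {s Γ C : Matrix n n ℂ}
    {b : n → ℂ} (hs : sᵀ = s) (hC : s * Matrix.diagonal b * s = C) (hΓ : Γᵀ * C = 1) :
    Γᵀ = Γ ∧ Matrix.diagonal b * s * Γ = Γ * s * Matrix.diagonal b ∧
      s * Γ * s * Matrix.diagonal b = 1 := by
  have hCt : Cᵀ = C := by
    rw [← hC, Matrix.transpose_mul, Matrix.transpose_mul, hs, Matrix.diagonal_transpose,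
      Matrix.mul_assoc]
  have h1 : C * Γ = 1 := by
    have h := congrArg Matrix.transpose hΓ
    rwa [Matrix.transpose_mul, hCt, Matrix.transpose_transpose, Matrix.transpose_one] at h
  have h2 : Γᵀ = Γ := left_inv_eq_right_inv hΓ h1
  rw [h2] at hΓ
  have h3 : s * (Matrix.diagonal b * s * Γ) = 1 := by
    rw [← h1, ← hC]; simp only [Matrix.mul_assoc]
  have h4 : Γ * s * Matrix.diagonal b * s = 1 := by
    rw [← hΓ, ← hC]; simp only [Matrix.mul_assoc]
  refine ⟨h2, (left_inv_eq_right_inv h4 h3).symm, ?_⟩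
  have h5 := mul_eq_one_comm.mp h4
  rw [← h5]
  simp only [Matrix.mul_assoc]

variable {G : Type*} [Ring G] [HopfAlgebra ℂ G] [StarRing G] [StarModule ℂ G] {Λ : Type*}
  {𝒢 : RibbonStar G} {𝒯 : Irreps G Λ} (𝒞 : Clebsch 𝒢 𝒯)
  [Fintype Λ] [DecidableEq Λ] [FiniteDimensional ℂ G] [IsSemisimpleRing G]

theorem τ_zero_gElt : 𝒯.τ 𝒯.zero (gElt 𝒢) = 1 := by
  have h := unitLeg_conv (LinearMap.id : G →ₗ[ℂ] G)
  have h2 := congrArg (fun f : G →ₗ[ℂ] G => f (gElt 𝒢)) h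
  simp only [conv_apply, comul_gElt, tens_tmul, LinearMap.id_apply, unitLeg_apply] at h2
  have h3 : algebraMap ℂ G (Coalgebra.counit (gElt 𝒢)) = 1 :=
    (isUnit_gElt 𝒢).mul_right_cancel (h2.trans (one_mul _).symm)
  have h4 := congrArg (Coalgebra.counit (R := ℂ)) h3
  rw [Bialgebra.counit_algebraMap, Bialgebra.counit_one] at h4
  rw [𝒯.τ_zero, h4, one_smul]

theorem qch_zero (x : G) : qch 𝒢 𝒯 𝒯.zero x = Coalgebra.counit (R := ℂ) x := by
  rw [qch_apply, τ_zero_gElt, mul_one, 𝒯.τ_zero, Matrix.trace_smul, Matrix.trace_one,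
    Fintype.card_fin, 𝒯.dim_zero]
  simp

theorem qdim_zero : qdim 𝒢 𝒯 𝒯.zero = 1 := by
  rw [← qch_one, qch_zero, Bialgebra.counit_one]

theorem zElt_zero : zElt 𝒢 𝒯 𝒯.zero = 1 := by
  have e : ∀ w : G ⊗[ℂ] G, slice (qch 𝒢 𝒯 𝒯.zero) w = tens unitLeg LinearMap.id w := by
    intro w
    induction w using TensorProduct.induction_on with
    | zero => simp
    | add x y hx hy => simp [hx, hy]
    | tmul a b => simp [qch_zero, unitLeg_apply, Algebra.smul_def]
  rw [zElt, e, ← Qm_eq_tens 𝒢 isLeg_unitLeg isLeg_id (comm_unitLeg_left _), Qm,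
    Rr_unitLeg_left 𝒢 isLeg_id, Rr_unitLeg_right]
  simp

theorem sElt_zero (J : Λ) : sElt 𝒢 𝒯 𝒯.zero J = qdim 𝒢 𝒯 J := by
  rw [sElt_eq, ← apply_slice, ← zElt, zElt_zero, qch_one]

/-- `∑ d_K²`. -/
def dimSq (𝒢 : RibbonStar G) (𝒯 : Irreps G Λ) : ℂ := ∑ K, qdim 𝒢 𝒯 K ^ 2

include 𝒞 in
-- Choose `a` with `s a = e_0` and put `b_L = a_L / d_L`. Pairing the fusion rule with `a` gives `s
-- diag(b) s = (N_{IJ}^0)`, the inverse of the conjugation matrix, so `s Γ s diag(b) = 1`; it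
-- remains to see that `b` is constant.
theorem Clebsch.sElt_orthogonality (hd : ∀ I, 0 < qdim 𝒢 𝒯 I)
    (hS : IsUnit (Matrix.of (sElt 𝒢 𝒯))) (K L : Λ) :
    ∑ I, sElt 𝒢 𝒯 K (𝒯.conj I) * sElt 𝒢 𝒯 I L = if K = L then dimSq 𝒢 𝒯 else 0 := by
  set s : Matrix Λ Λ ℂ := Matrix.of (sElt 𝒢 𝒯) with hsdef
  have hsym : sᵀ = s := by
    ext I J
    exact sElt_symm 𝒢 𝒯 J I
  obtain ⟨t, hst⟩ := hS.exists_right_inv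
  let a : Λ → ℂ := fun L => t L 𝒯.zero
  have ha : ∀ M, ∑ L, s M L * a L = if M = 𝒯.zero then 1 else 0 := by
    intro M
    have h := congrFun (congrFun hst M) 𝒯.zero
    rwa [Matrix.mul_apply, Matrix.one_apply] at h
  let b : Λ → ℂ := fun L => a L / qdim 𝒢 𝒯 L
  have hC : s * Matrix.diagonal b * s = Matrix.of fun I J => (𝒞.N I J 𝒯.zero : ℂ) := by
    ext I J
    rw [Matrix.mul_apply]
    simp only [Matrix.mul_diagonal, Matrix.of_apply]
    calc ∑ M, s I M * b M * s M J
        = ∑ M, (∑ P, (𝒞.N I J P : ℂ) * sElt 𝒢 𝒯 P M) * a M := by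
          refine Finset.sum_congr rfl fun M _ => ?_
          rw [← 𝒞.sElt_mul hd, hsdef, Matrix.of_apply, Matrix.of_apply, sElt_symm 𝒢 𝒯 M J]
          ring
      _ = ∑ P, (𝒞.N I J P : ℂ) * ∑ M, s P M * a M := by
          simp only [Finset.sum_mul, Finset.mul_sum]
          rw [Finset.sum_comm]
          refine Finset.sum_congr rfl fun P _ => Finset.sum_congr rfl fun M _ => ?_
          rw [hsdef, Matrix.of_apply, mul_assoc]
      _ = _ := by simp [ha]
  let Γ : Matrix Λ Λ ℂ := Matrix.of fun J I => if J = 𝒯.conj I then 1 else 0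
  have hΓ : Γᵀ * Matrix.of (fun I J => (𝒞.N I J 𝒯.zero : ℂ)) = 1 := by
    ext I J
    rw [Matrix.mul_apply, Matrix.one_apply, ← 𝒞.N_conj hd]
    simp [Γ]
  obtain ⟨h1, h2, h3⟩ := matrix_conjugation hsym hC hΓ
  have hsΓ : ∀ K I, (s * Γ) K I = sElt 𝒢 𝒯 K (𝒯.conj I) := by
    intro K I
    simp [Γ, Matrix.mul_apply, hsdef]
  -- The row of the trivial label in `diag(b) s Γ = Γ s diag(b)` reads `b_0 d_J = d_J b_J`.
  have hb : ∀ J, b J = b 𝒯.zero := by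
    intro J
    have h := congrFun (congrFun h2 𝒯.zero) J
    rw [Matrix.mul_assoc, Matrix.diagonal_mul, Matrix.mul_diagonal, hsΓ, sElt_zero,
      𝒞.qdim_conj hd, Matrix.mul_apply] at h
    have h4 : ∀ M, Γ 𝒯.zero M = if M = 𝒯.zero then 1 else 0 := by
      intro M
      rw [← h1]
      simp [Γ, conj_zero 𝒢 𝒯]
    simp only [h4, ite_mul, one_mul, zero_mul, Finset.sum_ite_eq', Finset.mem_univ, if_true] at h
    rw [hsdef, Matrix.of_apply, sElt_zero, mul_comm] at h
    exact (mul_left_cancel₀ (qdim_pos_ne 𝒢 𝒯 hd) h).symm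
  have key : ∀ K L, (∑ I, sElt 𝒢 𝒯 K (𝒯.conj I) * sElt 𝒢 𝒯 I L) * b 𝒯.zero =
      if K = L then 1 else 0 := by
    intro K L
    have h := congrFun (congrFun h3 K) L
    rw [Matrix.mul_diagonal, Matrix.mul_apply, hb, Matrix.one_apply] at h
    simp only [hsΓ] at h
    exact h
  -- The entry of both trivial labels fixes the constant as `1 / ∑ d_K²`.
  have hdim : dimSq 𝒢 𝒯 * b 𝒯.zero = 1 := by
    have h := key 𝒯.zero 𝒯.zero
    rw [if_pos rfl] at h
    rw [← h, dimSq]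
    congr 1
    refine Finset.sum_congr rfl fun I _ => ?_
    rw [sElt_zero, 𝒞.qdim_conj hd, sElt_symm, sElt_zero, sq]
  have hb0 : b 𝒯.zero ≠ 0 := right_ne_zero_of_mul_eq_one hdim
  have h := key K L
  apply mul_right_cancel₀ hb0
  rw [h, ite_mul, hdim, zero_mul]

theorem normN_sq (hd : ∀ I, 0 < qdim 𝒢 𝒯 I) : (normN 𝒢 𝒯 : ℂ) ^ 2 * dimSq 𝒢 𝒯 = 1 := by
  have hre : ∀ I, qdim 𝒢 𝒯 I = ((qdim 𝒢 𝒯 I).re : ℂ) := fun I =>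
    (Complex.conj_eq_iff_re.mp (IsSelfAdjoint.of_nonneg (hd I).le)).symm
  have hdim : dimSq 𝒢 𝒯 = ((∑ K, (qdim 𝒢 𝒯 K).re ^ 2 : ℝ) : ℂ) := by
    rw [dimSq]
    push_cast
    exact Finset.sum_congr rfl fun K _ => by rw [← hre]
  have hpos : 0 < ∑ K, (qdim 𝒢 𝒯 K).re ^ 2 := by
    refine Finset.sum_pos' (fun _ _ => sq_nonneg _) ⟨𝒯.zero, Finset.mem_univ _, ?_⟩
    rw [qdim_zero]
    simp
  rw [hdim, normN, ← Complex.ofReal_pow, ← Complex.ofReal_mul, inv_pow, Real.sq_sqrt hpos.le,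
    inv_mul_cancel₀ hpos.ne', Complex.ofReal_one]

include 𝒞 in
-- `z_I` acts on `V^L` as `s_{IL} / d_L`, so this is the orthogonality relation, with the prefactors
-- of `χ^K` supplying the normalization.
theorem Clebsch.τ_charProj (hd : ∀ I, 0 < qdim 𝒢 𝒯 I) (hS : IsUnit (SMatrix 𝒢 𝒯)) (K L : Λ) :
    𝒯.τ L (charProj 𝒢 𝒯 (zElt 𝒢 𝒯) K) = if K = L then 1 else 0 := by
  have hS' : IsUnit (Matrix.of (sElt 𝒢 𝒯)) := by
    have e : SMatrix 𝒢 𝒯 = (normN 𝒢 𝒯 : ℂ) • Matrix.of (sElt 𝒢 𝒯) := rfl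
    have h0 : (normN 𝒢 𝒯 : ℂ) ≠ 0 := by
      intro h
      have := normN_sq (𝒢 := 𝒢) (𝒯 := 𝒯) hd
      rw [h] at this
      simp at this
    rw [e] at hS
    have := hS.smul ((Units.mk0 _ h0)⁻¹)
    rwa [Units.smul_def, Units.val_inv_eq_inv_val, Units.val_mk0, inv_smul_smul₀ h0] at this
  rw [charProj, map_sum]
  simp only [map_smul, τ_zElt 𝒢 𝒯 hd, smul_smul, ← Finset.sum_smul, SMatrix, Matrix.of_apply]
  have h := 𝒞.sElt_orthogonality hd hS' K L
  have e : ∑ I, (normN 𝒢 𝒯 : ℂ) * qdim 𝒢 𝒯 K * ((normN 𝒢 𝒯 : ℂ) * sElt 𝒢 𝒯 K (𝒯.conj I)) *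
      (sElt 𝒢 𝒯 I L / qdim 𝒢 𝒯 L) = (normN 𝒢 𝒯 : ℂ) ^ 2 * (qdim 𝒢 𝒯 K / qdim 𝒢 𝒯 L) *
        ∑ I, sElt 𝒢 𝒯 K (𝒯.conj I) * sElt 𝒢 𝒯 I L := by
    rw [Finset.mul_sum]
    refine Finset.sum_congr rfl fun I _ => ?_
    ring
  rw [e, h]
  split_ifs with hKL
  · subst hKL
    rw [div_self (qdim_pos_ne 𝒢 𝒯 hd), mul_one, normN_sq hd, one_smul]
  · simp

include 𝒞 in
theorem Clebsch.charProj_zero (hd : ∀ I, 0 < qdim 𝒢 𝒯 I) (hS : IsUnit (SMatrix 𝒢 𝒯)) :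
    charProj 𝒢 𝒯 (zElt 𝒢 𝒯) 𝒯.zero = 𝒯.haar := by
  refine 𝒯.ext_rep fun L => ?_
  rw [𝒞.τ_charProj hd hS, 𝒯.τ_haar]
  simp only [eq_comm]

/-- The Drinfeld map is stable under the coregular action. -/
theorem exists_slice_comul (t u : G →ₗ[ℂ] ℂ) : ∃ t' : G →ₗ[ℂ] ℂ,
    slice u (Coalgebra.comul (R := ℂ) (slice t (monodromy 𝒢))) = slice t' (monodromy 𝒢) := by
  let t' : G →ₗ[ℂ] ℂ :=
    { toFun := fun a => tens t u (tensorFlip (𝒢.R : G ⊗[ℂ] G) * inclL a * (𝒢.R : G ⊗[ℂ] G))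
      map_add' := fun a b => by simp [mul_add, add_mul]
      map_smul' := fun c a => by simp }
  refine ⟨t', ?_⟩
  have h := Qm_conv_right 𝒢 (isLeg_triL (G := G)) comm_triL_triR comm_triM_triR
  rw [Qm_eq_tens 𝒢 isLeg_triL (isLeg_conv isLeg_triM isLeg_triR comm_triM_triR)
    (comm_triL_triM.conv_right comm_triL_triR), Qm_eq_tens 𝒢 isLeg_triL isLeg_triR
    comm_triL_triR] at h
  have h1 : ∀ w : G ⊗[ℂ] G, slice t (tens triL (conv triM triR) w) =
      Coalgebra.comul (R := ℂ) (slice t w) := by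
    intro w
    have e : ∀ x : G ⊗[ℂ] G, tens triM triR x = (1 : G) ⊗ₜ[ℂ] x := by
      intro x
      induction x using TensorProduct.induction_on with
      | zero => simp
      | add x y hx hy => simp [hx, hy, TensorProduct.tmul_add]
      | tmul a b => simp [triM_apply, triR_apply]
    induction w using TensorProduct.induction_on with
    | zero => simp
    | add x y hx hy => simp [hx, hy]
    | tmul a b => simp [conv_apply, e, triL_apply]
  have h2 : ∀ Y : G ⊗[ℂ] G, slice u (slice t (tens triL triM Y)) = tens t u Y • (1 : G) := by
    intro Y
    induction Y using TensorProduct.induction_on with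
    | zero => simp
    | add x y hx hy => simp [hx, hy, add_smul]
    | tmul a b => simp [triL_apply, triM_apply, mul_smul]
  have h3 : ∀ w : G ⊗[ℂ] G, slice u (slice t
      (Rr 𝒢 triM triL * tens triL triR w * Rr 𝒢 triL triM)) = slice t' w := by
    intro w
    induction w using TensorProduct.induction_on with
    | zero => simp
    | add x y hx hy => simp [hx, hy, mul_add, add_mul]
    | tmul a b =>
      have hc : Commute (triR b) (Rr 𝒢 triL (triM : G →ₗ[ℂ] G ⊗[ℂ] (G ⊗[ℂ] G))) :=
        (tens_commute (fun x => comm_triL_triR x b) (fun x => comm_triM_triR x b) _).symm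
      have hm : Rr 𝒢 triM (triL : G →ₗ[ℂ] G ⊗[ℂ] (G ⊗[ℂ] G)) * triL a * Rr 𝒢 triL triM =
          tens triL triM (tensorFlip (𝒢.R : G ⊗[ℂ] G) * inclL a * (𝒢.R : G ⊗[ℂ] G)) := by
        rw [tens_mul isLeg_triL isLeg_triM comm_triL_triM, tens_mul isLeg_triL isLeg_triM
          comm_triL_triM, tens_flip comm_triL_triM, inclL_apply, tens_tmul, isLeg_triM.one,
          mul_one]
        rfl
      rw [tens_tmul, mul_assoc, mul_assoc, hc.eq, ← mul_assoc, ← mul_assoc, hm, triR_apply,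
        slice_mul_right, slice_mul_right, h2, slice_tmul, smul_mul_assoc, one_mul]
      rfl
  rw [← h3, ← h, h1]

include 𝒞 in
/-- Factorizability: every element of `G` is a slice of `R'R`. -/
theorem Clebsch.exists_slice_eq (hd : ∀ I, 0 < qdim 𝒢 𝒯 I) (hS : IsUnit (SMatrix 𝒢 𝒯)) (x : G) :
    ∃ t : G →ₗ[ℂ] ℂ, slice t (monodromy 𝒢) = x := by
  let Z : Submodule ℂ G :=
    { carrier := {x | ∃ t : G →ₗ[ℂ] ℂ, slice t (monodromy 𝒢) = x}
      add_mem' := by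
        rintro _ _ ⟨t, rfl⟩ ⟨u, rfl⟩
        exact ⟨t + u, by simp [slice, TensorProduct.map_add_left]⟩
      zero_mem' := ⟨0, by simp [slice]⟩
      smul_mem' := by
        rintro c _ ⟨t, rfl⟩
        exact ⟨c • t, by simp [slice, TensorProduct.map_smul_left]⟩ }
  have hh : 𝒯.haar ∈ Z := by
    rw [← 𝒞.charProj_zero hd hS]
    exact Z.sum_mem fun I _ => Z.smul_mem _ ⟨_, rfl⟩
  -- The integral is itself a slice of `R'R`, and slices are stable under the coregular action, so
  -- all slices of `Δ(h)` are available.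
  have hφ : ∀ u : G →ₗ[ℂ] ℂ, slice u (Coalgebra.comul (R := ℂ) 𝒯.haar) ∈ Z := by
    intro u
    obtain ⟨t, ht⟩ := hh
    rw [← ht]
    obtain ⟨t', ht'⟩ := exists_slice_comul (𝒢 := 𝒢) t u
    exact ⟨t', ht'.symm⟩
  -- Schur orthogonality expresses slices of `Δ(h)` by matrix units multiplied by matrix elements of
  -- `τ^I(g)`; the inverse of `g` removes these factors.
  obtain ⟨g', hg'⟩ := (isUnit_gElt 𝒢).exists_right_inv
  have hb : ∀ p, 𝒯.basis p ∈ Z := by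
    rintro ⟨I, j, k⟩
    have key : 𝒯.basis ⟨I, j, k⟩ = ∑ i, (qdim 𝒢 𝒯 I * 𝒯.τ I g' i j) •
        slice (antip (𝒯.entry I k i)) (Coalgebra.comul (R := ℂ) 𝒯.haar) := by
      refine 𝒯.ext_rep fun J => ?_
      have e : ∀ (w : G ⊗[ℂ] G) (i) (p q : Fin (𝒯.dim J)),
          𝒯.τ J (slice (antip (𝒯.entry I k i)) w) p q =
            𝒯.sandwich I J (Matrix.single i p 1) w k q := by
        intro w i p q
        induction w using TensorProduct.induction_on with
        | zero => simp
        | add x y hx hy => simp [hx, hy]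
        | tmul a b =>
          simp [Irreps.sandwich_tmul, Matrix.mul_apply, Matrix.single_apply, Irreps.entry, ite_and]
      ext p q
      rw [map_sum, Matrix.sum_apply]
      simp only [map_smul, Matrix.smul_apply, e]
      by_cases hIJ : I = J
      · subst hIJ
        simp only [sandwich_self 𝒢 𝒯 hd, 𝒯.τ_basis_self, Matrix.trace_single_mul]
        have hgg := congrFun (congrFun (congrArg (𝒯.τ I) hg') p) j
        rw [map_mul, map_one, Matrix.mul_apply] at hgg
        have hd0 := qdim_pos_ne 𝒢 𝒯 (I := I) hd
        have e2 : ∀ i, (qdim 𝒢 𝒯 I * 𝒯.τ I g' i j) • ((((1 : ℂ) • 𝒯.τ I (gElt 𝒢) p i) /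
            qdim 𝒢 𝒯 I) • (1 : 𝒯.Mat I ℂ)) k q =
            (𝒯.τ I (gElt 𝒢) p i * 𝒯.τ I g' i j) * (1 : 𝒯.Mat I ℂ) k q := by
          intro i
          simp only [Matrix.smul_apply, smul_eq_mul]
          field_simp
        simp only [smul_eq_mul, one_mul] at e2 ⊢
        rw [Finset.sum_congr rfl fun i _ => e2 i, ← Finset.sum_mul, hgg]
        simp only [Matrix.single_apply, Matrix.one_apply, ite_and, eq_comm]
        split_ifs <;> simp
      · simp [𝒯.τ_basis_ne hIJ, sandwich_ne 𝒢 𝒯 hIJ]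
    rw [key]
    exact Z.sum_mem fun i _ => Z.smul_mem _ (hφ _)
  have htop : (⊤ : Submodule ℂ G) ≤ Z := by
    rw [← 𝒯.basis.span_eq, Submodule.span_le]
    rintro _ ⟨p, rfl⟩
    exact hb p
  exact htop (Submodule.mem_top (x := x))

end Modularity

/-! ## Monodromies built from legs -/

section Loops

variable {G : Type*} [Ring G] [HopfAlgebra ℂ G] [StarRing G] [StarModule ℂ G]
  (𝒢 : RibbonStar G) {A : Type*} [Ring A] [Algebra ℂ A] {B : Type*} [Ring B] [Algebra ℂ B]

/-- The monodromy of the leg `a` around the leg `ψ`, transported along `φ`. -/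
def loopN (a φ ψ : G →ₗ[ℂ] A) : A := Rr 𝒢 φ a * Qm 𝒢 a ψ * Ri 𝒢 φ a

theorem map_loopN (F : A →ₐ[ℂ] B) (a φ ψ : G →ₗ[ℂ] A) :
    F (loopN 𝒢 a φ ψ) =
      loopN 𝒢 (F.toLinearMap ∘ₗ a) (F.toLinearMap ∘ₗ φ) (F.toLinearMap ∘ₗ ψ) := by
  rw [loopN, map_mul, map_mul, map_Rr, map_Qm, map_Ri, loopN]

variable {𝒢}

theorem Rr_commute {f g : G →ₗ[ℂ] A} {c : A} (hf : ∀ x, Commute (f x) c)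
    (hg : ∀ x, Commute (g x) c) : Commute (Rr 𝒢 f g) c := tens_commute hf hg _

theorem Ri_commute {f g : G →ₗ[ℂ] A} {c : A} (hf : ∀ x, Commute (f x) c)
    (hg : ∀ x, Commute (g x) c) : Commute (Ri 𝒢 f g) c := tens_commute hf hg _

theorem Qm_commute {f g : G →ₗ[ℂ] A} {c : A} (hf : ∀ x, Commute (f x) c)
    (hg : ∀ x, Commute (g x) c) : Commute (Qm 𝒢 f g) c :=
  (Rr_commute hg hf).mul_left (Rr_commute hf hg)

theorem loopN_commute {a φ ψ : G →ₗ[ℂ] A} {c : A} (ha : ∀ x, Commute (a x) c)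
    (hφ : ∀ x, Commute (φ x) c) (hψ : ∀ x, Commute (ψ x) c) : Commute (loopN 𝒢 a φ ψ) c :=
  ((Rr_commute hφ ha).mul_left (Qm_commute ha hψ)).mul_left (Ri_commute hφ ha)

/-- `R_{φa}` carries `φ * (a * ψ)` to `a * (φ * ψ)`, and `Q_{aψ}` commutes both with `a * ψ` and
with `φ`. -/
theorem loopN_commute_conv {a φ ψ : G →ₗ[ℂ] A} (ha : IsLeg a) (hφ : IsLeg φ) (hψ : IsLeg ψ)
    (haφ : Comm a φ) (haψ : Comm a ψ) (hφψ : Comm φ ψ) (x : G) :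
    Commute (loopN 𝒢 a φ ψ) (conv a (conv φ ψ) x) := by
  have h1 : SemiconjBy (Rr 𝒢 φ a) (conv φ (conv a ψ) x) (conv a (conv φ ψ) x) := by
    have h := Rr_tens_conv 𝒢 hφ ha haφ.symm hφψ haψ (Coalgebra.comul x)
    rw [← conv_apply, ← conv_apply, conv_assoc, conv_assoc] at h
    exact h
  have h2 : SemiconjBy (Ri 𝒢 φ a) (conv a (conv φ ψ) x) (conv φ (conv a ψ) x) :=
    SemiconjBy.units_inv_symm_left (a := Ru 𝒢 hφ ha haφ.symm) h1
  have h3 : SemiconjBy (Qm 𝒢 a ψ) (conv φ (conv a ψ) x) (conv φ (conv a ψ) x) :=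
    (conv_commute (fun y => (Qm_commute (fun z => haφ z y) fun z => (hφψ y z).symm).symm)
      (fun y => (Qm_commute_conv 𝒢 ha hψ haψ y).symm) x).symm
  exact (h1.mul_left h3).mul_left h2

/-- `N` commutes with `a * ι` and with `b`, hence with `R_{a*ι,b} = R_{ab} R_{ιb}`. So its conjugate
by `R_{ab}⁻¹` is its conjugate by `R_{ιb}`, the element which also dresses `Q_{bψ'}`, and undressed
the two commute. -/
theorem loopN_exchange {a b φ ψ ι ψ' : G →ₗ[ℂ] A} (ha : IsLeg a) (hb : IsLeg b) (hι : IsLeg ι)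
    (hab : Comm a b) (hιb : Comm ι b)
    (hN : ∀ x, Commute (loopN 𝒢 a φ ψ) (conv a ι x))
    (hNb : ∀ x, Commute (loopN 𝒢 a φ ψ) (b x)) (hNψ : ∀ x, Commute (loopN 𝒢 a φ ψ) (ψ' x)) :
    Commute (Ri 𝒢 a b * loopN 𝒢 a φ ψ * Rr 𝒢 a b) (loopN 𝒢 b ι ψ') := by
  set N := loopN 𝒢 a φ ψ
  have h1 : Commute (Rr 𝒢 a b * Rr 𝒢 ι b) N := by
    rw [← Rr_conv_left 𝒢 hb hιb]
    exact Rr_commute (fun x => (hN x).symm) fun x => (hNb x).symm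
  have e : Ri 𝒢 a b * N * Rr 𝒢 a b = Rr 𝒢 ι b * N * Ri 𝒢 ι b := by
    calc Ri 𝒢 a b * N * Rr 𝒢 a b
        = Ri 𝒢 a b * (N * (Rr 𝒢 a b * Rr 𝒢 ι b)) * Ri 𝒢 ι b := by
          simp only [mul_assoc, Rr_mul_Ri 𝒢 hι hb hιb, mul_one]
      _ = (Ri 𝒢 a b * Rr 𝒢 a b) * Rr 𝒢 ι b * N * Ri 𝒢 ι b := by
          rw [← h1.eq]; simp only [mul_assoc]
      _ = _ := by rw [Ri_mul_Rr 𝒢 ha hb hab, one_mul]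
  have hQ : Commute N (Qm 𝒢 b ψ') :=
    (Qm_commute (fun x => (hNb x).symm) fun x => (hNψ x).symm).symm
  have hu := Ri_mul_Rr 𝒢 hι hb hιb
  rw [e, loopN]
  calc Rr 𝒢 ι b * N * Ri 𝒢 ι b * (Rr 𝒢 ι b * Qm 𝒢 b ψ' * Ri 𝒢 ι b)
      = Rr 𝒢 ι b * N * (Ri 𝒢 ι b * Rr 𝒢 ι b) * Qm 𝒢 b ψ' * Ri 𝒢 ι b := by
        simp only [mul_assoc]
    _ = Rr 𝒢 ι b * Qm 𝒢 b ψ' * (Ri 𝒢 ι b * Rr 𝒢 ι b) * N * Ri 𝒢 ι b := by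
        rw [hu, mul_one, mul_one, mul_assoc (Rr 𝒢 ι b) N, hQ.eq]; simp only [mul_assoc]
    _ = _ := by simp only [mul_assoc]

/-- Functoriality before decomposing the tensor product. The Yang-Baxter equation pulls the dressing
factors out of the middle, and then `R_{ab} R_{ψb} = R_{a*ψ,b}` commutes with `Q_{aψ}`. -/
theorem loopN_mul {a b φ ψ : G →ₗ[ℂ] A} (ha : IsLeg a) (hb : IsLeg b) (hφ : IsLeg φ)
    (hψ : IsLeg ψ) (hab : Comm a b) (haφ : Comm a φ) (haψ : Comm a ψ) (hbφ : Comm b φ)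
    (hbψ : Comm b ψ) (hφψ : Comm φ ψ) :
    loopN 𝒢 a φ ψ * Rr 𝒢 a b * loopN 𝒢 b φ ψ = Rr 𝒢 a b * loopN 𝒢 (conv a b) φ ψ := by
  have hconv := isLeg_conv ha hb hab
  have e1 : Rr 𝒢 φ (conv a b) = Rr 𝒢 φ b * Rr 𝒢 φ a := Rr_conv_right 𝒢 hφ hbφ.symm hab
  have e2 : Ri 𝒢 φ (conv a b) = Ri 𝒢 φ a * Ri 𝒢 φ b := by
    refine left_inv_eq_right_inv (a := Rr 𝒢 φ (conv a b))
      (Ri_mul_Rr 𝒢 hφ hconv (haφ.conv_left hbφ).symm) ?_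
    rw [e1, mul_assoc, ← mul_assoc (Rr 𝒢 φ a), Rr_mul_Ri 𝒢 hφ ha haφ.symm, one_mul,
      Rr_mul_Ri 𝒢 hφ hb hbφ.symm]
  have e3 : Qm 𝒢 (conv a b) ψ = Rr 𝒢 ψ b * Qm 𝒢 a ψ * Rr 𝒢 b ψ :=
    Qm_conv_left 𝒢 hψ hab hbψ
  have ybe := yang_baxter 𝒢 hφ ha hb haφ.symm hbφ.symm hab
  have ybe' : Ri 𝒢 φ a * Rr 𝒢 a b * Rr 𝒢 φ b = Rr 𝒢 φ b * Rr 𝒢 a b * Ri 𝒢 φ a := by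
    have h := congrArg (fun X => Ri 𝒢 φ a * X * Ri 𝒢 φ a) ybe
    simp only [← mul_assoc, Ri_mul_Rr 𝒢 hφ ha haφ.symm, one_mul] at h
    rw [mul_assoc _ (Rr 𝒢 φ a) (Ri 𝒢 φ a), Rr_mul_Ri 𝒢 hφ ha haφ.symm, mul_one] at h
    exact h.symm
  have c1 : Commute (Qm 𝒢 a ψ) (Rr 𝒢 φ b) :=
    Qm_commute (fun x => (Rr_commute (fun y => (haφ x y).symm) fun y => (hab x y).symm).symm)
      fun x => (Rr_commute (fun y => hφψ y x) fun y => hbψ y x).symm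
  have c2 : Commute (Ri 𝒢 φ a) (Qm 𝒢 b ψ) :=
    Ri_commute (fun x => (Qm_commute (fun y => hbφ y x) fun y => (hφψ x y).symm).symm)
      fun x => (Qm_commute (fun y => (hab x y).symm) fun y => (haψ x y).symm).symm
  have c3 : Commute (Rr 𝒢 a b * Rr 𝒢 ψ b) (Qm 𝒢 a ψ) := by
    rw [← Rr_conv_left 𝒢 hb hbψ.symm]
    exact Rr_commute (fun x => (Qm_commute_conv 𝒢 ha hψ haψ x).symm) fun x =>
      (Qm_commute (fun y => hab y x) fun y => (hbψ x y).symm).symm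
  have hl : loopN 𝒢 a φ ψ * Rr 𝒢 a b * loopN 𝒢 b φ ψ =
      Rr 𝒢 φ a * Rr 𝒢 φ b * Rr 𝒢 a b * Rr 𝒢 ψ b * Qm 𝒢 a ψ * Rr 𝒢 b ψ * Ri 𝒢 φ a *
        Ri 𝒢 φ b := by
    calc loopN 𝒢 a φ ψ * Rr 𝒢 a b * loopN 𝒢 b φ ψ
        = Rr 𝒢 φ a * Qm 𝒢 a ψ * (Ri 𝒢 φ a * Rr 𝒢 a b * Rr 𝒢 φ b) * Qm 𝒢 b ψ * Ri 𝒢 φ b := by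
          simp only [loopN, mul_assoc]
      _ = Rr 𝒢 φ a * (Qm 𝒢 a ψ * Rr 𝒢 φ b) * Rr 𝒢 a b * (Ri 𝒢 φ a * Qm 𝒢 b ψ) * Ri 𝒢 φ b := by
          rw [ybe']; simp only [mul_assoc]
      _ = Rr 𝒢 φ a * Rr 𝒢 φ b * (Qm 𝒢 a ψ * (Rr 𝒢 a b * Rr 𝒢 ψ b)) * Rr 𝒢 b ψ * Ri 𝒢 φ a *
            Ri 𝒢 φ b := by
          rw [c1.eq, c2.eq, show Qm 𝒢 b ψ = Rr 𝒢 ψ b * Rr 𝒢 b ψ from rfl]; simp only [mul_assoc]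
      _ = _ := by rw [← c3.eq]; simp only [mul_assoc]
  rw [hl, loopN, e1, e2, e3]
  simp only [← mul_assoc]
  rw [ybe]

/-- One step of a telescoping product: with `φ = ι_n` it adds a loop to the monodromy around all the
preceding ones. -/
theorem loopN_mul_Qm {a φ ψ : G →ₗ[ℂ] A} (ha : IsLeg a) (hφ : IsLeg φ) (haφ : Comm a φ)
    (haψ : Comm a ψ) (hφψ : Comm φ ψ) :
    loopN 𝒢 a φ ψ * Qm 𝒢 a φ = Qm 𝒢 a (conv φ ψ) := by
  rw [Qm_conv_right 𝒢 ha haψ hφψ, loopN, Qm]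
  calc Rr 𝒢 φ a * Qm 𝒢 a ψ * Ri 𝒢 φ a * (Rr 𝒢 φ a * Rr 𝒢 a φ)
      = Rr 𝒢 φ a * Qm 𝒢 a ψ * (Ri 𝒢 φ a * Rr 𝒢 φ a) * Rr 𝒢 a φ := by simp only [mul_assoc]
    _ = _ := by rw [Ri_mul_Rr 𝒢 hφ ha haφ.symm, mul_one]; rfl

theorem loopN_unitLeg {φ ψ : G →ₗ[ℂ] A} (hφ : IsLeg φ) (hψ : IsLeg ψ) :
    loopN 𝒢 unitLeg φ ψ = 1 := by
  have h := Rr_mul_Ri 𝒢 hφ isLeg_unitLeg (comm_unitLeg_right φ)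
  rw [loopN, Qm, Rr_unitLeg_left 𝒢 hψ, Rr_unitLeg_right 𝒢 ψ, hψ.one, one_mul, mul_one, h]

theorem isUnit_loopN {a φ ψ : G →ₗ[ℂ] A} (ha : IsLeg a) (hφ : IsLeg φ) (hψ : IsLeg ψ)
    (haφ : Comm a φ) (haψ : Comm a ψ) : IsUnit (loopN 𝒢 a φ ψ) :=
  ((Ru 𝒢 hφ ha haφ.symm).isUnit.mul
    ((Ru 𝒢 hψ ha haψ.symm).isUnit.mul (Ru 𝒢 ha hψ haψ).isUnit)).mul
    (Ru 𝒢 hφ ha haφ.symm)⁻¹.isUnit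

end Loops

/-! ## Families of commuting legs -/

section Systems

variable {G : Type*} [Ring G] [HopfAlgebra ℂ G] [StarRing G] [StarModule ℂ G]
  {A : Type*} [Ring A] [Algebra ℂ A] {B : Type*} [Ring B] [Algebra ℂ B]

/-- A sequence of pairwise commuting legs. -/
structure LegSystem (G : Type*) [Ring G] [HopfAlgebra ℂ G] (A : Type*) [Ring A] [Algebra ℂ A] where
  s : ℕ → (G →ₗ[ℂ] A)
  isLeg : ∀ n, IsLeg (s n)
  comm : ∀ n k, n ≠ k → Comm (s n) (s k)

namespace LegSystem

variable (S : LegSystem G A)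

/-- The product `s 0 * ⋯ * s (n - 1)`. -/
def io : ℕ → (G →ₗ[ℂ] A)
  | 0 => unitLeg
  | n + 1 => conv (io n) (S.s n)

theorem io_commute {c : A} {n : ℕ} (h : ∀ k < n, ∀ x, Commute (S.s k x) c) (x : G) :
    Commute (S.io n x) c := by
  induction n generalizing x with
  | zero => exact Algebra.commute_algebraMap_left _ _
  | succ n ih =>
    exact conv_commute (fun y => ih (fun k hk => h k (by omega)) y) (fun y => h n (by omega) y) x

theorem comm_io {n k : ℕ} (h : n ≤ k) : Comm (S.io n) (S.s k) := fun x y =>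
  S.io_commute (fun j hj z => S.comm j k (by omega) z y) x

theorem isLeg_io (n : ℕ) : IsLeg (S.io n) := by
  induction n with
  | zero => exact isLeg_unitLeg
  | succ n ih => exact isLeg_conv ih (S.isLeg n) (S.comm_io le_rfl)

/-- The image of a system of legs under a homomorphism. -/
def map (F : A →ₐ[ℂ] B) : LegSystem G B where
  s n := F.toLinearMap ∘ₗ S.s n
  isLeg n := (S.isLeg n).comp F
  comm n k h := (S.comm n k h).comp F

theorem map_io (F : A →ₐ[ℂ] B) (n : ℕ) : (S.map F).io n = F.toLinearMap ∘ₗ S.io n := by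
  induction n with
  | zero => exact (comp_unitLeg F).symm
  | succ n ih => rw [io, ih, io, comp_conv]; rfl

variable {𝒢 : RibbonStar G}

/-- The legs beyond `ν` commute with the monodromy one by one; up to `ν` this is
`loopN_commute_conv`. -/
theorem loopN_commute_io {a : G →ₗ[ℂ] A} (ha : IsLeg a) (hS : ∀ n, Comm a (S.s n)) {ν n : ℕ}
    (h : ν < n) (x : G) :
    Commute (loopN 𝒢 a (S.io ν) (S.s ν)) (conv a (S.io n) x) := by
  have haio : ∀ n, Comm a (S.io n) := fun n x y =>
    (S.io_commute (fun k _ z => (hS k x z).symm) y).symm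
  induction n, h using Nat.le_induction generalizing x with
  | base =>
    exact loopN_commute_conv ha (S.isLeg_io ν) (S.isLeg ν) (haio ν) (hS ν) (S.comm_io le_rfl) x
  | succ n hn ih =>
    rw [io, ← conv_assoc]
    refine (conv_commute (fun y => (ih y).symm) (fun y => ?_) x).symm
    exact (loopN_commute (fun z => hS n z y) (fun z => S.comm_io (by omega) z y)
      fun z => S.comm ν n (by omega) z y).symm

end LegSystem

end Systems

/-! ## Matrices over an algebra and their legs -/

section MatrixLegs

variable {G : Type*} [Ring G] [HopfAlgebra ℂ G] [StarRing G] [StarModule ℂ G]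
  {Λ : Type*} (𝒯 : Irreps G Λ) {B : Type*} [Ring B] [Algebra ℂ B] {C : Type*} [Ring C] [Algebra ℂ C]

/-- `b ↦ 1 ⊗ b`. -/
def scalarHom (n : Type*) [Fintype n] [DecidableEq n] (B : Type*) [Ring B] [Algebra ℂ B] :
    B →ₐ[ℂ] Matrix n n B :=
  { Matrix.scalar n with
    commutes' := fun r => by simp [Matrix.algebraMap_eq_diagonal, Matrix.scalar_apply] }

theorem scalarHom_apply {n : Type*} [Fintype n] [DecidableEq n] (b : B) :
    scalarHom n B b = Matrix.diagonal fun _ => b := rfl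

/-- The leg `τ^J`, with values in the matrices over `B`. -/
def tauLeg (J : Λ) (B : Type*) [Ring B] [Algebra ℂ B] : G →ₗ[ℂ] 𝒯.Mat J B :=
  (Algebra.ofId ℂ B).mapMatrix.toLinearMap ∘ₗ 𝒯.lin J

theorem tauLeg_apply (J : Λ) (x : G) : tauLeg 𝒯 J B x = scal B (𝒯.τ J x) := rfl

/-- The leg `φ`, with values in the matrices over `B`. -/
def scalLeg (J : Λ) (φ : G →ₗ[ℂ] B) : G →ₗ[ℂ] 𝒯.Mat J B := (scalarHom _ B).toLinearMap ∘ₗ φ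

theorem scalLeg_apply (J : Λ) (φ : G →ₗ[ℂ] B) (x : G) :
    scalLeg 𝒯 J φ x = Matrix.diagonal fun _ => φ x := rfl

theorem isLeg_tauLeg (J : Λ) : IsLeg (tauLeg 𝒯 J B) := (𝒯.isLeg_lin J).comp _

theorem isLeg_scalLeg (J : Λ) {φ : G →ₗ[ℂ] B} (h : IsLeg φ) : IsLeg (scalLeg 𝒯 J φ) := h.comp _

theorem scal_commute {n : Type*} [Fintype n] [DecidableEq n] (X : Matrix n n ℂ) (b : B) :
    Commute (scal B X) (scalarHom n B b) := by
  ext i j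
  rw [scalarHom_apply, Matrix.mul_diagonal, Matrix.diagonal_mul]
  exact Algebra.commutes _ _

theorem comm_tauLeg_scalLeg (J : Λ) (φ : G →ₗ[ℂ] B) : Comm (tauLeg 𝒯 J B) (scalLeg 𝒯 J φ) :=
  fun _ _ => scal_commute _ _

theorem comm_scalLeg (J : Λ) {φ ψ : G →ₗ[ℂ] B} (h : Comm φ ψ) :
    Comm (scalLeg 𝒯 J φ) (scalLeg 𝒯 J ψ) := h.comp _

theorem scalLeg_conv (J : Λ) (φ ψ : G →ₗ[ℂ] B) :
    scalLeg 𝒯 J (conv φ ψ) = conv (scalLeg 𝒯 J φ) (scalLeg 𝒯 J ψ) := comp_conv _ _ _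

theorem slot_tmul (J : Λ) (φ : G →ₗ[ℂ] B) (a b : G) (i j) :
    𝒯.slot J φ (a ⊗ₜ b) i j = 𝒯.τ J a i j • φ b := by
  simp [Irreps.slot, Irreps.entry]

theorem slot_add (J : Λ) (φ : G →ₗ[ℂ] B) (x y : G ⊗[ℂ] G) :
    𝒯.slot J φ (x + y) = 𝒯.slot J φ x + 𝒯.slot J φ y := by
  ext i j
  simp [Irreps.slot]

theorem slot_eq (J : Λ) (φ : G →ₗ[ℂ] B) (x : G ⊗[ℂ] G) :
    𝒯.slot J φ x = tens (tauLeg 𝒯 J B) (scalLeg 𝒯 J φ) x := by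
  induction x using TensorProduct.induction_on with
  | zero => ext i j; simp [Irreps.slot]
  | add x y hx hy => rw [slot_add, hx, hy, map_add]
  | tmul a b =>
    ext i j
    rw [slot_tmul, tens_tmul, tauLeg_apply, scalLeg_apply, Matrix.mul_diagonal]
    exact Algebra.smul_def _ _

theorem slot_map (J : Λ) (φ : G →ₗ[ℂ] B) (F : B →ₗ[ℂ] C) (x : G ⊗[ℂ] G) :
    (𝒯.slot J φ x).map F = 𝒯.slot J (F ∘ₗ φ) x := by
  induction x using TensorProduct.induction_on with
  | zero => ext i j; simp [Irreps.slot]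
  | add x y hx hy => rw [slot_add, slot_add, Matrix.map_add F (by simp), hx, hy]
  | tmul a b =>
    ext i j
    simp [slot_tmul]

theorem mapMatrix_tauLeg (J : Λ) (F : B →ₐ[ℂ] C) :
    F.mapMatrix.toLinearMap ∘ₗ tauLeg 𝒯 J B = tauLeg 𝒯 J C := by
  ext x i j
  simp [tauLeg_apply]

theorem mapMatrix_scalLeg (J : Λ) (φ : G →ₗ[ℂ] B) (F : B →ₐ[ℂ] C) :
    F.mapMatrix.toLinearMap ∘ₗ scalLeg 𝒯 J φ = scalLeg 𝒯 J (F.toLinearMap ∘ₗ φ) := by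
  ext x i j
  simp [scalLeg_apply, Matrix.diagonal_apply, apply_ite F]

/-- `leg1` as a homomorphism. -/
def leg1Hom (I J : Λ) (B : Type*) [Ring B] [Algebra ℂ B] : 𝒯.Mat I B →ₐ[ℂ]
    Matrix (Fin (𝒯.dim I) × Fin (𝒯.dim J)) (Fin (𝒯.dim I) × Fin (𝒯.dim J)) B :=
  AlgHom.ofLinearMap
    { toFun := leg1 𝒯 J
      map_add' := fun X Y => by ext p q; simp [leg1, add_mul]
      map_smul' := fun c X => by ext p q; simp [leg1] }
    (by simp [leg1])
    (fun X Y => by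
      ext p q
      simp [leg1, Matrix.mul_apply, Fintype.sum_prod_type, Matrix.one_apply])

/-- `leg2` as a homomorphism. -/
def leg2Hom (I J : Λ) (B : Type*) [Ring B] [Algebra ℂ B] : 𝒯.Mat J B →ₐ[ℂ]
    Matrix (Fin (𝒯.dim I) × Fin (𝒯.dim J)) (Fin (𝒯.dim I) × Fin (𝒯.dim J)) B :=
  AlgHom.ofLinearMap
    { toFun := leg2 𝒯 I
      map_add' := fun X Y => by ext p q; simp [leg2, mul_add]
      map_smul' := fun c X => by ext p q; simp [leg2] }
    (by simp [leg2])
    (fun X Y => by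
      ext p q
      simp [leg2, Matrix.mul_apply, Fintype.sum_prod_type, Matrix.one_apply])

theorem leg1Hom_apply (I J : Λ) (X : 𝒯.Mat I B) : leg1Hom 𝒯 I J B X = leg1 𝒯 J X := rfl

theorem leg2Hom_apply (I J : Λ) (X : 𝒯.Mat J B) : leg2Hom 𝒯 I J B X = leg2 𝒯 I X := rfl

/-- `τ^I` acting on the first factor. -/
def tauLeg1 (I J : Λ) (B : Type*) [Ring B] [Algebra ℂ B] : G →ₗ[ℂ]
    Matrix (Fin (𝒯.dim I) × Fin (𝒯.dim J)) (Fin (𝒯.dim I) × Fin (𝒯.dim J)) B :=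
  (leg1Hom 𝒯 I J B).toLinearMap ∘ₗ tauLeg 𝒯 I B

/-- `τ^J` acting on the second factor. -/
def tauLeg2 (I J : Λ) (B : Type*) [Ring B] [Algebra ℂ B] : G →ₗ[ℂ]
    Matrix (Fin (𝒯.dim I) × Fin (𝒯.dim J)) (Fin (𝒯.dim I) × Fin (𝒯.dim J)) B :=
  (leg2Hom 𝒯 I J B).toLinearMap ∘ₗ tauLeg 𝒯 J B

/-- `φ` acting on the coefficients of matrices with two factors. -/
def scalLeg2 (I J : Λ) (φ : G →ₗ[ℂ] B) : G →ₗ[ℂ]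
    Matrix (Fin (𝒯.dim I) × Fin (𝒯.dim J)) (Fin (𝒯.dim I) × Fin (𝒯.dim J)) B :=
  (scalarHom _ B).toLinearMap ∘ₗ φ

theorem tauLeg1_mul_tauLeg2 (I J : Λ) (x y : G) :
    tauLeg1 𝒯 I J B x * tauLeg2 𝒯 I J B y = scal B (𝒯.τ I x ⊗ₖ 𝒯.τ J y) := by
  ext p q
  simp [tauLeg1, tauLeg2, leg1Hom_apply, leg2Hom_apply, leg1, leg2, tauLeg_apply,
    Matrix.mul_apply, Fintype.sum_prod_type, Matrix.one_apply]

theorem comm_tauLeg1_tauLeg2 (I J : Λ) : Comm (tauLeg1 𝒯 I J B) (tauLeg2 𝒯 I J B) := fun x y => by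
  rw [Commute, SemiconjBy, tauLeg1_mul_tauLeg2]
  ext p q
  simp [tauLeg1, tauLeg2, leg1Hom_apply, leg2Hom_apply, leg1, leg2, tauLeg_apply,
    Matrix.mul_apply, Fintype.sum_prod_type, Matrix.one_apply]
  exact Algebra.commutes _ _

theorem isLeg_tauLeg1 (I J : Λ) : IsLeg (tauLeg1 𝒯 I J B) := (isLeg_tauLeg 𝒯 I).comp _

theorem isLeg_tauLeg2 (I J : Λ) : IsLeg (tauLeg2 𝒯 I J B) := (isLeg_tauLeg 𝒯 J).comp _

theorem leg1Hom_scalLeg (I J : Λ) (φ : G →ₗ[ℂ] B) :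
    (leg1Hom 𝒯 I J B).toLinearMap ∘ₗ scalLeg 𝒯 I φ = scalLeg2 𝒯 I J φ := by
  ext x p q
  obtain ⟨p1, p2⟩ := p
  obtain ⟨q1, q2⟩ := q
  simp [leg1Hom_apply, leg1, scalLeg_apply, scalLeg2, scalarHom_apply, Matrix.diagonal_apply,
    Matrix.one_apply, ite_and]
  split_ifs <;> rfl

theorem leg2Hom_scalLeg (I J : Λ) (φ : G →ₗ[ℂ] B) :
    (leg2Hom 𝒯 I J B).toLinearMap ∘ₗ scalLeg 𝒯 J φ = scalLeg2 𝒯 I J φ := by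
  ext x p q
  obtain ⟨p1, p2⟩ := p
  obtain ⟨q1, q2⟩ := q
  simp [leg2Hom_apply, leg2, scalLeg_apply, scalLeg2, scalarHom_apply, Matrix.diagonal_apply,
    Matrix.one_apply, ite_and]
  split_ifs <;> rfl

theorem isLeg_scalLeg2 (I J : Λ) {φ : G →ₗ[ℂ] B} (h : IsLeg φ) : IsLeg (scalLeg2 𝒯 I J φ) :=
  h.comp _

theorem comm_scalLeg2 (I J : Λ) {φ ψ : G →ₗ[ℂ] B} (h : Comm φ ψ) :
    Comm (scalLeg2 𝒯 I J φ) (scalLeg2 𝒯 I J ψ) := h.comp _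

theorem comm_tauLeg1_scalLeg2 (I J : Λ) (φ : G →ₗ[ℂ] B) :
    Comm (tauLeg1 𝒯 I J B) (scalLeg2 𝒯 I J φ) := by
  rw [← leg1Hom_scalLeg]
  exact (comm_tauLeg_scalLeg 𝒯 I φ).comp _

theorem comm_tauLeg2_scalLeg2 (I J : Λ) (φ : G →ₗ[ℂ] B) :
    Comm (tauLeg2 𝒯 I J B) (scalLeg2 𝒯 I J φ) := by
  rw [← leg2Hom_scalLeg]
  exact (comm_tauLeg_scalLeg 𝒯 J φ).comp _

theorem scal_rep2 (I J : Λ) (x : G ⊗[ℂ] G) :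
    scal B (𝒯.rep2 I J x) = tens (tauLeg1 𝒯 I J B) (tauLeg2 𝒯 I J B) x := by
  induction x using TensorProduct.induction_on with
  | zero => ext p q; simp [Irreps.rep2]
  | add x y hx hy => rw [Irreps.rep2_add, map_add, ← hx, ← hy]; ext p q; simp
  | tmul a b => rw [Irreps.rep2_tmul, tens_tmul, tauLeg1_mul_tauLeg2]

theorem scal_intertwine_tens {m n : Type*} [Fintype m] [DecidableEq m] [Fintype n] [DecidableEq n]
    {X : Matrix m n B} {f g : G →ₗ[ℂ] Matrix n n B} {f' g' : G →ₗ[ℂ] Matrix m m B}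
    (hf : ∀ x, X * f x = f' x * X) (hg : ∀ x, X * g x = g' x * X) (w : G ⊗[ℂ] G) :
    X * tens f g w = tens f' g' w * X := by
  induction w using TensorProduct.induction_on with
  | zero => simp
  | add x y hx hy => simp [Matrix.mul_add, Matrix.add_mul, hx, hy]
  | tmul a b =>
    rw [tens_tmul, tens_tmul, ← Matrix.mul_assoc, hf, Matrix.mul_assoc, hg, Matrix.mul_assoc]

variable {𝒢 : RibbonStar G}

/-- `X` may be rectangular, as a Clebsch-Gordan map from `V^I ⊗ V^J` to `V^K` is. -/
theorem scal_intertwine_loopN {m n : Type*} [Fintype m] [DecidableEq m] [Fintype n]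
    [DecidableEq n] {X : Matrix m n B} {a φ ψ : G →ₗ[ℂ] Matrix n n B}
    {a' φ' ψ' : G →ₗ[ℂ] Matrix m m B} (ha : ∀ x, X * a x = a' x * X)
    (hφ : ∀ x, X * φ x = φ' x * X) (hψ : ∀ x, X * ψ x = ψ' x * X) :
    X * loopN 𝒢 a φ ψ = loopN 𝒢 a' φ' ψ' * X := by
  simp only [loopN, Qm, Rr, Ri, ← Matrix.mul_assoc]
  rw [scal_intertwine_tens hφ ha, Matrix.mul_assoc _ X, scal_intertwine_tens hψ ha,
    ← Matrix.mul_assoc, Matrix.mul_assoc _ X, scal_intertwine_tens ha hψ,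
    ← Matrix.mul_assoc, Matrix.mul_assoc _ X, scal_intertwine_tens hφ ha, ← Matrix.mul_assoc]

theorem scal_mul {k l n : Type*} [Fintype l] (X : Matrix k l ℂ) (Y : Matrix l n ℂ) :
    scal B (X * Y) = scal B X * scal B Y := Matrix.map_mul (f := algebraMap ℂ B)

theorem scal_smul {k l : Type*} (c : ℂ) (X : Matrix k l ℂ) : scal B (c • X) = c • scal B X := by
  ext i j
  simp [Algebra.smul_def]

theorem scal_sum {k l ι : Type*} (t : Finset ι) (X : ι → Matrix k l ℂ) :
    scal B (∑ i ∈ t, X i) = ∑ i ∈ t, scal B (X i) := by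
  ext i j
  simp [Matrix.sum_apply]

theorem scal_map (F : B →ₐ[ℂ] C) {k l : Type*} (X : Matrix k l ℂ) :
    (scal B X).map F = scal C X := by
  ext i j
  simp

/-- The monodromy of the leg `τ^J` around the leg number `ν` of a system of legs. -/
def loopMat (𝒢 : RibbonStar G) (S : LegSystem G B) (ν : ℕ) (J : Λ) : 𝒯.Mat J B :=
  loopN 𝒢 (tauLeg 𝒯 J B) (scalLeg 𝒯 J (S.io ν)) (scalLeg 𝒯 J (S.s ν))

theorem map_loopMat (S : LegSystem G B) (F : B →ₐ[ℂ] C) (ν : ℕ) (J : Λ) :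
    (loopMat 𝒯 𝒢 S ν J).map F = loopMat 𝒯 𝒢 (S.map F) ν J := by
  have h := map_loopN 𝒢 F.mapMatrix (tauLeg 𝒯 J B) (scalLeg 𝒯 J (S.io ν)) (scalLeg 𝒯 J (S.s ν))
  rw [mapMatrix_tauLeg, mapMatrix_scalLeg, mapMatrix_scalLeg, ← LegSystem.map_io] at h
  exact h

theorem leg1_loopMat (S : LegSystem G B) (ν : ℕ) (I J : Λ) :
    leg1 𝒯 J (loopMat 𝒯 𝒢 S ν I) =
      loopN 𝒢 (tauLeg1 𝒯 I J B) (scalLeg2 𝒯 I J (S.io ν)) (scalLeg2 𝒯 I J (S.s ν)) := by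
  rw [← leg1Hom_apply, loopMat, map_loopN, leg1Hom_scalLeg, leg1Hom_scalLeg, tauLeg1]

theorem leg2_loopMat (S : LegSystem G B) (ν : ℕ) (I J : Λ) :
    leg2 𝒯 I (loopMat 𝒯 𝒢 S ν J) =
      loopN 𝒢 (tauLeg2 𝒯 I J B) (scalLeg2 𝒯 I J (S.io ν)) (scalLeg2 𝒯 I J (S.s ν)) := by
  rw [← leg2Hom_apply, loopMat, map_loopN, leg2Hom_scalLeg, leg2Hom_scalLeg, tauLeg2]

/-- `loopN_exchange` for the legs `τ^I`, `τ^J` on the two matrix factors and `ι = ι_μ`; the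
condition `ν < μ` is what makes the first monodromy commute with `τ^I * ι_μ`. -/
theorem loopMat_exchange (S : LegSystem G B) {ν μ : ℕ} (h : ν < μ) (I J : Λ) :
    scal B (𝒯.rep2 I J 𝒢.Rinv) * leg1 𝒯 J (loopMat 𝒯 𝒢 S ν I) *
        scal B (𝒯.rep2 I J 𝒢.R) * leg2 𝒯 I (loopMat 𝒯 𝒢 S μ J) =
      leg2 𝒯 I (loopMat 𝒯 𝒢 S μ J) * scal B (𝒯.rep2 I J 𝒢.Rinv) *
        leg1 𝒯 J (loopMat 𝒯 𝒢 S ν I) * scal B (𝒯.rep2 I J 𝒢.R) := by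
  have hS2 : ∀ x, Commute (loopN 𝒢 (tauLeg1 𝒯 I J B) (scalLeg2 𝒯 I J (S.io ν))
      (scalLeg2 𝒯 I J (S.s ν))) (conv (tauLeg1 𝒯 I J B) (scalLeg2 𝒯 I J (S.io μ)) x) := by
    intro x
    have h2 := (S.map (scalarHom (Fin (𝒯.dim I) × Fin (𝒯.dim J)) B)).loopN_commute_io (𝒢 := 𝒢)
      (isLeg_tauLeg1 𝒯 I J) (fun n => comm_tauLeg1_scalLeg2 𝒯 I J (S.s n)) h x
    rw [LegSystem.map_io, LegSystem.map_io] at h2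
    exact h2
  rw [leg1_loopMat, leg2_loopMat, scal_rep2, scal_rep2]
  have key := loopN_exchange (𝒢 := 𝒢) (b := tauLeg2 𝒯 I J B) (ψ' := scalLeg2 𝒯 I J (S.s μ))
    (isLeg_tauLeg1 𝒯 I J) (isLeg_tauLeg2 𝒯 I J) (isLeg_scalLeg2 𝒯 I J (S.isLeg_io μ))
    (comm_tauLeg1_tauLeg2 𝒯 I J) (comm_tauLeg2_scalLeg2 𝒯 I J _).symm hS2
    (fun x => loopN_commute (fun y => comm_tauLeg1_tauLeg2 𝒯 I J y x)
      (fun y => (comm_tauLeg2_scalLeg2 𝒯 I J _ x y).symm)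
      fun y => (comm_tauLeg2_scalLeg2 𝒯 I J _ x y).symm)
    (fun x => loopN_commute (fun y => comm_tauLeg1_scalLeg2 𝒯 I J _ y x)
      (fun y => comm_scalLeg2 𝒯 I J (S.comm_io h.le) y x)
      fun y => comm_scalLeg2 𝒯 I J (S.comm ν μ h.ne) y x)
  exact key.eq.trans (by simp only [mul_assoc]; rfl)

end MatrixLegs

/-! ### The functoriality relation for monodromies built from legs. -/

section Functoriality

variable {G : Type*} [Ring G] [HopfAlgebra ℂ G] [StarRing G] [StarModule ℂ G] {Λ : Type*}
  {𝒢 : RibbonStar G} {𝒯 : Irreps G Λ} (𝒞 : Clebsch 𝒢 𝒯)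
  [Fintype Λ] [FiniteDimensional ℂ G] [IsSemisimpleRing G]
  {B : Type*} [Ring B] [Algebra ℂ B]

/-- Expand the `R_{ab}` on the right of `loopN_mul` by `rep2_R`; each `C` carries the monodromy of
`τ^I * τ^J` to that of `τ^K`, and the scalars `κ` cancel. -/
theorem Clebsch.loopMat_functoriality (S : LegSystem G B) (ν : ℕ) (I J : Λ) :
    leg1 𝒯 J ((𝒞.kap I)⁻¹ • loopMat 𝒯 𝒢 S ν I) * scal B (𝒯.rep2 I J 𝒢.R) *
        leg2 𝒯 I ((𝒞.kap J)⁻¹ • loopMat 𝒯 𝒢 S ν J) =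
      ∑ K, ∑ a, scal B (𝒞.C I J K a)ᴴ * ((𝒞.kap K)⁻¹ • loopMat 𝒯 𝒢 S ν K) *
        scal B (𝒞.C I J K a) := by
  have h1 := 𝒞.kap_ne_zero I
  have h2 := 𝒞.kap_ne_zero J
  have hmul := loopN_mul (𝒢 := 𝒢) (isLeg_tauLeg1 𝒯 I J (B := B)) (isLeg_tauLeg2 𝒯 I J)
    (isLeg_scalLeg2 𝒯 I J (S.isLeg_io ν)) (isLeg_scalLeg2 𝒯 I J (S.isLeg ν))
    (comm_tauLeg1_tauLeg2 𝒯 I J) (comm_tauLeg1_scalLeg2 𝒯 I J _)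
    (comm_tauLeg1_scalLeg2 𝒯 I J _) (comm_tauLeg2_scalLeg2 𝒯 I J _)
    (comm_tauLeg2_scalLeg2 𝒯 I J _) (comm_scalLeg2 𝒯 I J (S.comm_io (le_refl ν)))
  have hC : ∀ K a, scal B (𝒞.C I J K a) * loopN 𝒢 (conv (tauLeg1 𝒯 I J B) (tauLeg2 𝒯 I J B))
      (scalLeg2 𝒯 I J (S.io ν)) (scalLeg2 𝒯 I J (S.s ν)) =
      loopMat 𝒯 𝒢 S ν K * scal B (𝒞.C I J K a) := by
    intro K a
    have hsc : ∀ (φ : G →ₗ[ℂ] B) x, scal B (𝒞.C I J K a) * scalLeg2 𝒯 I J φ x =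
        scalLeg 𝒯 K φ x * scal B (𝒞.C I J K a) := by
      intro φ x
      ext i j
      simp only [scalLeg2, LinearMap.comp_apply, AlgHom.toLinearMap_apply, scalarHom_apply,
        scalLeg_apply, Matrix.mul_diagonal, Matrix.diagonal_mul, Matrix.map_apply]
      exact Algebra.commutes _ _
    refine scal_intertwine_loopN (fun x => ?_) (hsc _) (hsc _)
    rw [conv_apply, ← scal_rep2, ← scal_mul, 𝒞.intertwine, scal_mul, tauLeg_apply]
  rw [← leg1Hom_apply, ← leg2Hom_apply, map_smul, map_smul, leg1Hom_apply, leg2Hom_apply,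
    leg1_loopMat, leg2_loopMat, smul_mul_assoc, smul_mul_assoc, mul_smul_comm, smul_smul,
    scal_rep2]
  refine (congrArg (fun X => ((𝒞.kap I)⁻¹ * (𝒞.kap J)⁻¹) • X) hmul).trans ?_
  generalize loopN 𝒢 (conv (tauLeg1 𝒯 I J B) (tauLeg2 𝒯 I J B)) (scalLeg2 𝒯 I J (S.io ν))
    (scalLeg2 𝒯 I J (S.s ν)) = L at hC
  simp only [Rr, ← scal_rep2]
  rw [𝒞.rep2_R, scal_sum, Finset.sum_mul, Finset.smul_sum]
  refine Finset.sum_congr rfl fun K _ => ?_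
  rw [scal_sum, Finset.sum_mul, Finset.smul_sum]
  refine Finset.sum_congr rfl fun a _ => ?_
  rw [scal_smul, smul_mul_assoc, scal_mul, Matrix.mul_assoc, hC, smul_smul, Matrix.mul_smul,
    Matrix.smul_mul, Matrix.mul_assoc]
  congr 1
  have h3 := 𝒞.kap_ne_zero K
  field_simp

end Functoriality

/-! ## Quantum traces of monodromies -/

section QuantumTraces

variable {G : Type*} [Ring G] [HopfAlgebra ℂ G] [StarRing G] [StarModule ℂ G]
  {Λ : Type*} (𝒢 : RibbonStar G) (𝒯 : Irreps G Λ) {B : Type*} [Ring B] [Algebra ℂ B]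
  {C : Type*} [Ring C] [Algebra ℂ C]

theorem map_id_antipode_Rinv : TensorProduct.map LinearMap.id (HopfAlgebra.antipode ℂ) 𝒢.Rinv =
    (𝒢.R : G ⊗[ℂ] G) := by
  have h := Rr_antip_antip 𝒢 (isLeg_inclL (G := G)) isLeg_inclR comm_inclL_inclR
  rw [Rr, Rr, tens_inclL_inclR] at h
  rw [Rinv_eq_map_antipode]
  refine Eq.trans ?_ h
  induction (𝒢.R : G ⊗[ℂ] G) using TensorProduct.induction_on with
  | zero => simp
  | add x y hx hy => simp [hx, hy]
  | tmul a b => simp [inclL_apply, inclR_apply]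

theorem qtr_eq (I : Λ) (X : 𝒯.Mat I B) :
    qtr 𝒢 𝒯 I X = (X * tauLeg 𝒯 I B (gElt 𝒢)).trace := rfl

theorem map_qtr (F : B →ₐ[ℂ] C) (I : Λ) (X : 𝒯.Mat I B) :
    F (qtr 𝒢 𝒯 I X) = qtr 𝒢 𝒯 I (X.map F) := by
  simp [qtr, Matrix.trace, Matrix.mul_apply]

theorem qtr_smul (I : Λ) (c : ℂ) (X : 𝒯.Mat I B) : qtr 𝒢 𝒯 I (c • X) = c • qtr 𝒢 𝒯 I X := by
  rw [qtr_eq, qtr_eq, smul_mul_assoc, Matrix.trace_smul]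

theorem trace_mul_tauLeg (I : Λ) (X : 𝒯.Mat I B) (x : G) :
    (X * tauLeg 𝒯 I B x).trace = (tauLeg 𝒯 I B x * X).trace := by
  simp only [Matrix.trace, Matrix.diag, Matrix.mul_apply]
  rw [Finset.sum_comm]
  exact Finset.sum_congr rfl fun i _ => Finset.sum_congr rfl fun j _ =>
    (Algebra.commutes _ _).symm

theorem qtr_tens (I : Λ) (ψ : G →ₗ[ℂ] B) (x : G ⊗[ℂ] G) :
    qtr 𝒢 𝒯 I (tens (tauLeg 𝒯 I B) (scalLeg 𝒯 I ψ) x) = ψ (slice (qch 𝒢 𝒯 I) x) := by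
  induction x using TensorProduct.induction_on with
  | zero => simp [qtr]
  | add x y hx hy => rw [map_add, map_add, map_add, ← hx, ← hy, qtr_eq, qtr_eq, qtr_eq,
      Matrix.add_mul, Matrix.trace_add]
  | tmul a b =>
    rw [qtr_eq, tens_tmul, mul_assoc, ← (comm_tauLeg_scalLeg 𝒯 I ψ _ _).eq, ← mul_assoc,
      ← (isLeg_tauLeg 𝒯 I).mul, slice_tmul, map_smul, qch_apply, ← map_mul, scalLeg_apply,
      Matrix.trace, Matrix.trace, Finset.sum_smul]
    refine Finset.sum_congr rfl fun i _ => ?_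
    rw [Matrix.diag, Matrix.mul_diagonal]
    exact (Algebra.smul_def _ _).symm

variable [FiniteDimensional ℂ G]

/-- Write `R = (id ⊗ S)(R⁻¹)`. Moving the left factor cyclically through `g` merges both factors
into `(id ⊗ S)(R⁻¹R) = 1`. -/
theorem qtr_conj_R (I : Λ) {φ : G →ₗ[ℂ] B} (hφ : IsLeg φ) {Y : 𝒯.Mat I B}
    (hY : ∀ x, Commute (scalLeg 𝒯 I φ x) Y) :
    qtr 𝒢 𝒯 I (Rr 𝒢 (scalLeg 𝒯 I φ) (tauLeg 𝒯 I B) * Y * Ri 𝒢 (scalLeg 𝒯 I φ) (tauLeg 𝒯 I B)) =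
      qtr 𝒢 𝒯 I Y := by
  let ν : G ⊗[ℂ] G →ₗ[ℂ] G ⊗[ℂ] G := TensorProduct.map LinearMap.id (HopfAlgebra.antipode ℂ)
  have hσ := isLeg_scalLeg 𝒯 I hφ
  have hτ := isLeg_tauLeg 𝒯 I (B := B)
  have hc := comm_tauLeg_scalLeg 𝒯 I φ
  -- Stated for arbitrary tensors so that it can be checked on pure ones; it is used at `x = w =
  -- R⁻¹`.
  have key : ∀ x w : G ⊗[ℂ] G,
      (tens (scalLeg 𝒯 I φ) (tauLeg 𝒯 I B) (ν x) * Y * tens (scalLeg 𝒯 I φ) (tauLeg 𝒯 I B) w *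
        tauLeg 𝒯 I B (gElt 𝒢)).trace =
      (Y * tauLeg 𝒯 I B (gElt 𝒢) * tens (scalLeg 𝒯 I φ) (tauLeg 𝒯 I B) (ν (x * ν w))).trace := by
    intro x w
    induction x using TensorProduct.induction_on with
    | zero => simp
    | add x y hx hy => simp only [map_add, add_mul, mul_add, Matrix.trace_add, hx, hy]
    | tmul a b =>
      induction w using TensorProduct.induction_on with
      | zero => simp
      | add x y hx hy => simp only [map_add, add_mul, mul_add, Matrix.trace_add, hx, hy]
      | tmul c d =>
        simp only [ν, TensorProduct.map_tmul, LinearMap.id_apply,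
          Algebra.TensorProduct.tmul_mul_tmul, tens_tmul, hσ.mul,
          HopfAlgebra.antipode_mul_antidistrib, hτ.mul]
        have e1 : Y * tauLeg 𝒯 I B (gElt 𝒢) * (scalLeg 𝒯 I φ a * scalLeg 𝒯 I φ c *
            (tauLeg 𝒯 I B (HopfAlgebra.antipode ℂ (HopfAlgebra.antipode ℂ d)) *
              tauLeg 𝒯 I B (HopfAlgebra.antipode ℂ b))) =
            scalLeg 𝒯 I φ a * Y * scalLeg 𝒯 I φ c * tauLeg 𝒯 I B d * tauLeg 𝒯 I B (gElt 𝒢) *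
              tauLeg 𝒯 I B (HopfAlgebra.antipode ℂ b) := by
          rw [mul_assoc _ (tauLeg 𝒯 I B d), ← hτ.mul d, ← gElt_mul_antipode_sq, hτ.mul (gElt 𝒢),
            (hY a).eq]
          have h2 := (hc (gElt 𝒢) (a * c)).eq
          rw [hσ.mul] at h2
          simp only [← mul_assoc] at h2 ⊢
          rw [mul_assoc Y, mul_assoc Y, h2]
          simp only [mul_assoc]
        rw [e1]
        refine Eq.trans ?_ (trace_mul_tauLeg 𝒯 I _ _).symm
        congr 1
        simp only [← mul_assoc]
        rw [(hc _ a).eq]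
  have h := key 𝒢.Rinv 𝒢.Rinv
  simp only [ν, map_id_antipode_Rinv] at h
  rw [qtr_eq, qtr_eq]
  refine h.trans ?_
  rw [RibbonStar.Rinv, Units.inv_mul, Algebra.TensorProduct.one_def, TensorProduct.map_tmul,
    HopfAlgebra.antipode_one, LinearMap.id_apply, tens_tmul, hσ.one, hτ.one, mul_one, mul_one]

/-- The dressing by `R` disappears under the quantum trace, and tracing `R'R` over `τ^I` leaves
`z_I` on the leg `ν`. -/
theorem qtr_loopMat (S : LegSystem G B) (ν : ℕ) (I : Λ) :
    qtr 𝒢 𝒯 I (loopMat 𝒯 𝒢 S ν I) = S.s ν (zElt 𝒢 𝒯 I) := by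
  rw [loopMat, loopN, qtr_conj_R 𝒢 𝒯 I (S.isLeg_io ν), Qm_eq_tens 𝒢 (isLeg_tauLeg 𝒯 I)
    (isLeg_scalLeg 𝒯 I (S.isLeg ν)) (comm_tauLeg_scalLeg 𝒯 I _), qtr_tens, zElt]
  exact fun x => (Qm_commute (fun y => comm_tauLeg_scalLeg 𝒯 I _ y x) fun y =>
    (comm_scalLeg 𝒯 I (S.comm_io le_rfl) x y).symm).symm

/-- The decreasing order of the product makes `loopN_mul_Qm` telescope to the monodromy around all
legs at once. -/
theorem prod_loopMat (S : LegSystem G B) (m : ℕ) (I : Λ) (c : ℂ) :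
    (List.ofFn fun ν : Fin m => c • loopMat 𝒯 𝒢 S ν I).reverse.prod =
      c ^ m • Qm 𝒢 (tauLeg 𝒯 I B) (scalLeg 𝒯 I (S.io m)) := by
  induction m with
  | zero =>
    have h : scalLeg 𝒯 I (S.io 0) = unitLeg := by
      
      exact LinearMap.ext fun x => (scalarHom (Fin (𝒯.dim I)) B).commutes _
    simp [h, Qm, Rr_unitLeg_right, Rr_unitLeg_left 𝒢 (isLeg_tauLeg 𝒯 I), (isLeg_tauLeg 𝒯 I).one]
  | succ m ih =>
    rw [List.ofFn_succ', List.concat_eq_append, List.reverse_append]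
    simp only [List.reverse_cons, List.reverse_nil, List.nil_append, List.singleton_append,
      List.prod_cons, Fin.val_last, Fin.val_castSucc]
    rw [ih, smul_mul_smul_comm, ← pow_succ', loopMat, LegSystem.io, scalLeg_conv,
      loopN_mul_Qm (isLeg_tauLeg 𝒯 I) (isLeg_scalLeg 𝒯 I (S.isLeg_io m))
        (comm_tauLeg_scalLeg 𝒯 I _) (comm_tauLeg_scalLeg 𝒯 I _)
        (comm_scalLeg 𝒯 I (S.comm_io le_rfl))]

theorem qtr_Qm_io (S : LegSystem G B) (m : ℕ) (I : Λ) :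
    qtr 𝒢 𝒯 I (Qm 𝒢 (tauLeg 𝒯 I B) (scalLeg 𝒯 I (S.io m))) = S.io m (zElt 𝒢 𝒯 I) := by
  rw [Qm_eq_tens 𝒢 (isLeg_tauLeg 𝒯 I) (isLeg_scalLeg 𝒯 I (S.isLeg_io m))
    (comm_tauLeg_scalLeg 𝒯 I _), qtr_tens, zElt]

end QuantumTraces

/-! ## The universal properties of the graph algebra and the semi-direct product -/

section Universal

variable {G : Type*} [Ring G] [HopfAlgebra ℂ G] [StarRing G] [StarModule ℂ G]
  {Λ : Type*} {𝒢 : RibbonStar G} {𝒯 : Irreps G Λ} (𝒞 : Clebsch 𝒢 𝒯)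
  {B : Type*} [Ring B] [Algebra ℂ B] {m : ℕ} [Fintype Λ]

/-- The projection of the free algebra onto `ℒ_m`. -/
abbrev graphMk (m : ℕ) : FreeAlgebra ℂ (Gen 𝒯 m) →ₐ[ℂ] GraphAlg 𝒞 m :=
  RingQuot.mkAlgHom ℂ (GraphRel 𝒞 m)

/-- The projection of the tensor algebra onto `𝒮_m`. -/
abbrev semiMk (m : ℕ) : TensorAlgebra ℂ (G × GraphAlg 𝒞 m) →ₐ[ℂ] SemiAlg 𝒞 m :=
  RingQuot.mkAlgHom ℂ (SemiRel 𝒞 m)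

theorem GraphAlg.hom_ext {F F' : GraphAlg 𝒞 m →ₐ[ℂ] B}
    (h : ∀ (ν : Fin m) (J : Λ), (graphM 𝒞 ν J).map F = (graphM 𝒞 ν J).map F') : F = F' := by
  refine RingQuot.ringQuot_ext' ℂ F F' (FreeAlgebra.hom_ext ?_)
  funext ⟨ν, J, i, j⟩
  exact congrFun (congrFun (h ν J) i) j

theorem SemiAlg.hom_ext {F F' : SemiAlg 𝒞 m →ₐ[ℂ] B}
    (hG : ∀ x, F (ofG 𝒞 m x) = F' (ofG 𝒞 m x))
    (hM : ∀ (ν : Fin m) (J : Λ), (mono 𝒞 ν J).map F = (mono 𝒞 ν J).map F') : F = F' := by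
  refine RingQuot.ringQuot_ext' ℂ F F' (TensorAlgebra.hom_ext ?_)
  refine LinearMap.prod_ext (LinearMap.ext fun x => hG x) (LinearMap.ext fun X => ?_)
  have hL : F.comp (ofL 𝒞 m) = F'.comp (ofL 𝒞 m) := GraphAlg.hom_ext 𝒞 fun ν J => by
    have := hM ν J
    simp only [mono, Matrix.map_map] at this
    exact this
  exact congrArg (fun f : GraphAlg 𝒞 m →ₐ[ℂ] B => f X) hL

theorem leg1_map {C : Type*} [Ring C] [Algebra ℂ C] (F : B →ₐ[ℂ] C) {I : Λ} (J : Λ)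
    (X : 𝒯.Mat I B) : (leg1 𝒯 J X).map F = leg1 𝒯 J (X.map F) := by
  ext p q
  simp [leg1, Matrix.one_apply, apply_ite F]

theorem leg2_map {C : Type*} [Ring C] [Algebra ℂ C] (F : B →ₐ[ℂ] C) (I : Λ) {J : Λ}
    (X : 𝒯.Mat J B) : (leg2 𝒯 I X).map F = leg2 𝒯 I (X.map F) := by
  ext p q
  simp [leg2, Matrix.one_apply, apply_ite F]

theorem map_matrix_sum {C : Type*} [Ring C] [Algebra ℂ C] (F : B →ₐ[ℂ] C) {ι n : Type*}
    (t : Finset ι) (X : ι → Matrix n n B) : (∑ i ∈ t, X i).map F = ∑ i ∈ t, (X i).map F := by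
  ext i j
  simp [Matrix.sum_apply]

theorem map_fusion_sum {C : Type*} [Ring C] [Algebra ℂ C] (F : B →ₐ[ℂ] C) (I J : Λ)
    (M : ∀ K, 𝒯.Mat K B) :
    (∑ K, ∑ a, scal B (𝒞.C I J K a)ᴴ * M K * scal B (𝒞.C I J K a)).map F =
      ∑ K, ∑ a, scal C (𝒞.C I J K a)ᴴ * (M K).map F * scal C (𝒞.C I J K a) := by
  rw [map_matrix_sum]
  refine Finset.sum_congr rfl fun K _ => ?_
  rw [map_matrix_sum]
  refine Finset.sum_congr rfl fun a _ => ?_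
  rw [Matrix.map_mul, Matrix.map_mul, scal_map, scal_map]

/-- A family of matrices satisfying the relations of the graph algebra. -/
structure IsGraphFamily (M : ∀ (_ : Fin m) (J : Λ), 𝒯.Mat J B) : Prop where
  trivial : ∀ ν, M ν 𝒯.zero = 1
  functoriality : ∀ ν I J,
    leg1 𝒯 J (M ν I) * scal B (𝒯.rep2 I J 𝒢.R) * leg2 𝒯 I (M ν J) =
      ∑ K, ∑ a, scal B (𝒞.C I J K a)ᴴ * M ν K * scal B (𝒞.C I J K a)
  exchange : ∀ ν μ, ν < μ → ∀ I J,
    scal B (𝒯.rep2 I J 𝒢.Rinv) * leg1 𝒯 J (M ν I) * scal B (𝒯.rep2 I J 𝒢.R) *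
        leg2 𝒯 I (M μ J) =
      leg2 𝒯 I (M μ J) * scal B (𝒯.rep2 I J 𝒢.Rinv) * leg1 𝒯 J (M ν I) *
        scal B (𝒯.rep2 I J 𝒢.R)

theorem isGraphFamily_graphM : IsGraphFamily 𝒞 (fun (ν : Fin m) J => graphM 𝒞 ν J) where
  trivial ν := by
    ext i j
    have h := RingQuot.mkAlgHom_rel ℂ (GraphRel.trivial (𝒞 := 𝒞) ν i j)
    refine h.trans ?_
    simp [Matrix.one_apply]
    rfl
  functoriality ν I J := by
    ext p q
    have h := RingQuot.mkAlgHom_rel ℂ (GraphRel.functoriality (𝒞 := 𝒞) ν I J p q)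
    have e : ∀ X : Matrix (Fin (𝒯.dim I) × Fin (𝒯.dim J)) (Fin (𝒯.dim I) × Fin (𝒯.dim J))
        (FreeAlgebra ℂ (Gen 𝒯 m)), graphMk 𝒞 m (X p q) = X.map (graphMk 𝒞 m) p q := fun _ => rfl
    refine Eq.trans ?_ (h.trans ?_)
    · refine Eq.trans ?_ (e _).symm
      rw [Matrix.map_mul, Matrix.map_mul, leg1_map, leg2_map, scal_map]
      rfl
    · refine (e _).trans ?_
      rw [map_fusion_sum]
      rfl
  exchange ν μ h I J := by
    ext p q
    have h := RingQuot.mkAlgHom_rel ℂ (GraphRel.exchange (𝒞 := 𝒞) ν μ h I J p q)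
    have e : ∀ X : Matrix (Fin (𝒯.dim I) × Fin (𝒯.dim J)) (Fin (𝒯.dim I) × Fin (𝒯.dim J))
        (FreeAlgebra ℂ (Gen 𝒯 m)), graphMk 𝒞 m (X p q) = X.map (graphMk 𝒞 m) p q := fun _ => rfl
    refine Eq.trans ?_ (h.trans ?_)
    · refine Eq.trans ?_ (e _).symm
      rw [Matrix.map_mul, Matrix.map_mul, Matrix.map_mul, leg1_map, leg2_map, scal_map, scal_map]
      rfl
    · refine (e _).trans ?_
      rw [Matrix.map_mul, Matrix.map_mul, Matrix.map_mul, leg1_map, leg2_map, scal_map, scal_map]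
      rfl

variable {𝒞} in
theorem IsGraphFamily.lift_rel {M : ∀ (_ : Fin m) (J : Λ), 𝒯.Mat J B} (hM : IsGraphFamily 𝒞 M)
    ⦃x y : FreeAlgebra ℂ (Gen 𝒯 m)⦄ (h : GraphRel 𝒞 m x y) :
    FreeAlgebra.lift ℂ (fun p : Gen 𝒯 m => M p.1 p.2.1 p.2.2.1 p.2.2.2) x =
      FreeAlgebra.lift ℂ (fun p : Gen 𝒯 m => M p.1 p.2.1 p.2.2.1 p.2.2.2) y := by
  set F := FreeAlgebra.lift ℂ fun p : Gen 𝒯 m => M p.1 p.2.1 p.2.2.1 p.2.2.2 with hF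
  have hm : ∀ ν I, (freeM 𝒯 ν I).map F = M ν I := by
    intro ν I
    ext i j
    simp [freeM, hF]
  have e : ∀ {I J : Λ} (X : Matrix (Fin (𝒯.dim I) × Fin (𝒯.dim J)) (Fin (𝒯.dim I) × Fin (𝒯.dim J))
      (FreeAlgebra ℂ (Gen 𝒯 m))) p q, F (X p q) = X.map F p q := fun _ _ _ => rfl
  cases h with
  | trivial ν i j =>
    have h := congrFun (congrFun (hM.trivial ν) i) j
    rw [← hm] at h
    refine h.trans ?_
    simp [Matrix.one_apply, apply_ite F]
  | functoriality ν I J p q =>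
    rw [e, e, Matrix.map_mul, Matrix.map_mul, leg1_map, leg2_map, scal_map, hm, hm,
      hM.functoriality, map_fusion_sum]
    simp only [hm]
  | exchange ν μ h I J p q =>
    rw [e, e]
    simp only [Matrix.map_mul, leg1_map, leg2_map, scal_map, hm]
    rw [hM.exchange ν μ h]

variable {𝒞} in
/-- The homomorphism from `ℒ_m` defined by a family satisfying its relations. -/
def IsGraphFamily.lift {M : ∀ (_ : Fin m) (J : Λ), 𝒯.Mat J B} (hM : IsGraphFamily 𝒞 M) :
    GraphAlg 𝒞 m →ₐ[ℂ] B :=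
  RingQuot.liftAlgHom ℂ ⟨_, hM.lift_rel⟩

variable {𝒞} in
theorem IsGraphFamily.map_lift {M : ∀ (_ : Fin m) (J : Λ), 𝒯.Mat J B} (hM : IsGraphFamily 𝒞 M)
    (ν : Fin m) (J : Λ) : (graphM 𝒞 ν J).map hM.lift = M ν J := by
  ext i j
  refine (RingQuot.liftAlgHom_mkAlgHom_apply ℂ _ hM.lift_rel (freeM 𝒯 ν J i j)).trans ?_
  simp [freeM]

theorem cross_relation (ν : Fin m) (J : Λ) (x : G) :
    𝒯.slot J (ofG 𝒞 m).toLinearMap (Coalgebra.comul (R := ℂ) x) * mono 𝒞 ν J =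
      mono 𝒞 ν J * 𝒯.slot J (ofG 𝒞 m).toLinearMap (Coalgebra.comul (R := ℂ) x) := by
  ext i j
  have h := RingQuot.mkAlgHom_rel ℂ (SemiRel.cross (𝒞 := 𝒞) ν J x i j)
  have e : ∀ X : 𝒯.Mat J (TensorAlgebra ℂ (G × GraphAlg 𝒞 m)),
      semiMk 𝒞 m (X i j) = X.map (semiMk 𝒞 m) i j := fun _ => rfl
  have hs : (𝒯.slot J (preG 𝒞 m) (Coalgebra.comul (R := ℂ) x)).map (semiMk 𝒞 m) =
      𝒯.slot J (ofG 𝒞 m).toLinearMap (Coalgebra.comul (R := ℂ) x) :=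
    slot_map 𝒯 J (preG 𝒞 m) (semiMk 𝒞 m).toLinearMap _
  have hm : ((graphM 𝒞 ν J).map (preL 𝒞 m)).map (semiMk 𝒞 m) = mono 𝒞 ν J := rfl
  refine Eq.trans ?_ (h.trans ?_)
  · refine Eq.trans ?_ (e _).symm
    rw [Matrix.map_mul, hs, hm]
  · refine (e _).trans ?_
    rw [Matrix.map_mul, hs, hm]

section Lift

variable {𝒞} {M : ∀ (_ : Fin m) (J : Λ), 𝒯.Mat J B} (hM : IsGraphFamily 𝒞 M)
  {φ : G →ₗ[ℂ] B} (hφ : IsLeg φ)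
  (hc : ∀ ν J x, 𝒯.slot J φ (Coalgebra.comul (R := ℂ) x) * M ν J =
    M ν J * 𝒯.slot J φ (Coalgebra.comul (R := ℂ) x))

include hφ hc in
theorem semiLift_rel ⦃X Y : TensorAlgebra ℂ (G × GraphAlg 𝒞 m)⦄ (h : SemiRel 𝒞 m X Y) :
    TensorAlgebra.lift ℂ (φ.coprod hM.lift.toLinearMap) X =
      TensorAlgebra.lift ℂ (φ.coprod hM.lift.toLinearMap) Y := by
  set F := TensorAlgebra.lift ℂ (φ.coprod hM.lift.toLinearMap) with hF
  have hG : ∀ x, F (preG 𝒞 m x) = φ x := fun x => by simp [hF, preG]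
  have hL : ∀ x, F (preL 𝒞 m x) = hM.lift x := fun x => by simp [hF, preL]
  cases h with
  | mulG x y => rw [map_mul F, hG, hG, hG, hφ.mul]
  | oneG => rw [map_one F, hG, hφ.one]
  | mulL X Y => rw [map_mul F, hL, hL, hL, map_mul]
  | oneL => rw [map_one F, hL, map_one]
  | cross ν J x i j =>
    have e : ∀ X : 𝒯.Mat J (TensorAlgebra ℂ (G × GraphAlg 𝒞 m)),
        F (X i j) = X.map F i j := fun _ => rfl
    have hs : (𝒯.slot J (preG 𝒞 m) (Coalgebra.comul (R := ℂ) x)).map F =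
        𝒯.slot J φ (Coalgebra.comul (R := ℂ) x) := by
      refine (slot_map 𝒯 J (preG 𝒞 m) F.toLinearMap _).trans ?_
      congr 1
      exact LinearMap.ext hG
    have hm : ((graphM 𝒞 ν J).map (preL 𝒞 m)).map F = M ν J := by
      rw [← hM.map_lift, Matrix.map_map]
      ext i j
      exact hL _
    rw [e, e, Matrix.map_mul, Matrix.map_mul, hs, hm, hc]

/-- The homomorphism from `𝒮_m` defined by a family of matrices and a leg. -/
def semiLift : SemiAlg 𝒞 m →ₐ[ℂ] B := RingQuot.liftAlgHom ℂ ⟨_, semiLift_rel hM hφ hc⟩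

theorem semiLift_ofG (x : G) : semiLift hM hφ hc (ofG 𝒞 m x) = φ x := by
  refine (RingQuot.liftAlgHom_mkAlgHom_apply ℂ _ (semiLift_rel hM hφ hc) (preG 𝒞 m x)).trans ?_
  simp [preG]

theorem semiLift_ofL (X : GraphAlg 𝒞 m) : semiLift hM hφ hc (ofL 𝒞 m X) = hM.lift X := by
  refine (RingQuot.liftAlgHom_mkAlgHom_apply ℂ _ (semiLift_rel hM hφ hc) (preL 𝒞 m X)).trans ?_
  simp [preL]

theorem map_semiLift (ν : Fin m) (J : Λ) : (mono 𝒞 ν J).map (semiLift hM hφ hc) = M ν J := by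
  rw [← hM.map_lift]
  ext i j
  exact semiLift_ofL hM hφ hc _

end Lift

end Universal

/-! ## The `*`-operation and systems of legs -/

section StarLegs

variable {G : Type*} [Ring G] [HopfAlgebra ℂ G] [StarRing G] [StarModule ℂ G] {Λ : Type*}
  {𝒢 : RibbonStar G} {𝒯 : Irreps G Λ} (𝒞 : Clebsch 𝒢 𝒯)
  {A : Type*} [Ring A] [Algebra ℂ A] {B : Type*} [Ring B] [Algebra ℂ B]

/-- A letter pair stands for `R` on the corresponding two legs; the hypotheses are Yang-Baxter
equations. With `N = φa (ψa aψ) φa⁻¹`, moving the adjoint of `N` past `R_{φψ}` turns it into `N⁻¹`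
conjugated by `aψ aφ = R_{a,φ*ψ}`. -/
theorem star_loop_group {H : Type*} [Group H] {aφ aψ φψ φa ψa : H}
    (h1 : aφ * aψ * φψ = φψ * aψ * aφ) (h2 : φψ * φa * ψa = ψa * φa * φψ)
    (h3 : φa * φψ * aψ = aψ * φψ * φa) :
    aφ * (aψ * ψa)⁻¹ * aφ⁻¹ * φψ = φψ * (aψ * aφ * (φa * (ψa * aψ) * φa⁻¹)⁻¹ * (aψ * aφ)⁻¹) := by
  have e1 : φψ⁻¹ * (aφ * (aψ * ψa) * aφ⁻¹) * φψ =
      aψ * aφ * (φa * (ψa * aψ) * φa⁻¹) * (aψ * aφ)⁻¹ := by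
    have e2 : φψ⁻¹ * aφ * aψ = aψ * aφ * φψ⁻¹ := by
      rw [mul_assoc, inv_mul_eq_iff_eq_mul, eq_comm, ← mul_assoc, mul_inv_eq_iff_eq_mul,
        ← mul_assoc, ← h1]
    have e3 : φa * ψa = φψ⁻¹ * (ψa * φa * φψ) := by rw [← h2]; group
    have e4 : aψ * φψ * aφ⁻¹ * aψ⁻¹ = aφ⁻¹ * φψ := by
      rw [eq_inv_mul_iff_mul_eq, ← mul_assoc, ← mul_assoc, ← mul_assoc, h1]; group
    calc φψ⁻¹ * (aφ * (aψ * ψa) * aφ⁻¹) * φψ = (φψ⁻¹ * aφ * aψ) * ψa * aφ⁻¹ * φψ := by group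
      _ = aψ * aφ * φψ⁻¹ * ψa * (aφ⁻¹ * φψ) := by rw [e2]; group
      _ = aψ * aφ * φψ⁻¹ * ψa * (aψ * φψ * φa) * φa⁻¹ * aφ⁻¹ * aψ⁻¹ := by rw [← e4]; group
      _ = aψ * aφ * (φψ⁻¹ * (ψa * φa * φψ)) * aψ * φa⁻¹ * aφ⁻¹ * aψ⁻¹ := by rw [← h3]; group
      _ = _ := by rw [← e3]; group
  have e5 : φψ⁻¹ * (aφ * (aψ * ψa)⁻¹ * aφ⁻¹) * φψ =
      aψ * aφ * (φa * (ψa * aψ) * φa⁻¹)⁻¹ * (aψ * aφ)⁻¹ := by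
    have h := congrArg (·⁻¹) e1
    simp only [mul_inv_rev, inv_inv, mul_assoc] at h ⊢
    exact h
  rw [← e5]
  group

/-- The inductive step when one more leg `s` is appended to `ι`: `N` commutes with `as ιs =
R_{a*ι,s}`, so only the dressing changes. -/
theorem star_loop_group_step {H : Type*} [Group H] {aι as ιs N : H}
    (h1 : aι * as * ιs = ιs * as * aι) (h2 : as * ιs * N = N * (as * ιs)) :
    aι * N⁻¹ * aι⁻¹ * ιs = ιs * (as * aι * N⁻¹ * (as * aι)⁻¹) := by
  have e1 : N⁻¹ * (as * ιs) = as * ιs * N⁻¹ := by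
    rw [inv_mul_eq_iff_eq_mul, ← mul_assoc, eq_mul_inv_iff_mul_eq, h2]
  have e2 : aι⁻¹ * ιs = as * ιs * (as * aι)⁻¹ := by
    rw [eq_mul_inv_iff_mul_eq, mul_assoc, inv_mul_eq_iff_eq_mul, ← mul_assoc, ← mul_assoc, h1]
  calc aι * N⁻¹ * aι⁻¹ * ιs = aι * (N⁻¹ * (as * ιs)) * (as * aι)⁻¹ := by
        rw [mul_assoc _ aι⁻¹, e2]; group
    _ = (aι * as * ιs) * N⁻¹ * (as * aι)⁻¹ := by rw [e1]; group
    _ = _ := by rw [h1]; group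

theorem isUnit_tens {f g : G →ₗ[ℂ] A} (hf : IsLeg f) (hg : IsLeg g) (h : Comm f g)
    {x : G ⊗[ℂ] G} (hx : IsUnit x) : IsUnit (tens f g x) := by
  obtain ⟨u, rfl⟩ := hx
  refine ⟨⟨tens f g u, tens f g (u⁻¹ : (G ⊗[ℂ] G)ˣ), ?_, ?_⟩, rfl⟩
  · rw [← tens_mul hf hg h, Units.mul_inv, tens_one hf hg]
  · rw [← tens_mul hf hg h, Units.inv_mul, tens_one hf hg]

namespace LegSystem

variable (S : LegSystem G A)

/-- The element inducing the scalar product on the first `n` factors. -/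
def gramElt : ℕ → A
  | 0 => 1
  | n + 1 => gramElt n * tens (S.io n) (S.s n) 𝒞.omega

theorem gramElt_commute {c : A} {n : ℕ} (h : ∀ k < n, ∀ x, Commute (S.s k x) c) :
    Commute (S.gramElt 𝒞 n) c := by
  induction n with
  | zero => exact Commute.one_left c
  | succ n ih =>
    exact (ih fun k hk => h k (by omega)).mul_left
      (tens_commute (fun x => S.io_commute (fun k hk => h k (by omega)) x)
        (fun x => h n (by omega) x) _)

theorem map_gramElt (F : A →ₐ[ℂ] B) (n : ℕ) : (S.map F).gramElt 𝒞 n = F (S.gramElt 𝒞 n) := by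
  induction n with
  | zero => exact (map_one F).symm
  | succ n ih => rw [gramElt, ih, gramElt, map_mul, map_tens, map_io]; rfl

theorem tens_omega {f g : G →ₗ[ℂ] A} (hf : IsLeg f) (hg : IsLeg g) (h : Comm f g) :
    tens f g 𝒞.omega = Rr 𝒢 f g * (conv f g (𝒞.κ : G) *
      (f ((𝒞.κ⁻¹ : Gˣ) : G) * g ((𝒞.κ⁻¹ : Gˣ) : G))) := by
  rw [Clebsch.omega, tens_mul hf hg h, tens_mul hf hg h, tens_tmul]
  rfl

variable [StarRing A] [StarModule ℂ A]

/-- The star reverses the two factors, and commutation of the legs restores their order; the twist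
by `P` is carried by `f` alone. -/
theorem star_tens {f g : G →ₗ[ℂ] A} (h : Comm f g) {P : A}
    (hf : ∀ x, star (f x) * P = P * f (star x)) (hg : ∀ x, star (g x) = g (star x))
    (hP : ∀ x, Commute (g x) P) (w : G ⊗[ℂ] G) :
    star (tens f g w) * P = P * tens f g (star w) := by
  induction w using TensorProduct.induction_on with
  | zero => simp
  | add x y hx hy => rw [map_add, star_add, add_mul, hx, hy, star_add, map_add, mul_add]
  | tmul a b =>
    rw [tens_tmul, star_mul, mul_assoc, hf, hg, ← mul_assoc, (hP _).eq, mul_assoc,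
      ← (h _ _).eq, TensorProduct.star_tmul, tens_tmul]

variable [Fintype Λ] [FiniteDimensional ℂ G] [IsSemisimpleRing G]

theorem isUnit_gramElt (n : ℕ) : IsUnit (S.gramElt 𝒞 n) := by
  induction n with
  | zero => exact isUnit_one
  | succ n ih =>
    exact ih.mul (isUnit_tens (S.isLeg_io n) (S.isLeg n) (S.comm_io le_rfl) 𝒞.isUnit_omega)

theorem κ_inv_commute {f : G →ₗ[ℂ] A} (hf : IsLeg f) (x : G) :
    Commute (f x) (f ((𝒞.κ⁻¹ : Gˣ) : G)) := by
  rw [Commute, SemiconjBy, ← hf.mul, ← hf.mul, 𝒞.κ_inv_central]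

theorem κ_commute {f : G →ₗ[ℂ] A} (hf : IsLeg f) (x : G) : Commute (f x) (f (𝒞.κ : G)) := by
  rw [Commute, SemiconjBy, ← hf.mul, ← hf.mul, 𝒞.κ_central]

variable (hstar : ∀ n x, star (S.s n x) = S.s n (star x))

include hstar

/-- The star flips each coproduct; the factor `R` in `ω` undoes the flip, and the `κ`-factors of `ω`
commute with the image of `io (n + 1)`. -/
theorem star_io (n : ℕ) (x : G) :
    star (S.io n x) * S.gramElt 𝒞 n = S.gramElt 𝒞 n * S.io n (star x) := by
  induction n generalizing x with
  | zero =>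
    rw [io, gramElt, mul_one, one_mul, unitLeg_apply, unitLeg_apply, Algebra.algebraMap_eq_smul_one,
      Algebra.algebraMap_eq_smul_one, star_smul, star_one, Irreps.counit_star 𝒯]
  | succ n ih =>
    have hP : ∀ y, Commute (S.s n y) (S.gramElt 𝒞 n) := fun y =>
      (S.gramElt_commute 𝒞 fun k hk z => S.comm k n (by omega) z y).symm
    have hio := S.isLeg_io n
    have hs := S.isLeg n
    have hc : Comm (S.io n) (S.s n) := S.comm_io le_rfl
    have hflip : tens (S.io n) (S.s n) (star (Coalgebra.comul (R := ℂ) x)) =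
        conv (S.s n) (S.io n) (star x) := by
      rw [conv_apply, 𝒢.comul_star, tens_flip hc.symm]
    have hk : ∀ y, Commute (conv (S.io n) (S.s n) y)
        (conv (S.io n) (S.s n) (𝒞.κ : G) *
          (S.io n ((𝒞.κ⁻¹ : Gˣ) : G) * S.s n ((𝒞.κ⁻¹ : Gˣ) : G))) := fun y =>
      (κ_commute 𝒞 (isLeg_conv hio hs hc) y).mul_right
        ((conv_commute (fun z => κ_inv_commute 𝒞 hio z) (fun z => (hc _ z).symm) y).mul_right
          (conv_commute (fun z => hc z _) (fun z => κ_inv_commute 𝒞 hs z) y))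
    rw [io, gramElt, conv_apply, ← mul_assoc, star_tens hc (ih) (hstar n) hP, hflip, mul_assoc,
      tens_omega 𝒞 hio hs hc, mul_assoc, mul_assoc, ← mul_assoc (conv _ _ _),
      ← Rr_mul_conv 𝒢 hio hs hc, mul_assoc, mul_assoc, (hk _).eq]
    simp only [mul_assoc]

include 𝒞 in
-- Write `ω = x^* x`; by `star_tens` the factor `x^*` can be moved in front of the Gram element of
-- the first `n` legs.
theorem exists_gramElt_eq (n : ℕ) : ∃ Y, S.gramElt 𝒞 n = star Y * Y := by
  induction n with
  | zero => exact ⟨1, by simp [gramElt]⟩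
  | succ n ih =>
    obtain ⟨Y, hY⟩ := ih
    obtain ⟨x, hx⟩ := 𝒞.exists_omega_eq
    have hP : ∀ y, Commute (S.s n y) (S.gramElt 𝒞 n) := fun y =>
      (S.gramElt_commute 𝒞 fun k hk z => S.comm k n (by omega) z y).symm
    refine ⟨Y * tens (S.io n) (S.s n) x, ?_⟩
    rw [gramElt, hx, tens_mul (S.isLeg_io n) (S.isLeg n) (S.comm_io le_rfl), ← mul_assoc,
      ← star_tens (S.comm_io le_rfl) (S.star_io 𝒞 hstar n) (hstar n) hP, hY, star_mul]
    simp only [mul_assoc]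

variable {a : G →ₗ[ℂ] A} (ha : IsLeg a) (hS : ∀ n, Comm a (S.s n))
  (hastar : ∀ x, star (a x) = a (star x))

include ha hS hastar

/-- The star inverts `R` and flips it, by `R^* = R'⁻¹`. After passing the Gram element of the first
`ν` legs, the element obtained is moved through the `R` of the last `ω` by `star_loop_group`; the
`κ`-factors of `ω` give the conjugation by `κ`. -/
theorem star_loopN_base (ν : ℕ) (N : Aˣ) (hN : (N : A) = loopN 𝒢 a (S.io ν) (S.s ν)) :
    star (N : A) * S.gramElt 𝒞 (ν + 1) = S.gramElt 𝒞 (ν + 1) *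
      (S.io (ν + 1) ((𝒞.κ⁻¹ : Gˣ) : G) * (Rr 𝒢 a (S.io (ν + 1)) * ((N⁻¹ : Aˣ) : A) *
        Ri 𝒢 a (S.io (ν + 1))) * S.io (ν + 1) (𝒞.κ : G)) := by
  have hφ := S.isLeg_io ν
  have hψ := S.isLeg ν
  have hφψ : Comm (S.io ν) (S.s ν) := S.comm_io le_rfl
  have haφ : Comm a (S.io ν) := fun x y =>
    (S.io_commute (fun k _ z => (hS k x z).symm) y).symm
  have haψ := hS ν
  have hι := isLeg_conv hφ hψ hφψ
  set P := S.gramElt 𝒞 ν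
  have hPa : ∀ x, Commute (a x) P := fun x =>
    (S.gramElt_commute 𝒞 fun k _ z => (hS k x z).symm).symm
  have hPψ : ∀ x, Commute (S.s ν x) P := fun x =>
    (S.gramElt_commute 𝒞 fun k hk z => S.comm k ν (by omega) z x).symm
  rw [gramElt, io]
  set φ := S.io ν with hφdef
  set ψ := S.s ν with hψdef
  have hst := star_tens haφ.symm (S.star_io 𝒞 hstar ν) hastar hPa
  have s1 : star (Rr 𝒢 φ a) * P = P * Ri 𝒢 a φ := by
    rw [Rr, hst, star_R 𝒞, tens_flip haφ.symm, Ri]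
  have s2 : star (Ri 𝒢 φ a) * P = P * Rr 𝒢 a φ := by
    rw [Ri, hst, star_Rinv 𝒞, tens_flip haφ.symm, Rr]
  have hst2 : ∀ w, star (tens a ψ w) = tens a ψ (star w) := fun w => by
    have := star_tens (P := 1) haψ (fun x => by rw [mul_one, one_mul, hastar]) (hstar ν)
      (fun x => Commute.one_right _) w
    rwa [mul_one, one_mul] at this
  have s3 : star (Qm 𝒢 a ψ) = Ri 𝒢 ψ a * Ri 𝒢 a ψ := by
    rw [Qm, star_mul, Rr, Rr, hst2, ← tens_flip haψ, hst2, star_R 𝒞, tens_flip haψ, ← tensorFlip_star,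
      star_R 𝒞, tensorFlip_tensorFlip]
    rfl
  have hs : star (N : A) * P = P * (Rr 𝒢 a φ * (Ri 𝒢 ψ a * Ri 𝒢 a ψ) * Ri 𝒢 a φ) := by
    have hc : Commute (Ri 𝒢 ψ a * Ri 𝒢 a ψ) P :=
      (Ri_commute hPψ hPa).mul_left (Ri_commute hPa hPψ)
    rw [hN, loopN, star_mul, star_mul, s3, mul_assoc, mul_assoc, s1, ← mul_assoc _ P, hc.eq,
      mul_assoc, ← mul_assoc, s2]
    simp only [mul_assoc]
  set aφ := Ru 𝒢 ha hφ haφ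
  set aψ := Ru 𝒢 ha hψ haψ
  set φψ := Ru 𝒢 hφ hψ hφψ
  set φa := Ru 𝒢 hφ ha haφ.symm
  set ψa := Ru 𝒢 hψ ha haψ.symm
  have hgrp := star_loop_group (aφ := aφ) (aψ := aψ) (φψ := φψ) (φa := φa) (ψa := ψa)
    (Units.ext (yang_baxter 𝒢 ha hφ hψ haφ haψ hφψ))
    (Units.ext (yang_baxter 𝒢 hφ hψ ha hφψ haφ.symm haψ.symm))
    (Units.ext (yang_baxter 𝒢 hφ ha hψ haφ.symm hφψ haψ))
  have hNu : N = φa * (ψa * aψ) * φa⁻¹ := Units.ext hN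
  have haι : Ru 𝒢 ha hι (haφ.conv_right haψ) = aψ * aφ :=
    Units.ext (Rr_conv_right 𝒢 ha haψ hφψ)
  rw [← hNu, ← haι] at hgrp
  have hgrp' := congrArg Units.val hgrp
  set T : A := Rr 𝒢 a (conv φ ψ) * ((N⁻¹ : Aˣ) : A) * Ri 𝒢 a (conv φ ψ) with hT
  have hg : Rr 𝒢 a φ * (Ri 𝒢 ψ a * Ri 𝒢 a ψ) * Ri 𝒢 a φ * Rr 𝒢 φ ψ = Rr 𝒢 φ ψ * T := by
    rw [mul_inv_rev] at hgrp'
    exact hgrp'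
  set k : A := φ ((𝒞.κ⁻¹ : Gˣ) : G) * ψ ((𝒞.κ⁻¹ : Gˣ) : G) with hk
  have hka : ∀ x, Commute (a x) k := fun x => (haφ x _).mul_right (haψ x _)
  have hkφ : ∀ x, Commute (φ x) k := fun x => (κ_inv_commute 𝒞 hφ x).mul_right (hφψ x _)
  have hkψ : ∀ x, Commute (ψ x) k := fun x => (hφψ _ x).symm.mul_right (κ_inv_commute 𝒞 hψ x)
  have hkι : ∀ x, Commute (conv φ ψ x) k := conv_commute hkφ hkψ
  have hkN : Commute (N : A) k := by rw [hN]; exact loopN_commute hka hkφ hkψ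
  have hkT : Commute T k :=
    ((Rr_commute hka hkι).mul_left hkN.units_inv_left).mul_left (Ri_commute hka hkι)
  have hκ : conv φ ψ (𝒞.κ : G) * conv φ ψ ((𝒞.κ⁻¹ : Gˣ) : G) = 1 := by
    rw [← hι.mul, Units.mul_inv, hι.one]
  rw [← mul_assoc, hs, tens_omega 𝒞 hφ hψ hφψ, ← hk]
  calc P * (Rr 𝒢 a φ * (Ri 𝒢 ψ a * Ri 𝒢 a ψ) * Ri 𝒢 a φ) *
        (Rr 𝒢 φ ψ * (conv φ ψ (𝒞.κ : G) * k))
      = P * (Rr 𝒢 a φ * (Ri 𝒢 ψ a * Ri 𝒢 a ψ) * Ri 𝒢 a φ * Rr 𝒢 φ ψ) *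
          (conv φ ψ (𝒞.κ : G) * k) := by simp only [mul_assoc]
    _ = P * Rr 𝒢 φ ψ * (k * T) * conv φ ψ (𝒞.κ : G) := by
        rw [hg, (hkι _).eq, ← hkT.eq]; simp only [mul_assoc]
    _ = P * Rr 𝒢 φ ψ * ((k * (conv φ ψ (𝒞.κ : G) * conv φ ψ ((𝒞.κ⁻¹ : Gˣ) : G))) * T) *
          conv φ ψ (𝒞.κ : G) := by rw [hκ, mul_one]
    _ = _ := by rw [← mul_assoc k, ← (hkι _).eq]; simp only [mul_assoc]; rfl

theorem star_loopN {ν n : ℕ} (h : ν < n) (N : Aˣ)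
    (hN : (N : A) = loopN 𝒢 a (S.io ν) (S.s ν)) :
    star (N : A) * S.gramElt 𝒞 n = S.gramElt 𝒞 n *
      (S.io n ((𝒞.κ⁻¹ : Gˣ) : G) * (Rr 𝒢 a (S.io n) * ((N⁻¹ : Aˣ) : A) *
        Ri 𝒢 a (S.io n)) * S.io n (𝒞.κ : G)) := by
  induction n, h using Nat.le_induction with
  | base => exact S.star_loopN_base 𝒞 hstar ha hS hastar ν N hN
  | succ n hn ih =>
    have hι := S.isLeg_io n
    have hs := S.isLeg n
    have hιs : Comm (S.io n) (S.s n) := S.comm_io le_rfl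
    have haι : Comm a (S.io n) := fun x y =>
      (S.io_commute (fun k _ z => (hS k x z).symm) y).symm
    have has := hS n
    have hι' := isLeg_conv hι hs hιs
    have hNs : ∀ x, Commute (N : A) (S.s n x) := fun x => by
      rw [hN]
      exact loopN_commute (fun z => hS n z x) (fun z => S.comm_io (by omega) z x)
        fun z => S.comm ν n (by omega) z x
    have hNι : ∀ x, Commute (N : A) (conv a (S.io n) x) := fun x => by
      rw [hN]
      exact S.loopN_commute_io ha hS (by omega) x
    rw [gramElt, io]
    set P := S.gramElt 𝒞 n
    set ι := S.io n with hιdef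
    set s := S.s n with hsdef
    set uaι := Ru 𝒢 ha hι haι
    set uas := Ru 𝒢 ha hs has
    set uιs := Ru 𝒢 hι hs hιs
    have hcomm : uas * uιs * N = N * (uas * uιs) := by
      refine Units.ext ?_
      have h2 : Commute (Rr 𝒢 (conv a ι) s) (N : A) :=
        Rr_commute (fun x => (hNι x).symm) fun x => (hNs x).symm
      rw [Rr_conv_left 𝒢 hs hιs] at h2
      exact h2.eq
    have hgrp := star_loop_group_step (aι := uaι) (as := uas) (ιs := uιs) (N := N)
      (Units.ext (yang_baxter 𝒢 ha hι hs haι has hιs)) hcomm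
    have haι' : Ru 𝒢 ha hι' (haι.conv_right has) = uas * uaι :=
      Units.ext (Rr_conv_right 𝒢 ha has hιs)
    rw [← haι'] at hgrp
    set T : A := Rr 𝒢 a ι * ((N⁻¹ : Aˣ) : A) * Ri 𝒢 a ι with hT
    set T' : A := Rr 𝒢 a (conv ι s) * ((N⁻¹ : Aˣ) : A) * Ri 𝒢 a (conv ι s) with hT'
    have hg : T * Rr 𝒢 ι s = Rr 𝒢 ι s * T' := congrArg Units.val hgrp
    set k := s ((𝒞.κ⁻¹ : Gˣ) : G) with hk
    set l := ι ((𝒞.κ⁻¹ : Gˣ) : G) with hl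
    have hkι : ∀ x, Commute (ι x) k := fun x => hιs x _
    have hks : ∀ x, Commute (s x) k := fun x => κ_inv_commute 𝒞 hs x
    have hlι : ∀ x, Commute (ι x) l := fun x => κ_inv_commute 𝒞 hι x
    have hls : ∀ x, Commute (s x) l := fun x => (hιs _ x).symm
    have hka : ∀ x, Commute (a x) k := fun x => has x _
    have hkT : Commute T k :=
      ((Rr_commute hka hkι).mul_left (hNs _).units_inv_left).mul_left (Ri_commute hka hkι)
    have hκ : conv ι s (𝒞.κ : G) * conv ι s ((𝒞.κ⁻¹ : Gˣ) : G) = 1 := by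
      rw [← hι'.mul, Units.mul_inv, hι'.one]
    have hκι : ι (𝒞.κ : G) * l = 1 := by
      rw [hl, ← hι.mul, Units.mul_inv, hι.one]
    have hlR : Commute (Rr 𝒢 ι s) l := Rr_commute hlι hls
    have hkR : Commute (Rr 𝒢 ι s) k := Rr_commute hkι hks
    have hlc : ∀ x, Commute (conv ι s x) l := conv_commute hlι hls
    have hkc : ∀ x, Commute (conv ι s x) k := conv_commute hkι hks
    rw [← mul_assoc, ih, tens_omega 𝒞 hι hs hιs, ← hk, ← hl]
    calc P * (l * T * ι (𝒞.κ : G)) * (Rr 𝒢 ι s * (conv ι s (𝒞.κ : G) * (l * k)))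
        = P * (l * T * ι (𝒞.κ : G)) * ((l * k) * (Rr 𝒢 ι s * conv ι s (𝒞.κ : G))) := by
          rw [← mul_assoc (Rr 𝒢 ι s), ((hlR.mul_right hkR).mul_left
            ((hlc _).mul_right (hkc _))).eq]
      _ = P * (l * (T * (ι (𝒞.κ : G) * l) * k) * (Rr 𝒢 ι s * conv ι s (𝒞.κ : G))) := by
          simp only [mul_assoc]
      _ = P * (l * k) * (T * Rr 𝒢 ι s) * conv ι s (𝒞.κ : G) := by
          rw [hκι, mul_one, hkT.eq]; simp only [mul_assoc]
      _ = P * ((l * k) * Rr 𝒢 ι s) * (conv ι s (𝒞.κ : G) * conv ι s ((𝒞.κ⁻¹ : Gˣ) : G)) * T' *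
            conv ι s (𝒞.κ : G) := by
          rw [hg, hκ, mul_one]; simp only [mul_assoc]
      _ = P * (Rr 𝒢 ι s * ((l * k) * conv ι s (𝒞.κ : G))) * conv ι s ((𝒞.κ⁻¹ : Gˣ) : G) * T' *
            conv ι s (𝒞.κ : G) := by
          rw [← (hlR.mul_right hkR).eq]; simp only [mul_assoc]
      _ = _ := by
          rw [← ((hlc _).mul_right (hkc _)).eq]; simp only [mul_assoc]

end LegSystem

end StarLegs

/-! ## The homomorphisms defined by systems of legs -/

section SystemHom

variable {G : Type*} [Ring G] [HopfAlgebra ℂ G] [StarRing G] [StarModule ℂ G] {Λ : Type*}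
  {𝒢 : RibbonStar G} {𝒯 : Irreps G Λ} (𝒞 : Clebsch 𝒢 𝒯)
  [Fintype Λ] [FiniteDimensional ℂ G] [IsSemisimpleRing G]
  {B : Type*} [Ring B] [Algebra ℂ B] {C : Type*} [Ring C] [Algebra ℂ C] {m : ℕ}

theorem tauLeg_zero : tauLeg 𝒯 𝒯.zero B = unitLeg := by
  ext x i j
  rw [tauLeg_apply, 𝒯.τ_zero, unitLeg_apply, scal_smul, Algebra.algebraMap_eq_smul_one]
  simp [Matrix.one_apply]

theorem rep2_zero_zero (x : (G ⊗[ℂ] G)) :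
    𝒯.rep2 𝒯.zero 𝒯.zero x = tens unitLeg unitLeg x := by
  have h := scal_rep2 𝒯 𝒯.zero 𝒯.zero (B := ℂ) x
  rw [tauLeg1, tauLeg2, tauLeg_zero, comp_unitLeg, comp_unitLeg] at h
  exact h

/-- The sign of the root is fixed by the normalization: `N_{00}^0 = 1`, so there is a map `C` with
`C C^* = κ_0`, whence `κ_0 ≥ 0`, while `|κ_0| = 1`. -/
theorem Clebsch.kap_zero [DecidableEq Λ] (hd : ∀ I, 0 < qdim 𝒢 𝒯 I) : 𝒞.kap 𝒯.zero = 1 := by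
  have hN := 𝒞.N_conj hd 𝒯.zero 𝒯.zero
  rw [conj_zero 𝒢 𝒯, if_pos rfl] at hN
  have hN' : 0 < 𝒞.N 𝒯.zero 𝒯.zero 𝒯.zero := Nat.pos_of_ne_zero fun h => by simp [h] at hN
  have hk := 𝒞.kap_ne_zero 𝒯.zero
  have h := 𝒞.normal_same 𝒯.zero 𝒯.zero 𝒯.zero ⟨0, hN'⟩ ⟨0, hN'⟩
  rw [if_pos rfl, rep2_zero_zero, tens_flip (comm_unitLeg_left _), ← Rr,
    Rr_unitLeg_left 𝒢 isLeg_unitLeg, Matrix.mul_one, mul_div_cancel_right₀ _ hk] at h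
  set X := 𝒞.C 𝒯.zero 𝒯.zero 𝒯.zero ⟨0, hN'⟩
  have i : Fin (𝒯.dim 𝒯.zero) := ⟨0, 𝒯.dim_pos _⟩
  have h0 : 0 ≤ 𝒞.kap 𝒯.zero := by
    have h1 := congrFun (congrFun h i) i
    rw [Matrix.smul_apply, Matrix.one_apply_eq, smul_eq_mul, mul_one] at h1
    rw [← h1, Matrix.mul_apply]
    exact Finset.sum_nonneg fun j _ => mul_star_self_nonneg _
  have h1 := 𝒞.kap_mul_star 𝒯.zero
  have h2 : star (𝒞.kap 𝒯.zero) = 𝒞.kap 𝒯.zero := (IsSelfAdjoint.of_nonneg h0).star_eq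
  rw [h2] at h1
  rcases mul_self_eq_one_iff.mp h1 with h3 | h3
  · exact h3
  · rw [h3] at h0
    exact absurd h0 (by rw [Complex.nonneg_iff]; norm_num)

theorem isGraphFamily_loopMat (hκ : 𝒞.kap 𝒯.zero = 1) (S : LegSystem G B) :
    IsGraphFamily 𝒞 (fun (ν : Fin m) J => (𝒞.kap J)⁻¹ • loopMat 𝒯 𝒢 S ν J) where
  trivial ν := by
    rw [hκ, inv_one, one_smul, loopMat, tauLeg_zero,
      loopN_unitLeg (isLeg_scalLeg 𝒯 _ (S.isLeg_io ν)) (isLeg_scalLeg 𝒯 _ (S.isLeg ν))]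
  functoriality ν I J := 𝒞.loopMat_functoriality S ν I J
  exchange ν μ h I J := by
    have h := loopMat_exchange 𝒯 (𝒢 := 𝒢) S (ν := (ν : ℕ)) (μ := (μ : ℕ)) h I J
    simp only [← leg1Hom_apply, ← leg2Hom_apply, map_smul, Matrix.mul_smul, Matrix.smul_mul] at h ⊢
    rw [smul_comm, h]

theorem slot_mul_loopMat (S : LegSystem G B) {ν n : ℕ} (h : ν < n) (J : Λ) (x : G) :
    Commute (𝒯.slot J (S.io n) (Coalgebra.comul (R := ℂ) x)) (loopMat 𝒯 𝒢 S ν J) := by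
  have h1 := (S.map (scalarHom (Fin (𝒯.dim J)) B)).loopN_commute_io (𝒢 := 𝒢) (isLeg_tauLeg 𝒯 J)
    (fun n => comm_tauLeg_scalLeg 𝒯 J (S.s n)) h x
  rw [LegSystem.map_io, LegSystem.map_io] at h1
  rw [slot_eq, ← conv_apply]
  exact h1.symm

/-- The homomorphism on `𝒮_m` defined by a system of legs, with `x ↦ io n x` on `G`. -/
def sysHom (hκ : 𝒞.kap 𝒯.zero = 1) (S : LegSystem G B) {n : ℕ} (h : m ≤ n) :
    SemiAlg 𝒞 m →ₐ[ℂ] B :=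
  semiLift (isGraphFamily_loopMat 𝒞 hκ S) (S.isLeg_io n) fun ν J x => by
    rw [Matrix.mul_smul, Matrix.smul_mul, (slot_mul_loopMat S (by omega) J x).eq]

variable {𝒞}

/-- A homomorphism given by a system of legs on the generators. -/
structure IsSysHom (F : SemiAlg 𝒞 m →ₐ[ℂ] B) (S : LegSystem G B) (n : ℕ) : Prop where
  map_ofG : ∀ x, F (ofG 𝒞 m x) = S.io n x
  map_mono : ∀ (ν : Fin m) (J : Λ), (mono 𝒞 ν J).map F = (𝒞.kap J)⁻¹ • loopMat 𝒯 𝒢 S ν J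

theorem isSysHom_sysHom (hκ : 𝒞.kap 𝒯.zero = 1) (S : LegSystem G B) {n : ℕ} (h : m ≤ n) :
    IsSysHom (sysHom 𝒞 hκ S h) S n where
  map_ofG _ := semiLift_ofG ..
  map_mono ν J := map_semiLift (isGraphFamily_loopMat 𝒞 hκ S) _ _ ν J

theorem map_matrix_smul (F : B →ₐ[ℂ] C) {k l : Type*} (c : ℂ) (X : Matrix k l B) :
    (c • X).map F = c • X.map F := by
  ext i j
  simp

namespace IsSysHom

variable {F : SemiAlg 𝒞 m →ₐ[ℂ] B} {S : LegSystem G B} {n : ℕ} (hF : IsSysHom F S n)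

include hF

theorem comp (F' : B →ₐ[ℂ] C) : IsSysHom (F'.comp F) (S.map F') n where
  map_ofG x := by rw [AlgHom.comp_apply, hF.map_ofG, S.map_io]; rfl
  map_mono ν J := by
    have h : (mono 𝒞 ν J).map (F'.comp F) = ((mono 𝒞 ν J).map F).map F' := rfl
    rw [h, hF.map_mono, map_matrix_smul, map_loopMat]

theorem map_cLoop (ν : Fin m) (I : Λ) : F (cLoop 𝒞 ν I) = S.s ν (zElt 𝒢 𝒯 I) := by
  rw [cLoop, map_smul, map_qtr, hF.map_mono, qtr_smul, qtr_loopMat,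
    smul_inv_smul₀ (𝒞.kap_ne_zero I)]

theorem map_cTotal (I : Λ) : F (cTotal 𝒞 m I) = S.io m (zElt 𝒢 𝒯 I) := by
  have h : ((List.ofFn fun ν : Fin m => mono 𝒞 ν I).reverse.prod).map F =
      (List.ofFn fun ν : Fin m => (𝒞.kap I)⁻¹ • loopMat 𝒯 𝒢 S ν I).reverse.prod := by
    have h1 := map_list_prod F.mapMatrix (List.ofFn fun ν : Fin m => mono 𝒞 ν I).reverse
    rw [List.map_reverse, List.map_ofFn] at h1
    refine h1.trans ?_
    congr 3
    exact funext fun ν => hF.map_mono ν I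
  rw [cTotal, map_smul, map_qtr, h, prod_loopMat, qtr_smul, qtr_Qm_io, smul_smul, ← mul_pow,
    mul_inv_cancel₀ (𝒞.kap_ne_zero I), one_pow, one_smul]

omit hF in
theorem map_charProj (F : B →ₗ[ℂ] C) (c : Λ → B) (K : Λ) :
    F (charProj 𝒢 𝒯 c K) = charProj 𝒢 𝒯 (fun I => F (c I)) K := by
  simp [charProj]

theorem map_chiLoop (ν : Fin m) (K : Λ) :
    F (chiLoop 𝒞 ν K) = S.s ν (charProj 𝒢 𝒯 (zElt 𝒢 𝒯) K) := by
  rw [chiLoop, map_charProj (S.s ν)]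
  exact (map_charProj F.toLinearMap _ K).trans
    (congrArg (fun c => charProj 𝒢 𝒯 c K) (funext fun I => hF.map_cLoop ν I))

theorem map_chiTotal (K : Λ) :
    F (chiTotal 𝒞 m K) = S.io m (charProj 𝒢 𝒯 (zElt 𝒢 𝒯) K) := by
  rw [chiTotal, map_charProj (S.io m)]
  exact (map_charProj F.toLinearMap _ K).trans
    (congrArg (fun c => charProj 𝒢 𝒯 c K) (funext fun I => hF.map_cTotal I))

/-- `c_ν^I` and `c_0^I` are mapped to the images of `z_I` under `s_ν` and `ι_m`, and the combination
`χ^0` of the `z_I` is the integral. -/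
theorem map_moduliUnit [DecidableEq Λ] (hd : ∀ I, 0 < qdim 𝒢 𝒯 I) (hS : IsUnit (SMatrix 𝒢 𝒯))
    (K : Fin m → Λ) : F (moduliUnit 𝒞 K) = S.io m 𝒯.haar *
      (List.ofFn fun ν : Fin m => S.s ν (charProj 𝒢 𝒯 (zElt 𝒢 𝒯) (K ν))).prod := by
  rw [moduliUnit, map_mul, hF.map_chiTotal, 𝒞.charProj_zero hd hS, map_list_prod, List.map_ofFn]
  congr 3
  exact funext fun ν => hF.map_chiLoop ν (K ν)

end IsSysHom

end SystemHom

/-! ## Operators on tensor products of representation spaces -/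

section Sites

variable {G : Type*} [Ring G] [HopfAlgebra ℂ G] [StarRing G] [StarModule ℂ G] {Λ : Type*}
  (𝒯 : Irreps G Λ) {m : ℕ} (K : Fin m → Λ)

theorem site_apply (ν : Fin m) (x : G) (p q : Idx 𝒯 K) [Decidable (∀ μ, μ ≠ ν → p μ = q μ)] :
    site 𝒯 K ν x p q = if ∀ μ, μ ≠ ν → p μ = q μ then 𝒯.τ (K ν) x (p ν) (q ν) else 0 := by
  rw [site, LinearMap.coe_mk, AddHom.coe_mk, Matrix.of_apply]
  congr

theorem sum_update {ν : Fin m} (p : Idx 𝒯 K) (f : Idx 𝒯 K → ℂ)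
    (hf : ∀ r, ¬ (∀ μ, μ ≠ ν → p μ = r μ) → f r = 0) :
    ∑ r, f r = ∑ j, f (Function.update p ν j) := by
  refine (Fintype.sum_of_injective (Function.update p ν) (Function.update_injective p ν) _ _
    (fun r hr => hf r fun h => hr ⟨r ν, ?_⟩) fun _ => rfl).symm
  funext μ
  by_cases hμ : μ = ν
  · subst hμ; simp
  · rw [Function.update_of_ne hμ, h μ hμ]

theorem site_mul_apply (ν : Fin m) (x : G) (X : Op 𝒯 K) (p q : Idx 𝒯 K) :
    (site 𝒯 K ν x * X) p q = ∑ j, 𝒯.τ (K ν) x (p ν) j * X (Function.update p ν j) q := by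
  classical
  rw [Matrix.mul_apply, sum_update 𝒯 K (ν := ν) p]
  · refine Finset.sum_congr rfl fun j _ => ?_
    rw [site_apply, if_pos fun μ hμ => by rw [Function.update_of_ne hμ], Function.update_self]
  · intro r hr
    rw [site_apply, if_neg hr, zero_mul]

theorem isLeg_site (ν : Fin m) : IsLeg (site 𝒯 K ν) where
  one := by
    classical
    ext p q
    rw [site_apply, map_one]
    by_cases h : p = q
    · subst h; simp
    · rw [Matrix.one_apply_ne h]
      split_ifs with h1
      · refine Matrix.one_apply_ne fun h2 => h (funext fun μ => ?_)
        by_cases hμ : μ = ν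
        · subst hμ; exact h2
        · exact h1 μ hμ
      · rfl
  mul x y := by
    classical
    ext p q
    rw [site_mul_apply, site_apply, map_mul, Matrix.mul_apply]
    have h : ∀ j, (∀ μ, μ ≠ ν → Function.update p ν j μ = q μ) ↔ ∀ μ, μ ≠ ν → p μ = q μ :=
      fun j => forall₂_congr fun μ hμ => by rw [Function.update_of_ne hμ]
    simp only [site_apply, h, Function.update_self]
    split_ifs <;> simp

/-- Operators at distinct sites multiply entrywise; this gives both their commutation and the matrix
units of the total algebra. -/
theorem prod_site_apply (x : Fin m → G) {l : List (Fin m)} (hl : l.Nodup)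
    (p q : Idx 𝒯 K) [Decidable (∀ μ, μ ∉ l → p μ = q μ)] :
    (l.map fun ν => site 𝒯 K ν (x ν)).prod p q =
      if ∀ μ, μ ∉ l → p μ = q μ then (l.map fun ν => 𝒯.τ (K ν) (x ν) (p ν) (q ν)).prod else 0 := by
  classical
  induction l generalizing p with
  | nil =>
    simp only [List.map_nil, List.prod_nil, List.not_mem_nil, not_false_eq_true, forall_const,
      ← funext_iff]
    exact Matrix.one_apply
  | cons ν l ih =>
    have hν := (List.nodup_cons.mp hl).1
    rw [List.map_cons, List.prod_cons, site_mul_apply, Finset.sum_eq_single (q ν)]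
    · rw [ih (List.nodup_cons.mp hl).2]
      have h : (∀ μ, μ ∉ l → Function.update p ν (q ν) μ = q μ) ↔
          ∀ μ, μ ∉ ν :: l → p μ = q μ := by
        refine ⟨fun h μ hμ => ?_, fun h μ hμ => ?_⟩
        · rw [List.mem_cons, not_or] at hμ
          rw [← h μ hμ.2, Function.update_of_ne hμ.1]
        · by_cases e : μ = ν
          · subst e; simp
          · rw [Function.update_of_ne e]
            exact h μ (by simp [e, hμ])
      have h' : (l.map fun κ => 𝒯.τ (K κ) (x κ) (Function.update p ν (q ν) κ) (q κ)) =
          l.map fun κ => 𝒯.τ (K κ) (x κ) (p κ) (q κ) :=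
        List.map_congr_left fun κ hκ => by
          have e : κ ≠ ν := fun e => hν (e ▸ hκ)
          rw [Function.update_of_ne e]
      simp only [h, h', List.map_cons, List.prod_cons]
      split_ifs <;> simp
    · intro j _ hj
      rw [ih (List.nodup_cons.mp hl).2, if_neg, mul_zero]
      intro h
      have := h ν hν
      rw [Function.update_self] at this
      exact hj this
    · simp

theorem comm_site {ν μ : Fin m} (h : ν ≠ μ) : Comm (site 𝒯 K ν) (site 𝒯 K μ) := fun x y => by
  classical
  have h1 : ∀ z : Fin m → G, Commute (site 𝒯 K ν (z ν)) (site 𝒯 K μ (z μ)) := fun z => by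
    ext p q
    have e1 := prod_site_apply 𝒯 K z (l := [ν, μ]) (by simp [h]) p q
    have e2 := prod_site_apply 𝒯 K z (l := [μ, ν]) (by simp [h.symm]) p q
    simp only [List.map_cons, List.map_nil, List.prod_cons, List.prod_nil, mul_one, List.mem_cons,
      List.not_mem_nil, or_false] at e1 e2
    rw [e1, e2]
    simp only [or_comm, mul_comm]
  simpa [h.symm] using h1 fun κ => if κ = ν then x else y

theorem star_site (ν : Fin m) (x : G) : star (site 𝒯 K ν x) = site 𝒯 K ν (star x) := by
  classical
  ext p q
  rw [Matrix.star_apply, site_apply, site_apply, map_star, Matrix.star_apply]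
  have h : (∀ μ, μ ≠ ν → q μ = p μ) ↔ ∀ μ, μ ≠ ν → p μ = q μ :=
    forall₂_congr fun _ _ => eq_comm
  simp only [h]
  split_ifs <;> simp

theorem site_of_scalar {ν : Fin m} {x : G} {c : ℂ} (h : 𝒯.τ (K ν) x = c • 1) :
    site 𝒯 K ν x = c • 1 := by
  classical
  ext p q
  rw [site_apply, h, ← (isLeg_site 𝒯 K ν).one, Matrix.smul_apply, Matrix.smul_apply, site_apply,
    map_one]
  split_ifs <;> simp

/-- The legs acting on the factors of `V^{K_1} ⊗ ⋯ ⊗ V^{K_m}`. -/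
def siteSystem : LegSystem G (Op 𝒯 K) where
  s n := if h : n < m then site 𝒯 K ⟨n, h⟩ else unitLeg
  isLeg n := by
    split_ifs
    · exact isLeg_site 𝒯 K _
    · exact isLeg_unitLeg
  comm n k h := by
    split_ifs
    · exact comm_site 𝒯 K (by simpa [Fin.ext_iff] using h)
    · exact comm_unitLeg_right _
    · exact comm_unitLeg_left _
    · exact comm_unitLeg_left _

theorem siteSystem_s (ν : Fin m) : (siteSystem 𝒯 K).s ν = site 𝒯 K ν := dif_pos ν.2

theorem star_siteSystem (n : ℕ) (x : G) :
    star ((siteSystem 𝒯 K).s n x) = (siteSystem 𝒯 K).s n (star x) := by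
  by_cases h : n < m
  · rw [siteSystem_s 𝒯 K ⟨n, h⟩]
    exact star_site 𝒯 K _ x
  · have e : (siteSystem 𝒯 K).s n = unitLeg := dif_neg h
    rw [e, unitLeg_apply, unitLeg_apply, Algebra.algebraMap_eq_smul_one,
      Algebra.algebraMap_eq_smul_one, star_smul, star_one, 𝒯.counit_star]

theorem io_siteSystem {n : ℕ} (h : n ≤ m) : (siteSystem 𝒯 K).io n = iota 𝒯 K n := by
  induction n with
  | zero => rfl
  | succ n ih =>
    rw [LegSystem.io, ih (by omega), iota, dif_pos (by omega : n < m),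
      ← siteSystem_s 𝒯 K ⟨n, h⟩]
    rfl

theorem gramElt_siteSystem [Fintype Λ] {𝒢 : RibbonStar G} {𝒯 : Irreps G Λ} (𝒞 : Clebsch 𝒢 𝒯)
    (K : Fin m → Λ) {n : ℕ} (h : n ≤ m) :
    (siteSystem 𝒯 K).gramElt 𝒞 n = gram 𝒞 K n := by
  induction n with
  | zero => rfl
  | succ n ih =>
    rw [LegSystem.gramElt, ih (by omega), gram, dif_pos (by omega : n < m),
      io_siteSystem 𝒯 K (by omega), siteSystem_s 𝒯 K ⟨n, h⟩]
    rfl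

end Sites

/-! ## The direct sum of all operator algebras -/

section TotalOp

/-- The product of systems of legs. -/
def LegSystem.pi {G : Type*} [Ring G] [HopfAlgebra ℂ G] {ι : Type*} {A : ι → Type*}
    [∀ i, Ring (A i)] [∀ i, Algebra ℂ (A i)] (S : ∀ i, LegSystem G (A i)) :
    LegSystem G (∀ i, A i) where
  s n := LinearMap.pi fun i => (S i).s n
  isLeg n := ⟨funext fun i => ((S i).isLeg n).one, fun x y => funext fun i =>
    ((S i).isLeg n).mul x y⟩
  comm n k h := fun x y => funext fun i => (S i).comm n k h x y

theorem LegSystem.pi_map {G : Type*} [Ring G] [HopfAlgebra ℂ G] {ι : Type*} {A : ι → Type*}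
    [∀ i, Ring (A i)] [∀ i, Algebra ℂ (A i)] (S : ∀ i, LegSystem G (A i)) (i : ι) :
    (LegSystem.pi S).map (Pi.evalAlgHom ℂ A i) = S i := rfl

variable {G : Type*} [Ring G] [HopfAlgebra ℂ G] [StarRing G] [StarModule ℂ G] {Λ : Type*}
  (𝒯 : Irreps G Λ) (m : ℕ)

/-- The operators on the direct sum of the spaces `V^{K_1} ⊗ ⋯ ⊗ V^{K_m}` which preserve the
summands. -/
abbrev TotalOp := ∀ K : Fin m → Λ, Op 𝒯 K

/-- The legs acting on the factors. -/
def totalSystem : LegSystem G (TotalOp 𝒯 m) := LegSystem.pi fun K => siteSystem 𝒯 K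

theorem star_totalSystem (n : ℕ) (x : G) :
    star ((totalSystem 𝒯 m).s n x) = (totalSystem 𝒯 m).s n (star x) :=
  funext fun K => star_siteSystem 𝒯 K n x

variable [Fintype Λ] [FiniteDimensional ℂ G] [IsSemisimpleRing G]

/-- A matrix unit of the block `K` is the product over the sites of matrix units of `G` with labels
`K_ν`; any other block is killed at a site where its label differs. -/
theorem total_eq_top {A : Subalgebra ℂ (TotalOp 𝒯 m)}
    (hA : ∀ ν < m, ∀ x, (totalSystem 𝒯 m).s ν x ∈ A) : A = ⊤ := by
  classical
  have h1 : ∀ (K : Fin m → Λ) (p q : Idx 𝒯 K), Pi.single K (Matrix.single p q 1) ∈ A := by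
    intro K p q
    let x : Fin m → G := fun ν => 𝒯.basis ⟨K ν, p ν, q ν⟩
    have h : ((List.finRange m).map fun ν : Fin m => (totalSystem 𝒯 m).s ν (x ν)).prod =
        Pi.single K (Matrix.single p q 1) := by
      funext K'
      have e : ((List.finRange m).map fun ν : Fin m => (totalSystem 𝒯 m).s ν (x ν)).prod K' =
          ((List.finRange m).map fun ν : Fin m => site 𝒯 K' ν (x ν)).prod := by
        have h := map_list_prod (Pi.evalAlgHom ℂ (fun K : Fin m → Λ => Op 𝒯 K) K')
          ((List.finRange m).map fun ν : Fin m => (totalSystem 𝒯 m).s ν (x ν))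
        rw [List.map_map] at h
        refine h.trans (congrArg List.prod (List.map_congr_left fun ν _ => ?_))
        change (siteSystem 𝒯 K').s ν (x ν) = _
        rw [siteSystem_s]
      rw [e]
      ext r s
      rw [prod_site_apply 𝒯 K' x (List.nodup_finRange m), if_pos (by simp)]
      by_cases hK : K = K'
      · subst hK
        rw [Pi.single_eq_same]
        simp only [x, 𝒯.τ_basis_self, Matrix.single_apply]
        by_cases hpq : p = r ∧ q = s
        · obtain ⟨rfl, rfl⟩ := hpq
          simp
        · rw [if_neg hpq, List.prod_eq_zero_iff, List.mem_map]
          have : ∃ ν, ¬ (p ν = r ν ∧ q ν = s ν) := by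
            by_contra! hc
            exact hpq ⟨funext fun ν => (hc ν).1, funext fun ν => (hc ν).2⟩
          obtain ⟨ν, hν⟩ := this
          exact ⟨ν, List.mem_finRange ν, if_neg hν⟩
      · rw [Pi.single_eq_of_ne (Ne.symm hK), Matrix.zero_apply, List.prod_eq_zero_iff,
          List.mem_map]
        obtain ⟨ν, hν⟩ := Function.ne_iff.mp hK
        exact ⟨ν, List.mem_finRange ν, by rw [𝒯.τ_basis_ne hν, Matrix.zero_apply]⟩
    rw [← h]
    refine A.list_prod_mem fun y hy => ?_
    obtain ⟨ν, _, rfl⟩ := List.mem_map.mp hy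
    exact hA ν ν.2 _
  refine eq_top_iff.mpr fun X _ => ?_
  have h2 : X = ∑ K, ∑ p, ∑ q, X K p q • Pi.single K (Matrix.single p q (1 : ℂ)) := by
    have h3 : ∀ K, (Pi.single K (X K) : TotalOp 𝒯 m) =
        ∑ p, ∑ q, X K p q • Pi.single K (Matrix.single p q (1 : ℂ)) := fun K => by
      conv_lhs => rw [Matrix.matrix_eq_sum_single (X K)]
      rw [← LinearMap.single_apply (R := ℂ), map_sum]
      refine Finset.sum_congr rfl fun p _ => ?_
      rw [map_sum]
      refine Finset.sum_congr rfl fun q _ => ?_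
      rw [← LinearMap.single_apply (R := ℂ), ← map_smul, Matrix.smul_single, smul_eq_mul, mul_one]
    rw [← Finset.sum_congr rfl fun K _ => h3 K]
    exact (Finset.univ_sum_single X).symm
  rw [h2]
  exact A.sum_mem fun K _ => A.sum_mem fun p _ => A.sum_mem fun q _ => A.smul_mem (h1 K p q) _

/-- `∑_K ∏_ν dim(K_ν)² = (∑_I dim(I)²)^m`. -/
theorem finrank_total : Module.finrank ℂ (TotalOp 𝒯 m) = Module.finrank ℂ G ^ m := by
  classical
  rw [Module.finrank_eq_card_basis 𝒯.basis, Module.finrank_pi_fintype]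
  simp only [Module.finrank_matrix, Module.finrank_self, mul_one, Fintype.card_sigma,
    Fintype.card_prod, Fintype.card_fin, Fintype.card_pi, ← Finset.prod_mul_distrib]
  rw [Fintype.sum_pow]

end TotalOp

/-! ## The legs are generated by the monodromies -/

section Generation

variable {G : Type*} [Ring G] [HopfAlgebra ℂ G] {B : Type*} [Ring B] [Algebra ℂ B]
  {A : Subalgebra ℂ B}

theorem tens_mem {f g : G →ₗ[ℂ] B} (hf : ∀ x, f x ∈ A) (hg : ∀ x, g x ∈ A) (w : G ⊗[ℂ] G) :
    tens f g w ∈ A := by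
  induction w using TensorProduct.induction_on with
  | zero => rw [map_zero]; exact A.zero_mem
  | add x y hx hy => rw [map_add]; exact A.add_mem hx hy
  | tmul x y => exact A.mul_mem (hf x) (hg y)

theorem LegSystem.io_mem (S : LegSystem G B) {n : ℕ} (h : ∀ ν < n, ∀ x, S.s ν x ∈ A) (x : G) :
    S.io n x ∈ A := by
  induction n generalizing x with
  | zero => exact A.algebraMap_mem _
  | succ n ih => exact tens_mem (fun y => ih (fun ν hν => h ν (by omega)) y) (h n (by omega)) _

variable [StarRing G] [StarModule ℂ G] {Λ : Type*} (𝒯 : Irreps G Λ)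

theorem tauLeg_mem (J : Λ) (x : G) : tauLeg 𝒯 J B x ∈ A.matrix := fun _ _ => A.algebraMap_mem _

theorem scalLeg_mem (J : Λ) {φ : G →ₗ[ℂ] B} (h : ∀ x, φ x ∈ A) (x : G) :
    scalLeg 𝒯 J φ x ∈ A.matrix := fun i j => by
  rw [scalLeg_apply, Matrix.diagonal_apply]
  split_ifs
  · exact h x
  · exact A.zero_mem

theorem slot_apply (J : Λ) (φ : G →ₗ[ℂ] B) (x : G ⊗[ℂ] G) (i j : Fin (𝒯.dim J)) :
    𝒯.slot J φ x i j = φ (slice (𝒯.entry J i j) x) := by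
  induction x using TensorProduct.induction_on with
  | zero => simp [Irreps.slot]
  | add x y hx hy => rw [slot_add, Matrix.add_apply, hx, hy, map_add, map_add]
  | tmul x y => rw [slot_tmul, slice_tmul, map_smul]; rfl

variable [Fintype Λ] [FiniteDimensional ℂ G] [IsSemisimpleRing G]

theorem slice_eq_sum (t : G →ₗ[ℂ] ℂ) (x : G ⊗[ℂ] G) :
    slice t x = ∑ p, t (𝒯.basis p) • slice (𝒯.entry p.1 p.2.1 p.2.2) x := by
  induction x using TensorProduct.induction_on with
  | zero => simp
  | add x y hx hy => simp only [map_add, smul_add, Finset.sum_add_distrib, hx, hy]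
  | tmul x y =>
    simp only [slice_tmul, smul_smul, ← Finset.sum_smul]
    congr 1
    conv_lhs => rw [← 𝒯.basis.sum_repr x, map_sum]
    refine Finset.sum_congr rfl fun p _ => ?_
    rw [map_smul, smul_eq_mul, mul_comm, 𝒯.basis_repr]
    rfl

variable [DecidableEq Λ] {𝒢 : RibbonStar G} {𝒯} (𝒞 : Clebsch 𝒢 𝒯)

include 𝒞 in
-- By induction the legs before `ν` lie in `A`, so the dressing of the monodromy can be removed. The
-- entries of `(τ^J ⊗ s_ν)(R'R)` are the images under `s_ν` of slices of `R'R`, and by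
-- factorizability slices exhaust `G`.
theorem LegSystem.mem_of_loopMat (hd : ∀ I, 0 < qdim 𝒢 𝒯 I) (hS : IsUnit (SMatrix 𝒢 𝒯))
    (S : LegSystem G B) {m : ℕ}
    (h : ∀ ν < m, ∀ J, loopMat 𝒯 𝒢 S ν J ∈ A.matrix) : ∀ ν < m, ∀ x, S.s ν x ∈ A := by
  intro ν
  induction ν using Nat.strong_induction_on with
  | _ ν ih =>
    intro hν x
    have hio : ∀ x, S.io ν x ∈ A := S.io_mem fun k hk => ih k hk (by omega)
    have hQ : ∀ J, Qm 𝒢 (tauLeg 𝒯 J B) (scalLeg 𝒯 J (S.s ν)) ∈ A.matrix := fun J => by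
      have hφ := isLeg_scalLeg 𝒯 J (S.isLeg_io ν)
      have ha := isLeg_tauLeg 𝒯 J (B := B)
      have hc := (comm_tauLeg_scalLeg 𝒯 J (S.io ν)).symm
      have e : Qm 𝒢 (tauLeg 𝒯 J B) (scalLeg 𝒯 J (S.s ν)) =
          Ri 𝒢 (scalLeg 𝒯 J (S.io ν)) (tauLeg 𝒯 J B) * loopMat 𝒯 𝒢 S ν J *
            Rr 𝒢 (scalLeg 𝒯 J (S.io ν)) (tauLeg 𝒯 J B) := by
        have h1 := Ri_mul_Rr 𝒢 hφ ha hc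
        rw [loopMat, loopN]
        simp only [mul_assoc]
        rw [h1, mul_one, ← mul_assoc, h1, one_mul]
      rw [e]
      exact mul_mem (mul_mem (tens_mem (scalLeg_mem 𝒯 J hio) (tauLeg_mem 𝒯 J) _) (h ν hν J))
        (tens_mem (scalLeg_mem 𝒯 J hio) (tauLeg_mem 𝒯 J) _)
    obtain ⟨t, rfl⟩ := 𝒞.exists_slice_eq hd hS x
    rw [slice_eq_sum 𝒯, map_sum]
    refine A.sum_mem fun p _ => ?_
    rw [map_smul, ← slot_apply, slot_eq, ← Qm_eq_tens 𝒢 (isLeg_tauLeg 𝒯 _)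
      (isLeg_scalLeg 𝒯 _ (S.isLeg ν)) (comm_tauLeg_scalLeg 𝒯 _ _)]
    exact A.smul_mem (hQ p.1 p.2.1 p.2.2) _

end Generation

/-! ## Ordered products of submodules of an algebra -/

section OrderedProducts

variable {B : Type*} [Ring B] [Algebra ℂ B]

/-- The product `U 0 ⋯ U (n - 1)`. -/
def orderedProd (U : ℕ → Submodule ℂ B) : ℕ → Submodule ℂ B
  | 0 => 1
  | n + 1 => orderedProd U n * U n

variable {U : ℕ → Submodule ℂ B}

theorem mul_orderedProd_le {W : Submodule ℂ B} {n : ℕ} (h : ∀ k < n, W * U k ≤ U k * W) :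
    W * orderedProd U n ≤ orderedProd U n * W := by
  induction n with
  | zero => rw [orderedProd, mul_one, one_mul]
  | succ n ih =>
    rw [orderedProd]
    calc W * (orderedProd U n * U n) = W * orderedProd U n * U n := (mul_assoc _ _ _).symm
      _ ≤ orderedProd U n * W * U n := mul_le_mul_left (ih fun k hk => h k (by omega)) _
      _ = orderedProd U n * (W * U n) := mul_assoc _ _ _
      _ ≤ orderedProd U n * (U n * W) := mul_le_mul_right (h n (by omega)) _
      _ = _ := (mul_assoc _ _ _).symm

theorem one_le_orderedProd (h1 : ∀ k, 1 ≤ U k) (n : ℕ) : 1 ≤ orderedProd U n := by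
  induction n with
  | zero => exact le_rfl
  | succ n ih => calc (1 : Submodule ℂ B) = 1 * 1 := (one_mul 1).symm
      _ ≤ _ := mul_le_mul' ih (h1 n)

theorem le_orderedProd (h1 : ∀ k, 1 ≤ U k) {k n : ℕ} (h : k < n) : U k ≤ orderedProd U n := by
  induction n, h using Nat.le_induction with
  | base => calc U k = 1 * U k := (one_mul _).symm
      _ ≤ _ := mul_le_mul_left (one_le_orderedProd h1 k) _
  | succ n _ ih => calc U k ≤ orderedProd U n := ih
      _ = orderedProd U n * 1 := (mul_one _).symm
      _ ≤ _ := mul_le_mul_right (h1 n) _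

/-- If each factor is closed under products and can be moved past the earlier ones, the ordered
monomials form an algebra. -/
theorem orderedProd_mul_self_le (h2 : ∀ k, U k * U k ≤ U k)
    (h3 : ∀ i j, i < j → U j * U i ≤ U i * U j) (n : ℕ) :
    orderedProd U n * orderedProd U n ≤ orderedProd U n := by
  induction n with
  | zero => rw [orderedProd, one_mul]
  | succ n ih =>
    rw [orderedProd]
    calc orderedProd U n * U n * (orderedProd U n * U n)
        = orderedProd U n * (U n * orderedProd U n) * U n := by simp only [mul_assoc]
      _ ≤ orderedProd U n * (orderedProd U n * U n) * U n :=
          mul_le_mul_left (mul_le_mul_right (mul_orderedProd_le fun k hk => h3 k n hk) _) _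
      _ = orderedProd U n * orderedProd U n * (U n * U n) := by simp only [mul_assoc]
      _ ≤ _ := mul_le_mul' ih (h2 n)

theorem exists_span_mul {V W : Submodule ℂ B} {a b : ℕ}
    (hV : ∃ s : Finset B, s.card ≤ a ∧ Submodule.span ℂ (s : Set B) = V)
    (hW : ∃ s : Finset B, s.card ≤ b ∧ Submodule.span ℂ (s : Set B) = W) :
    ∃ s : Finset B, s.card ≤ a * b ∧ Submodule.span ℂ (s : Set B) = V * W := by
  classical
  obtain ⟨s, hs, rfl⟩ := hV
  obtain ⟨t, ht, rfl⟩ := hW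
  refine ⟨Finset.image₂ (· * ·) s t, (Finset.card_image₂_le _ _ _).trans (Nat.mul_le_mul hs ht), ?_⟩
  rw [Submodule.span_mul_span, Finset.coe_image₂, Set.image2_mul]

theorem exists_span_orderedProd {d n : ℕ}
    (h : ∀ k < n, ∃ s : Finset B, s.card ≤ d ∧ Submodule.span ℂ (s : Set B) = U k) :
    ∃ s : Finset B, s.card ≤ d ^ n ∧ Submodule.span ℂ (s : Set B) = orderedProd U n := by
  induction n with
  | zero => exact ⟨{1}, by simp, by rw [Finset.coe_singleton, orderedProd, Submodule.one_eq_span]⟩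
  | succ n ih => exact exists_span_mul (ih fun k hk => h k (by omega)) (h n (by omega))

theorem exists_span_range {ι : Type*} [Fintype ι] (f : ι → B) :
    ∃ s : Finset B, s.card ≤ Fintype.card ι ∧
      Submodule.span ℂ (s : Set B) = Submodule.span ℂ (Set.range f) := by
  classical
  exact ⟨Finset.univ.image f, Finset.card_image_le, by simp⟩

theorem matrix_mul_mem {U V : Submodule ℂ B} {k l n : Type*} [Fintype l] {X : Matrix k l B}
    {Y : Matrix l n B} (hX : ∀ i j, X i j ∈ U) (hY : ∀ i j, Y i j ∈ V) (i : k) (j : n) :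
    (X * Y) i j ∈ U * V := by
  rw [Matrix.mul_apply]
  exact Submodule.sum_mem _ fun x _ => Submodule.mul_mem_mul (hX i x) (hY x j)

theorem scal_mem_one {k l : Type*} (X : Matrix k l ℂ) (i : k) (j : l) :
    scal B X i j ∈ (1 : Submodule ℂ B) := Submodule.algebraMap_mem _

theorem scal_mul_mem {U : Submodule ℂ B} {k l n : Type*} [Fintype l] (X : Matrix k l ℂ)
    {Y : Matrix l n B} (hY : ∀ i j, Y i j ∈ U) (i : k) (j : n) : (scal B X * Y) i j ∈ U := by
  rw [← one_mul U]
  exact matrix_mul_mem (scal_mem_one X) hY i j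

theorem mul_scal_mem {U : Submodule ℂ B} {k l n : Type*} [Fintype l] {X : Matrix k l B}
    (Y : Matrix l n ℂ) (hX : ∀ i j, X i j ∈ U) (i : k) (j : n) : (X * scal B Y) i j ∈ U := by
  rw [← mul_one U]
  exact matrix_mul_mem hX (scal_mem_one Y) i j

end OrderedProducts

/-! ## Reordering identities -/

section Reorder

variable {G : Type*} [Ring G] [HopfAlgebra ℂ G] [StarRing G] [StarModule ℂ G] {Λ : Type*}
  {𝒢 : RibbonStar G} {A : Type*} [Ring A] [Algebra ℂ A]

/-- The map `x ⊗ y ↦ f(x) Y g(y)`. -/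
def surround (f : G →ₗ[ℂ] A) (Y : A) (g : G →ₗ[ℂ] A) : G ⊗[ℂ] G →ₗ[ℂ] A :=
  tens (LinearMap.mulRight ℂ Y ∘ₗ f) g

theorem surround_tmul (f : G →ₗ[ℂ] A) (Y : A) (g : G →ₗ[ℂ] A) (x y : G) :
    surround f Y g (x ⊗ₜ y) = f x * Y * g y := rfl

theorem surround_zero (f g : G →ₗ[ℂ] A) (w : G ⊗[ℂ] G) : surround f 0 g w = 0 := by
  induction w using TensorProduct.induction_on with
  | zero => rw [map_zero]
  | add x y hx hy => rw [map_add, hx, hy, add_zero]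
  | tmul x y => rw [surround_tmul, mul_zero, zero_mul]

theorem surround_add (f g : G →ₗ[ℂ] A) (Y Z : A) (w : G ⊗[ℂ] G) :
    surround f (Y + Z) g w = surround f Y g w + surround f Z g w := by
  induction w using TensorProduct.induction_on with
  | zero => simp
  | add x y hx hy => rw [map_add, map_add, map_add, hx, hy]; abel
  | tmul x y => simp only [surround_tmul, mul_add, add_mul]

theorem surround_mul_mul {f g : G →ₗ[ℂ] A} {a b : A} (ha : ∀ x, Commute (f x) a)
    (hb : ∀ x, Commute (g x) b) (Y : A) (w : G ⊗[ℂ] G) :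
    surround f (a * Y * b) g w = a * surround f Y g w * b := by
  induction w using TensorProduct.induction_on with
  | zero => simp
  | add x y hx hy => rw [map_add, map_add, hx, hy, mul_add, add_mul]
  | tmul x y =>
    rw [surround_tmul, surround_tmul, ← mul_assoc, ← mul_assoc, (ha x).eq, mul_assoc _ b,
      ← (hb y).eq]
    simp only [mul_assoc]

/-- The antipode makes surrounding by `w` a right multiplication by `w` inside `G ⊗ G`, so a factor
`R` or `R⁻¹` in the middle can be cancelled. -/
theorem surround_antip_left {f g : G →ₗ[ℂ] A} (hf : IsLeg f) (hg : IsLeg g) (x w : G ⊗[ℂ] G) :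
    surround (antip f) (tens f g (TensorProduct.map (HopfAlgebra.antipode ℂ) LinearMap.id x)) g w =
      tens (antip f) g (x * w) := by
  induction x using TensorProduct.induction_on with
  | zero => rw [map_zero, map_zero, surround_zero, zero_mul, map_zero]
  | add x y hx hy => rw [map_add, map_add, add_mul, map_add, surround_add, hx, hy]
  | tmul x y =>
    induction w using TensorProduct.induction_on with
    | zero => simp
    | add x y hx hy => rw [map_add, hx, hy, mul_add, map_add]
    | tmul z t =>
      rw [surround_tmul, TensorProduct.map_tmul, tens_tmul, Algebra.TensorProduct.tmul_mul_tmul,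
        tens_tmul, antip_apply, antip_apply, HopfAlgebra.antipode_mul_antidistrib, hf.mul, hg.mul]
      simp only [mul_assoc, LinearMap.id_apply]

theorem surround_antip_right {f g : G →ₗ[ℂ] A} (hf : IsLeg f) (hg : IsLeg g) (h : Comm f g)
    (x w : G ⊗[ℂ] G) :
    surround (antip g) (tens f g (TensorProduct.map LinearMap.id (HopfAlgebra.antipode ℂ) x)) f
        (tensorFlip w) =
      tens f (antip g) (x * w) := by
  have e : ∀ y : G ⊗[ℂ] G, tens f g (TensorProduct.map LinearMap.id (HopfAlgebra.antipode ℂ) y) =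
      tens g f (TensorProduct.map (HopfAlgebra.antipode ℂ) LinearMap.id (tensorFlip y)) := fun y => by
    induction y using TensorProduct.induction_on with
    | zero => simp [tensorFlip]
    | add x y hx hy =>
      have : tensorFlip (x + y) = tensorFlip x + tensorFlip y := map_add _ _ _
      rw [this, map_add, map_add, hx, hy, map_add, map_add]
    | tmul x y => exact (h _ _).eq
  have e2 : tensorFlip x * tensorFlip w = tensorFlip (x * w) :=
    (map_mul (Algebra.TensorProduct.comm ℂ G G) x w).symm
  rw [e, surround_antip_left hg hf, e2]
  exact tens_flip (fun a b => h b (HopfAlgebra.antipode ℂ a) |>.symm) _ |>.trans (by rfl)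

variable [FiniteDimensional ℂ G]

/-- Recovers `X₁X₂` from `X₁RX₂`, and so turns functoriality into a formula for products of matrix
elements. -/
theorem surround_R {f g : G →ₗ[ℂ] A} (hf : IsLeg f) (hg : IsLeg g) (h : Comm f g) {a b : A}
    (ha : ∀ x, Commute (g x) a) (hb : ∀ x, Commute (f x) b) :
    surround (antip g) (a * Rr 𝒢 f g * b) f (tensorFlip (𝒢.R : G ⊗[ℂ] G)) = a * b := by
  have h1 := surround_antip_right hf hg h 𝒢.Rinv (𝒢.R : G ⊗[ℂ] G)
  rw [map_id_antipode_Rinv, Units.inv_mul, Algebra.TensorProduct.one_def, tens_tmul, antip_apply,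
    HopfAlgebra.antipode_one, hf.one, hg.one, one_mul] at h1
  rw [surround_mul_mul (f := antip g) (fun x => ha _) hb, Rr, h1, mul_one]

/-- The counterpart for `X₂R⁻¹X₁`, the combination occurring in the exchange relations. -/
theorem surround_Rinv {f g : G →ₗ[ℂ] A} (hf : IsLeg f) (hg : IsLeg g) {a b : A}
    (ha : ∀ x, Commute (f x) a) (hb : ∀ x, Commute (g x) b) :
    surround (antip f) (a * Ri 𝒢 f g * b) g 𝒢.Rinv = a * b := by
  have h1 := surround_antip_left hf hg (𝒢.R : G ⊗[ℂ] G) 𝒢.Rinv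
  rw [← Rinv_eq_map_antipode, Units.mul_inv, Algebra.TensorProduct.one_def, tens_tmul, antip_apply,
    HopfAlgebra.antipode_one, hf.one, hg.one, one_mul] at h1
  rw [surround_mul_mul (f := antip f) (fun x => ha _) hb, Ri, h1, mul_one]

end Reorder

/-! ## Ordered monomials span the graph algebra and the semi-direct product -/

section Spanning

variable {G : Type*} [Ring G] [HopfAlgebra ℂ G] [StarRing G] [StarModule ℂ G] {Λ : Type*}
  [Fintype Λ] {𝒢 : RibbonStar G} {𝒯 : Irreps G Λ} {𝒞 : Clebsch 𝒢 𝒯} {B : Type*} [Ring B]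
  [Algebra ℂ B] {C : Type*} [Ring C] [Algebra ℂ C] {m : ℕ}

theorem IsGraphFamily.map {M : ∀ (_ : Fin m) (J : Λ), 𝒯.Mat J B} (hM : IsGraphFamily 𝒞 M)
    (F : B →ₐ[ℂ] C) : IsGraphFamily 𝒞 fun ν J => (M ν J).map F where
  trivial ν := by rw [hM.trivial]; simp
  functoriality ν I J := by
    rw [← leg1_map, ← leg2_map, ← scal_map F, ← Matrix.map_mul, ← Matrix.map_mul,
      hM.functoriality, map_fusion_sum]
  exchange ν μ h I J := by
    simp only [← leg1_map, ← leg2_map, ← scal_map F, ← Matrix.map_mul]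
    rw [hM.exchange ν μ h]

variable (𝒞) in
theorem isGraphFamily_mono : IsGraphFamily 𝒞 fun (ν : Fin m) J => mono 𝒞 ν J :=
  (isGraphFamily_graphM 𝒞).map (ofL 𝒞 m)

/-- The span of the matrix elements of the monodromy number `n`. -/
def entrySpan (M : ∀ (_ : Fin m) (J : Λ), 𝒯.Mat J B) (n : ℕ) : Submodule ℂ B :=
  if h : n < m then Submodule.span ℂ (Set.range fun p : (Σ I : Λ, Fin (𝒯.dim I) × Fin (𝒯.dim I)) =>
    M ⟨n, h⟩ p.1 p.2.1 p.2.2) else 1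

variable (M : ∀ (_ : Fin m) (J : Λ), 𝒯.Mat J B)

theorem entrySpan_eq (ν : Fin m) : entrySpan M ν = Submodule.span ℂ
    (Set.range fun p : (Σ I : Λ, Fin (𝒯.dim I) × Fin (𝒯.dim I)) => M ν p.1 p.2.1 p.2.2) :=
  dif_pos ν.2

theorem entry_mem (ν : Fin m) (J : Λ) (i j : Fin (𝒯.dim J)) : M ν J i j ∈ entrySpan M ν := by
  rw [entrySpan_eq]
  exact Submodule.subset_span ⟨⟨J, i, j⟩, rfl⟩

theorem entrySpan_mul_le (ν μ : Fin m) {W : Submodule ℂ B}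
    (h : ∀ I J i j k l, M ν I i j * M μ J k l ∈ W) : entrySpan M ν * entrySpan M μ ≤ W := by
  rw [entrySpan_eq, entrySpan_eq, Submodule.span_mul_span, Submodule.span_le]
  rintro _ ⟨_, ⟨p, rfl⟩, _, ⟨q, rfl⟩, rfl⟩
  exact h _ _ _ _ _ _

theorem leg1_mul_leg2_apply {I J : Λ} (X : 𝒯.Mat I B) (Y : 𝒯.Mat J B)
    (p q : Fin (𝒯.dim I) × Fin (𝒯.dim J)) :
    (leg1 𝒯 J X * leg2 𝒯 I Y) p q = X p.1 q.1 * Y p.2 q.2 := by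
  simp [leg1, leg2, Matrix.mul_apply, Fintype.sum_prod_type, Matrix.one_apply]

theorem leg2_mul_leg1_apply {I J : Λ} (X : 𝒯.Mat I B) (Y : 𝒯.Mat J B)
    (p q : Fin (𝒯.dim I) × Fin (𝒯.dim J)) :
    (leg2 𝒯 I Y * leg1 𝒯 J X) p q = Y p.2 q.2 * X p.1 q.1 := by
  simp [leg1, leg2, Matrix.mul_apply, Fintype.sum_prod_type, Matrix.one_apply]

theorem leg1_mem {U : Submodule ℂ B} {I : Λ} (J : Λ) {X : 𝒯.Mat I B} (hX : ∀ i j, X i j ∈ U)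
    (p q) : leg1 𝒯 J X p q ∈ U := by
  rw [leg1, Matrix.kroneckerMap_apply, Matrix.one_apply]
  split_ifs
  · rw [mul_one]; exact hX _ _
  · rw [mul_zero]; exact U.zero_mem

theorem leg2_mem {U : Submodule ℂ B} (I : Λ) {J : Λ} {X : 𝒯.Mat J B} (hX : ∀ i j, X i j ∈ U)
    (p q) : leg2 𝒯 I X p q ∈ U := by
  rw [leg2, Matrix.kroneckerMap_apply, Matrix.one_apply]
  split_ifs
  · rw [one_mul]; exact hX _ _
  · rw [zero_mul]; exact U.zero_mem

theorem tauLeg2_commute_leg1 {I J : Λ} (X : 𝒯.Mat I B) (x : G) :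
    Commute (tauLeg2 𝒯 I J B x) (leg1 𝒯 J X) := by
  ext p q
  rw [tauLeg2, LinearMap.comp_apply]
  change (leg2 𝒯 I (tauLeg 𝒯 J B x) * leg1 𝒯 J X) p q =
    (leg1 𝒯 J X * leg2 𝒯 I (tauLeg 𝒯 J B x)) p q
  rw [leg2_mul_leg1_apply, leg1_mul_leg2_apply]
  exact Algebra.commutes _ _

theorem tauLeg1_commute_leg2 {I J : Λ} (X : 𝒯.Mat J B) (x : G) :
    Commute (tauLeg1 𝒯 I J B x) (leg2 𝒯 I X) := by
  ext p q
  rw [tauLeg1, LinearMap.comp_apply]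
  change (leg1 𝒯 J (tauLeg 𝒯 I B x) * leg2 𝒯 I X) p q =
    (leg2 𝒯 I X * leg1 𝒯 J (tauLeg 𝒯 I B x)) p q
  rw [leg2_mul_leg1_apply, leg1_mul_leg2_apply]
  exact Algebra.commutes _ _

theorem surround_entry_mem {U : Submodule ℂ B} {n : Type*} [Fintype n] [DecidableEq n]
    {Y : Matrix n n B} (hY : ∀ i j, Y i j ∈ U) {f g : G →ₗ[ℂ] Matrix n n B}
    (hf : ∀ x, ∃ X : Matrix n n ℂ, f x = scal B X) (hg : ∀ x, ∃ X : Matrix n n ℂ, g x = scal B X)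
    (w : G ⊗[ℂ] G) (i j : n) : surround f Y g w i j ∈ U := by
  induction w using TensorProduct.induction_on with
  | zero => rw [map_zero]; exact U.zero_mem
  | add x y hx hy => rw [map_add]; exact U.add_mem hx hy
  | tmul x y =>
    obtain ⟨X, hX⟩ := hf x
    obtain ⟨Z, hZ⟩ := hg y
    rw [surround_tmul, hX, hZ]
    exact mul_scal_mem Z (scal_mul_mem X hY) i j

theorem tauLeg1_eq_scal (I J : Λ) (x : G) :
    ∃ X : Matrix (Fin (𝒯.dim I) × Fin (𝒯.dim J)) (Fin (𝒯.dim I) × Fin (𝒯.dim J)) ℂ,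
      tauLeg1 𝒯 I J B x = scal B X := by
  refine ⟨𝒯.τ I x ⊗ₖ 𝒯.τ J 1, ?_⟩
  rw [← tauLeg1_mul_tauLeg2 𝒯 I J x 1, (isLeg_tauLeg2 𝒯 I J).one, mul_one]

theorem tauLeg2_eq_scal (I J : Λ) (x : G) :
    ∃ X : Matrix (Fin (𝒯.dim I) × Fin (𝒯.dim J)) (Fin (𝒯.dim I) × Fin (𝒯.dim J)) ℂ,
      tauLeg2 𝒯 I J B x = scal B X := by
  refine ⟨𝒯.τ I 1 ⊗ₖ 𝒯.τ J x, ?_⟩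
  rw [← tauLeg1_mul_tauLeg2 𝒯 I J 1 x, (isLeg_tauLeg1 𝒯 I J).one, one_mul]

variable {M} [FiniteDimensional ℂ G] [IsSemisimpleRing G]

namespace IsGraphFamily

variable (hM : IsGraphFamily 𝒞 M)

include hM

theorem one_le_entrySpan (n : ℕ) : 1 ≤ entrySpan M n := by
  by_cases h : n < m
  · rw [Submodule.one_le]
    have h1 := entry_mem M ⟨n, h⟩ 𝒯.zero 0 0
    rwa [hM.trivial, Matrix.one_apply_eq] at h1
  · rw [entrySpan, dif_neg h]

/-- Functoriality expresses `M₁RM₂` linearly in matrix elements; surrounding by `R` removes the `R`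
without leaving their span. -/
theorem entrySpan_mul_self_le (n : ℕ) : entrySpan M n * entrySpan M n ≤ entrySpan M n := by
  by_cases h : n < m
  swap
  · rw [entrySpan, dif_neg h, one_mul]
  refine entrySpan_mul_le M ⟨n, h⟩ ⟨n, h⟩ fun I J i j k l => ?_
  have h1 := surround_R (𝒢 := 𝒢) (isLeg_tauLeg1 𝒯 I J (B := B)) (isLeg_tauLeg2 𝒯 I J)
    (comm_tauLeg1_tauLeg2 𝒯 I J) (tauLeg2_commute_leg1 (M ⟨n, h⟩ I))
    (tauLeg1_commute_leg2 (M ⟨n, h⟩ J))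
  rw [Rr, ← scal_rep2, hM.functoriality] at h1
  have hY : ∀ p q, (∑ K, ∑ a, scal B (𝒞.C I J K a)ᴴ * M ⟨n, h⟩ K * scal B (𝒞.C I J K a)) p q ∈
      entrySpan M n := fun p q => by
    rw [Matrix.sum_apply]
    refine Submodule.sum_mem _ fun K _ => ?_
    rw [Matrix.sum_apply]
    exact Submodule.sum_mem _ fun a _ => mul_scal_mem _
      (scal_mul_mem _ (entry_mem M ⟨n, h⟩ K)) _ _
  have h3 := surround_entry_mem hY (f := antip (tauLeg2 𝒯 I J B)) (fun x => tauLeg2_eq_scal I J _)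
    (tauLeg1_eq_scal I J) (tensorFlip (𝒢.R : G ⊗[ℂ] G)) (i, k) (j, l)
  rw [h1, leg1_mul_leg2_apply] at h3
  exact h3

/-- The exchange relation puts the later monodromy on the right, up to scalar matrices, and
surrounding by `R⁻¹` removes the `R⁻¹` in the middle of the reversed product. -/
theorem entrySpan_exchange_le {k n : ℕ} (hk : k < n) :
    entrySpan M n * entrySpan M k ≤ entrySpan M k * entrySpan M n := by
  by_cases h : n < m
  swap
  · rw [entrySpan, dif_neg h, one_mul, mul_one]
  have hk' : k < m := by omega
  refine entrySpan_mul_le M ⟨n, h⟩ ⟨k, hk'⟩ fun J I i j k' l => ?_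
  set X := M ⟨k, hk'⟩ I
  set Y := M ⟨n, h⟩ J
  have h1 := surround_Rinv (𝒢 := 𝒢) (isLeg_tauLeg1 𝒯 I J (B := B)) (isLeg_tauLeg2 𝒯 I J)
    (tauLeg1_commute_leg2 Y) (tauLeg2_commute_leg1 X)
  have h2 := hM.exchange ⟨k, hk'⟩ ⟨n, h⟩ hk I J
  have h3 : scal B (𝒯.rep2 I J 𝒢.R) * scal B (𝒯.rep2 I J 𝒢.Rinv) = 1 := by
    rw [← scal_mul, ← 𝒯.rep2_mul, Units.mul_inv, 𝒯.rep2_one]; simp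
  have h4 : leg2 𝒯 I Y * Ri 𝒢 (tauLeg1 𝒯 I J B) (tauLeg2 𝒯 I J B) * leg1 𝒯 J X =
      scal B (𝒯.rep2 I J 𝒢.Rinv) * (leg1 𝒯 J X * scal B (𝒯.rep2 I J 𝒢.R) * leg2 𝒯 I Y) *
        scal B (𝒯.rep2 I J 𝒢.Rinv) := by
    rw [Ri, ← scal_rep2, ← mul_assoc, ← mul_assoc, h2, mul_assoc _ _ (scal B _), h3, mul_one]
  rw [h4] at h1
  have h5 := surround_entry_mem (U := entrySpan M k * entrySpan M n)
    (mul_scal_mem (𝒯.rep2 I J 𝒢.Rinv) (scal_mul_mem (𝒯.rep2 I J 𝒢.Rinv) (matrix_mul_mem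
      (mul_scal_mem (𝒯.rep2 I J 𝒢.R)
        (leg1_mem J (entry_mem M ⟨k, hk'⟩ I))) (leg2_mem I (entry_mem M ⟨n, h⟩ J)))))
    (f := antip (tauLeg1 𝒯 I J B)) (fun x => tauLeg1_eq_scal I J _)
    (tauLeg2_eq_scal I J) 𝒢.Rinv (k', i) (l, j)
  rw [h1, leg2_mul_leg1_apply] at h5
  exact h5

omit hM in
theorem exists_span_entrySpan (ν : Fin m) : ∃ s : Finset B, s.card ≤ Module.finrank ℂ G ∧
    Submodule.span ℂ (s : Set B) = entrySpan M ν := by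
  rw [entrySpan_eq, Module.finrank_eq_card_basis 𝒯.basis]
  exact exists_span_range _

end IsGraphFamily

theorem GraphAlg.eq_top {A : Subalgebra ℂ (GraphAlg 𝒞 m)}
    (h : ∀ (ν : Fin m) J i j, graphM 𝒞 ν J i j ∈ A) : A = ⊤ := by
  refine eq_top_iff.mpr fun X _ => ?_
  obtain ⟨x, rfl⟩ := RingQuot.mkAlgHom_surjective ℂ (GraphRel 𝒞 m) X
  induction x using FreeAlgebra.induction with
  | grade0 r => rw [AlgHom.commutes]; exact A.algebraMap_mem r
  | grade1 p => exact h p.1 p.2.1 p.2.2.1 p.2.2.2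
  | mul x y hx hy => rw [map_mul]; exact A.mul_mem (hx trivial) (hy trivial)
  | add x y hx hy => rw [map_add]; exact A.add_mem (hx trivial) (hy trivial)

theorem SemiAlg.eq_top {A : Subalgebra ℂ (SemiAlg 𝒞 m)} (hG : ∀ x, ofG 𝒞 m x ∈ A)
    (h : ∀ (ν : Fin m) J i j, mono 𝒞 ν J i j ∈ A) : A = ⊤ := by
  have hL : A.comap (ofL 𝒞 m) = ⊤ := GraphAlg.eq_top h
  refine eq_top_iff.mpr fun X _ => ?_
  obtain ⟨x, rfl⟩ := RingQuot.mkAlgHom_surjective ℂ (SemiRel 𝒞 m) X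
  induction x using TensorAlgebra.induction with
  | algebraMap r => rw [AlgHom.commutes]; exact A.algebraMap_mem r
  | ι p =>
    have e : TensorAlgebra.ι ℂ p = preG 𝒞 m p.1 + preL 𝒞 m p.2 := by
      rw [preG, preL, LinearMap.comp_apply, LinearMap.comp_apply, ← map_add]
      simp
    rw [e, map_add]
    exact A.add_mem (hG _) (show p.2 ∈ A.comap (ofL 𝒞 m) from hL ▸ trivial)
  | mul x y hx hy => rw [map_mul]; exact A.mul_mem (hx trivial) (hy trivial)
  | add x y hx hy => rw [map_add]; exact A.add_mem (hx trivial) (hy trivial)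

/-- A submodule containing `1` and closed under multiplication. -/
def subalgebraOfMulLe (V : Submodule ℂ B) (h1 : 1 ≤ V) (h2 : V * V ≤ V) : Subalgebra ℂ B :=
  V.toSubalgebra (Submodule.one_le.mp h1) fun _ _ hx hy => h2 (Submodule.mul_mem_mul hx hy)

variable (𝒞)

theorem exists_span_graphAlg : ∃ s : Finset (GraphAlg 𝒞 m),
    s.card ≤ Module.finrank ℂ G ^ m ∧ Submodule.span ℂ (s : Set (GraphAlg 𝒞 m)) = ⊤ := by
  have hM := isGraphFamily_graphM 𝒞 (m := m)
  have h := exists_span_orderedProd (U := entrySpan fun (ν : Fin m) J => graphM 𝒞 ν J)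
    (n := m) fun k hk => IsGraphFamily.exists_span_entrySpan ⟨k, hk⟩
  have htop := GraphAlg.eq_top (A := subalgebraOfMulLe _
      (one_le_orderedProd hM.one_le_entrySpan m)
      (orderedProd_mul_self_le hM.entrySpan_mul_self_le (fun _ _ => hM.entrySpan_exchange_le) m))
    fun ν J i j => le_orderedProd hM.one_le_entrySpan ν.2 (entry_mem _ ν J i j)
  have htop' : orderedProd (entrySpan fun (ν : Fin m) J => graphM 𝒞 ν J) m = ⊤ :=
    congrArg Subalgebra.toSubmodule htop
  rwa [htop'] at h

/-- Commutes `G` to the right of a monodromy: only `(τ^J ⊗ id)Δ(x)` commutes with it, but `1 ⊗ x = ∑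
τ^J(S(x₁)) (τ^J ⊗ id)Δ(x₂)` differs from this by scalar matrices. -/
theorem ofG_mul_entrySpan_le (k : ℕ) :
    LinearMap.range (ofG 𝒞 m).toLinearMap * entrySpan (fun (ν : Fin m) J => mono 𝒞 ν J) k ≤
      entrySpan (fun (ν : Fin m) J => mono 𝒞 ν J) k * LinearMap.range (ofG 𝒞 m).toLinearMap := by
  by_cases h : k < m
  swap
  · rw [entrySpan, dif_neg h, one_mul, mul_one]
  set V := entrySpan (fun (ν : Fin m) J => mono 𝒞 ν J) k *
    LinearMap.range (ofG 𝒞 m).toLinearMap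
  set γ := (ofG 𝒞 m).toLinearMap
  have hγ : IsLeg γ := ⟨map_one (ofG 𝒞 m), map_mul (ofG 𝒞 m)⟩
  rw [Submodule.mul_le]
  rintro _ ⟨x, rfl⟩ n hn
  rw [entrySpan_eq _ ⟨k, h⟩] at hn
  induction hn using Submodule.span_induction with
  | zero => rw [mul_zero]; exact V.zero_mem
  | add a b _ _ ha hb => rw [mul_add]; exact V.add_mem ha hb
  | smul c a _ ha => rw [mul_smul_comm]; exact V.smul_mem c ha
  | mem y hy =>
    obtain ⟨⟨J, i, j⟩, rfl⟩ := hy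
    have e1 : scalLeg 𝒯 J γ = conv (antip (tauLeg 𝒯 J _)) (conv (tauLeg 𝒯 J _) (scalLeg 𝒯 J γ)) := by
      rw [← conv_assoc, antip_conv_self (isLeg_tauLeg 𝒯 J), unitLeg_conv]
    have e2 : ∀ w, conv (tauLeg 𝒯 J _) (scalLeg 𝒯 J γ) w * mono 𝒞 ⟨k, h⟩ J =
        mono 𝒞 ⟨k, h⟩ J * conv (tauLeg 𝒯 J _) (scalLeg 𝒯 J γ) w := fun w => by
      have := cross_relation 𝒞 ⟨k, h⟩ J w
      rwa [slot_eq, ← conv_apply] at this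
    have e3 : (scalLeg 𝒯 J γ x * mono 𝒞 ⟨k, h⟩ J) i j = γ x * mono 𝒞 ⟨k, h⟩ J i j := by
      rw [scalLeg_apply, Matrix.diagonal_mul]
    have hm : ∀ w i j, (conv (tauLeg 𝒯 J (SemiAlg 𝒞 m)) (scalLeg 𝒯 J γ) w) i j ∈
        LinearMap.range γ := fun w i j => by
      rw [conv_apply, ← slot_eq, slot_apply]
      exact ⟨_, rfl⟩
    rw [← e3, e1, conv_apply]
    induction Coalgebra.comul (R := ℂ) x using TensorProduct.induction_on with
    | zero => rw [map_zero, zero_mul]; exact V.zero_mem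
    | add x y hx hy => rw [map_add, add_mul]; exact V.add_mem hx hy
    | tmul x y =>
      rw [tens_tmul, mul_assoc, e2]
      exact scal_mul_mem _ (matrix_mul_mem (entry_mem _ ⟨k, h⟩ J) (hm y)) i j

theorem exists_span_semiAlg : ∃ s : Finset (SemiAlg 𝒞 m),
    s.card ≤ Module.finrank ℂ G ^ m * Module.finrank ℂ G ∧
      Submodule.span ℂ (s : Set (SemiAlg 𝒞 m)) = ⊤ := by
  have hM := isGraphFamily_mono 𝒞 (m := m)
  have h := exists_span_orderedProd (U := entrySpan fun (ν : Fin m) J => mono 𝒞 ν J)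
    (n := m) fun k hk => IsGraphFamily.exists_span_entrySpan ⟨k, hk⟩
  set U := entrySpan fun (ν : Fin m) J => mono 𝒞 ν J
  set Γ := LinearMap.range (ofG 𝒞 m).toLinearMap with hΓ
  have hΓs : ∃ s : Finset (SemiAlg 𝒞 m), s.card ≤ Module.finrank ℂ G ∧
      Submodule.span ℂ (s : Set (SemiAlg 𝒞 m)) = Γ := by
    rw [Module.finrank_eq_card_basis 𝒯.basis, hΓ, LinearMap.range_eq_map, ← 𝒯.basis.span_eq,
      Submodule.map_span, ← Set.range_comp]
    exact exists_span_range _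
  have h1Γ : 1 ≤ Γ := Submodule.one_le.mpr ⟨1, map_one (ofG 𝒞 m)⟩
  have hΓΓ : Γ * Γ ≤ Γ := by
    rw [Submodule.mul_le]
    rintro _ ⟨x, rfl⟩ _ ⟨y, rfl⟩
    exact ⟨x * y, map_mul (ofG 𝒞 m) x y⟩
  have h1U := one_le_orderedProd hM.one_le_entrySpan m
  have hUU := orderedProd_mul_self_le hM.entrySpan_mul_self_le
    (fun _ _ => hM.entrySpan_exchange_le) m
  have hΓU : Γ * orderedProd U m ≤ orderedProd U m * Γ :=
    mul_orderedProd_le fun k _ => ofG_mul_entrySpan_le 𝒞 k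
  have h1 : 1 ≤ orderedProd U m * Γ := (one_mul (1 : Submodule ℂ (SemiAlg 𝒞 m))).symm.le.trans
    (mul_le_mul' h1U h1Γ)
  have h2 : orderedProd U m * Γ * (orderedProd U m * Γ) ≤ orderedProd U m * Γ :=
    calc orderedProd U m * Γ * (orderedProd U m * Γ)
        = orderedProd U m * (Γ * orderedProd U m) * Γ := by simp only [mul_assoc]
      _ ≤ orderedProd U m * (orderedProd U m * Γ) * Γ :=
          mul_le_mul_left (mul_le_mul_right hΓU _) _
      _ = orderedProd U m * orderedProd U m * (Γ * Γ) := by simp only [mul_assoc]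
      _ ≤ _ := mul_le_mul' hUU hΓΓ
  have htop := SemiAlg.eq_top (A := subalgebraOfMulLe _ h1 h2)
    (fun x => (show Γ ≤ orderedProd U m * Γ from (one_mul Γ).symm.le.trans
      (mul_le_mul_left h1U _)) ⟨x, rfl⟩)
    fun ν J i j => (show orderedProd U m ≤ orderedProd U m * Γ from
      (mul_one (orderedProd U m)).symm.le.trans (mul_le_mul_right h1Γ _))
      (le_orderedProd hM.one_le_entrySpan ν.2 (entry_mem _ ν J i j))
  have htop' : orderedProd U m * Γ = ⊤ := congrArg Subalgebra.toSubmodule htop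
  have h3 := exists_span_mul h hΓs
  rwa [htop'] at h3

/-- A surjection from a space spanned by at most as many vectors as the dimension of the target has
no kernel. -/
theorem bijective_of_span {V W : Type*} [AddCommGroup V] [Module ℂ V] [AddCommGroup W] [Module ℂ W]
    {F : V →ₗ[ℂ] W} (hF : Function.Surjective F)
    (h : ∃ s : Finset V, s.card ≤ Module.finrank ℂ W ∧ Submodule.span ℂ (s : Set V) = ⊤) :
    Function.Bijective F := by
  obtain ⟨s, hs, hV⟩ := h
  have : Module.Finite ℂ V := ⟨⟨s, hV⟩⟩
  have : Module.Finite ℂ W := Module.Finite.of_surjective F hF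
  have h1 : Module.finrank ℂ V ≤ Module.finrank ℂ W := by
    rw [← finrank_top ℂ V, ← hV]
    exact (finrank_span_finset_le_card s).trans hs
  have h2 := LinearMap.finrank_le_finrank_of_surjective hF
  exact ⟨(LinearMap.injective_iff_surjective_of_finrank_eq_finrank (le_antisymm h1 h2)).mpr hF, hF⟩

end Spanning

/-! ## Faithful representations of `ℒ_m` and `𝒮_m` -/

section Extend

variable {G : Type*} [Ring G] [HopfAlgebra ℂ G] {B : Type*} [Ring B] [Algebra ℂ B]

/-- The inclusion `b ↦ b ⊗ 1`. -/
abbrev extL (G B : Type*) [Ring G] [Algebra ℂ G] [Ring B] [Algebra ℂ B] :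
    B →ₐ[ℂ] B ⊗[ℂ] G := Algebra.TensorProduct.includeLeft

/-- The inclusion `x ↦ 1 ⊗ x`. -/
abbrev extR (G B : Type*) [Ring G] [Algebra ℂ G] [Ring B] [Algebra ℂ B] :
    G →ₐ[ℂ] B ⊗[ℂ] G := Algebra.TensorProduct.includeRight

theorem extL_commute_extR (b : B) (x : G) : Commute (extL G B b) (extR G B x) := by
  simp [Commute, SemiconjBy]

namespace LegSystem

variable (S : LegSystem G B) (m : ℕ)

/-- The leg number `m` of a system is replaced by the regular one. -/
def extend : LegSystem G (B ⊗[ℂ] G) where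
  s n := if n = m then (extR G B).toLinearMap else (extL G B).toLinearMap ∘ₗ S.s n
  isLeg n := by
    split_ifs
    · exact ⟨map_one (extR G B), map_mul (extR G B)⟩
    · exact (S.isLeg n).comp _
  comm n k h := by
    split_ifs with h1 h2 h2
    · exact absurd (h1.trans h2.symm) h
    · exact fun x y => (extL_commute_extR _ _).symm
    · exact fun x y => extL_commute_extR _ _
    · exact (S.comm n k h).comp _

theorem extend_s_self : (S.extend m).s m = (extR G B).toLinearMap := if_pos rfl

theorem extend_s {n : ℕ} (h : n ≠ m) : (S.extend m).s n = (extL G B).toLinearMap ∘ₗ S.s n :=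
  if_neg h

/-- The new leg comes last, so the first `m` legs are unchanged while `ι_{m+1}(x) = ∑ ι_m(x₁) ⊗ x₂`,
which keeps the information about `x`. -/
theorem extend_io {n : ℕ} (h : n ≤ m) : (S.extend m).io n = (extL G B).toLinearMap ∘ₗ S.io n := by
  induction n with
  | zero => exact (comp_unitLeg _).symm
  | succ n ih => rw [io, ih (by omega), extend_s S m (by omega), io, comp_conv]

variable [StarRing G] [StarModule ℂ G] {Λ : Type*} {𝒢 : RibbonStar G} (𝒯 : Irreps G Λ)

theorem extend_loopMat {ν : ℕ} (h : ν < m) (J : Λ) :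
    loopMat 𝒯 𝒢 (S.extend m) ν J = (loopMat 𝒯 𝒢 S ν J).map (extL G B) := by
  rw [map_loopMat, loopMat, loopMat, extend_io S m h.le, extend_s S m h.ne, S.map_io]
  rfl

theorem extend_gramElt [Fintype Λ] {𝒯 : Irreps G Λ} (𝒞 : Clebsch 𝒢 𝒯) {n : ℕ} (h : n ≤ m) :
    (S.extend m).gramElt 𝒞 n = extL G B (S.gramElt 𝒞 n) := by
  induction n with
  | zero => exact (map_one (extL G B)).symm
  | succ n ih =>
    rw [gramElt, ih (by omega), gramElt, map_mul (extL G B), map_tens, extend_io S m (by omega),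
      extend_s S m (by omega)]

variable [StarRing B] [StarModule ℂ B]

theorem star_extend (hstar : ∀ n x, star (S.s n x) = S.s n (star x)) (n : ℕ) (x : G) :
    star ((S.extend m).s n x) = (S.extend m).s n (star x) := by
  by_cases h : n = m
  · subst h
    rw [extend_s_self]
    change star ((1 : B) ⊗ₜ[ℂ] x) = 1 ⊗ₜ star x
    rw [TensorProduct.star_tmul, star_one]
  · rw [extend_s S m h]
    change star (S.s n x ⊗ₜ[ℂ] (1 : G)) = S.s n (star x) ⊗ₜ 1
    rw [TensorProduct.star_tmul, star_one, hstar]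

end LegSystem

end Extend

/-! ### `ℒ_m` and `𝒮_m` as the concrete algebras of site operators. -/

section Faithful

variable {G : Type*} [Ring G] [HopfAlgebra ℂ G] [StarRing G] [StarModule ℂ G] {Λ : Type*}
  {𝒢 : RibbonStar G} {𝒯 : Irreps G Λ} {𝒞 : Clebsch 𝒢 𝒯}
  [Fintype Λ] [FiniteDimensional ℂ G] [IsSemisimpleRing G]
  {B : Type*} [Ring B] [Algebra ℂ B] {m : ℕ}

theorem IsSysHom.loopMat_mem {F : SemiAlg 𝒞 m →ₐ[ℂ] B} {S : LegSystem G B} {n : ℕ}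
    (hF : IsSysHom F S n) {A : Subalgebra ℂ B}
    (hA : ∀ (ν : Fin m) J i j, F (mono 𝒞 ν J i j) ∈ A) :
    ∀ ν < m, ∀ J, loopMat 𝒯 𝒢 S ν J ∈ A.matrix := fun ν hν J => by
  have h : loopMat 𝒯 𝒢 S ν J = 𝒞.kap J • (mono 𝒞 ⟨ν, hν⟩ J).map F := by
    rw [hF.map_mono, smul_inv_smul₀ (𝒞.kap_ne_zero J)]
  rw [h]
  exact A.matrix.smul_mem (fun i j => hA ⟨ν, hν⟩ J i j) _

variable [DecidableEq Λ] (hd : ∀ I, 0 < qdim 𝒢 𝒯 I) (hS : IsUnit (SMatrix 𝒢 𝒯))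

include hd hS

/-- Surjective by factorizability, since the monodromies generate all site operators; injective
because ordered monomials number at most `(dim G)^m`, the dimension of the target. -/
theorem IsSysHom.bijective_comp_ofL {F : SemiAlg 𝒞 m →ₐ[ℂ] TotalOp 𝒯 m} {n : ℕ}
    (hF : IsSysHom F (totalSystem 𝒯 m) n) : Function.Bijective (F.comp (ofL 𝒞 m)) := by
  have hsurj : Function.Surjective (F.comp (ofL 𝒞 m)) := by
    rw [← AlgHom.range_eq_top]
    exact total_eq_top 𝒯 m ((totalSystem 𝒯 m).mem_of_loopMat 𝒞 hd hS
      (hF.loopMat_mem fun ν J i j => ⟨graphM 𝒞 ν J i j, rfl⟩))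
  refine bijective_of_span (F := (F.comp (ofL 𝒞 m)).toLinearMap) hsurj ?_
  rw [finrank_total]
  exact exists_span_graphAlg 𝒞

theorem IsSysHom.bijective {F : SemiAlg 𝒞 m →ₐ[ℂ] TotalOp 𝒯 m ⊗[ℂ] G}
    (hF : IsSysHom F ((totalSystem 𝒯 m).extend m) (m + 1)) : Function.Bijective F := by
  set S := (totalSystem 𝒯 m).extend m
  have hs : ∀ ν < m, ∀ x, S.s ν x ∈ F.range := S.mem_of_loopMat 𝒞 hd hS
    (hF.loopMat_mem fun ν J i j => ⟨mono 𝒞 ν J i j, rfl⟩)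
  have hL : F.range.comap (extL G (TotalOp 𝒯 m)) = ⊤ := total_eq_top 𝒯 m fun ν hν x => by
    have h := hs ν hν x
    rwa [LegSystem.extend_s _ _ hν.ne] at h
  have hR : ∀ x, S.s m x ∈ F.range := fun x => by
    -- The extra factor `G` is recovered from the image `ι_{m+1}` of `G` by dividing out `ι_m`,
    -- already in the range.
    have e : S.s m = conv (antip (S.io m)) (S.io (m + 1)) := by
      rw [LegSystem.io, ← conv_assoc, antip_conv_self (S.isLeg_io m), unitLeg_conv]
    rw [e]
    exact tens_mem (f := antip (S.io m)) (fun y => S.io_mem hs _) (fun y => ⟨ofG 𝒞 m y, hF.map_ofG y⟩) _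
  have hsurj : Function.Surjective F := by
    rw [← AlgHom.range_eq_top, eq_top_iff]
    rintro X -
    induction X using TensorProduct.induction_on with
    | zero => exact F.range.zero_mem
    | add x y hx hy => exact F.range.add_mem hx hy
    | tmul X x =>
      have h1 : extL G (TotalOp 𝒯 m) X ∈ F.range :=
        show X ∈ F.range.comap (extL G (TotalOp 𝒯 m)) from hL ▸ trivial
      have h2 := hR x
      rw [LegSystem.extend_s_self] at h2
      have h3 := F.range.mul_mem h1 h2
      change (X ⊗ₜ[ℂ] (1 : G)) * ((1 : TotalOp 𝒯 m) ⊗ₜ[ℂ] x) ∈ _ at h3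
      rwa [Algebra.TensorProduct.tmul_mul_tmul, one_mul, mul_one] at h3
  refine bijective_of_span (F := F.toLinearMap) hsurj ?_
  rw [Module.finrank_tensorProduct, finrank_total]
  exact exists_span_semiAlg 𝒞

end Faithful

/-! ## The `*`-operation of the semi-direct product -/

section StarOperation

variable {G : Type*} [Ring G] [HopfAlgebra ℂ G] [StarRing G] [StarModule ℂ G] {Λ : Type*}
  {𝒢 : RibbonStar G} {𝒯 : Irreps G Λ} {𝒞 : Clebsch 𝒢 𝒯}
  [Fintype Λ] [FiniteDimensional ℂ G] [IsSemisimpleRing G]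
  {B : Type*} [Ring B] [Algebra ℂ B] [StarRing B] [StarModule ℂ B] {m : ℕ}

theorem star_tauLeg (J : Λ) (x : G) : star (tauLeg 𝒯 J B x) = tauLeg 𝒯 J B (star x) := by
  rw [tauLeg_apply, tauLeg_apply, map_star]
  ext i j
  exact (algebraMap_star_comm _).symm

theorem star_scalarHom (n : Type*) [Fintype n] [DecidableEq n] (b : B) :
    star (scalarHom n B b) = scalarHom n B (star b) := by
  rw [scalarHom_apply, scalarHom_apply, Matrix.star_eq_conjTranspose,
    Matrix.diagonal_conjTranspose]
  rfl

variable {F : SemiAlg 𝒞 m →ₐ[ℂ] B} {S : LegSystem G B} {n : ℕ} (hF : IsSysHom F S n)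
  (hmn : m ≤ n) (hstar : ∀ n x, star (S.s n x) = S.s n (star x))

/-- The matrix `κ⁻¹ R^I M R^I⁻¹ κ`. -/
abbrev conjMono (𝒞 : Clebsch 𝒢 𝒯) (m : ℕ) (I : Λ) (Minv : 𝒯.Mat I (SemiAlg 𝒞 m)) :
    𝒯.Mat I (SemiAlg 𝒞 m) :=
  (𝒯.slot I (ofG 𝒞 m).toLinearMap (𝒢.R : G ⊗[ℂ] G) * Minv *
    𝒯.slot I (ofG 𝒞 m).toLinearMap 𝒢.Rinv).map
      fun F => ofG 𝒞 m ((𝒞.κ⁻¹ : Gˣ) : G) * F * ofG 𝒞 m (𝒞.κ : G)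

include hF hmn hstar

/-- This is `star_loopN` for the leg `τ^I` in matrices over `B`, in which the Gram element is a
scalar matrix. -/
theorem IsSysHom.star_map_mono (ν : Fin m) (I : Λ) {Minv : 𝒯.Mat I (SemiAlg 𝒞 m)}
    (h : Minv * mono 𝒞 ν I = 1) :
    star ((mono 𝒞 ν I).map F) * scalarHom _ B (S.gramElt 𝒞 n) =
      scalarHom _ B (S.gramElt 𝒞 n) * (conjMono 𝒞 m I Minv).map F := by
  obtain ⟨N, hN⟩ := isUnit_loopN (𝒢 := 𝒢) (isLeg_tauLeg 𝒯 I (B := B))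
    (isLeg_scalLeg 𝒯 I (S.isLeg_io ν)) (isLeg_scalLeg 𝒯 I (S.isLeg ν))
    (comm_tauLeg_scalLeg 𝒯 I _) (comm_tauLeg_scalLeg 𝒯 I _)
  have hM : (mono 𝒞 ν I).map F = (𝒞.kap I)⁻¹ • (N : 𝒯.Mat I B) := by rw [hF.map_mono, hN]; rfl
  have hk := 𝒞.kap_ne_zero I
  have hMinv : Minv.map F = 𝒞.kap I • ((N⁻¹ : (𝒯.Mat I B)ˣ) : 𝒯.Mat I B) := by
    have h1 := congrArg F.mapMatrix h
    rw [map_mul, map_one] at h1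
    change Minv.map F * (mono 𝒞 ν I).map F = 1 at h1
    rw [hM, mul_smul_comm] at h1
    have h2 : Minv.map F * (N : 𝒯.Mat I B) = 𝒞.kap I • 1 := by rw [← h1, smul_inv_smul₀ hk]
    rw [← Units.mul_inv_cancel_right (Minv.map F) N, h2, smul_mul_assoc, one_mul]
  have h1 := (S.map (scalarHom (Fin (𝒯.dim I)) B)).star_loopN 𝒞 (a := tauLeg 𝒯 I B)
    (fun n x => by
      change star (scalarHom _ B (S.s n x)) = scalarHom _ B (S.s n (star x))
      rw [star_scalarHom, hstar])
    (isLeg_tauLeg 𝒯 I) (fun n => comm_tauLeg_scalLeg 𝒯 I _) (star_tauLeg I)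
    (show (ν : ℕ) < n by omega) N (by rw [hN, LegSystem.map_io]; rfl)
  rw [LegSystem.map_gramElt, LegSystem.map_io] at h1
  -- As `κ_I` has modulus one, the star of the prefactor of `M` is the prefactor of `M⁻¹`.
  have hstark : star (𝒞.kap I)⁻¹ = 𝒞.kap I := by
    rw [star_inv₀]
    exact inv_eq_of_mul_eq_one_left (𝒞.kap_mul_star I)
  have hslot : ∀ w, (𝒯.slot I (ofG 𝒞 m).toLinearMap w).map F =
      tens (tauLeg 𝒯 I B) (scalLeg 𝒯 I (S.io n)) w := fun w => by
    have h2 := slot_map 𝒯 I (ofG 𝒞 m).toLinearMap F.toLinearMap w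
    have h3 : F.toLinearMap ∘ₗ (ofG 𝒞 m).toLinearMap = S.io n := LinearMap.ext hF.map_ofG
    rw [h3, slot_eq 𝒯 I (S.io n)] at h2
    exact h2
  have hC : (conjMono 𝒞 m I Minv).map F = scalarHom _ B (S.io n ((𝒞.κ⁻¹ : Gˣ) : G)) *
      ((𝒯.slot I (ofG 𝒞 m).toLinearMap (𝒢.R : G ⊗[ℂ] G) * Minv *
        𝒯.slot I (ofG 𝒞 m).toLinearMap 𝒢.Rinv).map F) * scalarHom _ B (S.io n (𝒞.κ : G)) := by
    ext i j
    rw [scalarHom_apply, scalarHom_apply, Matrix.mul_diagonal, Matrix.diagonal_mul]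
    simp only [Matrix.map_apply, map_mul, hF.map_ofG]
  rw [hC, Matrix.map_mul, Matrix.map_mul, hslot, hslot, hM, hMinv, star_smul, hstark,
    smul_mul_assoc, h1]
  simp only [mul_smul_comm, smul_mul_assoc]
  rfl

end StarOperation

/-! ### Uniqueness and existence of the `*`-operation, and its form in representations. -/

section StarOperation

variable {G : Type*} [Ring G] [HopfAlgebra ℂ G] [StarRing G] [StarModule ℂ G] {Λ : Type*}
  {𝒢 : RibbonStar G} {𝒯 : Irreps G Λ} {𝒞 : Clebsch 𝒢 𝒯}
  [Fintype Λ] [FiniteDimensional ℂ G] [IsSemisimpleRing G]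
  {B : Type*} [Ring B] [Algebra ℂ B] [StarRing B] [StarModule ℂ B] {m : ℕ}

namespace IsStarOperation

variable {st : SemiAlg 𝒞 m → SemiAlg 𝒞 m} (hst : IsStarOperation 𝒞 m st)

include hst

theorem map_one : st 1 = 1 := by
  have h := hst.map_ofG 1
  rwa [star_one, _root_.map_one] at h

theorem map_algebraMap (r : ℂ) : st (algebraMap ℂ _ r) = algebraMap ℂ _ (star r) := by
  rw [Algebra.algebraMap_eq_smul_one, hst.map_smul, hst.map_one, Algebra.algebraMap_eq_smul_one]

/-- The conditions prescribe the values on generators, because the inverse of a monodromy is unique.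
-/
theorem unique {st' : SemiAlg 𝒞 m → SemiAlg 𝒞 m} (hst' : IsStarOperation 𝒞 m st') : st' = st := by
  let A : Subalgebra ℂ (SemiAlg 𝒞 m) :=
    { carrier := {X | st' X = st X}
      mul_mem' := fun {X Y} (hX : st' X = st X) (hY : st' Y = st Y) =>
        show st' (X * Y) = st (X * Y) by rw [hst.map_mul, hst'.map_mul, hX, hY]
      add_mem' := fun {X Y} (hX : st' X = st X) (hY : st' Y = st Y) =>
        show st' (X + Y) = st (X + Y) by rw [hst.map_add, hst'.map_add, hX, hY]
      algebraMap_mem' := fun r => show st' _ = st _ by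
        rw [hst.map_algebraMap, hst'.map_algebraMap] }
  have hA : A = ⊤ := SemiAlg.eq_top
    (fun x => show st' _ = st _ by rw [hst.map_ofG, hst'.map_ofG]) fun ν J i j => by
      obtain ⟨X, hX, -, hX'⟩ := hst.map_mono ν J
      obtain ⟨Y, -, hY, hY'⟩ := hst'.map_mono ν J
      obtain rfl : Y = X := left_inv_eq_right_inv hY hX
      exact congrFun (congrFun (hY'.trans hX'.symm) j) i
  exact funext fun X => show X ∈ A from hA ▸ trivial

end IsStarOperation

variable {F : SemiAlg 𝒞 m →ₐ[ℂ] B} {S : LegSystem G B} {n : ℕ} (hF : IsSysHom F S n)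
  (hmn : m ≤ n) (hstar : ∀ n x, star (S.s n x) = S.s n (star x))

include hF hmn hstar

/-- Any `*`-operation is the adjoint twisted by the Gram element: this holds on generators, and the
elements for which it holds form a subalgebra. -/
theorem IsStarOperation.star_map {st : SemiAlg 𝒞 m → SemiAlg 𝒞 m} (hst : IsStarOperation 𝒞 m st)
    (X : SemiAlg 𝒞 m) : star (F X) * S.gramElt 𝒞 n = S.gramElt 𝒞 n * F (st X) := by
  set P := S.gramElt 𝒞 n
  let A : Subalgebra ℂ (SemiAlg 𝒞 m) :=
    { carrier := {X | star (F X) * P = P * F (st X)}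
      mul_mem' := fun {X Y} (hX : star (F X) * P = P * F (st X))
          (hY : star (F Y) * P = P * F (st Y)) =>
        show star (F (X * Y)) * P = P * F (st (X * Y)) by
          rw [hst.map_mul, _root_.map_mul, _root_.map_mul, star_mul, mul_assoc, hX, ← mul_assoc,
            hY, mul_assoc]
      add_mem' := fun {X Y} (hX : star (F X) * P = P * F (st X))
          (hY : star (F Y) * P = P * F (st Y)) =>
        show star (F (X + Y)) * P = P * F (st (X + Y)) by
          rw [hst.map_add, _root_.map_add, _root_.map_add, star_add, add_mul, hX, hY, mul_add]
      algebraMap_mem' := fun r => show star (F _) * P = P * F _ by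
        rw [hst.map_algebraMap, AlgHom.commutes, AlgHom.commutes, ← algebraMap_star_comm,
          Algebra.commutes] }
  have hA : A = ⊤ := SemiAlg.eq_top
    (fun x => show star (F _) * P = P * F _ by
      rw [hst.map_ofG, hF.map_ofG, hF.map_ofG, S.star_io 𝒞 hstar])
    fun ν J i j => by
      obtain ⟨Minv, -, h1, h2⟩ := hst.map_mono ν J
      have h3 := hF.star_map_mono hmn hstar ν J h1
      rw [← (show _ = conjMono 𝒞 m J Minv from h2)] at h3
      have h4 := congrFun (congrFun h3 j) i
      rw [scalarHom_apply, Matrix.mul_diagonal, Matrix.diagonal_mul] at h4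
      exact h4
  exact show X ∈ A from hA ▸ trivial

/-- Transport `Y ↦ P⁻¹ Y^* P` through the isomorphism `F`, with `P` the Gram element; it is
involutive because `P = Y^* Y` is self-adjoint. -/
theorem IsSysHom.exists_isStarOperation (hbij : Function.Bijective F) :
    ∃ st, IsStarOperation 𝒞 m st := by
  let e : SemiAlg 𝒞 m ≃ₐ[ℂ] B := AlgEquiv.ofBijective F hbij
  have he : ∀ X, e X = F X := fun _ => rfl
  obtain ⟨u, hu⟩ := S.isUnit_gramElt 𝒞 n
  have hsa : star (u : B) = u := by
    obtain ⟨Y, hY⟩ := S.exists_gramElt_eq 𝒞 hstar n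
    rw [hu, hY, star_mul, star_star]
  have hsa' : star ((u⁻¹ : Bˣ) : B) = (u⁻¹ : Bˣ) := by
    rw [← Units.coe_star, star_inv, (Units.ext hsa : star u = u)]
  let st : SemiAlg 𝒞 m → SemiAlg 𝒞 m := fun X => e.symm (((u⁻¹ : Bˣ) : B) * star (F X) * u)
  have hFst : ∀ X, F (st X) = ((u⁻¹ : Bˣ) : B) * star (F X) * u := fun X =>
    e.apply_symm_apply _
  have hFst' : ∀ X Y, star (F X) * S.gramElt 𝒞 n = S.gramElt 𝒞 n * F Y → st X = Y := by
    intro X Y h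
    refine hbij.1 ?_
    rw [hFst, mul_assoc, hu, h, ← hu, Units.inv_mul_cancel_left]
  refine ⟨st, ⟨fun X Y => hbij.1 ?_, fun c X => hbij.1 ?_, fun X Y => hbij.1 ?_,
    fun X => hbij.1 ?_, fun x => hFst' _ _ ?_, fun ν I => ?_⟩⟩
  · rw [hFst, map_add, map_add, hFst, hFst, star_add, mul_add, add_mul]
  · rw [hFst, map_smul, map_smul, hFst, star_smul, mul_smul_comm, smul_mul_assoc]
  · rw [hFst, map_mul, map_mul, hFst, hFst, star_mul]
    simp only [mul_assoc, Units.mul_inv_cancel_left]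
  · rw [hFst, hFst, star_mul, star_mul, hsa, hsa', star_star]
    simp only [mul_assoc, Units.inv_mul_cancel_left, Units.inv_mul, mul_one]
  · rw [hF.map_ofG, hF.map_ofG, S.star_io 𝒞 hstar]
  · obtain ⟨N, hN⟩ := isUnit_loopN (𝒢 := 𝒢) (isLeg_tauLeg 𝒯 I (B := B))
      (isLeg_scalLeg 𝒯 I (S.isLeg_io ν)) (isLeg_scalLeg 𝒯 I (S.isLeg ν))
      (comm_tauLeg_scalLeg 𝒯 I _) (comm_tauLeg_scalLeg 𝒯 I _)
    have hk := 𝒞.kap_ne_zero I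
    have hM : (mono 𝒞 ν I).map F = (𝒞.kap I)⁻¹ • (N : 𝒯.Mat I B) := by rw [hF.map_mono, hN]; rfl
    let Minv : 𝒯.Mat I (SemiAlg 𝒞 m) :=
      (𝒞.kap I • ((N⁻¹ : (𝒯.Mat I B)ˣ) : 𝒯.Mat I B)).map e.symm
    have hMinv : Minv.map F = 𝒞.kap I • ((N⁻¹ : (𝒯.Mat I B)ˣ) : 𝒯.Mat I B) := by
      ext i j
      exact e.apply_symm_apply _
    have hinj : Function.Injective fun X : 𝒯.Mat I (SemiAlg 𝒞 m) => X.map F :=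
      Matrix.map_injective hbij.1
    have h1 : mono 𝒞 ν I * Minv = 1 := by
      apply hinj
      beta_reduce
      rw [Matrix.map_mul, hM, hMinv, smul_mul_smul_comm, inv_mul_cancel₀ hk, Units.mul_inv,
        one_smul, Matrix.map_one F (map_zero F) (map_one F)]
    have h2 : Minv * mono 𝒞 ν I = 1 := by
      apply hinj
      beta_reduce
      rw [Matrix.map_mul, hM, hMinv, smul_mul_smul_comm, mul_inv_cancel₀ hk, Units.inv_mul,
        one_smul, Matrix.map_one F (map_zero F) (map_one F)]
    refine ⟨Minv, h1, h2, ?_⟩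
    ext i j
    refine hFst' _ _ ?_
    have h3 := congrFun (congrFun (hF.star_map_mono hmn hstar ν I h2) i) j
    rw [scalarHom_apply, Matrix.mul_diagonal, Matrix.diagonal_mul] at h3
    exact h3

end StarOperation

/-! ## Invariants -/

section Invariants

variable {G : Type*} [Ring G] [HopfAlgebra ℂ G] [StarRing G] [StarModule ℂ G] {Λ : Type*}
  {𝒢 : RibbonStar G} {𝒯 : Irreps G Λ} {𝒞 : Clebsch 𝒢 𝒯}
  [Fintype Λ] [FiniteDimensional ℂ G] [IsSemisimpleRing G]
  {B : Type*} [Ring B] [Algebra ℂ B] {m : ℕ}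

theorem isLeg_ofG : IsLeg (ofG 𝒞 m).toLinearMap := ⟨map_one (ofG 𝒞 m), map_mul (ofG 𝒞 m)⟩

theorem mulLeft_conv (f g : G →ₗ[ℂ] B) (X : B) (x : G) :
    conv (LinearMap.mulLeft ℂ X ∘ₗ f) g x = X * conv f g x := by
  rw [conv_apply, conv_apply]
  induction Coalgebra.comul (R := ℂ) x using TensorProduct.induction_on with
  | zero => simp
  | add x y hx hy => rw [map_add, map_add, hx, hy, mul_add]
  | tmul x y => exact mul_assoc _ _ _

theorem act_eq_conv (X : SemiAlg 𝒞 m) (x : G) : act 𝒞 m x X =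
    conv (LinearMap.mulRight ℂ X ∘ₗ (ofG 𝒞 m).toLinearMap) (antip (ofG 𝒞 m).toLinearMap) x := rfl

/-- Convolving `∑ x₁ X S(x₂)` with the inclusion of `G` cancels `S(x₂)`, so invariance under the
action is commutation with `G`. -/
theorem act_eq_counit_iff {X : SemiAlg 𝒞 m} :
    (∀ x : G, act 𝒞 m x X = Coalgebra.counit (R := ℂ) x • X) ↔
      ∀ x, Commute (ofG 𝒞 m x) X := by
  set γ := (ofG 𝒞 m).toLinearMap
  have hγ : IsLeg γ := isLeg_ofG
  have hε : ∀ x, Coalgebra.counit (R := ℂ) x • X = X * (unitLeg : G →ₗ[ℂ] SemiAlg 𝒞 m) x :=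
    fun x => by rw [unitLeg_apply, ← Algebra.commutes, Algebra.smul_def]
  constructor
  · intro h x
    have h1 : conv (LinearMap.mulRight ℂ X ∘ₗ γ) (antip γ) = LinearMap.mulLeft ℂ X ∘ₗ unitLeg :=
      LinearMap.ext fun y => (h y).trans (hε y)
    have h2 : conv (conv (LinearMap.mulRight ℂ X ∘ₗ γ) (antip γ)) γ x = γ x * X := by
      rw [conv_assoc, antip_conv_self hγ, conv_unitLeg]
      rfl
    rw [h1, mulLeft_conv, unitLeg_conv] at h2
    exact h2.symm
  · intro h x
    have h1 : LinearMap.mulRight ℂ X ∘ₗ γ = LinearMap.mulLeft ℂ X ∘ₗ γ :=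
      LinearMap.ext fun y => (h y).eq
    rw [act_eq_conv, h1, mulLeft_conv, self_conv_antip hγ, hε]

theorem mem_invariantAlg {X : SemiAlg 𝒞 m} :
    X ∈ invariantAlg 𝒞 m ↔ X ∈ (ofL 𝒞 m).range ∧ ∀ x, Commute (ofG 𝒞 m x) X :=
  and_congr_right fun _ => act_eq_counit_iff

theorem add_mem_invariantAlg {X Y : SemiAlg 𝒞 m} (hX : X ∈ invariantAlg 𝒞 m)
    (hY : Y ∈ invariantAlg 𝒞 m) : X + Y ∈ invariantAlg 𝒞 m := by
  rw [mem_invariantAlg] at *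
  exact ⟨add_mem hX.1 hY.1, fun x => (hX.2 x).add_right (hY.2 x)⟩

theorem mul_mem_invariantAlg {X Y : SemiAlg 𝒞 m} (hX : X ∈ invariantAlg 𝒞 m)
    (hY : Y ∈ invariantAlg 𝒞 m) : X * Y ∈ invariantAlg 𝒞 m := by
  rw [mem_invariantAlg] at *
  exact ⟨mul_mem hX.1 hY.1, fun x => (hX.2 x).mul_right (hY.2 x)⟩

theorem smul_mem_invariantAlg (c : ℂ) {X : SemiAlg 𝒞 m} (hX : X ∈ invariantAlg 𝒞 m) :
    c • X ∈ invariantAlg 𝒞 m := by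
  rw [mem_invariantAlg] at *
  exact ⟨Subalgebra.smul_mem _ hX.1 c, fun x => (hX.2 x).smul_right c⟩

section Faithful

variable [DecidableEq Λ] (hd : ∀ I, 0 < qdim 𝒢 𝒯 I) (hS : IsUnit (SMatrix 𝒢 𝒯))
  {F : SemiAlg 𝒞 m →ₐ[ℂ] TotalOp 𝒯 m} (hF : IsSysHom F (totalSystem 𝒯 m) m)

include hF

theorem IsSysHom.extend_ofL {F' : SemiAlg 𝒞 m →ₐ[ℂ] TotalOp 𝒯 m ⊗[ℂ] G}
    (hF' : IsSysHom F' ((totalSystem 𝒯 m).extend m) (m + 1)) {X : SemiAlg 𝒞 m}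
    (hX : X ∈ (ofL 𝒞 m).range) : F' X = extL G _ (F X) := by
  obtain ⟨Y, rfl⟩ := hX
  have h : F'.comp (ofL 𝒞 m) = ((extL G _).comp F).comp (ofL 𝒞 m) := GraphAlg.hom_ext 𝒞 fun ν J => by
    have h1 : (graphM 𝒞 ν J).map (F'.comp (ofL 𝒞 m)) = (mono 𝒞 ν J).map F' := rfl
    have h2 : (graphM 𝒞 ν J).map (((extL G _).comp F).comp (ofL 𝒞 m)) =
      ((mono 𝒞 ν J).map F).map (extL G _) := rfl
    rw [h1, h2, hF'.map_mono, hF.map_mono, map_matrix_smul, LegSystem.extend_loopMat _ _ _ ν.2]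
  exact DFunLike.congr_fun h Y

include hd hS

theorem IsSysHom.eq_of_range {X Y : SemiAlg 𝒞 m} (hX : X ∈ (ofL 𝒞 m).range)
    (hY : Y ∈ (ofL 𝒞 m).range) (h : F X = F Y) : X = Y := by
  obtain ⟨X, rfl⟩ := hX
  obtain ⟨Y, rfl⟩ := hY
  exact congrArg (ofL 𝒞 m) ((hF.bijective_comp_ofL hd hS).1 h)

theorem IsSysHom.exists_range (y : TotalOp 𝒯 m) : ∃ X ∈ (ofL 𝒞 m).range, F X = y := by
  obtain ⟨X, hX⟩ := (hF.bijective_comp_ofL hd hS).2 y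
  exact ⟨ofL 𝒞 m X, ⟨X, rfl⟩, hX⟩

theorem IsSysHom.mem_invariantAlg_iff {X : SemiAlg 𝒞 m} (hX : X ∈ (ofL 𝒞 m).range) :
    X ∈ invariantAlg 𝒞 m ↔ ∀ x, Commute ((totalSystem 𝒯 m).io m x) (F X) := by
  rw [mem_invariantAlg, and_iff_right hX]
  constructor
  · intro h x
    rw [← hF.map_ofG]
    exact (h x).map F
  · intro h x
    have hF' := isSysHom_sysHom (𝒞 := 𝒞) (𝒞.kap_zero hd) ((totalSystem 𝒯 m).extend m)
      (Nat.le_succ m)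
    set F' := sysHom 𝒞 (𝒞.kap_zero hd) ((totalSystem 𝒯 m).extend m) (Nat.le_succ m)
    refine (hF'.bijective hd hS).1 ?_
    rw [map_mul, map_mul, hF'.map_ofG, hF.extend_ofL hF' hX, LegSystem.io,
      LegSystem.extend_io _ _ le_rfl, LegSystem.extend_s_self]
    exact conv_commute (fun y => (h y).map (extL G _)) (fun y => (extL_commute_extR _ y).symm) x

/-- The star of a monodromy involves `G`, so that `st X` stays in `ℒ_m` needs invariance. In the
extension the Gram element acquires one more factor `ω` on `ι_m` and the new leg, which commutes
with `F (st X) ⊗ 1` by invariance; hence `st X` has no component along the extra factor `G`. -/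
theorem IsStarOperation.mem_invariantAlg {st : SemiAlg 𝒞 m → SemiAlg 𝒞 m}
    (hst : IsStarOperation 𝒞 m st) {X : SemiAlg 𝒞 m} (hX : X ∈ invariantAlg 𝒞 m) :
    st X ∈ invariantAlg 𝒞 m := by
  rw [GraphAlgebra.mem_invariantAlg] at hX
  have hc : ∀ x, Commute (ofG 𝒞 m x) (st X) := fun x => by
    have h1 := congrArg st (hX.2 (star x)).eq
    rw [hst.map_mul, hst.map_mul, hst.map_ofG, star_star] at h1
    exact h1.symm
  refine GraphAlgebra.mem_invariantAlg.mpr ⟨?_, hc⟩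
  set S := totalSystem 𝒯 m with hS_def
  have hF' := isSysHom_sysHom (𝒞 := 𝒞) (𝒞.kap_zero hd) (S.extend m) (Nat.le_succ m)
  set F' := sysHom 𝒞 (𝒞.kap_zero hd) (S.extend m) (Nat.le_succ m)
  have h1 := hst.star_map hF le_rfl (star_totalSystem 𝒯 m) X
  have h2 := hst.star_map hF' (Nat.le_succ m)
    ((totalSystem 𝒯 m).star_extend m (star_totalSystem 𝒯 m)) X
  rw [hF.extend_ofL hF' hX.1, LegSystem.gramElt, LegSystem.extend_gramElt _ _ _ le_rfl] at h2
  have h3 : star (extL G (TotalOp 𝒯 m) (F X)) = extL G _ (star (F X)) := by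
    change star (F X ⊗ₜ[ℂ] (1 : G)) = star (F X) ⊗ₜ 1
    rw [TensorProduct.star_tmul, star_one]
  rw [h3, ← mul_assoc, ← _root_.map_mul, h1, _root_.map_mul, mul_assoc, mul_assoc,
    LegSystem.extend_io _ _ le_rfl, LegSystem.extend_s_self] at h2
  have h4 : Commute (tens ((extL G _).toLinearMap ∘ₗ S.io m) (extR G _).toLinearMap 𝒞.omega)
      (extL G _ (F (st X))) := by
    refine tens_commute (fun y => ?_) (fun y => (extL_commute_extR _ y).symm) _
    refine Commute.map (?_ : Commute (S.io m y) (F (st X))) (extL G _)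
    rw [← hF.map_ofG]
    exact (hc y).map F
  rw [← h4.eq] at h2
  have h5 : F' (st X) = extL G _ (F (st X)) := by
    have hu1 : IsUnit (extL G (TotalOp 𝒯 m) (S.gramElt 𝒞 m)) :=
      (S.isUnit_gramElt 𝒞 m).map (extL G _)
    have hu2 : IsUnit (tens ((extL G _).toLinearMap ∘ₗ S.io m) (extR G _).toLinearMap 𝒞.omega) :=
      isUnit_tens ((S.isLeg_io m).comp _) ⟨_root_.map_one (extR G _), _root_.map_mul (extR G _)⟩
        (fun x y => extL_commute_extR _ y) 𝒞.isUnit_omega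
    exact (hu2.mul_left_cancel (hu1.mul_left_cancel h2)).symm
  obtain ⟨Y, hY, hYX⟩ := hF.exists_range hd hS (F (st X))
  have h6 : Y = st X := (hF'.bijective hd hS).1 (by rw [hF.extend_ofL hF' hY, hYX, h5])
  exact h6 ▸ hY

end Faithful

end Invariants

/-! ## The moduli algebra -/

section Moduli

variable {G : Type*} [Ring G] [HopfAlgebra ℂ G] [StarRing G] [StarModule ℂ G] {Λ : Type*}
  {𝒢 : RibbonStar G} {𝒯 : Irreps G Λ} {𝒞 : Clebsch 𝒢 𝒯}
  [Fintype Λ] [FiniteDimensional ℂ G] [IsSemisimpleRing G] {m : ℕ}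

theorem qtr_mem {B : Type*} [Ring B] [Algebra ℂ B] {A : Subalgebra ℂ B} {I : Λ} {X : 𝒯.Mat I B}
    (hX : X ∈ A.matrix) : qtr 𝒢 𝒯 I X ∈ A := by
  rw [qtr_eq, Matrix.trace]
  exact A.sum_mem fun i _ => (mul_mem hX (tauLeg_mem 𝒯 I _) :
    X * tauLeg 𝒯 I B (gElt 𝒢) ∈ A.matrix) i i

theorem charProj_mem {B : Type*} [Ring B] [Algebra ℂ B] {A : Subalgebra ℂ B} {c : Λ → B}
    (hc : ∀ I, c I ∈ A) (K : Λ) : charProj 𝒢 𝒯 c K ∈ A :=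
  A.sum_mem fun I _ => A.smul_mem (hc I) _

theorem mono_mem_range (ν : Fin m) (I : Λ) : mono 𝒞 ν I ∈ (ofL 𝒞 m).range.matrix :=
  fun i j => ⟨graphM 𝒞 ν I i j, rfl⟩

theorem moduliUnit_mem_range (K : Fin m → Λ) : moduliUnit 𝒞 K ∈ (ofL 𝒞 m).range := by
  refine mul_mem (charProj_mem (fun I => Subalgebra.smul_mem _ (qtr_mem ?_) _) _)
    (list_prod_mem fun x hx => ?_)
  · refine list_prod_mem fun x hx => ?_
    rw [List.mem_reverse, List.mem_ofFn] at hx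
    obtain ⟨ν, rfl⟩ := hx
    exact mono_mem_range ν I
  · rw [List.mem_ofFn] at hx
    obtain ⟨ν, rfl⟩ := hx
    exact charProj_mem (fun I => Subalgebra.smul_mem _ (qtr_mem (mono_mem_range ν I)) _) _

/-- `D` is the homomorphism of the site operators, because `R'` on two commuting legs is `R` with
the legs exchanged. -/
theorem isLoopRep_iff {K : Fin m → Λ} {D : SemiAlg 𝒞 m →ₐ[ℂ] Op 𝒯 K} :
    IsLoopRep 𝒞 K D ↔ IsSysHom D (siteSystem 𝒯 K) m := by
  have h : ∀ (ν : Fin m) (J : Λ), 𝒯.slot J (iota 𝒯 K ν) (tensorFlip (𝒢.R : G ⊗[ℂ] G)) *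
      ((𝒞.kap J)⁻¹ •
        𝒯.slot J (site 𝒯 K ν) (tensorFlip (𝒢.R : G ⊗[ℂ] G) * (𝒢.R : G ⊗[ℂ] G))) *
      𝒯.slot J (iota 𝒯 K ν) (tensorFlip 𝒢.Rinv) =
      (𝒞.kap J)⁻¹ • loopMat 𝒯 𝒢 (siteSystem 𝒯 K) ν J := fun ν J => by
    rw [slot_eq, slot_eq, slot_eq, tens_flip (comm_tauLeg_scalLeg 𝒯 J _),
      tens_flip (comm_tauLeg_scalLeg 𝒯 J _), ← io_siteSystem 𝒯 K ν.2.le, ← siteSystem_s,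
      loopMat, loopN, Qm_eq_tens 𝒢 (isLeg_tauLeg 𝒯 J)
        (isLeg_scalLeg 𝒯 J ((siteSystem 𝒯 K).isLeg ν)) (comm_tauLeg_scalLeg 𝒯 J _),
      mul_smul_comm, smul_mul_assoc]
    rfl
  constructor
  · exact fun hD => ⟨fun x => by rw [hD.map_ofG, io_siteSystem 𝒯 K le_rfl],
      fun ν J => (hD.map_mono ν J).trans (h ν J)⟩
  · exact fun hD => ⟨fun ν J => (hD.map_mono ν J).trans (h ν J).symm,
      fun x => by rw [hD.map_ofG, io_siteSystem 𝒯 K le_rfl]⟩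

theorem IsSysHom.unique {B : Type*} [Ring B] [Algebra ℂ B] {F F' : SemiAlg 𝒞 m →ₐ[ℂ] B}
    {S : LegSystem G B} {n : ℕ} (hF : IsSysHom F S n) (hF' : IsSysHom F' S n) : F = F' :=
  SemiAlg.hom_ext 𝒞 (fun x => by rw [hF.map_ofG, hF'.map_ofG])
    fun ν J => by rw [hF.map_mono, hF'.map_mono]

theorem posDef_gram (K : Fin m → Λ) : (gram 𝒞 K m).PosDef := by
  rw [← gramElt_siteSystem 𝒞 K le_rfl]
  obtain ⟨Y, hY⟩ := (siteSystem 𝒯 K).exists_gramElt_eq 𝒞 (star_siteSystem 𝒯 K) m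
  have h := (siteSystem 𝒯 K).isUnit_gramElt 𝒞 m
  rw [hY] at h ⊢
  exact (Matrix.posSemidef_conjTranspose_mul_self Y).posDef_iff_isUnit.mpr h

variable [DecidableEq Λ]

theorem Irreps.star_haar : star 𝒯.haar = 𝒯.haar :=
  𝒯.ext_rep fun L => by
    rw [map_star, 𝒯.τ_haar]
    split_ifs <;> simp

theorem haar_commute {B : Type*} [Ring B] [Algebra ℂ B] {f : G →ₗ[ℂ] B} (hf : IsLeg f) (x : G) :
    Commute (f x) (f 𝒯.haar) := by
  rw [Commute, SemiconjBy, ← hf.mul, ← hf.mul, 𝒯.mul_haar, 𝒯.haar_mul]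

variable (hd : ∀ I, 0 < qdim 𝒢 𝒯 I) (hS : IsUnit (SMatrix 𝒢 𝒯)) (K : Fin m → Λ)

section

variable {F : SemiAlg 𝒞 m →ₐ[ℂ] TotalOp 𝒯 m} (hF : IsSysHom F (totalSystem 𝒯 m) m)

include hd hS hF

/-- `χ_ν^{K_ν}` acts on the block `K'` as `δ_{K_ν K'_ν}`, and `χ_0^0` as the integral. -/
theorem IsSysHom.apply_moduliUnit (K' : Fin m → Λ) : F (moduliUnit 𝒞 K) K' =
    (if K = K' then (1 : ℂ) else 0) • iota 𝒯 K' m 𝒯.haar := by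
  have h := (hF.comp (Pi.evalAlgHom ℂ (fun K : Fin m → Λ => Op 𝒯 K) K')).map_moduliUnit hd hS K
  rw [totalSystem, LegSystem.pi_map, io_siteSystem 𝒯 K' le_rfl] at h
  refine h.trans ?_
  have h1 : ∀ ν : Fin m, (siteSystem 𝒯 K').s ν (charProj 𝒢 𝒯 (zElt 𝒢 𝒯) (K ν)) =
      (if K ν = K' ν then (1 : ℂ) else 0) • 1 := fun ν => by
    rw [siteSystem_s]
    refine site_of_scalar 𝒯 K' ?_
    rw [𝒞.τ_charProj hd hS]
    split_ifs <;> simp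
  simp only [h1]
  by_cases hK : K = K'
  · subst hK
    simp
  · obtain ⟨ν, hν⟩ := Function.ne_iff.mp hK
    rw [if_neg hK, zero_smul]
    have h2 : (0 : Op 𝒯 K') ∈ List.ofFn fun ν : Fin m =>
        (if K ν = K' ν then (1 : ℂ) else 0) • (1 : Op 𝒯 K') := by
      rw [List.mem_ofFn]
      exact ⟨ν, by rw [if_neg hν, zero_smul]⟩
    rw [List.prod_eq_zero h2, mul_zero]

omit [DecidableEq Λ] hd hS hF in
theorem io_totalSystem (x : G) : (totalSystem 𝒯 m).io m x K = iota 𝒯 K m x := by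
  have h := (totalSystem 𝒯 m).map_io (Pi.evalAlgHom ℂ (fun K : Fin m → Λ => Op 𝒯 K) K) m
  rw [totalSystem, LegSystem.pi_map, io_siteSystem 𝒯 K le_rfl] at h
  exact (LinearMap.congr_fun h x).symm

omit [DecidableEq Λ] hd hS hF in
theorem isLeg_iota : IsLeg (iota 𝒯 K m) := by
  rw [← io_siteSystem 𝒯 K le_rfl]
  exact (siteSystem 𝒯 K).isLeg_io m

theorem IsSysHom.moduliUnit_mem : moduliUnit 𝒞 K ∈ invariantAlg 𝒞 m := by
  rw [hF.mem_invariantAlg_iff hd hS (moduliUnit_mem_range K)]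
  intro x
  funext K'
  rw [Pi.mul_apply, Pi.mul_apply, io_totalSystem, hF.apply_moduliUnit hd hS]
  exact ((haar_commute (isLeg_iota K') x).smul_right _).eq

omit hd hS in
theorem IsSysHom.commute_iota {X : SemiAlg 𝒞 m} (hX : X ∈ invariantAlg 𝒞 m) (x : G) :
    Commute (iota 𝒯 K m x) (F X K) := by
  have h := congrFun (((mem_invariantAlg.mp hX).2 x).map F).eq K
  rwa [hF.map_ofG, Pi.mul_apply, Pi.mul_apply, io_totalSystem] at h

theorem IsSysHom.moduliUnit_commute {X : SemiAlg 𝒞 m} (hX : X ∈ invariantAlg 𝒞 m) :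
    moduliUnit 𝒞 K * X = X * moduliUnit 𝒞 K := by
  have he := hF.moduliUnit_mem hd hS K
  refine hF.eq_of_range hd hS (mul_mem_invariantAlg he hX).1 (mul_mem_invariantAlg hX he).1 ?_
  funext K'
  rw [map_mul, map_mul, Pi.mul_apply, Pi.mul_apply, hF.apply_moduliUnit hd hS]
  exact ((hF.commute_iota K' hX _).smul_left _).eq

theorem IsSysHom.moduliUnit_mul_self :
    moduliUnit 𝒞 K * moduliUnit 𝒞 K = moduliUnit 𝒞 K := by
  have he := hF.moduliUnit_mem hd hS K
  refine hF.eq_of_range hd hS (mul_mem_invariantAlg he he).1 he.1 ?_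
  funext K'
  rw [map_mul, Pi.mul_apply, hF.apply_moduliUnit hd hS, smul_mul_smul_comm,
    ← (isLeg_iota K').mul, 𝒯.haar_mul, 𝒯.counit_haar, one_smul]
  split_ifs <;> simp

/-- The product of the projectors is an invariant idempotent, so multiples of it are exactly its
fixed points. -/
theorem IsSysHom.mem_moduliSet {X : SemiAlg 𝒞 m} :
    X ∈ moduliSet 𝒞 K ↔ X ∈ invariantAlg 𝒞 m ∧ moduliUnit 𝒞 K * X = X := by
  constructor
  · rintro ⟨A, hA, rfl⟩
    exact ⟨mul_mem_invariantAlg (hF.moduliUnit_mem hd hS K) hA, by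
      rw [← mul_assoc, hF.moduliUnit_mul_self hd hS]⟩
  · exact fun h => ⟨X, h.1, h.2.symm⟩

theorem IsSysHom.apply_of_moduliSet {X : SemiAlg 𝒞 m} (hX : X ∈ moduliSet 𝒞 K) (K' : Fin m → Λ) :
    F X K' = (if K = K' then (1 : ℂ) else 0) • (iota 𝒯 K' m 𝒯.haar * F X K') := by
  have h := congrFun (congrArg F ((hF.mem_moduliSet hd hS K).mp hX).2) K'
  rw [map_mul, Pi.mul_apply, hF.apply_moduliUnit hd hS, smul_mul_assoc] at h
  exact h.symm

theorem IsSysHom.moduliSet_ext {X Y : SemiAlg 𝒞 m} (hX : X ∈ moduliSet 𝒞 K)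
    (hY : Y ∈ moduliSet 𝒞 K) (h : F X K = F Y K) : X = Y := by
  refine hF.eq_of_range hd hS ((hF.mem_moduliSet hd hS K).mp hX).1.1
    ((hF.mem_moduliSet hd hS K).mp hY).1.1 ?_
  funext K'
  by_cases hK : K = K'
  · subst hK
    exact h
  · rw [hF.apply_of_moduliSet hd hS K hX, hF.apply_of_moduliSet hd hS K hY, if_neg hK, zero_smul,
      zero_smul]

/-- Extend `y` by zero to the other blocks. With `p = ι_m(h)`, the relation `p y = y = y p` makes
`G` act on `y` through the counit from both sides, so the extension is invariant. -/
theorem IsSysHom.exists_moduliSet {y : Op 𝒯 K} (h1 : iota 𝒯 K m 𝒯.haar * y = y)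
    (h2 : y * iota 𝒯 K m 𝒯.haar = y) : ∃ X ∈ moduliSet 𝒞 K, F X K = y := by
  obtain ⟨X, hX, hXy⟩ := hF.exists_range hd hS (Pi.single K y)
  have hXA : X ∈ invariantAlg 𝒞 m := by
    rw [hF.mem_invariantAlg_iff hd hS hX, hXy]
    intro x
    funext K'
    rw [Pi.mul_apply, Pi.mul_apply, io_totalSystem]
    by_cases hK : K' = K
    · subst hK
      rw [Pi.single_eq_same, ← h1, ← mul_assoc, ← (isLeg_iota K').mul, 𝒯.mul_haar, map_smul,
        smul_mul_assoc, h1, ← h2, mul_assoc, ← (isLeg_iota K').mul, 𝒯.haar_mul, map_smul,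
        mul_smul_comm]
    · rw [Pi.single_eq_of_ne hK, mul_zero, zero_mul]
  refine ⟨X, (hF.mem_moduliSet hd hS K).mpr ⟨hXA, ?_⟩, by rw [hXy, Pi.single_eq_same]⟩
  refine hF.eq_of_range hd hS (mul_mem_invariantAlg (hF.moduliUnit_mem hd hS K) hXA).1 hX ?_
  funext K'
  rw [map_mul, Pi.mul_apply, hF.apply_moduliUnit hd hS, hXy]
  by_cases hK : K' = K
  · subst hK
    rw [Pi.single_eq_same, if_pos rfl, one_smul, h1]
  · rw [Pi.single_eq_of_ne hK, mul_zero]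

/-- `h^* = h`, so `ι_m(h)` is self-adjoint for the Gram element, and the coefficients on the blocks
are real. -/
theorem IsStarOperation.map_moduliUnit {st : SemiAlg 𝒞 m → SemiAlg 𝒞 m}
    (hst : IsStarOperation 𝒞 m st) : st (moduliUnit 𝒞 K) = moduliUnit 𝒞 K := by
  have he := hF.moduliUnit_mem hd hS K
  refine hF.eq_of_range hd hS (hst.mem_invariantAlg hd hS hF he).1 he.1 ?_
  have h1 := hst.star_map hF le_rfl (star_totalSystem 𝒯 m) (moduliUnit 𝒞 K)
  have h2 : star (F (moduliUnit 𝒞 K)) * (totalSystem 𝒯 m).gramElt 𝒞 m =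
      (totalSystem 𝒯 m).gramElt 𝒞 m * F (moduliUnit 𝒞 K) := by
    have h3 := (totalSystem 𝒯 m).star_io 𝒞 (star_totalSystem 𝒯 m) m 𝒯.haar
    rw [𝒯.star_haar] at h3
    funext K'
    have h4 := congrFun h3 K'
    rw [Pi.mul_apply, Pi.mul_apply, Pi.star_apply, io_totalSystem] at h4
    rw [Pi.mul_apply, Pi.mul_apply, Pi.star_apply, hF.apply_moduliUnit hd hS, star_smul,
      smul_mul_assoc, h4, mul_smul_comm]
    split_ifs <;> simp
  exact ((totalSystem 𝒯 m).isUnit_gramElt 𝒞 m).mul_left_cancel (h1.symm.trans h2)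

end

/-- The moduli algebra. -/
def moduliAlg : NonUnitalSubalgebra ℂ (SemiAlg 𝒞 m) where
  carrier := moduliSet 𝒞 K
  add_mem' := by
    have hF := isSysHom_sysHom (𝒞.kap_zero hd) (totalSystem 𝒯 m) (le_refl m)
    intro X Y hX hY
    rw [hF.mem_moduliSet hd hS] at *
    exact ⟨add_mem_invariantAlg hX.1 hY.1, by rw [mul_add, hX.2, hY.2]⟩
  mul_mem' := by
    have hF := isSysHom_sysHom (𝒞.kap_zero hd) (totalSystem 𝒯 m) (le_refl m)
    intro X Y hX hY
    rw [hF.mem_moduliSet hd hS] at *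
    exact ⟨mul_mem_invariantAlg hX.1 hY.1, by rw [← mul_assoc, hX.2]⟩
  zero_mem' := ⟨0, by
    rw [mem_invariantAlg]
    exact ⟨zero_mem _, fun x => Commute.zero_right _⟩, by rw [mul_zero]⟩
  smul_mem' := by
    have hF := isSysHom_sysHom (𝒞.kap_zero hd) (totalSystem 𝒯 m) (le_refl m)
    intro c X hX
    change c • X ∈ moduliSet 𝒞 K
    change X ∈ moduliSet 𝒞 K at hX
    rw [hF.mem_moduliSet hd hS] at *
    exact ⟨smul_mem_invariantAlg c hX.1, by rw [mul_smul_comm, hX.2]⟩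

theorem mem_W0_iff (w : Idx 𝒯 K → ℂ) : w ∈ W0 𝒯 K ↔ iota 𝒯 K m 𝒯.haar *ᵥ w = w := by
  constructor
  · intro h
    rw [h, 𝒯.counit_haar, one_smul]
  · intro h x
    rw [← h, Matrix.mulVec_mulVec, ← (isLeg_iota K).mul, 𝒯.mul_haar, map_smul, Matrix.smul_mulVec]

end Moduli

/-! ## Irreducible `*`-representations of corners of matrix algebras -/

section Corner

variable {n : Type*} [Fintype n] [DecidableEq n] {B : Type*} [Ring B] [Algebra ℂ B]

/-- The algebra `M` with unit `e` is identified by `D` with the corner `p Mat p`, which acts on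
`W = range p`; its `*`-operation `st` is the adjoint for the scalar product with Gram matrix `P`. -/
structure IsCorner (D : B →ₐ[ℂ] Matrix n n ℂ) (M : NonUnitalSubalgebra ℂ B) (e : B) (st : B → B)
    (p P : Matrix n n ℂ) (W : Submodule ℂ (n → ℂ)) : Prop where
  ext : ∀ X ∈ M, ∀ Y ∈ M, D X = D Y → X = Y
  exists_eq : ∀ y, p * y = y → y * p = y → ∃ X ∈ M, D X = y
  left : ∀ X ∈ M, p * D X = D X
  right : ∀ X ∈ M, D X * p = D X
  unit_mem : e ∈ M
  map_unit : D e = p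
  st_mem : ∀ X ∈ M, st X ∈ M
  st_unit : st e = e
  star_map : ∀ X ∈ M, star (D X) * P = P * D (st X)
  posDef : P.PosDef
  mem_iff : ∀ w, w ∈ W ↔ p *ᵥ w = w

namespace IsCorner

variable {D : B →ₐ[ℂ] Matrix n n ℂ} {M : NonUnitalSubalgebra ℂ B} {e : B} {st : B → B}
  {p P : Matrix n n ℂ} {W : Submodule ℂ (n → ℂ)} (h : IsCorner D M e st p P W)

include h

theorem unit_mul {X : B} (hX : X ∈ M) : e * X = X :=
  h.ext _ (M.mul_mem h.unit_mem hX) _ hX (by rw [map_mul, h.map_unit, h.left X hX])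

theorem mul_unit {X : B} (hX : X ∈ M) : X * e = X :=
  h.ext _ (M.mul_mem hX h.unit_mem) _ hX (by rw [map_mul, h.map_unit, h.right X hX])

theorem p_mul_p : p * p = p := by
  have := h.left e h.unit_mem
  rwa [h.map_unit] at this

theorem p_mulVec_mem (v : n → ℂ) : p *ᵥ v ∈ W := by
  rw [h.mem_iff, Matrix.mulVec_mulVec, h.p_mul_p]

theorem mulVec_mem {X : B} (hX : X ∈ M) (v : n → ℂ) : D X *ᵥ v ∈ W := by
  rw [h.mem_iff, Matrix.mulVec_mulVec, h.left X hX]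

theorem form_map {X : B} (hX : X ∈ M) (v w : n → ℂ) :
    star (D X *ᵥ v) ⬝ᵥ (P *ᵥ w) = star v ⬝ᵥ (P *ᵥ (D (st X) *ᵥ w)) := by
  rw [Matrix.star_mulVec, ← Matrix.dotProduct_mulVec, Matrix.mulVec_mulVec, Matrix.mulVec_mulVec]
  exact congrArg (fun Y => star v ⬝ᵥ (Y *ᵥ w)) (h.star_map X hX)

/-- A rank-one operator with image in `W` lies in the corner once its functional is cut down by `p`.
-/
theorem exists_rank_one {w : n → ℂ} (hw : w ∈ W) (l : n → ℂ) :
    ∃ X ∈ M, D X = Matrix.vecMulVec w (l ᵥ* p) := by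
  refine h.exists_eq _ ?_ ?_
  · rw [Matrix.mul_vecMulVec, (h.mem_iff w).mp hw]
  · rw [Matrix.vecMulVec_mul, Matrix.vecMul_vecMul, h.p_mul_p]

/-- From a nonzero `u` in `U`, rank-one operators built with the functional `star u` reach every
vector of `W`. -/
theorem irreducible {U : Submodule ℂ (n → ℂ)} (hU : U ≤ W)
    (hinv : ∀ X ∈ M, ∀ u ∈ U, D X *ᵥ u ∈ U) : U = ⊥ ∨ U = W := by
  by_cases hU0 : U = ⊥
  · exact Or.inl hU0
  · obtain ⟨u, hu, hu0⟩ := U.ne_bot_iff.mp hU0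
    refine Or.inr (le_antisymm hU fun w hw => ?_)
    obtain ⟨X, hX, hXw⟩ := h.exists_rank_one hw (star u)
    have h1 := hinv X hX u hu
    have h2 : star u ⬝ᵥ u ≠ 0 := fun e => hu0 (dotProduct_star_self_eq_zero.mp e)
    rw [hXw, Matrix.vecMulVec_mulVec, ← Matrix.dotProduct_mulVec, (h.mem_iff u).mp (hU hu)] at h1
    have h3 := U.smul_mem (star u ⬝ᵥ u)⁻¹ h1
    rwa [op_smul_eq_smul, smul_smul, inv_mul_cancel₀ h2, one_smul] at h3

theorem exists_unit_vector (hW : W ≠ ⊥) : ∃ w ∈ W, star w ⬝ᵥ (P *ᵥ w) = 1 := by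
  obtain ⟨w, hw, hw0⟩ := W.ne_bot_iff.mp hW
  have hpos := h.posDef.dotProduct_mulVec_pos hw0
  set c := star w ⬝ᵥ (P *ᵥ w)
  have hc : (c.re : ℂ) = c := (Complex.eq_re_of_ofReal_le hpos.le).symm
  have hre : 0 < c.re := (Complex.pos_iff.mp hpos).1
  refine ⟨((Real.sqrt c.re)⁻¹ : ℂ) • w, W.smul_mem _ hw, ?_⟩
  rw [star_smul, Matrix.mulVec_smul, smul_dotProduct, dotProduct_smul]
  change _ • _ • c = 1
  rw [← hc, ← Complex.ofReal_inv, RCLike.star_def, Complex.conj_ofReal, smul_eq_mul, smul_eq_mul,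
    ← Complex.ofReal_mul, ← Complex.ofReal_mul, Complex.ofReal_re, ← mul_assoc, ← mul_inv,
    Real.mul_self_sqrt hre.le, inv_mul_cancel₀ hre.ne', Complex.ofReal_one]

/-- `p` is self-adjoint for the form, because the unit is fixed by `st`. -/
theorem vecMul_p {w : n → ℂ} (hw : w ∈ W) : star w ᵥ* P ᵥ* p = star w ᵥ* P := by
  have h1 := h.star_map e h.unit_mem
  rw [h.st_unit, h.map_unit] at h1
  rw [Matrix.vecMul_vecMul, ← h1, ← Matrix.vecMul_vecMul]
  congr 1
  rw [Matrix.star_eq_conjTranspose, ← Matrix.star_mulVec, (h.mem_iff w).mp hw]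

/-- `R w` is the operator `|w⟩⟨w₀|` of the scalar product; linearity in `w` holds because `D` is
injective on `M`. -/
theorem exists_ketbra {w₀ : n → ℂ} (hw₀ : w₀ ∈ W) : ∃ R : W →ₗ[ℂ] M, ∀ w : W,
    D (R w : B) = Matrix.vecMulVec (w : n → ℂ) (star w₀ ᵥ* P) := by
  have h1 : ∀ w : W, ∃ X : M, D (X : B) = Matrix.vecMulVec (w : n → ℂ) (star w₀ ᵥ* P) := fun w => by
    obtain ⟨X, hX, hX'⟩ := h.exists_rank_one w.2 (star w₀ ᵥ* P)
    exact ⟨⟨X, hX⟩, by rw [hX', h.vecMul_p hw₀]⟩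
  choose R hR using h1
  refine ⟨⟨⟨R, fun v w => ?_⟩, fun c w => ?_⟩, hR⟩
  · refine Subtype.ext (h.ext _ (R _).2 _ (R v + R w).2 ?_)
    rw [hR, NonUnitalSubalgebra.coe_add, map_add, hR, hR, Submodule.coe_add,
      Matrix.add_vecMulVec]
  · refine Subtype.ext (h.ext _ (R _).2 _ (c • R w).2 ?_)
    rw [hR, NonUnitalSubalgebra.coe_smul, map_smul, hR, Submodule.coe_smul,
      Matrix.smul_vecMulVec]
    rfl

section Classification

variable {w₀ : W} (hw₀ : star (w₀ : n → ℂ) ⬝ᵥ (P *ᵥ w₀) = 1) {R : W →ₗ[ℂ] M}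
  (hR : ∀ w : W, D (R w : B) = Matrix.vecMulVec (w : n → ℂ) (star (w₀ : n → ℂ) ᵥ* P))

include hR

theorem mul_ketbra (X : M) (v : W) :
    X * R v = R ⟨D (X : B) *ᵥ v, h.mulVec_mem X.2 v⟩ := by
  refine Subtype.ext (h.ext _ (X * R v).2 _ (R _).2 ?_)
  rw [NonUnitalSubalgebra.coe_mul, map_mul, hR, hR, Matrix.mul_vecMulVec]

/-- The rule `(|v⟩⟨w₀|)^* |w⟩⟨w₀| = ⟨v, w⟩ |w₀⟩⟨w₀|`, from which the scalar product is recovered in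
any `*`-representation. -/
theorem st_ketbra_mul (v w : W) : (⟨st (R v : B), h.st_mem _ (R v).2⟩ : M) * R w =
    (star (v : n → ℂ) ⬝ᵥ (P *ᵥ (w : n → ℂ))) • R w₀ := by
  refine Subtype.ext (h.ext _ (_ * R w : M).2 _ (_ • R w₀ : M).2 ?_)
  have h1 : D (st (R v : B)) = Matrix.vecMulVec (w₀ : n → ℂ) (star (v : n → ℂ) ᵥ* P) := by
    refine h.posDef.isUnit.mul_left_cancel ?_
    rw [← h.star_map _ (R v).2, hR, Matrix.star_eq_conjTranspose, Matrix.conjTranspose_vecMulVec,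
      Matrix.vecMulVec_mul, Matrix.mul_vecMulVec, Matrix.star_vecMul, star_star,
      h.posDef.isHermitian.eq]
  rw [NonUnitalSubalgebra.coe_mul, NonUnitalSubalgebra.coe_smul, map_mul, map_smul, hR, hR, h1,
    Matrix.vecMulVec_mul_vecMulVec, ← Matrix.dotProduct_mulVec]
  exact Matrix.vecMulVec_smul _ _ _

include hw₀

theorem ketbra_mul_ketbra (w : W) : R w * R w₀ = R w := by
  rw [h.mul_ketbra hR]
  congr 1
  refine Subtype.ext ?_
  change D (R w : B) *ᵥ (w₀ : n → ℂ) = w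
  rw [hR, Matrix.vecMulVec_mulVec, ← Matrix.dotProduct_mulVec, hw₀, op_smul_eq_smul, one_smul]

/-- `p = p p = ∑ |p e_i⟩⟨w₀, w₀⟩⟨e_i p|`: the unit lies in the ideal generated by the operators
`|w⟩⟨w₀|`, so no unital representation on a nonzero space kills all of them. -/
theorem unit_eq_sum : ∃ Z : n → M, (⟨e, h.unit_mem⟩ : M) =
    ∑ i, R ⟨p *ᵥ Pi.single i 1, h.p_mulVec_mem _⟩ * Z i := by
  have h1 : ∀ i : n, ∃ X : M, D (X : B) = Matrix.vecMulVec (w₀ : n → ℂ) (Pi.single i 1 ᵥ* p) :=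
    fun i => by
      obtain ⟨X, hX, hX'⟩ := h.exists_rank_one w₀.2 (Pi.single i 1)
      exact ⟨⟨X, hX⟩, hX'⟩
  choose Z hZ using h1
  refine ⟨Z, Subtype.ext (h.ext _ h.unit_mem _ (∑ i, _ * Z i : M).2 ?_)⟩
  have h2 : ((∑ i, R ⟨p *ᵥ Pi.single i 1, h.p_mulVec_mem _⟩ * Z i : M) : B) =
      ∑ i, (R ⟨p *ᵥ Pi.single i 1, h.p_mulVec_mem _⟩ : B) * (Z i : B) := by
    simp
  rw [h2, map_sum, h.map_unit]
  simp only [map_mul, hR, hZ, Matrix.vecMulVec_mul_vecMulVec, ← Matrix.dotProduct_mulVec, hw₀]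
  conv_lhs => rw [← h.p_mul_p]
  ext a b
  simp [Matrix.mul_apply, Matrix.sum_apply, Matrix.vecMulVec_apply]

end Classification

/-- Choose a unit vector `k₀` in the range of the idempotent `π(|w₀⟩⟨w₀|)` and set `T w = π(|w⟩⟨w₀|)
k₀`. The multiplication rules make `T` isometric and intertwining, and irreducibility makes it onto.
-/
theorem classification {H : Type*} [NormedAddCommGroup H] [InnerProductSpace ℂ H]
    [CompleteSpace H] {π : M →ₙₐ[ℂ] (H →L[ℂ] H)} (hπ : IsIrredStarRep st M e π) :
    ∃ T : W ≃ₗ[ℂ] H,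
      (∀ v w : W, inner ℂ (T v) (T w) = star (v : n → ℂ) ⬝ᵥ (P *ᵥ (w : n → ℂ))) ∧
      ∀ (X : M) (v w : W), (w : n → ℂ) = D (X : B) *ᵥ (v : n → ℂ) → T w = π X (T v) := by
  have hnt := hπ.nontrivial
  have hone : π ⟨e, h.unit_mem⟩ = 1 := hπ.map_unit _ rfl
  have hone' : (1 : H →L[ℂ] H) ≠ 0 := one_ne_zero
  -- If `W = 0`, the unit of `M` is zero and a unital representation would give `1 = 0` on a nonzero
  -- space; this is the case without irreducible representations.
  have hW : W ≠ ⊥ := by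
    rintro rfl
    have hp : p = 0 := by
      ext i j
      have h1 := congrFun ((Submodule.mem_bot ℂ).mp (h.p_mulVec_mem (Pi.single j 1))) i
      simpa using h1
    have he : e = 0 := h.ext _ h.unit_mem _ M.zero_mem (by rw [h.map_unit, hp, map_zero])
    apply hone'
    rw [← hone, ← map_zero π]
    exact congrArg π (Subtype.ext he)
  obtain ⟨w₀, hw₀W, hw₀⟩ := h.exists_unit_vector hW
  obtain ⟨R, hR⟩ := h.exists_ketbra hw₀W
  lift w₀ to W using hw₀W
  have hq : π (R w₀) ≠ 0 := by
    intro h0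
    have h1 : ∀ w, π (R w) = 0 := fun w => by
      rw [← h.ketbra_mul_ketbra hw₀ hR w, map_mul, h0, mul_zero]
    obtain ⟨Z, hZ⟩ := h.unit_eq_sum hw₀ hR
    apply hone'
    rw [← hone, hZ, map_sum]
    exact Finset.sum_eq_zero fun i _ => by rw [map_mul, h1, zero_mul]
  obtain ⟨k, hk⟩ : ∃ k, π (R w₀) k ≠ 0 := by
    by_contra! hc
    exact hq (ContinuousLinearMap.ext hc)
  have hqq : ∀ x, π (R w₀) (π (R w₀) x) = π (R w₀) x := fun x => by
    rw [← mul_apply_eq_comp, ← map_mul, h.ketbra_mul_ketbra hw₀ hR]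
  set k₀ : H := ((‖π (R w₀) k‖⁻¹ : ℝ) : ℂ) • π (R w₀) k with hk₀
  have hk₀q : π (R w₀) k₀ = k₀ := by rw [hk₀, map_smul, hqq]
  have hk₀n : inner ℂ k₀ k₀ = (1 : ℂ) := by
    rw [inner_self_eq_norm_sq_to_K, hk₀, norm_smul, Complex.norm_real, norm_inv, norm_norm,
      inv_mul_cancel₀ (norm_ne_zero_iff.mpr hk)]
    simp
  clear_value k₀
  let T : W →ₗ[ℂ] H :=
    { toFun := fun w => π (R w) k₀
      map_add' := fun v w => by rw [map_add, map_add]; rfl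
      map_smul' := fun c w => by rw [map_smul, map_smul]; rfl }
  have hT : ∀ w, T w = π (R w) k₀ := fun _ => rfl
  have hinner : ∀ v w : W, inner ℂ (T v) (T w) =
      star (v : n → ℂ) ⬝ᵥ (P *ᵥ (w : n → ℂ)) := fun v w => by
    rw [hT, hT, ← ContinuousLinearMap.adjoint_inner_right,
      ← hπ.map_star (R v) ⟨st (R v : B), h.st_mem _ (R v).2⟩ rfl, ← mul_apply_eq_comp,
      ← map_mul, h.st_ketbra_mul hR, map_smul, FunLike.coe_smul, Pi.smul_apply, hk₀q,
      inner_smul_right, hk₀n, mul_one]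
  have hTX : ∀ (X : M) (v w : W), (w : n → ℂ) = D (X : B) *ᵥ (v : n → ℂ) → T w = π X (T v) := by
    intro X v w hw
    rw [hT, hT, ← mul_apply_eq_comp, ← map_mul, h.mul_ketbra hR]
    congr 3
    exact Subtype.ext hw
  have hinj : Function.Injective T := by
    rw [← LinearMap.ker_eq_bot, LinearMap.ker_eq_bot']
    intro v hv
    by_contra hv0
    have h1 := h.posDef.dotProduct_mulVec_pos (x := (v : n → ℂ)) fun h0 => hv0 (Subtype.ext h0)
    rw [← hinner, hv, inner_zero_left] at h1
    exact lt_irrefl _ h1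
  have hsurj : Function.Surjective T := by
    rw [← LinearMap.range_eq_top]
    -- The range is finite-dimensional, hence closed, and it contains `T w₀ = k₀`, which is nonzero.
    refine (hπ.irreducible (LinearMap.range T) (Submodule.closed_of_finiteDimensional _)
      ?_).resolve_left fun hbot => ?_
    · rintro X _ ⟨v, rfl⟩
      exact ⟨⟨D (X : B) *ᵥ v, h.mulVec_mem X.2 v⟩, hTX X v _ rfl⟩
    · have h1 : T w₀ ∈ LinearMap.range T := ⟨w₀, rfl⟩
      rw [hbot, Submodule.mem_bot, hT, hk₀q] at h1
      rw [h1, inner_zero_left] at hk₀n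
      exact zero_ne_one hk₀n
  exact ⟨LinearEquiv.ofBijective T ⟨hinj, hsurj⟩, hinner, hTX⟩

end IsCorner

end Corner

/-! ### Assembly of the theorem from the isomorphisms and the corner structure. -/

section

variable {G : Type*} [Ring G] [HopfAlgebra ℂ G] [StarRing G] [StarModule ℂ G]
  {Λ : Type*} {𝒢 : RibbonStar G} {𝒯 : Irreps G Λ} {𝒞 : Clebsch 𝒢 𝒯}
  [Fintype Λ] [DecidableEq Λ] [FiniteDimensional ℂ G] [IsSemisimpleRing G] {m : ℕ}
  (hd : ∀ I, 0 < qdim 𝒢 𝒯 I) (hS : IsUnit (SMatrix 𝒢 𝒯)) (K : Fin m → Λ)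

include hd

theorem ofL_injective (hS : IsUnit (SMatrix 𝒢 𝒯)) : Function.Injective (ofL 𝒞 m) := by
  have hF := isSysHom_sysHom (𝒞.kap_zero hd) (totalSystem 𝒯 m) (le_refl m)
  have h := (hF.bijective_comp_ofL hd hS).1
  rw [AlgHom.coe_comp] at h
  exact h.of_comp

theorem existsUnique_isStarOperation (hS : IsUnit (SMatrix 𝒢 𝒯)) :
    ∃! st, IsStarOperation 𝒞 m st := by
  have hF := isSysHom_sysHom (𝒞.kap_zero hd) ((totalSystem 𝒯 m).extend m) (Nat.le_succ m)
  obtain ⟨st, hst⟩ := hF.exists_isStarOperation (Nat.le_succ m)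
    (LegSystem.star_extend _ m (star_totalSystem 𝒯 m)) (hF.bijective hd hS)
  exact ⟨st, hst, fun _ h => hst.unique h⟩

theorem existsUnique_isLoopRep : ∃! D, IsLoopRep 𝒞 K D := by
  have hD := isSysHom_sysHom (𝒞.kap_zero hd) (siteSystem 𝒯 K) (le_refl m)
  exact ⟨_, isLoopRep_iff.mpr hD, fun D' h => (isLoopRep_iff.mp h).unique hD⟩

/-- `D` is the block `K` of the isomorphism of `ℒ_m` with the total operator algebra, and on the
moduli algebra all other blocks vanish. -/
theorem isCorner_moduliAlg {st : SemiAlg 𝒞 m → SemiAlg 𝒞 m} (hst : IsStarOperation 𝒞 m st)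
    {D : SemiAlg 𝒞 m →ₐ[ℂ] Op 𝒯 K} (hD : IsLoopRep 𝒞 K D) :
    IsCorner D (moduliAlg hd hS K) (moduliUnit 𝒞 K) st (iota 𝒯 K m 𝒯.haar) (gram 𝒞 K m)
      (W0 𝒯 K) := by
  have hF := isSysHom_sysHom (𝒞.kap_zero hd) (totalSystem 𝒯 m) (le_refl m)
  set F := sysHom 𝒞 (𝒞.kap_zero hd) (totalSystem 𝒯 m) (le_refl m)
  have hD' := isLoopRep_iff.mp hD
  have hDF : ∀ X, D X = F X K := by
    have h := hF.comp (Pi.evalAlgHom ℂ (fun K : Fin m → Λ => Op 𝒯 K) K)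
    rw [totalSystem, LegSystem.pi_map] at h
    rw [hD'.unique h]
    exact fun _ => rfl
  have hleft : ∀ X ∈ moduliSet 𝒞 K, iota 𝒯 K m 𝒯.haar * D X = D X := fun X hX => by
    have h := hF.apply_of_moduliSet hd hS K hX K
    rw [if_pos rfl, one_smul, ← hDF] at h
    exact h.symm
  have hunit : D (moduliUnit 𝒞 K) = iota 𝒯 K m 𝒯.haar := by
    rw [hDF, hF.apply_moduliUnit hd hS, if_pos rfl, one_smul]
  have hcomm : ∀ X ∈ moduliSet 𝒞 K, X * moduliUnit 𝒞 K = X := fun X hX => by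
    have h := (hF.mem_moduliSet hd hS K).mp hX
    rw [← hF.moduliUnit_commute hd hS K h.1, h.2]
  exact
    { ext := fun X hX Y hY h => hF.moduliSet_ext hd hS K hX hY (by rw [← hDF, ← hDF, h])
      exists_eq := fun y h1 h2 => by
        obtain ⟨X, hX, h⟩ := hF.exists_moduliSet hd hS K h1 h2
        exact ⟨X, hX, (hDF X).trans h⟩
      left := hleft
      right := fun X hX => by rw [← hunit, ← map_mul, hcomm X hX]
      unit_mem := (hF.mem_moduliSet hd hS K).mpr
        ⟨hF.moduliUnit_mem hd hS K, hF.moduliUnit_mul_self hd hS K⟩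
      map_unit := hunit
      st_mem := fun X hX => (hF.mem_moduliSet hd hS K).mpr
        ⟨hst.mem_invariantAlg hd hS hF ((hF.mem_moduliSet hd hS K).mp hX).1, by
          conv_rhs => rw [← hcomm X hX, hst.map_mul, hst.map_moduliUnit hd hS K hF]⟩
      st_unit := hst.map_moduliUnit hd hS K hF
      star_map := fun X _ => by
        rw [← gramElt_siteSystem 𝒞 K le_rfl]
        exact hst.star_map hD' le_rfl (star_siteSystem 𝒯 K) X
      posDef := posDef_gram K
      mem_iff := mem_W0_iff K }

end

end GraphAlgebra

end

open GraphAlgebra in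
theorem mainTheorem7
    {G : Type*} [Ring G] [HopfAlgebra ℂ G] [StarRing G] [StarModule ℂ G]
    [FiniteDimensional ℂ G] [IsSemisimpleRing G]
    {Λ : Type*} [Fintype Λ] [DecidableEq Λ]
    (𝒢 : RibbonStar G) (𝒯 : Irreps G Λ) (𝒞 : Clebsch 𝒢 𝒯)
    (hd : ∀ I, 0 < qdim 𝒢 𝒯 I) (hS : IsUnit (SMatrix 𝒢 𝒯))
    (m : ℕ) (K : Fin m → Λ) :
    -- the graph algebra is a subalgebra of the semi-direct product
    Function.Injective (ofL 𝒞 m) ∧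
    -- the `*`-operation and the representation `D` exist and are unique
    (∃! st, IsStarOperation 𝒞 m st) ∧
    (∃! D, IsLoopRep 𝒞 K D) ∧
    ∀ st, IsStarOperation 𝒞 m st → ∀ D, IsLoopRep 𝒞 K D →
      -- `⟨·,·⟩` is a positive definite scalar product
      (gram 𝒞 K m).PosDef ∧
      -- the moduli algebra is a `*`-algebra with unit `χ_0^0 ∏ χ_ν^{K_ν}`
      ∃ M : NonUnitalSubalgebra ℂ (SemiAlg 𝒞 m),
        (M : Set (SemiAlg 𝒞 m)) = moduliSet 𝒞 K ∧
        moduliUnit 𝒞 K ∈ M ∧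
        (∀ X ∈ M, moduliUnit 𝒞 K * X = X ∧ X * moduliUnit 𝒞 K = X) ∧
        (∀ X ∈ M, st X ∈ M) ∧
        -- `D` restricts to a unital `*`-representation of it on `W^0(K_1, …, K_m)`
        (∀ X ∈ M, ∀ w ∈ W0 𝒯 K, D X *ᵥ w ∈ W0 𝒯 K) ∧
        (∀ w ∈ W0 𝒯 K, D (moduliUnit 𝒞 K) *ᵥ w = w) ∧
        (∀ X ∈ M, ∀ v ∈ W0 𝒯 K, ∀ w ∈ W0 𝒯 K,
          form 𝒞 K (D X *ᵥ v) w = form 𝒞 K v (D (st X) *ᵥ w)) ∧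
        -- which is irreducible
        (∀ U ≤ W0 𝒯 K, (∀ X ∈ M, ∀ u ∈ U, D X *ᵥ u ∈ U) → U = ⊥ ∨ U = W0 𝒯 K) ∧
        -- and every irreducible `*`-representation is unitarily equivalent to it
        ∀ (H : Type*) [NormedAddCommGroup H] [InnerProductSpace ℂ H] [CompleteSpace H]
          (π : M →ₙₐ[ℂ] (H →L[ℂ] H)), IsIrredStarRep st M (moduliUnit 𝒞 K) π →
          ∃ T : W0 𝒯 K ≃ₗ[ℂ] H,
            (∀ v w : W0 𝒯 K, inner ℂ (T v) (T w) = form 𝒞 K v w) ∧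
            ∀ (X : M) (v w : W0 𝒯 K),
              (w : Idx 𝒯 K → ℂ) = D (X : SemiAlg 𝒞 m) *ᵥ (v : Idx 𝒯 K → ℂ) →
              T w = π X (T v) := by
  refine ⟨ofL_injective hd hS, existsUnique_isStarOperation hd hS, existsUnique_isLoopRep hd K,
    fun st hst D hD => ?_⟩
  have h := isCorner_moduliAlg hd hS K hst hD
  exact ⟨h.posDef, moduliAlg hd hS K, rfl, h.unit_mem,
    fun X hX => ⟨h.unit_mul hX, h.mul_unit hX⟩, h.st_mem, fun X hX w _ => h.mulVec_mem hX w,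
    fun w hw => by rw [h.map_unit]; exact (h.mem_iff w).mp hw,
    fun X hX v _ w _ => h.form_map hX v w, fun U hU hinv => h.irreducible hU hinv,
    fun H _ _ _ π hπ => h.classification hπ⟩
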